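/- Let $AE_3$ be the real Kac--Moody algebra given by the Chevalley--Serre presentation with generators $e_i,f_i,h_i$ ($i=1,2,3$) and Cartan matrix $A=\begin{pmatrix}2&-1&0\\-1&2&-2\\0&-2&2\end{pmatrix}$; let $\omega$ be its Chevalley involution ($e_i\mapsto -f_i$, $f_i\mapsto -e_i$, $h_i\mapsto -h_i$) and $x^T=-\omega(x)$. Symmetrizations $(\dots)$ and the symbol $\bar\delta$ have strength one, repeated indices are summed, $\varepsilon_{123}=\varepsilon^{123}=1$, and $\varepsilon_{23}=\varepsilon^{23}=1$ for Greek indices, which run over $2,3$. (0) There is a unique symmetric invariant bilinear form $\langle\cdot|\cdot\rangle$ on $AE_3$ with $\langle e_i|f_j\rangle=\delta_{ij}$ and $\langle h_i|h_j\rangle=A_{ij}$. The elements $K^1{}_2=e_1$, $K^2{}_3=e_2$, $K^1{}_3=[e_1,e_2]$, $K^2{}_1=f_1$, $K^3{}_2=f_2$, $K^3{}_1=[f_2,f_1]$, $K^1{}_1=-h_2-h_3$, $K^2{}_2=-h_1-h_2-h_3$, $K^3{}_3=-h_1-2h_2-h_3$ satisfy $[K^a{}_b,K^c{}_d]=\delta^c_bK^a{}_d-\delta^a_dK^c{}_b$.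 Put $K=\sum_aK^a{}_a$, and let level $n\in\mathbb Z$ be the space of $x$ with $[K,x]=2nx$. Level $0$ is the span of the $K^a{}_b$ (that is, $\mathfrak{gl}_3$). (1) There is exactly one collection of elements $E_{a_1\dots a_{\ell-1}}{}^{b_1b_2}$ ($\ell\ge1$) of $AE_3$ (the gradient generators) which are symmetric in the $a$'s and in the $b$'s, vanish under any contraction of a lower with an upper index, satisfy $$[K^c{}_d,E_{a_1\dots a_k}{}^{b_1b_2}]=-k\,\delta^c_{(a_1}E_{a_2\dots a_k)d}{}^{b_1b_2}+2\delta^{(b_1}_dE_{a_1\dots a_k}{}^{b_2)c}+k\,\delta^c_dE_{a_1\dots a_k}{}^{b_1b_2},$$ and $E^{33}=e_3$, and for which, with $F^{a_1\dots a_k}{}_{b_1b_2}=(E_{a_1\dots a_k}{}^{b_1b_2})^T$, the elements $$\bar K_{\ell}{}^\alpha{}_\beta=\varepsilon_{\beta\gamma}E_{1\dots1}{}^{\gamma\alpha},\quad \bar K_{-\ell}{}^\alpha{}_\beta=\varepsilon^{\alpha\gamma}F^{1\dots1}{}_{\gamma\beta}\ (\ell\ge1,\ \ell-1\text{ indices }1),\quad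 \bar K_0{}^\alpha{}_\beta=K^\alpha{}_\beta-\tfrac12\delta^\alpha_\beta K^\gamma{}_\gamma$$ and $\hat c=-K^1{}_1$ satisfy for all $m,n\in\mathbb Z$ the affine relations $$[\bar K_m{}^\alpha{}_\beta,\bar K_n{}^\gamma{}_\delta]=\delta^\gamma_\beta\bar K_{m+n}{}^\alpha{}_\delta-\delta^\alpha_\delta\bar K_{m+n}{}^\gamma{}_\beta+m\,\delta_{m,-n}\big(\delta^\alpha_\delta\delta^\gamma_\beta-\tfrac12\delta^\alpha_\beta\delta^\gamma_\delta\big)\hat c .$$ With $\hat d=\frac14K^1{}_1-\frac12(K^2{}_2+K^3{}_3)$ one has $[\hat c,\bar K_m{}^\alpha{}_\beta]=0$ and $[\hat d,\bar K_m{}^\alpha{}_\beta]=-m\bar K_m{}^\alpha{}_\beta$, and $\hat c$, $\hat d$ and the $\bar K_m{}^\alpha{}_\beta$ span the affine subalgebra $A_1^{(1)}$, i.e. the subalgebra generated by $e_2,e_3,f_2,f_3,h_1,h_2,h_3$. (2) For each $\ell\ge1$ the span $G_\ell$ of the $E_{a_1\dots a_{\ell-1}}{}^{b_1b_2}$ lies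 in level $\ell$ and is an irreducible $\mathfrak{gl}_3$-representation with Dynkin labels $[\ell-1,2]$: $E_{1\dots1}{}^{33}\ne0$ is annihilated by $f_1,f_2$ and has $h_1$-, $h_2$-eigenvalues $-(\ell-1)$, $-2$. With $$P_{a_1\dots a_\ell}{}^{b_1b_2}|^{c_1\dots c_\ell}{}_{d_1d_2}=\bar\delta^{c_1\dots c_\ell}_{a_1\dots a_\ell}\bar\delta^{b_1b_2}_{d_1d_2}-\tfrac{2\ell}{3+\ell}\,\bar\delta^{c_1\dots c_{\ell-1}}_{a_1\dots a_{\ell-1}}\delta^{(b_1}_{a_\ell}\delta^{b_2)}_{(d_1}\delta^{c_\ell}_{d_2)}+\tfrac{\ell(\ell-1)}{(3+\ell)(2+\ell)}\,\bar\delta^{c_1\dots c_{\ell-2}}_{a_1\dots a_{\ell-2}}\bar\delta^{b_1b_2}_{a_{\ell-1}a_\ell}\bar\delta^{c_{\ell-1}c_\ell}_{d_1d_2}$$ (symmetrized over the $a$'s and over the $c$'s; the second and third terms are present only for $\ell\ge1$ and $\ell\ge2$), one has $\langle E_{a_1\dots a_\ell}{}^{b_1b_2}|F^{c_1\dots c_k}{}_{d_1d_2}\rangle=P_{a_1\dots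 a_\ell}{}^{b_1b_2}|^{c_1\dots c_\ell}{}_{d_1d_2}$ if $k=\ell$, and $0$ if $k\neq\ell$. (3) Let $N_\ell$ be the sum of all $\mathfrak{gl}_3$-subrepresentations of level $\ell$ that meet $G_\ell$ only in $0$ (the non-gradient representations). Then level $\ell$ is $G_\ell\oplus N_\ell$ and $N_\ell\cap A_1^{(1)}=0$; likewise at level $-\ell$, with $G_{-\ell}$ the span of the $F^{a_1\dots a_{\ell-1}}{}_{b_1b_2}$ and $N_{-\ell}$ defined in the same way. Below, $\equiv$ means equality modulo $N_n$, where $n\neq0$ is the level of the two sides. (4) For all $\ell,k\ge1$, $$[E_{a_1\dots a_{\ell-1}}{}^{b_1b_2},E_{c_1\dots c_{k-1}}{}^{d_1d_2}]\equiv-E_{a_1\dots a_{\ell-1}c_1\dots c_{k-1}e}{}^{d_1(b_1}\varepsilon^{b_2)d_2e}-E_{a_1\dots a_{\ell-1}c_1\dots c_{k-1}e}{}^{d_2(b_1}\varepsilon^{b_2)d_1e},$$ and the right hand side is fixed up to normalization by the tensor symmetries: any family of elements of $G_{\ell+k}$ with the same indices which is symmetric and traceless in $(a,b)$ and in $(c,d)$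 and covariant under $\mathfrak{gl}_3$ is a real multiple of it. Moreover $$[F^{a_1\dots a_{\ell-1}}{}_{b_1b_2},F^{c_1\dots c_{k-1}}{}_{d_1d_2}]\equiv F^{a_1\dots a_{\ell-1}c_1\dots c_{k-1}e}{}_{d_1(b_1}\varepsilon_{b_2)d_2e}+F^{a_1\dots a_{\ell-1}c_1\dots c_{k-1}e}{}_{d_2(b_1}\varepsilon_{b_2)d_1e}.$$ (5) For $\ell>k\ge0$, $$[E_{a_1\dots a_\ell}{}^{b_1b_2},F^{c_1\dots c_k}{}_{d_1d_2}]\equiv2\,P_{a_1\dots a_\ell}{}^{b_1b_2}|^{e_1\dots e_\ell}{}_{f_1f_2}\,P_{g_1\dots g_k}{}^{h_1h_2}|^{c_1\dots c_k}{}_{d_1d_2}\,\varepsilon_{e_\ell h_1i}\,\delta^{f_1}_{h_2}\,\bar\delta^{g_1\dots g_k}_{e_1\dots e_k}\,E_{e_{k+1}\dots e_{\ell-1}}{}^{f_2i},$$ and the commutators $[E_{c_1\dots c_k}{}^{d_1d_2},F^{a_1\dots a_\ell}{}_{b_1b_2}]$ are given by the transposed formula: the same coefficients, with $E_{e_{k+1}\dots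 e_{\ell-1}}{}^{f_2i}$ replaced by its transpose $F^{e_{k+1}\dots e_{\ell-1}}{}_{f_2i}$. (6) For all $\ell\ge0$, exactly, $$[E_{a_1\dots a_\ell}{}^{b_1b_2},F^{c_1\dots c_\ell}{}_{d_1d_2}]=-P_{a_1\dots a_\ell}{}^{b_1b_2}|^{e_1\dots e_\ell}{}_{f_1f_2}\,P_{g_1\dots g_\ell}{}^{h_1h_2}|^{c_1\dots c_\ell}{}_{d_1d_2}\Big(\delta^{g_1}_{e_1}\cdots\delta^{g_\ell}_{e_\ell}\delta^{f_1}_{h_1}\delta^{f_2}_{h_2}K-2\,\delta^{g_1}_{e_1}\cdots\delta^{g_\ell}_{e_\ell}\delta^{f_1}_{h_1}K^{f_2}{}_{h_2}+\ell\,\delta^{f_1}_{h_1}\delta^{f_2}_{h_2}\delta^{g_1}_{e_1}\cdots\delta^{g_{\ell-1}}_{e_{\ell-1}}K^{g_\ell}{}_{e_\ell}\Big).$$ -/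

import Mathlib

noncomputable section

namespace AE3

/-! ## The Kac-Moody algebra and its Chevalley generators -/

/-- The Cartan matrix of `AE₃`: nodes 1-2 are joined by a single line and nodes 2-3 by a double
line. The nodes 1, 2, 3 are numbered 0, 1, 2 (and so are the tensor indices 1, 2, 3 below). -/
def cartan : Matrix (Fin 3) (Fin 3) ℤ := !![2, -1, 0; -1, 2, -2; 0, -2, 2]

/-- `AE₃` in split real form, by its Chevalley-Serre presentation. -/
abbrev Alg : Type := Matrix.ToLieAlgebra ℝ cartan

/-- The class in `AE₃` of an element of the free Lie algebra on the Chevalley generators. -/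
def ofFree (x : FreeLieAlgebra ℝ (CartanMatrix.Generators (Fin 3))) : Alg :=
  LieSubmodule.Quotient.mk (N := CartanMatrix.Relations.toIdeal ℝ cartan) x

/-- The Chevalley generators `e_i`. -/
def genE (i : Fin 3) : Alg := ofFree (FreeLieAlgebra.of ℝ (.E i))

/-- The Chevalley generators `f_i`. -/
def genF (i : Fin 3) : Alg := ofFree (FreeLieAlgebra.of ℝ (.F i))

/-- The Chevalley generators `h_i`. -/
def genH (i : Fin 3) : Alg := ofFree (FreeLieAlgebra.of ℝ (.H i))

theorem ofFree_lie (x y : FreeLieAlgebra ℝ (CartanMatrix.Generators (Fin 3))) :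
    ofFree ⁅x, y⁆ = ⁅ofFree x, ofFree y⁆ := rfl

theorem ofFree_eq_zero {x : FreeLieAlgebra ℝ (CartanMatrix.Generators (Fin 3))}
    (hx : x ∈ CartanMatrix.Relations.toSet ℝ cartan) : ofFree x = 0 :=
  LieSubmodule.Quotient.mk_eq_zero'.2 (LieSubmodule.subset_lieSpan hx)

/-- The quotient map onto `AE₃` as a homomorphism of Lie algebras. -/
def ofFreeHom : FreeLieAlgebra ℝ (CartanMatrix.Generators (Fin 3)) →ₗ⁅ℝ⁆ Alg where
  toFun := ofFree
  map_add' _ _ := rfl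
  map_smul' _ _ := rfl
  map_lie' := rfl

/-- The images of the Chevalley generators under the Chevalley involution. -/
def omegaGen : CartanMatrix.Generators (Fin 3) → Alg
  | .H i => -genH i
  | .E i => -genF i
  | .F i => -genE i

theorem rel_HH (i j : Fin 3) : ⁅genH i, genH j⁆ = 0 :=
  ofFree_eq_zero (x := CartanMatrix.Relations.HH ℝ (i, j)) (by
    simp [CartanMatrix.Relations.toSet])

theorem rel_EF (i j : Fin 3) : ⁅genE i, genF j⁆ = if i = j then genH i else 0 := by
  have h := ofFree_eq_zero (x := CartanMatrix.Relations.EF ℝ (i, j)) (by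
    simp [CartanMatrix.Relations.toSet])
  by_cases hij : i = j
  · subst hij
    simp only [CartanMatrix.Relations.EF, Function.uncurry, if_true] at h ⊢
    exact sub_eq_zero.1 h
  · simp only [CartanMatrix.Relations.EF, Function.uncurry, if_neg hij] at h ⊢
    exact h

theorem rel_HE (i j : Fin 3) : ⁅genH i, genE j⁆ = cartan i j • genE j := by
  have h := ofFree_eq_zero (x := CartanMatrix.Relations.HE ℝ cartan (i, j)) (by
    simp [CartanMatrix.Relations.toSet])
  have h2 : ofFreeHom (CartanMatrix.Relations.HE ℝ cartan (i, j)) = 0 := h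
  simp only [CartanMatrix.Relations.HE, Function.uncurry, map_sub, map_zsmul, LieHom.map_lie] at h2
  exact sub_eq_zero.1 h2

theorem rel_HF (i j : Fin 3) : ⁅genH i, genF j⁆ = -(cartan i j • genF j) := by
  have h := ofFree_eq_zero (x := CartanMatrix.Relations.HF ℝ cartan (i, j)) (by
    simp [CartanMatrix.Relations.toSet])
  have h2 : ofFreeHom (CartanMatrix.Relations.HF ℝ cartan (i, j)) = 0 := h
  simp only [CartanMatrix.Relations.HF, Function.uncurry, map_add, map_zsmul, LieHom.map_lie] at h2
  exact eq_neg_of_add_eq_zero_left h2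

theorem map_ad_pow {L M : Type*} [LieRing L] [LieAlgebra ℝ L] [LieRing M] [LieAlgebra ℝ M]
    (φ : L →ₗ⁅ℝ⁆ M) (x y : L) (n : ℕ) :
    φ (((LieAlgebra.ad ℝ L x) ^ n) y) = ((LieAlgebra.ad ℝ M (φ x)) ^ n) (φ y) := by
  induction n generalizing y with
  | zero => simp
  | succ n ih => simp [pow_succ, ih]

theorem ad_neg_pow {L : Type*} [LieRing L] [LieAlgebra ℝ L] (x y : L) (n : ℕ) :
    ((LieAlgebra.ad ℝ L (-x)) ^ n) y = (-1 : ℝ) ^ n • ((LieAlgebra.ad ℝ L x) ^ n) y := by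
  have : LieAlgebra.ad ℝ L (-x) = (-1 : ℝ) • LieAlgebra.ad ℝ L x := by simp
  rw [this, smul_pow]
  rfl

theorem rel_adE (i j : Fin 3) :
    ((LieAlgebra.ad ℝ Alg (genE i)) ^ (-cartan i j).toNat) ⁅genE i, genE j⁆ = 0 := by
  have h := ofFree_eq_zero (x := CartanMatrix.Relations.adE ℝ cartan (i, j)) (by
    simp [CartanMatrix.Relations.toSet])
  have h2 : ofFreeHom (CartanMatrix.Relations.adE ℝ cartan (i, j)) = 0 := h
  simp only [CartanMatrix.Relations.adE, Function.uncurry, map_ad_pow, LieHom.map_lie] at h2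
  exact h2

theorem rel_adF (i j : Fin 3) :
    ((LieAlgebra.ad ℝ Alg (genF i)) ^ (-cartan i j).toNat) ⁅genF i, genF j⁆ = 0 := by
  have h := ofFree_eq_zero (x := CartanMatrix.Relations.adF ℝ cartan (i, j)) (by
    simp [CartanMatrix.Relations.toSet])
  have h2 : ofFreeHom (CartanMatrix.Relations.adF ℝ cartan (i, j)) = 0 := h
  simp only [CartanMatrix.Relations.adF, Function.uncurry, map_ad_pow, LieHom.map_lie] at h2
  exact h2

theorem lift_omegaGen_eq_zero {x : FreeLieAlgebra ℝ (CartanMatrix.Generators (Fin 3))}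
    (hx : x ∈ CartanMatrix.Relations.toIdeal ℝ cartan) :
    FreeLieAlgebra.lift ℝ omegaGen x = 0 := by
  have key : CartanMatrix.Relations.toIdeal ℝ cartan ≤ (FreeLieAlgebra.lift ℝ omegaGen).ker := by
    refine LieSubmodule.lieSpan_le.2 ?_
    rintro y (((((⟨⟨i, j⟩, rfl⟩ | ⟨⟨i, j⟩, rfl⟩) | ⟨⟨i, j⟩, rfl⟩) | ⟨⟨i, j⟩, rfl⟩) |
      ⟨⟨i, j⟩, rfl⟩) | ⟨⟨i, j⟩, rfl⟩)
    all_goals rw [SetLike.mem_coe, LieHom.mem_ker]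
    · simp [CartanMatrix.Relations.HH, omegaGen, rel_HH]
    · by_cases hij : i = j
      · subst hij
        simp [CartanMatrix.Relations.EF, omegaGen]
        rw [← lie_skew, rel_EF]
        simp
      · simp [CartanMatrix.Relations.EF, omegaGen, hij]
        rw [← lie_skew, rel_EF]
        simp [Ne.symm hij]
    · simp [CartanMatrix.Relations.HE, omegaGen, rel_HF]
    · simp [CartanMatrix.Relations.HF, omegaGen, rel_HE]
    · simp only [CartanMatrix.Relations.adE, Function.uncurry, Function.comp, map_ad_pow,
        LieHom.map_lie, FreeLieAlgebra.lift_of_apply, omegaGen, ad_neg_pow, lie_neg, neg_lie,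
        neg_neg, rel_adF, smul_zero]
    · simp only [CartanMatrix.Relations.adF, Function.uncurry, Function.comp, map_ad_pow,
        LieHom.map_lie, FreeLieAlgebra.lift_of_apply, omegaGen, ad_neg_pow, lie_neg, neg_lie,
        neg_neg, rel_adE, smul_zero]
  exact LieHom.mem_ker.1 (key hx)

/-- The Chevalley involution: `ω(e_i) = -f_i`, `ω(f_i) = -e_i`, `ω(h_i) = -h_i`. -/
def omega : Alg →ₗ⁅ℝ⁆ Alg where
  toLinearMap := (CartanMatrix.Relations.toIdeal ℝ cartan).toSubmodule.liftQ
    (FreeLieAlgebra.lift ℝ omegaGen : FreeLieAlgebra ℝ (CartanMatrix.Generators (Fin 3)) →ₗ[ℝ] Alg)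
    (fun _ hx => lift_omegaGen_eq_zero hx)
  map_lie' := by
    rintro ⟨x⟩ ⟨y⟩
    exact (FreeLieAlgebra.lift ℝ omegaGen).map_lie x y

theorem omega_genE (i : Fin 3) : omega (genE i) = -genF i :=
  FreeLieAlgebra.lift_of_apply omegaGen _

theorem omega_genF (i : Fin 3) : omega (genF i) = -genE i :=
  FreeLieAlgebra.lift_of_apply omegaGen _

theorem omega_genH (i : Fin 3) : omega (genH i) = -genH i :=
  FreeLieAlgebra.lift_of_apply omegaGen _

/-- The generalized transposition `xᵀ = -ω(x)`. -/
def transpose (x : Alg) : Alg := -omega x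

/-- The standard invariant form: symmetric, invariant, `⟨e_i|f_j⟩ = δ_ij`,
`⟨h_i|h_j⟩ = A_ij`. -/
structure IsStandardForm (B : LinearMap.BilinForm ℝ Alg) : Prop where
  symm : ∀ x y, B x y = B y x
  invariant : ∀ x y z, B ⁅x, y⁆ z = B x ⁅y, z⁆
  ef : ∀ i j, B (genE i) (genF j) = if i = j then 1 else 0
  hh : ∀ i j, B (genH i) (genH j) = cartan i j

/-! ## The subalgebra `gl₃` and the level -/

/-- The generators `K^a_b` of `gl₃`: `e_i = K^i_{i+1}`, `f_i = K^{i+1}_i`,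
`h_i = K^i_i - K^{i+1}_{i+1}` for `i = 1, 2`, and `h_3 = -K^1_1 - K^2_2 + K^3_3`. -/
def glK : Fin 3 → Fin 3 → Alg :=
  ![![-genH 1 - genH 2, genE 0, ⁅genE 0, genE 1⁆],
    ![genF 0, -genH 0 - genH 1 - genH 2, genE 1],
    ![⁅genF 1, genF 0⁆, genF 1, -genH 0 - (2 : ℝ) • genH 1 - genH 2]]

/-- The trace `K = K^a_a`. -/
def glTr : Alg := ∑ a, glK a a

/-- The elements of level `n`, on which `K` has the eigenvalue `2 n`. -/
def level (n : ℤ) : Submodule ℝ Alg :=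
  LinearMap.ker ((LieAlgebra.ad ℝ Alg glTr : Alg →ₗ[ℝ] Alg) - (2 * n : ℝ) • LinearMap.id)

/-- A linear subspace stable under the adjoint action of `gl₃`. -/
def IsGlStable (S : Submodule ℝ Alg) : Prop :=
  ∀ a b, ∀ x ∈ S, ⁅glK a b, x⁆ ∈ S

/-- The sum of all `gl₃`-subrepresentations of level `n` that meet `G` only in zero. -/
def nonGradient (n : ℤ) (G : Submodule ℝ Alg) : Submodule ℝ Alg :=
  sSup {S | S ≤ level n ∧ IsGlStable S ∧ Disjoint S G}

/-! ## Tensors -/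

/-- The Kronecker symbol. -/
def kron (a b : Fin 3) : ℝ := if a = b then 1 else 0

/-- The totally antisymmetric symbol with `ε_{123} = 1`. -/
def eps (a b c : Fin 3) : ℝ :=
  ((b : ℝ) - (a : ℝ)) * ((c : ℝ) - (a : ℝ)) * ((c : ℝ) - (b : ℝ)) / 2

/-- Families `T_{a_1…a_k}^{b_1 b_2}` (or `T^{a_1…a_k}_{b_1 b_2}`) of elements of `AE₃`. -/
abbrev Tens (k : ℕ) : Type := (Fin k → Fin 3) → Fin 3 → Fin 3 → Alg

/-- Symmetry in the `a`'s, symmetry in the `b`'s, and vanishing of any contraction. -/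
structure IsIrreducibleTensor {k : ℕ} (T : Tens k) : Prop where
  symm_left : ∀ (σ : Equiv.Perm (Fin k)) a b₁ b₂, T (a ∘ σ) b₁ b₂ = T a b₁ b₂
  symm_right : ∀ a b₁ b₂, T a b₁ b₂ = T a b₂ b₁
  traceless : ∀ (i : Fin k) a b, ∑ s, T (Function.update a i s) s b = 0

/-- The action of `K^c_d` on a tensor `T_{a_1…a_k}^{b_1 b_2}`:
`-∑_i δ^c_{a_i} T_{a_1…d…a_k}^{b_1b_2} + δ^{b_1}_d T_a^{c b_2} + δ^{b_2}_d T_a^{b_1 c}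
+ k δ^c_d T_a^{b_1b_2}`. -/
def glAct {k : ℕ} (c d : Fin 3) (T : Tens k) : Tens k := fun a b₁ b₂ =>
  -(∑ i, kron c (a i) • T (Function.update a i d) b₁ b₂)
    + kron b₁ d • T a c b₂ + kron b₂ d • T a b₁ c + (k * kron c d) • T a b₁ b₂

/-- `δ̄^{b₁b₂}_{d₁d₂}`, strength one. -/
def symPair (b₁ b₂ d₁ d₂ : Fin 3) : ℝ :=
  (kron b₁ d₁ * kron b₂ d₂ + kron b₁ d₂ * kron b₂ d₁) / 2

/-- `δ^{(b₁}_a δ^{b₂)}_{(d₁} δ^c_{d₂)}`, strength one. -/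
def symMix (b₁ b₂ a c d₁ d₂ : Fin 3) : ℝ :=
  (kron b₁ a * kron b₂ d₁ * kron c d₂ + kron b₂ a * kron b₁ d₁ * kron c d₂
    + kron b₁ a * kron b₂ d₂ * kron c d₁ + kron b₂ a * kron b₁ d₂ * kron c d₁) / 4

/-- `δ̄_{a_1…a_k}^{c_1…c_k}`, strength one. -/
def symDelta {k : ℕ} (a c : Fin k → Fin 3) : ℝ :=
  (∑ σ : Equiv.Perm (Fin k), ∏ i, kron (a i) (c (σ i))) / (k.factorial : ℝ)

/-- The projector `P_{a_1…a_k}^{b₁b₂}|^{c_1…c_k}_{d₁d₂}` onto the representation with Dynkin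
labels `[k,2]`. The symmetrization over the `a`'s and `c`'s is written out as the average over the
pairings `a_i ↔ c_{σ i}` and the sums over the distinguished positions; these sums have `k` and
`k (k-1)` terms, so the coefficients of the strength one symmetrized expressions are `1`,
`-2k/(3+k)` and `k(k-1)/((3+k)(2+k))`. -/
def proj {k : ℕ} (a : Fin k → Fin 3) (b₁ b₂ : Fin 3) (c : Fin k → Fin 3) (d₁ d₂ : Fin 3) : ℝ :=
  (∑ σ : Equiv.Perm (Fin k),
    ((∏ i, kron (a i) (c (σ i))) * symPair b₁ b₂ d₁ d₂
      - 2 / (3 + k) * ∑ i, (∏ j ∈ Finset.univ.erase i, kron (a j) (c (σ j)))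
          * symMix b₁ b₂ (a i) (c (σ i)) d₁ d₂
      + 1 / ((3 + k) * (2 + k)) * ∑ i, ∑ j ∈ Finset.univ.erase i,
          (∏ m ∈ (Finset.univ.erase i).erase j, kron (a m) (c (σ m)))
            * symPair b₁ b₂ (a i) (a j) * symPair (c (σ i)) (c (σ j)) d₁ d₂))
    / (k.factorial : ℝ)

/-! ## The affine subalgebra -/

/-- The affine subalgebra `A₁⁽¹⁾`, generated by the nodes 2 and 3 and the Cartan subalgebra. -/
def affineSubalgebra : LieSubalgebra ℝ Alg :=
  LieSubalgebra.lieSpan ℝ Alg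
    ({genE 1, genE 2, genF 1, genF 2} ∪ Set.range genH)

/-- The central element `ĉ = -K^1_1`. -/
def affC : Alg := -glK 0 0

/-- The derivation `d̂ = K^1_1 / 4 - (K^2_2 + K^3_3) / 2`. -/
def affD : Alg := (1 / 4 : ℝ) • glK 0 0 - (1 / 2 : ℝ) • (glK 1 1 + glK 2 2)

/-- `ε_{βγ}` for Greek indices, which run over 2, 3 and are numbered 0, 1; `ε_{23} = 1`. -/
def epsG (β γ : Fin 2) : ℝ := eps 0 β.succ γ.succ

/-- The Kronecker symbol for Greek indices. -/
def kronG (α β : Fin 2) : ℝ := if α = β then 1 else 0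

/-- The transposed generators `F^{a_1…a_k}_{b₁b₂} = (E_{a_1…a_k}^{b₁b₂})ᵀ`. -/
def transposeFamily (E : (k : ℕ) → Tens k) : (k : ℕ) → Tens k := fun k a b₁ b₂ =>
  transpose (E k a b₁ b₂)

/-- The elements `K̄_m^α_β`: for `m = 0` the traceless part of `K^α_β`, for `m = k + 1 > 0` the
element `ε_{βγ} E_{1…1}^{γα}`, and for `m = -(k + 1) < 0` the element `ε^{αγ} F^{1…1}_{γβ}`,
with `k` indices 1. -/
def affK (E : (k : ℕ) → Tens k) : ℤ → Fin 2 → Fin 2 → Alg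
  | Int.ofNat 0, α, β =>
      glK α.succ β.succ - (kronG α β / 2) • ∑ γ : Fin 2, glK γ.succ γ.succ
  | Int.ofNat (k + 1), α, β => ∑ γ, epsG β γ • E k (fun _ => 0) γ.succ α.succ
  | Int.negSucc k, α, β => ∑ γ, epsG α γ • transposeFamily E k (fun _ => 0) γ.succ β.succ

/-- `E k` is the family `E_{a_1…a_k}^{b₁b₂}` of gradient generators of level `k + 1`: an
irreducible tensor of type `[k,2]`, covariant under `gl₃`, with `E^{33} = e_3`, whose components
with affine indices satisfy the relations of `A₁⁽¹⁾`. -/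
structure IsGradientFamily (E : (k : ℕ) → Tens k) : Prop where
  irreducible : ∀ k, IsIrreducibleTensor (E k)
  covariant : ∀ k c d a b₁ b₂, ⁅glK c d, E k a b₁ b₂⁆ = glAct c d (E k) a b₁ b₂
  chevalley : E 0 ![] 2 2 = genE 2
  affine : ∀ (m n : ℤ) (α β γ δ : Fin 2), ⁅affK E m α β, affK E n γ δ⁆ =
    kronG γ β • affK E (m + n) α δ - kronG α δ • affK E (m + n) γ β
      + (if m = -n then (m : ℝ) * (kronG α δ * kronG γ β - kronG α β * kronG γ δ / 2) else 0) • affC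

/-- The linear span of the components of a tensor. -/
def tensorSpan {k : ℕ} (T : Tens k) : Submodule ℝ Alg :=
  Submodule.span ℝ {x | ∃ a b₁ b₂, T a b₁ b₂ = x}

/-! ## Right hand sides of the commutators -/

/-- `T_{a c e}^{d₁(b₁} ε^{b₂)d₂e} + T_{a c e}^{d₂(b₁} ε^{b₂)d₁e}`, summed over `e`, with
strength one symmetrization over `b₁, b₂`. -/
def epsSum {k l : ℕ} (T : Tens (k + l + 1)) (a : Fin k → Fin 3) (b₁ b₂ : Fin 3)
    (c : Fin l → Fin 3) (d₁ d₂ : Fin 3) : Alg :=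
  ∑ e : Fin 3,
    ((eps b₂ d₂ e / 2) • T (Fin.snoc (Fin.append a c) e) d₁ b₁
      + (eps b₁ d₂ e / 2) • T (Fin.snoc (Fin.append a c) e) d₁ b₂
      + (eps b₂ d₁ e / 2) • T (Fin.snoc (Fin.append a c) e) d₂ b₁
      + (eps b₁ d₁ e / 2) • T (Fin.snoc (Fin.append a c) e) d₂ b₂)

/-- With `p = k + m + 1`:
`P_{a_1…a_p}^{b₁b₂}|^{e_1…e_p}_{f₁f₂} P_{g_1…g_k}^{h₁h₂}|^{c_1…c_k}_{d₁d₂}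
ε_{e_p h₁ i} δ^{f₁}_{h₂} δ̄_{e_1…e_k}^{g_1…g_k} T_{e_{k+1}…e_{p-1}}^{f₂ i}`. -/
def projSum {k m : ℕ} (T : Tens m) (a : Fin (k + m + 1) → Fin 3) (b₁ b₂ : Fin 3)
    (c : Fin k → Fin 3) (d₁ d₂ : Fin 3) : Alg :=
  ∑ e : Fin (k + m + 1) → Fin 3, ∑ f₁, ∑ f₂, ∑ g : Fin k → Fin 3, ∑ h₁, ∑ h₂, ∑ i,
    (proj a b₁ b₂ e f₁ f₂ * proj g h₁ h₂ c d₁ d₂ * eps (e (Fin.last (k + m))) h₁ i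
      * kron h₂ f₁ * symDelta (fun j => e (Fin.castSucc (Fin.castAdd m j))) g)
      • T (fun j => e (Fin.castSucc (Fin.natAdd k j))) f₂ i

/-- `P_{a_1…a_k}^{b₁b₂}|^{e_1…e_k}_{f₁f₂} P_{g_1…g_k}^{h₁h₂}|^{c_1…c_k}_{d₁d₂}
(δ^g_e δ^{f₁}_{h₁} δ^{f₂}_{h₂} K - 2 δ^g_e δ^{f₁}_{h₁} K^{f₂}_{h₂}
+ k δ^{f₁}_{h₁} δ^{f₂}_{h₂} δ^{g_1}_{e_1}⋯δ^{g_{k-1}}_{e_{k-1}} K^{g_k}_{e_k})`; the last term is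
written as a sum over the `k` positions, which is the same since the projectors are symmetric in
the `e`'s and in the `g`'s. -/
def glSum {k : ℕ} (a : Fin k → Fin 3) (b₁ b₂ : Fin 3)
    (c : Fin k → Fin 3) (d₁ d₂ : Fin 3) : Alg :=
  ∑ e : Fin k → Fin 3, ∑ f₁, ∑ f₂, ∑ g : Fin k → Fin 3, ∑ h₁, ∑ h₂,
    (proj a b₁ b₂ e f₁ f₂ * proj g h₁ h₂ c d₁ d₂) •
      (((∏ i, kron (g i) (e i)) * kron f₁ h₁ * kron f₂ h₂) • glTr
        - (2 * (∏ i, kron (g i) (e i)) * kron f₁ h₁) • glK f₂ h₂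
        + (kron f₁ h₁ * kron f₂ h₂) •
            ∑ i, (∏ j ∈ Finset.univ.erase i, kron (g j) (e j)) • glK (g i) (e i))

end AE3

end

/-! An algebra given by generators and relations might collapse, so lower bounds come first. The
words in the letters f_i carry a Verma module for the Lie algebra without Serre relations. The Serre
elements in the e_i act on it by zero, and those in the f_i generate a submodule without vacuum
component. Hence the vacuum coefficient descends to linear functionals on AE_3 that are dual to the
h_i (`corootCoord_genH`). The invariant form is built as a graph in AE_3 × AE_3^*: the pairs
generated from the h_i and the Chevalley generators form an invariant subspace that is symmetric
under the evaluation pairing, and symmetry forces it to be single valued (`formGraph_isotropic`,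
`formGraph_unique`). Uniqueness of the form follows from the height grading.

The affine subalgebra is the centralizer of K^1_1, because a word of weight zero under K^1_1 cannot
contain a letter of node 1 (`centralizer_le`, `mem_affine_of_lie`). Its loop generators are ladders
under u = [e_2,e_3] and v = [f_3,f_2], and the four Serre relations of A_1^(1) already imply all
loop relations (`LoopData.loopRelations`).

The tensor side rests on one principle, `IsIrr.eq_zero`: a symmetric traceless tensor is generated
by its component 1…1, 33 under the raising operators. Together with the affine relations, which
force this component to be a loop generator, it gives uniqueness of the gradient family. Applied to
both index sets, it identifies the invariant pairing of E with F with the projector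
(`form_gradient`). For existence, [E_k, E_0] is contracted with ε and projected onto the irreducible
part; the factor is fixed by the affine component (`gradient_loopValued`).

The non-gradient part N is the orthogonal complement of the F's (`nonGradient_eq`): a
subrepresentation not orthogonal to them contains an affine vector that pairs nontrivially with F,
and affine vectors of nonzero level are gradient. So a congruence modulo N is an equality of
pairings with the F's. For [E,E], covariance and weights reduce this to a single component, a loop
commutator of y with h (`IsBiTensor.gradientPart_eq_zero`). The [F,F] formula is the transpose. For
different levels, ⟨[E,F]|F'⟩ = ⟨E|[F,F']⟩ reduces [E,F] to [F,F] (`lie_transpose_sub_projSum_mem`).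
At opposite levels the commutator lies in gl_3, where the form is nondegenerate, and ⟨[E,F]|K⟩ is
the action of K on the known pairing ⟨E|F⟩ (`lie_transpose_eq_glSum`). -/

namespace AE3

/-! ### Verma modules of the Lie algebra without Serre relations. -/

section Verma

variable {lam : Fin 3 → ℝ}

/-- The vector space on the words in the letters `f_i`: the Verma module of the Lie algebra without
Serre relations. -/
abbrev Words : Type := List (Fin 3) →₀ ℝ

/-- The highest weight vector. -/
noncomputable def vacuum : Words := Finsupp.single [] 1

/-- The action of `f_k` on words. -/
noncomputable def vermaF (k : Fin 3) : Module.End ℝ Words := Finsupp.lmapDomain ℝ ℝ (List.cons k)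

/-- The eigenvalue of `h_k` on a word, for the highest weight `lam`. -/
noncomputable def wordWeight (lam : Fin 3 → ℝ) (k : Fin 3) : List (Fin 3) → ℝ
  | [] => lam k
  | j :: w => wordWeight lam k w - cartan k j

/-- The action of `h_k` on words. -/
noncomputable def vermaH (lam : Fin 3 → ℝ) (k : Fin 3) : Module.End ℝ Words :=
  Finsupp.linearCombination ℝ fun w => Finsupp.single w (wordWeight lam k w)

/-- The image of a word under `e_k`. -/
noncomputable def vermaEWord (lam : Fin 3 → ℝ) (k : Fin 3) : List (Fin 3) → Words
  | [] => 0
  | j :: w => vermaF j (vermaEWord lam k w) +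
      if j = k then Finsupp.single w (wordWeight lam k w) else 0

/-- The action of `e_k` on words. -/
noncomputable def vermaE (lam : Fin 3 → ℝ) (k : Fin 3) : Module.End ℝ Words :=
  Finsupp.linearCombination ℝ (vermaEWord lam k)

/-- The coefficient of the highest weight vector. -/
noncomputable def vacuumCoeff : Words →ₗ[ℝ] ℝ := Finsupp.lapply []

theorem vermaF_single (k : Fin 3) (w : List (Fin 3)) (r : ℝ) :
    vermaF k (Finsupp.single w r) = Finsupp.single (k :: w) r := by
  simp [vermaF]

theorem vermaH_single (k : Fin 3) (w : List (Fin 3)) :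
    vermaH lam k (Finsupp.single w 1) = wordWeight lam k w • Finsupp.single w (1 : ℝ) := by
  simp [vermaH]

theorem vermaH_vacuum (k : Fin 3) : vermaH lam k vacuum = lam k • vacuum :=
  vermaH_single k []

theorem vermaE_vacuum (k : Fin 3) : vermaE lam k vacuum = 0 := by
  simp [vermaE, vacuum, vermaEWord]

/-- Every word arises from the empty one by the `vermaF`. Identities between operators therefore
reduce to the vacuum and to passing one letter. -/
theorem words_hom_ext {M : Type*} [AddCommMonoid M] [Module ℝ M] {A B : Words →ₗ[ℝ] M}
    (h0 : A vacuum = B vacuum)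
    (h1 : ∀ k m, A m = B m → A (vermaF k m) = B (vermaF k m)) : A = B := by
  refine Finsupp.lhom_ext' fun w => LinearMap.ext_ring ?_
  change A (Finsupp.single w 1) = B (Finsupp.single w 1)
  induction w with
  | nil => exact h0
  | cons k w ih => rw [← vermaF_single]; exact h1 k _ ih

theorem vermaH_vermaF (k j : Fin 3) (m : Words) :
    vermaH lam k (vermaF j m) = vermaF j (vermaH lam k m) - (cartan k j : ℝ) • vermaF j m := by
  suffices h : (vermaH lam k) ∘ₗ (vermaF j) =
      (vermaF j) ∘ₗ (vermaH lam k) - (cartan k j : ℝ) • vermaF j from LinearMap.congr_fun h m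
  refine Finsupp.lhom_ext' fun w => LinearMap.ext_ring ?_
  change vermaH lam k (vermaF j (Finsupp.single w 1)) =
    vermaF j (vermaH lam k (Finsupp.single w 1)) - (cartan k j : ℝ) • vermaF j (Finsupp.single w 1)
  rw [vermaF_single, vermaH_single, vermaH_single, map_smul, vermaF_single, ← sub_smul]
  rfl

/-- The recursion defining `vermaEWord` is this relation read on basis words. -/
theorem vermaE_vermaF (k j : Fin 3) (m : Words) :
    vermaE lam k (vermaF j m) =
      vermaF j (vermaE lam k m) + if j = k then vermaH lam k m else 0 := by
  suffices h : (vermaE lam k) ∘ₗ (vermaF j) =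
      (vermaF j) ∘ₗ (vermaE lam k) + if j = k then vermaH lam k else 0 by
    have := LinearMap.congr_fun h m
    split_ifs at this ⊢ <;> exact this
  refine Finsupp.lhom_ext' fun w => LinearMap.ext_ring ?_
  change vermaE lam k (vermaF j (Finsupp.single w 1)) = vermaF j (vermaE lam k (Finsupp.single w 1))
    + (if j = k then vermaH lam k else 0) (Finsupp.single w 1)
  rw [vermaF_single]
  split_ifs with h <;> simp [vermaE, vermaEWord, vermaH, h]

theorem vermaH_vermaH (k j : Fin 3) (m : Words) :
    vermaH lam k (vermaH lam j m) = vermaH lam j (vermaH lam k m) := by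
  suffices h : (vermaH lam k) ∘ₗ (vermaH lam j) = (vermaH lam j) ∘ₗ (vermaH lam k) from
    LinearMap.congr_fun h m
  refine words_hom_ext ?_ fun i m h => ?_
  · simp [vermaH_vacuum, smul_smul, mul_comm]
  · simp only [LinearMap.comp_apply, vermaH_vermaF, map_sub, map_smul] at h ⊢
    rw [h]
    module

/-- Unlike the relations with `vermaF`, this one is not built into the definitions. It holds on the
vacuum, where both sides vanish, and propagates through each letter. -/
theorem vermaH_vermaE (k j : Fin 3) (m : Words) :
    vermaH lam k (vermaE lam j m) =
      vermaE lam j (vermaH lam k m) + (cartan k j : ℝ) • vermaE lam j m := by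
  suffices h : (vermaH lam k) ∘ₗ (vermaE lam j) =
      (vermaE lam j) ∘ₗ (vermaH lam k) + (cartan k j : ℝ) • vermaE lam j from
    LinearMap.congr_fun h m
  refine words_hom_ext ?_ fun i m h => ?_
  · simp [vermaH_vacuum, vermaE_vacuum]
  · simp only [LinearMap.comp_apply, LinearMap.add_apply, LinearMap.smul_apply] at h ⊢
    by_cases hij : i = j
    · subst hij
      simp only [vermaE_vermaF, vermaH_vermaF, map_add, map_sub, map_smul, if_true, h,
        vermaH_vermaH k i]
      module
    · simp only [vermaE_vermaF, vermaH_vermaF, map_add, map_sub, map_smul, if_neg hij, h,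
        add_zero]
      module

theorem vacuumCoeff_vermaF (k : Fin 3) (m : Words) : vacuumCoeff (vermaF k m) = 0 := by
  suffices h : vacuumCoeff ∘ₗ (vermaF k) = 0 from LinearMap.congr_fun h m
  refine Finsupp.lhom_ext' fun w => LinearMap.ext_ring ?_
  change vacuumCoeff (vermaF k (Finsupp.single w 1)) = 0
  rw [vermaF_single]
  simp [vacuumCoeff]

theorem vacuumCoeff_vermaH (k : Fin 3) (m : Words) :
    vacuumCoeff (vermaH lam k m) = lam k * vacuumCoeff m := by
  suffices h : vacuumCoeff ∘ₗ (vermaH lam k) = lam k • vacuumCoeff from LinearMap.congr_fun h m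
  refine Finsupp.lhom_ext' fun w => LinearMap.ext_ring ?_
  change vacuumCoeff (vermaH lam k (Finsupp.single w 1)) = lam k • vacuumCoeff (Finsupp.single w 1)
  rw [vermaH_single, map_smul]
  cases w <;> simp [vacuumCoeff, wordWeight]

end Verma

/-! ### Serre elements commute with the opposite generators. -/

section Serre

variable {L : Type*} [LieRing L] [LieAlgebra ℝ L]

theorem lie_ad_pow_weight {e h x : L} {t a : ℝ} (hh : ⁅h, e⁆ = t • e) (hx : ⁅h, x⁆ = a • x) (n : ℕ) :
    ⁅h, (LieAlgebra.ad ℝ L e ^ n) x⁆ = (a + n * t) • (LieAlgebra.ad ℝ L e ^ n) x := by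
  induction n with
  | zero => simp [hx]
  | succ n ih =>
    rw [pow_succ', Module.End.mul_apply, LieAlgebra.ad_apply, leibniz_lie, hh, ih, smul_lie,
      lie_smul, ← add_smul]
    push_cast
    ring_nf

theorem lie_lie_weight {h x y : L} {a b : ℝ} (hx : ⁅h, x⁆ = a • x) (hy : ⁅h, y⁆ = b • y) :
    ⁅h, ⁅x, y⁆⁆ = (a + b) • ⁅x, y⁆ := by
  rw [leibniz_lie, hx, hy, smul_lie, lie_smul, add_smul]

/-- The sl_2 computation on a primitive vector, with e in the role of the lowering operator. The
coefficient vanishes at n = a, which is what makes Serre elements commute with the opposite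
generator of the same node. -/
theorem lie_ad_pow_succ {e h g x : L} {a : ℝ} (hg : ⁅g, e⁆ = h) (hh : ⁅h, e⁆ = (-2 : ℝ) • e)
    (hx : ⁅h, x⁆ = a • x) (gx : ⁅g, x⁆ = 0) (n : ℕ) :
    ⁅g, (LieAlgebra.ad ℝ L e ^ (n + 1)) x⁆ =
      ((n + 1) * (a - n)) • (LieAlgebra.ad ℝ L e ^ n) x := by
  induction n with
  | zero => simp [leibniz_lie g e x, gx, hg, hx]
  | succ n ih =>
    rw [pow_succ', Module.End.mul_apply, LieAlgebra.ad_apply, leibniz_lie, hg,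
      lie_ad_pow_weight hh hx, ih, lie_smul]
    have : ⁅e, (LieAlgebra.ad ℝ L e ^ n) x⁆ = (LieAlgebra.ad ℝ L e ^ (n + 1)) x := by
      rw [pow_succ', Module.End.mul_apply, LieAlgebra.ad_apply]
    rw [this, ← add_smul]
    push_cast
    ring_nf

theorem lie_ad_pow_eq_zero {e g x : L} (hg : ⁅g, e⁆ = 0) (gx : ⁅g, x⁆ = 0) (n : ℕ) :
    ⁅g, (LieAlgebra.ad ℝ L e ^ n) x⁆ = 0 := by
  induction n with
  | zero => simpa
  | succ n ih =>
    rw [pow_succ', Module.End.mul_apply, LieAlgebra.ad_apply, leibniz_lie, hg, ih]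
    simp

/-- A Serre element commutes with the opposite Chevalley generators. -/
theorem lie_serre_eq_zero (e g h : Fin 3 → L)
    (hge : ∀ i j, ⁅g i, e j⁆ = if i = j then h i else 0)
    (hhe : ∀ i j, ⁅h i, e j⁆ = -(cartan i j : ℝ) • e j) (i j k : Fin 3) :
    ⁅g k, (LieAlgebra.ad ℝ L (e i) ^ (-cartan i j).toNat) ⁅e i, e j⁆⁆ = 0 := by
  by_cases hij : i = j
  · subst hij
    simp
  have hsucc : (LieAlgebra.ad ℝ L (e i) ^ (-cartan i j).toNat) ⁅e i, e j⁆ =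
      (LieAlgebra.ad ℝ L (e i) ^ ((-cartan i j).toNat + 1)) (e j) := by
    rw [pow_succ]; rfl
  by_cases hki : k = i
  · subst hki
    have hcast : (((-cartan k j).toNat : ℤ) : ℝ) = -(cartan k j : ℝ) := by
      have h0 : 0 ≤ -cartan k j := by
        revert hij; fin_cases k <;> fin_cases j <;> simp [cartan]
      rw [Int.toNat_of_nonneg h0]; push_cast; ring
    -- Here the weight a and the exponent n are both minus the Cartan entry, so the factor a - n is
    -- zero.
    rw [hsucc, lie_ad_pow_succ (h := h k) (a := -(cartan k j : ℝ)) (by rw [hge, if_pos rfl])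
      (by rw [hhe]; fin_cases k <;> simp [cartan]) (hhe k j) (by rw [hge, if_neg hij])]
    rw [Int.cast_natCast] at hcast
    rw [hcast]
    simp
  · by_cases hkj : k = j
    · subst hkj
      have : ⁅e i, h k⁆ = (cartan k i : ℝ) • e i := by
        rw [← lie_skew, hhe]; simp
      -- Bracketing with the opposite generator of the second node turns that node's letter into its
      -- coroot, and one more bracket with e_i gives a Cartan entry times e_i. The result dies
      -- either because this entry is zero or because a further power of ad e_i hits e_i itself.
      have hz : cartan k i = 0 ∨ (-cartan i k).toNat ≠ 0 := by
        revert hij; fin_cases i <;> fin_cases k <;> simp [cartan]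
      have hk : ∀ n : ℕ, n ≠ 0 ∨ cartan k i = 0 →
          ⁅g k, (LieAlgebra.ad ℝ L (e i) ^ (n + 1)) (e k)⁆ = 0 := by
        have hki' : ⁅g k, e i⁆ = 0 := by rw [hge, if_neg hki]
        have key : ∀ n : ℕ, ⁅g k, (LieAlgebra.ad ℝ L (e i) ^ n) (e k)⁆ =
            (LieAlgebra.ad ℝ L (e i) ^ n) (h k) := by
          intro n
          induction n with
          | zero => simp [hge]
          | succ n ih =>
            rw [pow_succ', Module.End.mul_apply, LieAlgebra.ad_apply, leibniz_lie, hki', ih]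
            simp
        intro n hn
        rw [key, pow_succ, Module.End.mul_apply, LieAlgebra.ad_apply, this, map_smul]
        rcases hn with hn | hn
        · obtain ⟨m, rfl⟩ := Nat.exists_eq_succ_of_ne_zero hn
          rw [pow_succ, Module.End.mul_apply]
          simp
        · simp [hn]
      rw [hsucc]
      exact hk _ hz.symm
    · rw [hsucc]
      exact lie_ad_pow_eq_zero (by rw [hge, if_neg hki]) (by rw [hge, if_neg hkj]) _

end Serre

/-! ### Linear functionals that read off the Cartan part. -/

section Coordinates

variable {lam : Fin 3 → ℝ}

open CartanMatrix

attribute [local instance 100] LieRing.ofAssociativeRing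

theorem end_lie_apply (A B : Module.End ℝ Words) (m : Words) : ⁅A, B⁆ m = A (B m) - B (A m) := rfl

/-- The Chevalley generators as operators on words. -/
noncomputable def vermaGen (lam : Fin 3 → ℝ) : Generators (Fin 3) → Module.End ℝ Words
  | .H i => vermaH lam i
  | .E i => vermaE lam i
  | .F i => vermaF i

/-- The Verma module as a representation of the free Lie algebra. -/
noncomputable def vermaRep (lam : Fin 3 → ℝ) :
    FreeLieAlgebra ℝ (Generators (Fin 3)) →ₗ⁅ℝ⁆ Module.End ℝ Words :=
  FreeLieAlgebra.lift ℝ (vermaGen lam)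

theorem vermaRep_of (g : Generators (Fin 3)) :
    vermaRep lam (FreeLieAlgebra.of ℝ g) = vermaGen lam g :=
  FreeLieAlgebra.lift_of_apply _ _

theorem lie_vermaE_vermaF (i j : Fin 3) :
    ⁅vermaE lam i, vermaF j⁆ = if i = j then vermaH lam i else 0 := by
  refine LinearMap.ext fun m => ?_
  rw [end_lie_apply, vermaE_vermaF]
  by_cases h : i = j
  · simp [h]
  · simp [h, Ne.symm h]

theorem lie_vermaH_vermaF (i j : Fin 3) :
    ⁅vermaH lam i, vermaF j⁆ = -(cartan i j : ℝ) • vermaF j := by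
  refine LinearMap.ext fun m => ?_
  rw [end_lie_apply, vermaH_vermaF]
  simp

theorem lie_vermaH_vermaE (i j : Fin 3) :
    ⁅vermaH lam i, vermaE lam j⁆ = (cartan i j : ℝ) • vermaE lam j := by
  refine LinearMap.ext fun m => ?_
  rw [end_lie_apply, vermaH_vermaE]
  simp

theorem lie_vermaH_vermaH (i j : Fin 3) : ⁅vermaH lam i, vermaH lam j⁆ = 0 := by
  refine LinearMap.ext fun m => ?_
  rw [end_lie_apply, vermaH_vermaH i j]
  simp

theorem lie_vermaF_vermaE (i j : Fin 3) :
    ⁅vermaF i, vermaE lam j⁆ = if i = j then -vermaH lam i else 0 := by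
  refine LinearMap.ext fun m => ?_
  rw [end_lie_apply, vermaE_vermaF]
  by_cases h : i = j
  · simp [h]
  · simp [h]

theorem lie_neg_vermaH_vermaE (i j : Fin 3) :
    ⁅-vermaH lam i, vermaE lam j⁆ = -(cartan i j : ℝ) • vermaE lam j := by
  refine LinearMap.ext fun m => ?_
  rw [end_lie_apply, LinearMap.neg_apply, vermaH_vermaE]
  simp

/-- The Serre element `ad(f_i)^{1-a_ij} f_j` as an operator on words. -/
noncomputable def serreF (i j : Fin 3) : Module.End ℝ Words :=
  (LieAlgebra.ad ℝ (Module.End ℝ Words) (vermaF i) ^ (-cartan i j).toNat) ⁅vermaF i, vermaF j⁆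

theorem lie_vermaE_serreF (i j k : Fin 3) : ⁅vermaE lam k, serreF i j⁆ = 0 :=
  lie_serre_eq_zero vermaF (vermaE lam) (vermaH lam) lie_vermaE_vermaF lie_vermaH_vermaF i j k

/-- A Serre element is a weight vector. Only the existence of the weight matters for the stability
of its span. -/
theorem lie_vermaH_serreF (i j k : Fin 3) : ∃ b : ℝ, ⁅vermaH lam k, serreF i j⁆ = b • serreF i j :=
  ⟨_, lie_ad_pow_weight (a := -(cartan k i : ℝ) + -(cartan k j : ℝ)) (lie_vermaH_vermaF k i)
    (lie_lie_weight (lie_vermaH_vermaF k i) (lie_vermaH_vermaF k j)) _⟩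

theorem vacuumCoeff_lie {A B : Module.End ℝ Words} (hA : ∀ m, vacuumCoeff (A m) = 0)
    (hB : ∀ m, vacuumCoeff (B m) = 0) (m : Words) : vacuumCoeff (⁅A, B⁆ m) = 0 := by
  rw [end_lie_apply, map_sub, hA, hB, sub_zero]

/-- Iterated commutators of the `vermaF` lengthen words, so the empty word never appears. -/
theorem vacuumCoeff_serreF (i j : Fin 3) (m : Words) : vacuumCoeff (serreF i j m) = 0 := by
  unfold serreF
  generalize (-cartan i j).toNat = n
  induction n generalizing m with
  | zero => exact vacuumCoeff_lie (vacuumCoeff_vermaF i) (vacuumCoeff_vermaF j) m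
  | succ n ih =>
    rw [pow_succ', Module.End.mul_apply, LieAlgebra.ad_apply]
    exact vacuumCoeff_lie (vacuumCoeff_vermaF i) ih m

/-- The Serre elements in the `e_i` vanish on the Verma module. -/
theorem serreE_eq_zero (i j : Fin 3) :
    (LieAlgebra.ad ℝ (Module.End ℝ Words) (vermaE lam i) ^ (-cartan i j).toNat)
      ⁅vermaE lam i, vermaE lam j⁆ = 0 := by
  -- The element commutes with all `vermaF` and kills the vacuum, hence it kills every word. No
  -- quotient is needed on this side.
  have hcomm := lie_serre_eq_zero (vermaE lam) vermaF (fun i => -vermaH lam i)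
    lie_vermaF_vermaE lie_neg_vermaH_vermaE i j
  refine words_hom_ext ?_ fun k m hm => ?_
  · generalize (-cartan i j).toNat = n
    clear hcomm
    induction n with
    | zero => simp [vermaE_vacuum]
    | succ n ih =>
      rw [pow_succ', Module.End.mul_apply, LieAlgebra.ad_apply, end_lie_apply]
      simp [ih, vermaE_vacuum]
  · have h := LinearMap.congr_fun (hcomm k) m
    rw [end_lie_apply, hm] at h
    simpa using h.symm

/-- The submodule of the Verma module generated by the Serre elements in the `f_i`. -/
inductive SerreSpan : Words → Prop
  | serre (i j : Fin 3) (m : Words) : SerreSpan (serreF i j m)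
  | vermaF (k : Fin 3) {m : Words} : SerreSpan m → SerreSpan (vermaF k m)
  | add {m n : Words} : SerreSpan m → SerreSpan n → SerreSpan (m + n)
  | smul (r : ℝ) {m : Words} : SerreSpan m → SerreSpan (r • m)

theorem SerreSpan.zero : SerreSpan 0 := by
  simpa using SerreSpan.smul 0 (SerreSpan.serre 0 0 0)

theorem SerreSpan.sub {m n : Words} (hm : SerreSpan m) (hn : SerreSpan n) : SerreSpan (m - n) := by
  simpa [sub_eq_add_neg] using hm.add (hn.smul (-1))

theorem SerreSpan.vacuumCoeff {m : Words} (hm : SerreSpan m) : vacuumCoeff m = 0 := by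
  induction hm with
  | serre i j m => exact vacuumCoeff_serreF i j m
  | vermaF k => exact vacuumCoeff_vermaF k _
  | add _ _ h1 h2 => rw [map_add, h1, h2, add_zero]
  | smul r _ h => rw [map_smul, h, smul_zero]

theorem SerreSpan.vermaH (k : Fin 3) {m : Words} (hm : SerreSpan m) :
    SerreSpan (vermaH lam k m) := by
  induction hm with
  | serre i j m =>
    obtain ⟨b, hb⟩ := lie_vermaH_serreF (lam := lam) i j k
    have h := LinearMap.congr_fun hb m
    rw [end_lie_apply, sub_eq_iff_eq_add] at h
    rw [h]
    exact ((SerreSpan.serre i j m).smul b).add (.serre i j _)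
  | vermaF j h ih =>
    rw [vermaH_vermaF]
    exact (ih.vermaF j).sub ((h.vermaF j).smul _)
  | add _ _ h1 h2 => rw [map_add]; exact h1.add h2
  | smul r _ h => rw [map_smul]; exact h.smul r

/-- Since `vermaE` commutes with the Serre elements it moves past them onto the argument. This is
the step that makes the span a submodule, and a proper one because of `SerreSpan.vacuumCoeff`. -/
theorem SerreSpan.vermaE (k : Fin 3) {m : Words} (hm : SerreSpan m) :
    SerreSpan (vermaE lam k m) := by
  induction hm with
  | serre i j m =>
    have h := LinearMap.congr_fun (lie_vermaE_serreF (lam := lam) i j k) m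
    rw [end_lie_apply, LinearMap.zero_apply, sub_eq_zero] at h
    rw [h]
    exact .serre i j _
  | vermaF j h ih =>
    rw [vermaE_vermaF]
    refine (ih.vermaF j).add ?_
    split_ifs
    · exact h.vermaH k
    · exact .zero
  | add _ _ h1 h2 => rw [map_add]; exact h1.add h2
  | smul r _ h => rw [map_smul]; exact h.smul r

/-- A subspace of a module over a free Lie algebra that is stable under the generators is stable
under the Lie algebra. -/
theorem freeLie_stable {X M : Type*} [AddCommGroup M] [Module ℝ M]
    (ρ : FreeLieAlgebra ℝ X →ₗ⁅ℝ⁆ Module.End ℝ M) (S : Submodule ℝ M)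
    (hS : ∀ g, ∀ m ∈ S, ρ (FreeLieAlgebra.of ℝ g) m ∈ S) (x : FreeLieAlgebra ℝ X) :
    ∀ m ∈ S, ρ x m ∈ S := by
  let K : LieSubalgebra ℝ (Module.End ℝ M) :=
    { carrier := {φ | ∀ m ∈ S, φ m ∈ S}
      add_mem' := fun ha hb m hm => S.add_mem (ha m hm) (hb m hm)
      zero_mem' := fun m _ => S.zero_mem
      smul_mem' := fun r φ h m hm => S.smul_mem r (h m hm)
      lie_mem' := fun ha hb m hm => S.sub_mem (ha _ (hb m hm)) (hb _ (ha m hm)) }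
  let τ : FreeLieAlgebra ℝ X →ₗ⁅ℝ⁆ K :=
    FreeLieAlgebra.lift ℝ fun g => ⟨ρ (FreeLieAlgebra.of ℝ g), hS g⟩
  have h : K.incl.comp τ = ρ := FreeLieAlgebra.hom_ext fun g => by simp [τ]
  rw [← h]
  exact (τ x).2

/-- The submodule generated by the Serre elements as a linear subspace. -/
noncomputable def serreSubmodule : Submodule ℝ Words where
  carrier := {m | SerreSpan m}
  add_mem' := .add
  zero_mem' := .zero
  smul_mem' r _ h := .smul r h

theorem vermaRep_mem (x : FreeLieAlgebra ℝ (Generators (Fin 3))) :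
    ∀ m ∈ serreSubmodule, vermaRep lam x m ∈ serreSubmodule := by
  refine freeLie_stable _ _ (fun g m hm => ?_) x
  rw [vermaRep_of]
  cases g with
  | H i => exact SerreSpan.vermaH i hm
  | E i => exact SerreSpan.vermaE i hm
  | F i => exact SerreSpan.vermaF i hm

/-- The elements of the free Lie algebra that vanish on the quotient of the Verma module by the
Serre elements. -/
noncomputable def vermaKernel (lam : Fin 3 → ℝ) :
    LieIdeal ℝ (FreeLieAlgebra ℝ (Generators (Fin 3))) where
  carrier := {x | ∀ m, vermaRep lam x m ∈ serreSubmodule}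
  add_mem' ha hb m := by rw [map_add]; exact Submodule.add_mem _ (ha m) (hb m)
  zero_mem' m := by rw [map_zero]; exact Submodule.zero_mem _
  smul_mem' r x h m := by rw [map_smul]; exact Submodule.smul_mem _ r (h m)
  lie_mem {z x} h m := by
    rw [LieHom.map_lie]
    exact Submodule.sub_mem _ (vermaRep_mem z _ (h m)) (h _)

/-- All relations except the Serre relations in the f_i already hold on the Verma module itself;
these last ones hold modulo `serreSubmodule` by construction. -/
theorem relations_le_vermaKernel : Relations.toIdeal ℝ cartan ≤ vermaKernel lam := by
  refine LieSubmodule.lieSpan_le.2 ?_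
  rintro y (((((⟨⟨i, j⟩, rfl⟩ | ⟨⟨i, j⟩, rfl⟩) | ⟨⟨i, j⟩, rfl⟩) | ⟨⟨i, j⟩, rfl⟩) |
    ⟨⟨i, j⟩, rfl⟩) | ⟨⟨i, j⟩, rfl⟩) m
  · simp [Relations.HH, vermaRep_of, vermaGen, lie_vermaH_vermaH]
  · by_cases hij : i = j
    · subst hij
      simp [Relations.EF, vermaRep_of, vermaGen, lie_vermaE_vermaF]
    · simp [Relations.EF, vermaRep_of, vermaGen, lie_vermaE_vermaF, hij]
  · have h : vermaRep lam (Relations.HE ℝ cartan (i, j)) = 0 := by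
      simp only [Relations.HE, Function.uncurry, Function.comp, map_sub, map_zsmul, LieHom.map_lie,
        vermaRep_of, vermaGen, lie_vermaH_vermaE]
      module
    rw [h]
    exact Submodule.zero_mem _
  · have h : vermaRep lam (Relations.HF ℝ cartan (i, j)) = 0 := by
      simp only [Relations.HF, Function.uncurry, Function.comp, map_add, map_zsmul, LieHom.map_lie,
        vermaRep_of, vermaGen, lie_vermaH_vermaF]
      module
    rw [h]
    exact Submodule.zero_mem _
  · simp only [Relations.adE, Function.uncurry, Function.comp, map_ad_pow, LieHom.map_lie,
      vermaRep_of, vermaGen, serreE_eq_zero]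
    exact Submodule.zero_mem _
  · simp only [Relations.adF, Function.uncurry, Function.comp, map_ad_pow, LieHom.map_lie,
      vermaRep_of, vermaGen]
    exact SerreSpan.serre i j m

/-- The linear functional on `AE₃` that reads off the highest weight `lam` of the Cartan part. -/
noncomputable def weightFunctional (lam : Fin 3 → ℝ) : Alg →ₗ[ℝ] ℝ :=
  (Relations.toIdeal ℝ cartan).toSubmodule.liftQ
    (vacuumCoeff ∘ₗ (LinearMap.applyₗ vacuum : Module.End ℝ Words →ₗ[ℝ] Words) ∘ₗ
      (vermaRep lam : FreeLieAlgebra ℝ (Generators (Fin 3)) →ₗ[ℝ] Module.End ℝ Words))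
    (fun _ hx => SerreSpan.vacuumCoeff (relations_le_vermaKernel hx vacuum))

theorem weightFunctional_ofFree (x : FreeLieAlgebra ℝ (Generators (Fin 3))) :
    weightFunctional lam (ofFree x) = vacuumCoeff (vermaRep lam x vacuum) := rfl

/-- The coefficient of `h_i` in the Cartan part of an element of `AE₃`. -/
noncomputable def corootCoord (i : Fin 3) : Alg →ₗ[ℝ] ℝ := weightFunctional (Pi.single i 1)

/-- This is the lower bound on the presented algebra: the h_i stay linearly independent after
imposing the Serre relations. -/
theorem corootCoord_genH (i j : Fin 3) : corootCoord i (genH j) = if i = j then 1 else 0 := by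
  rw [corootCoord, genH, weightFunctional_ofFree, vermaRep_of]
  change vacuumCoeff (vermaH _ j vacuum) = _
  rw [vermaH_vacuum]
  rcases eq_or_ne i j with h | h
  · simp [vacuumCoeff, vacuum, h]
  · simp [vacuumCoeff, vacuum, h, h.symm]

/-- The vacuum is an eigenvector of h_j and the vacuum coefficient is an eigenfunctional with the
same eigenvalue, so the two terms of the commutator cancel. -/
theorem corootCoord_genH_lie (i j : Fin 3) (x : Alg) : corootCoord i ⁅genH j, x⁆ = 0 := by
  obtain ⟨x, rfl⟩ : ∃ y, ofFree y = x := Quotient.exists_rep x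
  rw [genH, ← ofFree_lie, corootCoord, weightFunctional_ofFree, LieHom.map_lie, vermaRep_of]
  change vacuumCoeff (vermaH _ j _ - _) = 0
  rw [map_sub, vacuumCoeff_vermaH]
  change _ - vacuumCoeff (vermaRep _ x (vermaH _ j vacuum)) = 0
  rw [vermaH_vacuum, map_smul, map_smul, smul_eq_mul, sub_self]

end Coordinates

end AE3

namespace AE3

/-! ### Eigenvectors in spans and in stable subspaces. -/

section Eigen

variable {V : Type*} [AddCommGroup V] [Module ℝ V]

theorem span_eigen_le (T : Module.End ℝ V) {X : Set V} (hX : ∀ x ∈ X, ∃ ν : ℝ, T x = ν • x) (μ : ℝ) :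
    Submodule.span ℝ {x ∈ X | T x ≠ μ • x} ≤ ⨆ ν ≠ μ, Module.End.eigenspace T ν := by
  refine Submodule.span_le.2 fun x hx => ?_
  obtain ⟨ν, hν⟩ := hX x hx.1
  have hne : ν ≠ μ := fun h => hx.2 (h ▸ hν)
  exact Submodule.mem_iSup_of_mem ν (Submodule.mem_iSup_of_mem hne (Module.End.mem_eigenspace_iff.2 hν))

/-- Sorts the spanning eigenvectors by whether they have eigenvalue μ. Diagonalizability is needed
only on the span. -/
theorem exists_eigen_decomposition (T : Module.End ℝ V) {X : Set V}
    (hX : ∀ x ∈ X, ∃ ν : ℝ, T x = ν • x) (μ : ℝ) {y : V} (hy : y ∈ Submodule.span ℝ X) :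
    ∃ a ∈ Submodule.span ℝ {x ∈ X | T x = μ • x}, ∃ b ∈ ⨆ ν ≠ μ, Module.End.eigenspace T ν,
      y = a + b := by
  have hsplit : X = {x ∈ X | T x = μ • x} ∪ {x ∈ X | T x ≠ μ • x} := by
    ext x
    by_cases h : T x = μ • x <;> simp [h]
  rw [hsplit, Submodule.span_union] at hy
  obtain ⟨a, ha, b, hb, rfl⟩ := Submodule.mem_sup.1 hy
  exact ⟨a, ha, b, span_eigen_le T hX μ hb, rfl⟩

theorem span_le_eigenspace (T : Module.End ℝ V) (X : Set V) (μ : ℝ) :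
    Submodule.span ℝ {x ∈ X | T x = μ • x} ≤ Module.End.eigenspace T μ :=
  Submodule.span_le.2 fun _ hx => Module.End.mem_eigenspace_iff.2 hx.2

/-- An eigenvector in the span of a set of eigenvectors lies in the span of those with the same
eigenvalue. -/
theorem mem_span_eigen (T : Module.End ℝ V) {X : Set V} (hX : ∀ x ∈ X, ∃ ν : ℝ, T x = ν • x)
    {μ : ℝ} {y : V} (hy : y ∈ Submodule.span ℝ X) (hT : T y = μ • y) :
    y ∈ Submodule.span ℝ {x ∈ X | T x = μ • x} := by
  obtain ⟨a, ha, b, hb, rfl⟩ := exists_eigen_decomposition T hX μ hy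
  have ha' := Module.End.mem_eigenspace_iff.1 (span_le_eigenspace T X μ ha)
  have hb' : b ∈ Module.End.eigenspace T μ := by
    rw [map_add, ha', smul_add, add_right_inj] at hT
    exact Module.End.mem_eigenspace_iff.2 hT
  have hb0 : b = 0 :=
    Submodule.disjoint_def.1 (Module.End.eigenspaces_iSupIndep T μ) b hb' hb
  rwa [hb0, add_zero]

/-- The eigencomponents of an element of a stable subspace lie in the subspace. -/
theorem eigencomponent_mem (T : Module.End ℝ V) (S : Submodule ℝ V) (hS : ∀ x ∈ S, T x ∈ S)
    {μ : ℝ} {a b : V} (ha : T a = μ • a) (hb : b ∈ ⨆ ν ≠ μ, Module.End.eigenspace T ν)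
    (hab : a + b ∈ S) : a ∈ S := by
  -- In the quotient by S the classes of a and -b coincide, while they lie in independent sums of
  -- eigenspaces; so both vanish.
  let T' : Module.End ℝ (V ⧸ S) := S.mapQ S T hS
  have hmap : ∀ ν, (Module.End.eigenspace T ν).map S.mkQ ≤ Module.End.eigenspace T' ν := by
    rintro ν _ ⟨x, hx, rfl⟩
    have hx' := Module.End.mem_eigenspace_iff.1 hx
    refine Module.End.mem_eigenspace_iff.2 ?_
    change S.mkQ (T x) = ν • S.mkQ x
    rw [hx', map_smul]
  have ha' : S.mkQ a ∈ Module.End.eigenspace T' μ :=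
    hmap μ ⟨a, Module.End.mem_eigenspace_iff.2 ha, rfl⟩
  have hb' : S.mkQ b ∈ ⨆ ν ≠ μ, Module.End.eigenspace T' ν := by
    have h := Submodule.mem_map_of_mem (f := S.mkQ) hb
    simp only [Submodule.map_iSup] at h
    exact iSup₂_mono (fun ν _ => hmap ν) h
  have hsum : S.mkQ a = -S.mkQ b := by
    rw [eq_neg_iff_add_eq_zero, ← map_add]
    exact (Submodule.Quotient.mk_eq_zero S).2 hab
  have h0 : S.mkQ a = 0 := Submodule.disjoint_def.1 (Module.End.eigenspaces_iSupIndep T' μ) _ ha'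
    (hsum ▸ Submodule.neg_mem _ hb')
  exact (Submodule.Quotient.mk_eq_zero S).1 h0

end Eigen

/-! ### Spanning by iterated commutators, and centralizers of Cartan elements. -/

section Words

open CartanMatrix

/-- A Lie subalgebra containing the `e_i` and the `f_i` is everything. -/
theorem mem_of_genE_genF_mem (K : LieSubalgebra ℝ Alg) (hE : ∀ i, genE i ∈ K)
    (hF : ∀ i, genF i ∈ K) (x : Alg) : x ∈ K := by
  have hH : ∀ i, genH i ∈ K := fun i => by
    have := K.lie_mem (hE i) (hF i)
    rwa [rel_EF, if_pos rfl] at this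
  let g : Generators (Fin 3) → K
    | .H i => ⟨genH i, hH i⟩
    | .E i => ⟨genE i, hE i⟩
    | .F i => ⟨genF i, hF i⟩
  -- The free Lie algebra maps to K, and composing with the inclusion gives back the quotient map,
  -- which is surjective.
  have h : K.incl.comp (FreeLieAlgebra.lift ℝ g) = ofFreeHom := FreeLieAlgebra.hom_ext fun c => by
    cases c <;> simp [g] <;> rfl
  obtain ⟨y, rfl⟩ : ∃ y, ofFree y = x := Quotient.exists_rep x
  change ofFreeHom y ∈ K
  rw [← h]
  exact (FreeLieAlgebra.lift ℝ g y).2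

/-- The stabilizer of a subspace. -/
noncomputable def stabilizer {V : Type*} [AddCommGroup V] [Module ℝ V] [LieRingModule Alg V]
    [LieModule ℝ Alg V] (S : Submodule ℝ V) : LieSubalgebra ℝ Alg where
  carrier := {z | ∀ x ∈ S, ⁅z, x⁆ ∈ S}
  add_mem' ha hb x hx := by rw [add_lie]; exact S.add_mem (ha x hx) (hb x hx)
  zero_mem' x _ := by rw [zero_lie]; exact S.zero_mem
  smul_mem' r z hz x hx := by rw [smul_lie]; exact S.smul_mem r (hz x hx)
  lie_mem' ha hb x hx := by
    rw [lie_lie]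
    exact S.sub_mem (ha _ (hb x hx)) (hb _ (ha x hx))

/-- The Chevalley generators `e_i` and `f_i`, with a sign. -/
noncomputable def chev (s : Bool) (i : Fin 3) : Alg := bif s then genE i else genF i

/-- The sign of a Chevalley generator. -/
def chevSign (s : Bool) : ℝ := bif s then 1 else -1

theorem lie_genH_chev (s : Bool) (i j : Fin 3) :
    ⁅genH i, chev s j⁆ = (chevSign s * cartan i j) • chev s j := by
  cases s
  · simp only [chev, chevSign, cond_false, rel_HF]; module
  · simp only [chev, chevSign, cond_true, rel_HE]; module

theorem lie_chev_chev_not (s : Bool) (i j : Fin 3) :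
    ⁅chev s i, chev (!s) j⁆ = if i = j then chevSign s • genH i else 0 := by
  cases s
  · simp only [chev, chevSign, cond_false, Bool.not_false, cond_true]
    rw [← lie_skew, rel_EF]
    by_cases h : i = j
    · simp [h]
    · simp [h, Ne.symm h]
  · simp only [chev, chevSign, cond_true, Bool.not_true, cond_false, rel_EF, one_smul]

theorem alg_stable {V : Type*} [AddCommGroup V] [Module ℝ V] [LieRingModule Alg V]
    [LieModule ℝ Alg V] (S : Submodule ℝ V) (h : ∀ s i, ∀ x ∈ S, ⁅chev s i, x⁆ ∈ S) (z : Alg) :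
    ∀ x ∈ S, ⁅z, x⁆ ∈ S :=
  mem_of_genE_genF_mem (stabilizer S) (fun i => h true i) (fun i => h false i) z

/-- Iterated commutators of the `e_i` or of the `f_i`. -/
noncomputable def word (s : Bool) (i : Fin 3) : List (Fin 3) → Alg
  | [] => chev s i
  | j :: w => ⁅chev s j, word s i w⁆

/-- The spanning set of iterated commutators and Cartan elements. -/
def wordSet : Set Alg := {x | ∃ s i w, word s i w = x} ∪ Set.range genH

theorem lie_genH_word (s : Bool) (i k : Fin 3) (w : List (Fin 3)) :
    ⁅genH k, word s i w⁆ =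
      (chevSign s * (cartan k i + (w.map fun j => (cartan k j : ℝ)).sum)) • word s i w := by
  induction w with
  | nil => simp [word, lie_genH_chev]
  | cons j w ih =>
    rw [word, lie_lie_weight (lie_genH_chev s k j) ih, List.map_cons, List.sum_cons]
    ring_nf

/-- A generator of opposite sign strips letters: by the Leibniz rule it meets a letter of the same
node, producing a coroot that acts on the remaining word by its weight. Keeping the sign fixed in
the target span is what allows the induction to put the outer letter back. -/
theorem lie_chev_word_mem (s : Bool) (k i : Fin 3) (w : List (Fin 3)) :
    ⁅chev (!s) k, word s i w⁆ ∈
      Submodule.span ℝ ({x | ∃ i w, word s i w = x} ∪ Set.range genH) := by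
  have hnot : ∀ k j, ⁅chev (!s) k, chev s j⁆ = if k = j then chevSign (!s) • genH k else 0 := by
    intro k j
    have := lie_chev_chev_not (!s) k j
    rwa [Bool.not_not] at this
  induction w with
  | nil =>
    rw [word, hnot]
    split_ifs
    · exact Submodule.smul_mem _ _ (Submodule.subset_span (Or.inr ⟨k, rfl⟩))
    · exact Submodule.zero_mem _
  | cons j w ih =>
    rw [word, leibniz_lie, hnot]
    refine Submodule.add_mem _ ?_ ?_
    · split_ifs
      · rw [smul_lie, lie_genH_word]
        exact Submodule.smul_mem _ _ (Submodule.smul_mem _ _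
          (Submodule.subset_span (Or.inl ⟨i, w, rfl⟩)))
      · rw [zero_lie]; exact Submodule.zero_mem _
    · refine Submodule.span_induction (p := fun x _ => ⁅chev s j, x⁆ ∈ _) ?_ ?_ ?_ ?_ ih
      · rintro x (⟨i, w, rfl⟩ | ⟨i, rfl⟩)
        · exact Submodule.subset_span (Or.inl ⟨i, j :: w, rfl⟩)
        · rw [← lie_skew, lie_genH_chev]
          exact Submodule.neg_mem _ (Submodule.smul_mem _ _
            (Submodule.subset_span (Or.inl ⟨j, [], rfl⟩)))
      · rw [lie_zero]; exact Submodule.zero_mem _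
      · intro x y _ _ hx hy; rw [lie_add]; exact Submodule.add_mem _ hx hy
      · intro r x _ hx; rw [lie_smul]; exact Submodule.smul_mem _ _ hx

/-- The span is stable under all Chevalley generators, hence under the whole algebra, hence a
subalgebra. It contains the generators. -/
theorem span_wordSet : Submodule.span ℝ wordSet = ⊤ := by
  have hstab : ∀ s i, ∀ x ∈ Submodule.span ℝ wordSet, ⁅chev s i, x⁆ ∈ Submodule.span ℝ wordSet := by
    intro s k x hx
    refine Submodule.span_induction (p := fun x _ => ⁅chev s k, x⁆ ∈ _) ?_ ?_ ?_ ?_ hx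
    · rintro x (⟨s', i, w, rfl⟩ | ⟨i, rfl⟩)
      · by_cases hs : s = s'
        · subst hs
          exact Submodule.subset_span (Or.inl ⟨s, i, k :: w, rfl⟩)
        · obtain rfl : s = !s' := by cases s <;> cases s' <;> simp_all
          refine Submodule.span_mono ?_ (lie_chev_word_mem s' k i w)
          exact Set.union_subset_union_left _ fun x ⟨i, w, h⟩ => ⟨s', i, w, h⟩
      · rw [← lie_skew, lie_genH_chev]
        exact Submodule.neg_mem _ (Submodule.smul_mem _ _
          (Submodule.subset_span (Or.inl ⟨s, k, [], rfl⟩)))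
    · rw [lie_zero]; exact Submodule.zero_mem _
    · intro x y _ _ hx hy; rw [lie_add]; exact Submodule.add_mem _ hx hy
    · intro r x _ hx; rw [lie_smul]; exact Submodule.smul_mem _ _ hx
  have hgen : ∀ s i, chev s i ∈ Submodule.span ℝ wordSet := fun s i =>
    Submodule.subset_span (Or.inl ⟨s, i, [], rfl⟩)
  let K : LieSubalgebra ℝ Alg :=
    { Submodule.span ℝ wordSet with
      lie_mem' := fun {x y} _ hy => alg_stable (Submodule.span ℝ wordSet) hstab x y hy }
  exact top_le_iff.1 fun x _ => mem_of_genE_genF_mem K (hgen true) (hgen false) x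

/-- The element of the Cartan subalgebra with coordinates `c`. -/
noncomputable def cartanElem (c : Fin 3 → ℝ) : Alg := ∑ i, c i • genH i

/-- The value of the simple root `α_j` on `cartanElem c`. -/
noncomputable def simpleRoot (c : Fin 3 → ℝ) (j : Fin 3) : ℝ := ∑ i, c i * cartan i j

theorem lie_cartanElem_word (c : Fin 3 → ℝ) (s : Bool) (i : Fin 3) (w : List (Fin 3)) :
    ⁅cartanElem c, word s i w⁆ =
      (chevSign s * (simpleRoot c i + (w.map (simpleRoot c)).sum)) • word s i w := by
  induction w with
  | nil =>
    simp only [word, cartanElem, sum_lie, smul_lie, lie_genH_chev, List.map_nil, List.sum_nil,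
      add_zero, simpleRoot, smul_smul, ← Finset.sum_smul, Finset.mul_sum]
    refine congrArg (· • chev s i) (Finset.sum_congr rfl fun j _ => by ring)
  | cons j w ih =>
    have h : ⁅cartanElem c, chev s j⁆ = (chevSign s * simpleRoot c j) • chev s j := by
      simp only [cartanElem, sum_lie, smul_lie, lie_genH_chev, simpleRoot, smul_smul,
        ← Finset.sum_smul, Finset.mul_sum]
      refine congrArg (· • chev s j) (Finset.sum_congr rfl fun j _ => by ring)
    rw [word, lie_lie_weight h ih, List.map_cons, List.sum_cons]
    ring_nf

theorem lie_cartanElem_genH (c : Fin 3 → ℝ) (i : Fin 3) : ⁅cartanElem c, genH i⁆ = 0 := by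
  simp [cartanElem, sum_lie, rel_HH]

theorem wordSet_eigen (c : Fin 3 → ℝ) :
    ∀ x ∈ wordSet, ∃ ν : ℝ, LieAlgebra.ad ℝ Alg (cartanElem c) x = ν • x := by
  rintro x (⟨s, i, w, rfl⟩ | ⟨i, rfl⟩)
  · exact ⟨_, lie_cartanElem_word c s i w⟩
  · exact ⟨0, by simp [lie_cartanElem_genH]⟩

theorem word_ne_zero_of_weight {c : Fin 3 → ℝ} {μ : ℝ} {s : Bool} {i : Fin 3} {w : List (Fin 3)}
    (h : ⁅cartanElem c, word s i w⁆ = μ • word s i w) (h0 : word s i w ≠ 0) :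
    chevSign s * (simpleRoot c i + (w.map (simpleRoot c)).sum) = μ := by
  rw [lie_cartanElem_word] at h
  exact smul_left_injective ℝ h0 h

theorem chevSign_mul_self (s : Bool) : chevSign s * chevSign s = 1 := by
  cases s <;> simp [chevSign]

/-- If `cartanElem c` has eigenvalue zero on all simple roots but one and a positive one on that,
its centralizer consists of Cartan elements and words that avoid this simple root. -/
theorem centralizer_le {c : Fin 3 → ℝ} {k : Fin 3} (hk : 0 < simpleRoot c k)
    (hj : ∀ j ≠ k, simpleRoot c j = 0) {S : Submodule ℝ Alg} (hH : ∀ i, genH i ∈ S)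
    (hS : ∀ s, ∀ i ≠ k, chev s i ∈ S) (hst : ∀ s, ∀ i ≠ k, ∀ x ∈ S, ⁅chev s i, x⁆ ∈ S) {x : Alg}
    (hx : ⁅cartanElem c, x⁆ = 0) : x ∈ S := by
  -- Only words of total weight zero contribute. All simple roots take nonnegative values on
  -- `cartanElem c`, so every letter of such a word has value zero and differs from k.
  have hmem := mem_span_eigen (LieAlgebra.ad ℝ Alg (cartanElem c)) (wordSet_eigen c) (μ := 0)
    (y := x) (by rw [span_wordSet]; trivial) (by simpa using hx)
  refine Submodule.span_le.2 ?_ hmem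
  rintro _ ⟨⟨s, i, w, rfl⟩ | ⟨i, rfl⟩, h0⟩
  · by_cases hw : word s i w = 0
    · rw [hw]; exact S.zero_mem
    have hsum := word_ne_zero_of_weight h0 hw
    have hnn : ∀ j, 0 ≤ simpleRoot c j := fun j => by
      by_cases h : j = k
      · rw [h]; exact hk.le
      · rw [hj j h]
    have hsum' : simpleRoot c i + (w.map (simpleRoot c)).sum = 0 := by
      have h2 := congrArg (chevSign s * ·) hsum
      simpa [← mul_assoc, chevSign_mul_self] using h2
    clear hsum h0 hmem hw
    have hw0 : ∀ w : List (Fin 3), 0 ≤ (w.map (simpleRoot c)).sum := fun w =>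
      List.sum_nonneg fun y hy => by
        obtain ⟨j, -, rfl⟩ := List.mem_map.1 hy
        exact hnn j
    induction w with
    | nil =>
      refine hS s i fun h => hk.ne' ?_
      simpa [h] using hsum'
    | cons j w ih =>
      rw [List.map_cons, List.sum_cons] at hsum'
      have h1 := hnn i
      have h2 := hnn j
      have h3 := hw0 w
      refine hst s j (fun h => hk.ne' ?_) _ (ih (by linarith))
      rw [← h]
      linarith
  · exact hH i

end Words

end AE3

namespace AE3

/-! ### Existence and uniqueness of the invariant form. -/

section Form

/-- The coordinates of the element of the Cartan subalgebra on which all simple roots are one. -/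
noncomputable def rhoCoord : Fin 3 → ℝ := ![-2, -5, -9 / 2]

/-- The Cartan matrix is invertible, so the equations for these coordinates have a solution. The
adjoint eigenvalue on a word is then its signed height, which is never zero. -/
theorem simpleRoot_rhoCoord : simpleRoot rhoCoord = fun _ => 1 := by
  funext j
  fin_cases j <;> simp [simpleRoot, rhoCoord, cartan, Fin.sum_univ_three] <;> norm_num

/-- The element of the Cartan subalgebra on which all simple roots are one. -/
noncomputable def rhoElem : Alg := cartanElem rhoCoord

theorem lie_rhoElem_word (s : Bool) (i : Fin 3) (w : List (Fin 3)) :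
    ⁅rhoElem, word s i w⁆ = (chevSign s * (1 + w.length)) • word s i w := by
  rw [rhoElem, lie_cartanElem_word, simpleRoot_rhoCoord]
  simp

theorem lie_rhoElem_chev (s : Bool) (i : Fin 3) : ⁅rhoElem, chev s i⁆ = chevSign s • chev s i := by
  simpa [word] using lie_rhoElem_word s i []

theorem lie_rhoElem_genH (i : Fin 3) : ⁅rhoElem, genH i⁆ = 0 := lie_cartanElem_genH _ i

theorem chevSign_ne_zero (s : Bool) : chevSign s ≠ 0 := by cases s <;> simp [chevSign]

theorem chevSign_not (s : Bool) : chevSign (!s) = -chevSign s := by cases s <;> simp [chevSign]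

theorem corootCoord_rhoElem_lie (i : Fin 3) (x : Alg) : corootCoord i ⁅rhoElem, x⁆ = 0 := by
  simp [rhoElem, cartanElem, sum_lie, corootCoord_genH_lie]

/-- The coordinates vanish on commutators with Cartan elements, and an element of nonzero height is
a multiple of such a commutator. -/
theorem corootCoord_eq_zero {μ : ℝ} (hμ : μ ≠ 0) {x : Alg} (hx : ⁅rhoElem, x⁆ = μ • x)
    (i : Fin 3) : corootCoord i x = 0 := by
  have h := corootCoord_rhoElem_lie i x
  rw [hx, map_smul, smul_eq_mul] at h
  exact (mul_eq_zero.1 h).resolve_left hμ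

theorem one_add_length_ne_zero (w : List (Fin 3)) : (1 + w.length : ℝ) ≠ 0 := by positivity

theorem corootCoord_word (i : Fin 3) (s : Bool) (j : Fin 3) (w : List (Fin 3)) :
    corootCoord i (word s j w) = 0 :=
  corootCoord_eq_zero (mul_ne_zero (chevSign_ne_zero s) (one_add_length_ne_zero w))
    (lie_rhoElem_word s j w) i

theorem linearMap_ext_wordSet {M : Type*} [AddCommMonoid M] [Module ℝ M] {A B : Alg →ₗ[ℝ] M}
    (hw : ∀ s i w, A (word s i w) = B (word s i w)) (hH : ∀ i, A (genH i) = B (genH i)) :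
    A = B := by
  refine LinearMap.ext_on span_wordSet ?_
  rintro x (⟨s, i, w, rfl⟩ | ⟨i, rfl⟩)
  exacts [hw s i w, hH i]

/-- Height leaves only opposite generators y, and then the commutator is a multiple of h_k, which
has no h_j part. -/
theorem corootCoord_lie_chev_of_ne {j k : Fin 3} (hjk : j ≠ k) (s : Bool) (y : Alg) :
    corootCoord j ⁅chev s k, y⁆ = 0 := by
  suffices h : (corootCoord j) ∘ₗ (LieAlgebra.ad ℝ Alg (chev s k) : Alg →ₗ[ℝ] Alg) = 0 from
    LinearMap.congr_fun h y
  refine linearMap_ext_wordSet (fun s' i w => ?_) fun i => ?_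
  · change corootCoord j ⁅chev s k, word s' i w⁆ = 0
    by_cases hs : s' = s
    · subst hs
      exact corootCoord_word j s' i (k :: w)
    · obtain rfl : s' = !s := by cases s <;> cases s' <;> simp_all
      cases w with
      | nil =>
        rw [word, lie_chev_chev_not]
        split_ifs
        · rw [map_smul, corootCoord_genH, if_neg hjk, smul_zero]
        · rw [map_zero]
      | cons l w =>
        refine corootCoord_eq_zero ?_ (lie_lie_weight (lie_rhoElem_chev s k)
          (lie_rhoElem_word (!s) i (l :: w))) j
        rw [chevSign_not, List.length_cons]
        push_cast
        have : chevSign s + -chevSign s * (1 + ((w.length : ℝ) + 1)) =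
          -(chevSign s * (1 + w.length)) := by ring
        rw [this]
        exact neg_ne_zero.2 (mul_ne_zero (chevSign_ne_zero s) (one_add_length_ne_zero w))
  · change corootCoord j ⁅chev s k, genH i⁆ = 0
    rw [← lie_skew, map_neg, corootCoord_genH_lie, neg_zero]

/-- The functional `⟨h_i|·⟩`. -/
noncomputable def cartanFunctional (i : Fin 3) : Module.Dual ℝ Alg :=
  ∑ j, (cartan i j : ℝ) • corootCoord j

/-- By height only a Cartan element y contributes, for which the double commutator is explicit.
Symmetry of the Cartan matrix turns the root value into ⟨h_k|y⟩. This is the compatibility of the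
candidate functionals of e_i and f_i with that of h_i. -/
theorem corootCoord_lie_lie (s : Bool) (i k : Fin 3) (y : Alg) :
    corootCoord i ⁅chev s i, ⁅chev (!s) k, y⁆⁆ = if k = i then cartanFunctional k y else 0 := by
  suffices h : (corootCoord i) ∘ₗ (LieAlgebra.ad ℝ Alg (chev s i) : Alg →ₗ[ℝ] Alg) ∘ₗ
      (LieAlgebra.ad ℝ Alg (chev (!s) k) : Alg →ₗ[ℝ] Alg) =
      if k = i then cartanFunctional k else 0 by
    have := LinearMap.congr_fun h y
    split_ifs at this ⊢ <;> exact this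
  refine linearMap_ext_wordSet (fun s' j w => ?_) fun j => ?_
  · change corootCoord i ⁅chev s i, ⁅chev (!s) k, word s' j w⁆⁆ = _
    have h0 : (if k = i then cartanFunctional k else 0) (word s' j w) = 0 := by
      split_ifs
      · simp [cartanFunctional, corootCoord_word]
      · rfl
    rw [h0]
    refine corootCoord_eq_zero ?_ (lie_lie_weight (lie_rhoElem_chev s i)
      (lie_lie_weight (lie_rhoElem_chev (!s) k) (lie_rhoElem_word s' j w))) i
    rw [chevSign_not, add_neg_cancel_left]
    exact mul_ne_zero (chevSign_ne_zero s') (one_add_length_ne_zero w)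
  · change corootCoord i ⁅chev s i, ⁅chev (!s) k, genH j⁆⁆ = _
    rw [← lie_skew _ (genH j), lie_genH_chev, lie_neg, lie_smul, lie_chev_chev_not, chevSign_not]
    by_cases h : i = k
    · subst h
      have hsymm : cartan i j = cartan j i := by
        fin_cases i <;> fin_cases j <;> rfl
      simp only [if_true, map_neg, map_smul, corootCoord_genH, cartanFunctional,
        LinearMap.sum_apply, LinearMap.smul_apply, smul_eq_mul, mul_ite, mul_one, mul_zero,
        Finset.sum_ite_eq', Finset.mem_univ, hsymm]
      have := chevSign_mul_self s
      linear_combination (cartan j i : ℝ) * this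
    · simp [h, Ne.symm h]

/-- Pairs of an element and a linear functional. -/
abbrev DualPair : Type := Alg × Module.Dual ℝ Alg

/-- The diagonal action, contragredient in the second entry. A subspace of pairs stable under it is
an invariant relation between elements and functionals, so invariance of the form becomes stability
of its graph. -/
noncomputable instance : LieRingModule Alg DualPair where
  bracket z p := (⁅z, p.1⁆, ⁅z, p.2⁆)
  add_lie _ _ _ := Prod.ext (add_lie _ _ _) (add_lie _ _ _)
  lie_add _ _ _ := Prod.ext (lie_add _ _ _) (lie_add _ _ _)
  leibniz_lie _ _ _ := Prod.ext (leibniz_lie _ _ _) (leibniz_lie _ _ _)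

noncomputable instance : LieModule ℝ Alg DualPair where
  smul_lie _ _ _ := Prod.ext (smul_lie _ _ _) (smul_lie _ _ _)
  lie_smul _ _ _ := Prod.ext (lie_smul _ _ _) (lie_smul _ _ _)

/-- The pair of `h_i` and `⟨h_i|·⟩`. -/
noncomputable def cartanPair (i : Fin 3) : DualPair := (genH i, cartanFunctional i)

/-- The pair of a Chevalley generator `x` and `⟨x|·⟩`. -/
noncomputable def chevPair (s : Bool) (i : Fin 3) : DualPair :=
  (chev s i, chevSign s • ((corootCoord i) ∘ₗ (LieAlgebra.ad ℝ Alg (chev s i) : Alg →ₗ[ℝ] Alg)))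

theorem chevPair_snd_apply (s : Bool) (i : Fin 3) (y : Alg) :
    (chevPair s i).2 y = chevSign s * corootCoord i ⁅chev s i, y⁆ := rfl

/-- Together with `lie_chev_not_chevPair`, this shows that pairs satisfy the commutation relations
of their first entries. The functionals attached to the generators are thus consistent, and words of
pairs can be treated like words. -/
theorem lie_chev_cartanPair (s : Bool) (k i : Fin 3) :
    ⁅chev s k, cartanPair i⁆ = -(chevSign s * cartan i k) • chevPair s k := by
  refine Prod.ext ?_ (LinearMap.ext fun y => ?_)
  · change ⁅chev s k, genH i⁆ = -(chevSign s * cartan i k) • chev s k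
    rw [← lie_skew, lie_genH_chev, neg_smul]
  · change -(cartanFunctional i ⁅chev s k, y⁆) = -(chevSign s * cartan i k) * (chevPair s k).2 y
    rw [chevPair_snd_apply]
    have h : cartanFunctional i ⁅chev s k, y⁆ = cartan i k * corootCoord k ⁅chev s k, y⁆ := by
      simp only [cartanFunctional, LinearMap.sum_apply, LinearMap.smul_apply, smul_eq_mul]
      refine Finset.sum_eq_single k (fun j _ hj => ?_) (by simp)
      rw [corootCoord_lie_chev_of_ne hj, mul_zero]
    rw [h]
    have := chevSign_mul_self s
    linear_combination (cartan i k : ℝ) * corootCoord k ⁅chev s k, y⁆ * this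

theorem lie_chev_not_chevPair (s : Bool) (k i : Fin 3) :
    ⁅chev (!s) k, chevPair s i⁆ = if k = i then -chevSign s • cartanPair k else 0 := by
  refine Prod.ext ?_ (LinearMap.ext fun y => ?_)
  · change ⁅chev (!s) k, chev s i⁆ = _
    have := lie_chev_chev_not (!s) k i
    rw [Bool.not_not, chevSign_not] at this
    rw [this]
    split_ifs <;> rfl
  · change -(chevPair s i).2 ⁅chev (!s) k, y⁆ = _
    rw [chevPair_snd_apply, corootCoord_lie_lie]
    split_ifs
    · change _ = -chevSign s * cartanFunctional k y
      ring
    · simp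

/-- Iterated commutators as elements of the graph of the invariant form. -/
noncomputable def wordPair (s : Bool) (i : Fin 3) : List (Fin 3) → DualPair
  | [] => chevPair s i
  | j :: w => ⁅chev s j, wordPair s i w⁆

theorem lie_rhoElem_chevPair (s : Bool) (i : Fin 3) :
    ⁅rhoElem, chevPair s i⁆ = chevSign s • chevPair s i := by
  refine Prod.ext (lie_rhoElem_chev s i) (LinearMap.ext fun y => ?_)
  change -(chevPair s i).2 ⁅rhoElem, y⁆ = chevSign s * (chevPair s i).2 y
  have h : ⁅chev s i, ⁅rhoElem, y⁆⁆ =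
      ⁅rhoElem, ⁅chev s i, y⁆⁆ - chevSign s • ⁅chev s i, y⁆ := by
    rw [leibniz_lie rhoElem, lie_rhoElem_chev, smul_lie]
    abel
  rw [chevPair_snd_apply, chevPair_snd_apply, h, map_sub, corootCoord_rhoElem_lie, map_smul,
    smul_eq_mul]
  ring

theorem lie_cartanElem_pair {z : Alg} {p : DualPair} {a b : ℝ} {x : Alg}
    (hx : ⁅z, x⁆ = a • x) (hp : ⁅z, p⁆ = b • p) : ⁅z, ⁅x, p⁆⁆ = (a + b) • ⁅x, p⁆ := by
  rw [leibniz_lie, hx, hp, smul_lie, add_smul]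
  exact congrArg _ (lie_smul b x p)

theorem lie_rhoElem_wordPair (s : Bool) (i : Fin 3) (w : List (Fin 3)) :
    ⁅rhoElem, wordPair s i w⁆ = (chevSign s * (1 + w.length)) • wordPair s i w := by
  induction w with
  | nil => simp [wordPair, lie_rhoElem_chevPair]
  | cons j w ih =>
    rw [wordPair, lie_cartanElem_pair (lie_rhoElem_chev s j) ih]
    push_cast [List.length_cons]
    ring_nf

theorem lie_genH_chevPair (s : Bool) (j i : Fin 3) :
    ⁅genH j, chevPair s i⁆ = (chevSign s * cartan j i) • chevPair s i := by
  refine Prod.ext (lie_genH_chev s j i) (LinearMap.ext fun y => ?_)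
  change -(chevPair s i).2 ⁅genH j, y⁆ = (chevSign s * cartan j i) * (chevPair s i).2 y
  have h : ⁅chev s i, ⁅genH j, y⁆⁆ =
      ⁅genH j, ⁅chev s i, y⁆⁆ - (chevSign s * cartan j i) • ⁅chev s i, y⁆ := by
    rw [leibniz_lie (genH j), lie_genH_chev, smul_lie]
    abel
  rw [chevPair_snd_apply, chevPair_snd_apply, h, map_sub, corootCoord_genH_lie, map_smul,
    smul_eq_mul]
  ring

theorem lie_genH_wordPair (s : Bool) (j i : Fin 3) (w : List (Fin 3)) :
    ∃ b : ℝ, ⁅genH j, wordPair s i w⁆ = b • wordPair s i w := by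
  induction w with
  | nil => exact ⟨_, lie_genH_chevPair s j i⟩
  | cons k w ih =>
    obtain ⟨b, hb⟩ := ih
    exact ⟨_, lie_cartanElem_pair (lie_genH_chev s j k) hb⟩

/-- The generating set of the graph of the invariant form. -/
def formGraphSet : Set DualPair := {p | ∃ s i w, wordPair s i w = p} ∪ Set.range cartanPair

/-- The graph of the invariant form, as a map to the dual. -/
noncomputable def formGraph : Submodule ℝ DualPair := Submodule.span ℝ formGraphSet

theorem wordPair_mem (s : Bool) (i : Fin 3) (w : List (Fin 3)) : wordPair s i w ∈ formGraph :=
  Submodule.subset_span (Or.inl ⟨s, i, w, rfl⟩)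

theorem cartanPair_mem (i : Fin 3) : cartanPair i ∈ formGraph :=
  Submodule.subset_span (Or.inr ⟨i, rfl⟩)

theorem lie_chev_wordPair_mem (s : Bool) (k i : Fin 3) (w : List (Fin 3)) :
    ⁅chev (!s) k, wordPair s i w⁆ ∈
      Submodule.span ℝ ({p | ∃ i w, wordPair s i w = p} ∪ Set.range cartanPair) := by
  induction w with
  | nil =>
    rw [wordPair, lie_chev_not_chevPair]
    split_ifs
    · exact Submodule.smul_mem _ _ (Submodule.subset_span (Or.inr ⟨k, rfl⟩))
    · exact Submodule.zero_mem _
  | cons j w ih =>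
    have hnot : ⁅chev (!s) k, chev s j⁆ = if k = j then chevSign (!s) • genH k else 0 := by
      have := lie_chev_chev_not (!s) k j
      rwa [Bool.not_not] at this
    rw [wordPair, leibniz_lie, hnot]
    refine Submodule.add_mem _ ?_ ?_
    · split_ifs
      · obtain ⟨b, hb⟩ := lie_genH_wordPair s k i w
        rw [smul_lie, hb]
        exact Submodule.smul_mem _ _ (Submodule.smul_mem _ _
          (Submodule.subset_span (Or.inl ⟨i, w, rfl⟩)))
      · rw [zero_lie]; exact Submodule.zero_mem _
    · refine Submodule.span_induction (p := fun x _ => ⁅chev s j, x⁆ ∈ _) ?_ ?_ ?_ ?_ ih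
      · rintro x (⟨i, w, rfl⟩ | ⟨i, rfl⟩)
        · exact Submodule.subset_span (Or.inl ⟨i, j :: w, rfl⟩)
        · rw [lie_chev_cartanPair]
          exact Submodule.smul_mem _ _ (Submodule.subset_span (Or.inl ⟨j, [], rfl⟩))
      · rw [lie_zero]; exact Submodule.zero_mem _
      · intro x y _ _ hx hy; rw [lie_add]; exact Submodule.add_mem _ hx hy
      · intro r x _ hx; rw [lie_smul]; exact Submodule.smul_mem _ _ hx

/-- The argument for `span_wordSet`, carried out with pairs. -/
theorem formGraph_stable (z : Alg) : ∀ p ∈ formGraph, ⁅z, p⁆ ∈ formGraph := by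
  refine alg_stable formGraph (fun s k p hp => ?_) z
  refine Submodule.span_induction (p := fun x _ => ⁅chev s k, x⁆ ∈ formGraph) ?_ ?_ ?_ ?_ hp
  · rintro x (⟨s', i, w, rfl⟩ | ⟨i, rfl⟩)
    · by_cases hs : s = s'
      · subst hs
        exact wordPair_mem s i (k :: w)
      · obtain rfl : s = !s' := by cases s <;> cases s' <;> simp_all
        refine Submodule.span_mono ?_ (lie_chev_wordPair_mem s' k i w)
        exact Set.union_subset_union_left _ fun x ⟨i, w, h⟩ => ⟨s', i, w, h⟩
    · rw [lie_chev_cartanPair]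
      exact Submodule.smul_mem _ _ (wordPair_mem s k [])
  · rw [lie_zero]; exact Submodule.zero_mem _
  · intro x y _ _ hx hy; rw [lie_add]; exact Submodule.add_mem _ hx hy
  · intro r x _ hx; rw [lie_smul]; exact Submodule.smul_mem _ _ hx

/-- On a word of pairs both sides vanish: h_i commutes with `rhoElem`, whereas the word has nonzero
height. On Cartan pairs it is the symmetry of the Cartan matrix. -/
theorem formGraph_isotropic_cartan (i : Fin 3) {q : DualPair} (hq : q ∈ formGraph) :
    cartanFunctional i q.1 = q.2 (genH i) := by
  refine Submodule.span_induction (p := fun q _ => cartanFunctional i q.1 = q.2 (genH i))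
    ?_ ?_ ?_ ?_ hq
  · rintro x (⟨s, j, w, rfl⟩ | ⟨j, rfl⟩)
    · have hμ := mul_ne_zero (chevSign_ne_zero s) (one_add_length_ne_zero w)
      have h := lie_rhoElem_wordPair s j w
      have h1 : ⁅rhoElem, (wordPair s j w).1⁆ = _ := congrArg Prod.fst h
      have h2 := LinearMap.congr_fun (congrArg Prod.snd h) (genH i)
      change -(wordPair s j w).2 ⁅rhoElem, genH i⁆ =
        (chevSign s * (1 + w.length)) * (wordPair s j w).2 (genH i) at h2
      rw [lie_rhoElem_genH, map_zero, neg_zero] at h2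
      rw [(mul_eq_zero.1 h2.symm).resolve_left hμ]
      simp [cartanFunctional, corootCoord_eq_zero hμ h1]
    · have hsymm : cartan i j = cartan j i := by
        fin_cases i <;> fin_cases j <;> rfl
      simp [cartanFunctional, cartanPair, corootCoord_genH, hsymm]
  · simp
  · intro x y _ _ hx hy; simp [hx, hy]
  · intro r x _ hx; simp [hx]

/-- Symmetry against the whole graph passes from p to any bracket with p, because the graph is
stable and the action on functionals is contragredient. It therefore spreads from the Cartan pairs
to all words. -/
theorem formGraph_isotropic {p q : DualPair} (hp : p ∈ formGraph) (hq : q ∈ formGraph) :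
    p.2 q.1 = q.2 p.1 := by
  have hlie : ∀ (z : Alg) (p : DualPair), (∀ q ∈ formGraph, p.2 q.1 = q.2 p.1) →
      ∀ q ∈ formGraph, ⁅z, p⁆.2 q.1 = q.2 ⁅z, p⁆.1 := by
    intro z p h q hq
    change -(p.2 ⁅z, q.1⁆) = q.2 ⁅z, p.1⁆
    have := h _ (formGraph_stable z q hq)
    change p.2 ⁅z, q.1⁆ = -(q.2 ⁅z, p.1⁆) at this
    rw [this, neg_neg]
  have hword : ∀ s i w, ∀ q ∈ formGraph, (wordPair s i w).2 q.1 = q.2 (wordPair s i w).1 := by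
    intro s i w
    induction w with
    | nil =>
      intro q hq
      -- The generator pair is recovered from the Cartan pair of its own node, where the Cartan
      -- entry is 2 and can be divided out.
      have h := hlie (chev s i) (cartanPair i) (fun q hq => formGraph_isotropic_cartan i hq) q hq
      rw [lie_chev_cartanPair] at h
      have hne : -(chevSign s * cartan i i) ≠ 0 := by
        refine neg_ne_zero.2 (mul_ne_zero (chevSign_ne_zero s) ?_)
        fin_cases i <;> simp [cartan]
      simp only [Prod.smul_fst, Prod.smul_snd, LinearMap.smul_apply, map_smul] at h
      exact smul_right_injective ℝ hne h
    | cons j w ih => exact hlie (chev s j) _ ih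
  refine Submodule.span_induction (p := fun p _ => p.2 q.1 = q.2 p.1) ?_ ?_ ?_ ?_ hp
  · rintro x (⟨s, j, w, rfl⟩ | ⟨j, rfl⟩)
    · exact hword s j w q hq
    · exact formGraph_isotropic_cartan j hq
  · simp
  · intro x y _ _ hx hy; simp [hx, hy]
  · intro r x _ hx; simp [hx]

theorem exists_mem_formGraph (x : Alg) : ∃ φ, (x, φ) ∈ formGraph := by
  have h : formGraph.map (LinearMap.fst ℝ Alg (Module.Dual ℝ Alg)) = ⊤ := by
    rw [← top_le_iff, ← span_wordSet, Submodule.span_le]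
    have hw : ∀ s i w, (wordPair s i w).1 = word s i w := by
      intro s i w
      induction w with
      | nil => rfl
      | cons j w ih => rw [word, ← ih]; rfl
    rintro x (⟨s, i, w, rfl⟩ | ⟨i, rfl⟩)
    · exact ⟨_, wordPair_mem s i w, hw s i w⟩
    · exact ⟨_, cartanPair_mem i, rfl⟩
  obtain ⟨p, hp, rfl⟩ : x ∈ formGraph.map (LinearMap.fst ℝ Alg (Module.Dual ℝ Alg)) := by
    rw [h]; trivial
  exact ⟨p.2, hp⟩

/-- The difference of two functionals over x is a pair with first entry zero. Symmetry against the
graph, which projects onto the whole algebra, makes it vanish everywhere. -/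
theorem formGraph_unique {x : Alg} {φ χ : Module.Dual ℝ Alg} (h1 : (x, φ) ∈ formGraph)
    (h2 : (x, χ) ∈ formGraph) : φ = χ := by
  have h : ((0 : Alg), φ - χ) ∈ formGraph := by
    have := formGraph.sub_mem h1 h2
    simpa using this
  refine LinearMap.ext fun y => ?_
  obtain ⟨ψ, hψ⟩ := exists_mem_formGraph y
  have := formGraph_isotropic h hψ
  simp only [LinearMap.sub_apply, map_zero] at this
  exact sub_eq_zero.1 this

/-- The standard invariant form. -/
noncomputable def invForm : LinearMap.BilinForm ℝ Alg where
  toFun x := (exists_mem_formGraph x).choose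
  map_add' x y := formGraph_unique (exists_mem_formGraph _).choose_spec
    (formGraph.add_mem (exists_mem_formGraph x).choose_spec (exists_mem_formGraph y).choose_spec)
  map_smul' r x := formGraph_unique (exists_mem_formGraph _).choose_spec
    (formGraph.smul_mem r (exists_mem_formGraph x).choose_spec)

theorem invForm_mem (x : Alg) : (x, invForm x) ∈ formGraph := (exists_mem_formGraph x).choose_spec

theorem invForm_isStandardForm : IsStandardForm invForm where
  symm x y := formGraph_isotropic (invForm_mem x) (invForm_mem y)
  invariant x y z := by
    have h := formGraph_unique (invForm_mem ⁅y, x⁆) (formGraph_stable y _ (invForm_mem x))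
    have h2 := LinearMap.congr_fun h z
    change invForm ⁅y, x⁆ z = -(invForm x ⁅y, z⁆) at h2
    rw [← lie_skew, map_neg, LinearMap.neg_apply, h2, neg_neg]
  ef i j := by
    have h := formGraph_unique (invForm_mem (genE i)) (wordPair_mem true i [])
    rw [h]
    change chevSign true * corootCoord i ⁅genE i, genF j⁆ = _
    rw [rel_EF]
    split_ifs <;> simp [corootCoord_genH, chevSign]
  hh i j := by
    have h := formGraph_unique (invForm_mem (genH i)) (cartanPair_mem i)
    rw [h]
    simp [cartanFunctional, corootCoord_genH]

/-- Moving `rhoElem` across the form shows that coroots are orthogonal to words. Then `rhoElem` is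
orthogonal to everything, and a word w is a nonzero multiple of its bracket with `rhoElem`, so ⟨w|y⟩
is a multiple of ⟨rhoElem|[w,y]⟩ = 0. An invariant form is thus determined on the Cartan subalgebra.
-/
theorem IsStandardForm.eq_zero_of_lie {B : LinearMap.BilinForm ℝ Alg}
    (hinv : ∀ x y z, B ⁅x, y⁆ z = B x ⁅y, z⁆) (hh : ∀ i j, B (genH i) (genH j) = 0) : B = 0 := by
  have hH : ∀ i, B (genH i) = 0 := by
    intro i
    refine linearMap_ext_wordSet (fun s j w => ?_) fun j => hh i j
    have h := hinv (genH i) rhoElem (word s j w)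
    rw [← lie_skew, lie_rhoElem_genH, neg_zero, map_zero, lie_rhoElem_word, map_smul] at h
    have hμ := mul_ne_zero (chevSign_ne_zero s) (one_add_length_ne_zero w)
    exact (smul_eq_zero.1 h.symm).resolve_left hμ
  have hrho : B rhoElem = 0 := by simp [rhoElem, cartanElem, hH]
  refine linearMap_ext_wordSet (fun s j w => ?_) hH
  refine LinearMap.ext fun y => ?_
  have hμ := mul_ne_zero (chevSign_ne_zero s) (one_add_length_ne_zero w)
  have h := hinv rhoElem (word s j w) y
  rw [hrho, lie_rhoElem_word, map_smul, LinearMap.smul_apply, LinearMap.zero_apply] at h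
  exact (smul_eq_zero.1 h).resolve_left hμ

theorem existsUnique_isStandardForm : ∃! B : LinearMap.BilinForm ℝ Alg, IsStandardForm B := by
  refine ⟨invForm, invForm_isStandardForm, fun B hB => ?_⟩
  refine sub_eq_zero.1 (IsStandardForm.eq_zero_of_lie (fun x y z => ?_) fun i j => ?_)
  · simp [hB.invariant, invForm_isStandardForm.invariant]
  · simp [hB.hh, invForm_isStandardForm.hh]

end Form

end AE3

namespace AE3

/-! ### The loop relations follow from the Serre relations of A_1^(1). -/

section Loop

variable {L : Type*} [LieRing L] [LieAlgebra ℝ L]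

/-- The relations of the loop algebra of `sl₂` in its central extension, `x m = e ⊗ tᵐ`,
`y m = f ⊗ tᵐ`, `h m = [e,f] ⊗ tᵐ`. -/
structure LoopRelations (x y h : ℤ → L) (c : L) : Prop where
  xx : ∀ m n, ⁅x m, x n⁆ = 0
  yy : ∀ m n, ⁅y m, y n⁆ = 0
  xy : ∀ m n, ⁅x m, y n⁆ = h (m + n) + if m + n = 0 then (m : ℝ) • c else 0
  hx : ∀ m n, ⁅h m, x n⁆ = (2 : ℝ) • x (m + n)
  hy : ∀ m n, ⁅h m, y n⁆ = (-2 : ℝ) • y (m + n)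
  hh : ∀ m n, ⁅h m, h n⁆ = if m + n = 0 then (2 * m : ℝ) • c else 0
  cx : ∀ m, ⁅c, x m⁆ = 0
  cy : ∀ m, ⁅c, y m⁆ = 0
  ch : ∀ m, ⁅c, h m⁆ = 0

/-- Part of the relations of the loop algebra, with `u = h 1`, `v = h (-1)`. -/
structure LoopData (x y : ℤ → L) (u v h c : L) : Prop where
  ux : ∀ m n, n = m + 1 → ⁅u, x m⁆ = (2 : ℝ) • x n
  uy : ∀ m n, n = m + 1 → ⁅u, y m⁆ = (-2 : ℝ) • y n
  vx : ∀ m n, n = m - 1 → ⁅v, x m⁆ = (2 : ℝ) • x n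
  vy : ∀ m n, n = m - 1 → ⁅v, y m⁆ = (-2 : ℝ) • y n
  r0 : ∀ m n, m + n = 0 → ⁅x m, y n⁆ = h + (m : ℝ) • c
  r1 : ∀ m n, m + n = 1 → ⁅x m, y n⁆ = u
  r1' : ∀ m n, m + n = -1 → ⁅x m, y n⁆ = v
  hx : ∀ m, ⁅h, x m⁆ = (2 : ℝ) • x m
  hy : ∀ m, ⁅h, y m⁆ = (-2 : ℝ) • y m
  cx : ∀ m, ⁅c, x m⁆ = 0
  cy : ∀ m, ⁅c, y m⁆ = 0
  sx : ⁅x 0, x 1⁆ = 0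
  sx' : ⁅x (-1), x (-2)⁆ = 0
  sy : ⁅y 1, y 2⁆ = 0
  sy' : ⁅y 0, y (-1)⁆ = 0

namespace LoopData

variable {x y : ℤ → L} {u v h c : L}

/-- The symmetry exchanging positive and negative modes. The shifts are chosen so that the Serre
relations, which concern the simple root vectors x_0, y_1 and their opposites x_{-1}, y_0, are
permuted. -/
theorem reflect (D : LoopData x y u v h c) :
    LoopData (fun m => x (-1 - m)) (fun m => y (1 - m)) v u (h - c) (-c) where
  ux m n hn := D.vx _ _ (by omega)
  uy m n hn := D.vy _ _ (by omega)
  vx m n hn := D.ux _ _ (by omega)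
  vy m n hn := D.uy _ _ (by omega)
  r0 m n hn := by
    rw [D.r0 _ _ (by omega)]
    push_cast
    module
  r1 m n hn := D.r1' _ _ (by omega)
  r1' m n hn := D.r1 _ _ (by omega)
  hx m := by rw [sub_lie, D.hx, D.cx, sub_zero]
  hy m := by rw [sub_lie, D.hy, D.cy, sub_zero]
  cx m := by rw [neg_lie, D.cx, neg_zero]
  cy m := by rw [neg_lie, D.cy, neg_zero]
  sx := D.sx'
  sx' := by simpa using D.sx
  sy := by simpa using D.sy'
  sy' := by simpa using D.sy

/-- The symmetry exchanging the two nodes, that is x_0 with y_1 and x_{-1} with y_0. Statements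
about the y's follow from those about the x's. -/
theorem swap (D : LoopData x y u v h c) :
    LoopData (fun m => y (m + 1)) (fun m => x (m - 1)) (-u) (-v) (c - h) c where
  ux m n hn := by rw [neg_lie, D.uy _ (n + 1) (by omega)]; module
  uy m n hn := by rw [neg_lie, D.ux _ (n - 1) (by omega)]; module
  vx m n hn := by rw [neg_lie, D.vy _ (n + 1) (by omega)]; module
  vy m n hn := by rw [neg_lie, D.vx _ (n - 1) (by omega)]; module
  r0 m n hn := by
    obtain rfl : n = -m := by omega
    rw [← lie_skew, D.r0 _ _ (by omega)]
    push_cast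
    module
  r1 m n hn := by rw [← lie_skew, D.r1 _ _ (by omega)]
  r1' m n hn := by rw [← lie_skew, D.r1' _ _ (by omega)]
  hx m := by rw [sub_lie, D.hy, D.cy]; module
  hy m := by rw [sub_lie, D.hx, D.cx]; module
  cx m := D.cy _
  cy m := D.cx _
  sx := D.sy
  sx' := D.sy'
  sy := D.sx
  sy' := D.sx'

theorem lie_u_xx (D : LoopData x y u v h c) (m n : ℤ) :
    ⁅u, ⁅x m, x n⁆⁆ = (2 : ℝ) • (⁅x (m + 1), x n⁆ + ⁅x m, x (n + 1)⁆) := by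
  rw [leibniz_lie, D.ux m _ rfl, D.ux n _ rfl, smul_lie, lie_smul, smul_add]

theorem lie_u_xy (D : LoopData x y u v h c) (m n : ℤ) :
    ⁅u, ⁅x m, y n⁆⁆ = (2 : ℝ) • (⁅x (m + 1), y n⁆ - ⁅x m, y (n + 1)⁆) := by
  rw [leibniz_lie, D.ux m _ rfl, D.uy n _ rfl, smul_lie, lie_smul]
  module

/-- All [x_m, y_{1-m}] equal u, so applying ad u to them gives zero and equates neighbouring
products of total mode two. -/
theorem xy_two (D : LoopData x y u v h c) (m n : ℤ) (hmn : m + n = 2) :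
    ⁅x m, y n⁆ = ⁅x 1, y 1⁆ := by
  have hstep : ∀ m, ⁅x (m + 1), y (1 - m)⁆ = ⁅x m, y (2 - m)⁆ := by
    intro m
    have h := D.lie_u_xy m (1 - m)
    rw [D.r1 m (1 - m) (by omega), lie_self] at h
    have h2 := (smul_eq_zero.1 h.symm).resolve_left two_ne_zero
    rw [sub_eq_zero] at h2
    rw [h2]
    congr 2
    omega
  obtain rfl : n = 2 - m := by omega
  clear hmn
  induction m using Int.induction_on with
  | zero => simpa using (hstep 0).symm
  | succ i ih =>
    rw [show (2 - (i + 1) : ℤ) = 1 - i by ring, hstep, ih]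
  | pred i ih =>
    rw [← ih, ← hstep, sub_add_cancel, show (1 - (-i - 1) : ℤ) = 2 - -i by ring]

/-- By `xy_two` the Cartan element of mode two may be represented as [x_{m+1}, y_{1-m}]: x_{m+1}
commutes with x_m by hypothesis, and y_{1-m} with x_m gives u up to sign. -/
theorem lie_h2_x (D : LoopData x y u v h c) {m : ℤ} (hm : ⁅x m, x (m + 1)⁆ = 0) :
    ⁅⁅x 1, y 1⁆, x m⁆ = (2 : ℝ) • x (m + 2) := by
  rw [← D.xy_two (m + 1) (1 - m) (by omega), lie_lie, ← lie_skew (x (m + 1)) (x m), hm,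
    ← lie_skew (y (1 - m)), D.r1 m _ (by omega), lie_neg, neg_zero, lie_zero, sub_zero, lie_skew,
    D.ux _ (m + 2) (by omega)]

/-- Write H for [x_1,y_1]. Adding two evaluations of [u,H] gives 2[u,H] = 2[x_2,y_1] - 2[x_0,y_3],
and the right side is [H,u], computed by letting H act on u = [x_0,y_1]. So 3[u,H] = 0. -/
theorem lie_u_h2 (D : LoopData x y u v h c) : ⁅u, ⁅x 1, y 1⁆⁆ = 0 := by
  have hx := D.lie_h2_x (m := 0) D.sx
  have hy : ⁅⁅x 1, y 1⁆, y 1⁆ = (-2 : ℝ) • y 3 := by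
    rw [← D.xy_two 0 2 rfl, lie_lie, ← lie_skew (y 2), D.sy, neg_zero, lie_zero, zero_sub,
      D.r1 0 1 rfl, lie_skew, D.uy 2 3 rfl]
  have h1 : ⁅⁅x 1, y 1⁆, u⁆ = (2 : ℝ) • ⁅x 2, y 1⁆ - (2 : ℝ) • ⁅x 0, y 3⁆ := by
    rw [← D.r1 0 1 rfl, leibniz_lie, hx, hy, smul_lie, lie_smul]
    norm_num
    module
  have h2 := D.lie_u_xy 1 1
  have h3 := D.lie_u_xy 0 2
  rw [D.xy_two 0 2 rfl] at h3
  norm_num at h2 h3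
  rw [← lie_skew] at h1
  have h4 : (3 : ℝ) • ⁅u, ⁅x 1, y 1⁆⁆ = 0 := by
    linear_combination (norm := module) h2 + h3 - h1
  exact (smul_eq_zero.1 h4).resolve_left three_ne_zero

/-- Applying the Cartan element of mode two, and (ad u)^2, to the vanishing bracket yields the
difference and the sum of [x_m,x_{m+3}] and [x_{m+1},x_{m+2}]. Both are zero. -/
theorem xx_succ_of_lie (D : LoopData x y u v h c) {m : ℤ} (hm : ⁅x m, x (m + 1)⁆ = 0)
    (h1 : ⁅⁅x 1, y 1⁆, x m⁆ = (2 : ℝ) • x (m + 2))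
    (h2 : ⁅⁅x 1, y 1⁆, x (m + 1)⁆ = (2 : ℝ) • x (m + 3)) : ⁅x (m + 1), x (m + 2)⁆ = 0 := by
  have ha : ⁅⁅x 1, y 1⁆, ⁅x m, x (m + 1)⁆⁆ =
      (2 : ℝ) • (⁅x m, x (m + 3)⁆ - ⁅x (m + 1), x (m + 2)⁆) := by
    rw [leibniz_lie ⁅x 1, y 1⁆, h1, h2, smul_lie, lie_smul, ← lie_skew (x (m + 2))]
    module
  have hb : ⁅u, ⁅u, ⁅x m, x (m + 1)⁆⁆⁆ =
      (4 : ℝ) • (⁅x m, x (m + 3)⁆ + ⁅x (m + 1), x (m + 2)⁆) := by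
    rw [D.lie_u_xx, lie_self, zero_add, lie_smul, D.lie_u_xx]
    ring_nf
    module
  rw [hm, lie_zero] at ha
  rw [hm, lie_zero, lie_zero] at hb
  have h4 : (8 : ℝ) • ⁅x (m + 1), x (m + 2)⁆ = 0 := by
    linear_combination (norm := module) (2 : ℝ) • ha - hb
  exact (smul_eq_zero.1 h4).resolve_left (by norm_num)

/-- The Cartan element of mode two commutes with u, so its translation action on x_0 extends to all
nonnegative modes, and `xx_succ_of_lie` can be iterated. -/
theorem xx_succ_nat (D : LoopData x y u v h c) (m : ℕ) : ⁅x m, x (m + 1)⁆ = 0 := by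
  have hx : ∀ m : ℕ, ⁅⁅x 1, y 1⁆, x m⁆ = (2 : ℝ) • x (m + 2) := by
    intro m
    induction m with
    | zero => exact D.lie_h2_x (m := 0) D.sx
    | succ m ih =>
      have h0 : ⁅⁅x 1, y 1⁆, u⁆ = 0 := by rw [← lie_skew, D.lie_u_h2, neg_zero]
      have h := leibniz_lie ⁅x 1, y 1⁆ u (x m)
      rw [h0, zero_lie, zero_add, ih, D.ux m (m + 1) rfl, lie_smul, lie_smul,
        D.ux _ (m + 1 + 2) (by ring)] at h
      push_cast
      exact smul_right_injective L (two_ne_zero (α := ℝ)) h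
  induction m with
  | zero => exact D.sx
  | succ m ih =>
    have := D.xx_succ_of_lie ih (hx m) (by
      have := hx (m + 1)
      push_cast at this
      rw [this]
      ring_nf)
    push_cast
    rw [add_assoc]
    exact this

/-- Modes below -1 are reflections of nonnegative ones. The gap at -1 is bridged from the Serre
relation at -2, using that x_{-1} and x_1 commute. -/
theorem xx_succ (D : LoopData x y u v h c) (m : ℤ) : ⁅x m, x (m + 1)⁆ = 0 := by
  rcases lt_trichotomy m (-1) with hm | rfl | hm
  · obtain ⟨n, rfl⟩ : ∃ n : ℕ, m = -2 - n := ⟨(-2 - m).toNat, by omega⟩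
    have := D.reflect.xx_succ_nat n
    rw [← lie_skew, neg_eq_zero]
    convert this using 2
    · congr 1; ring
    · congr 1; ring
  · have h0 : ⁅x (-1), x 1⁆ = 0 := by
      have h : ⁅v, ⁅x 0, x 1⁆⁆ = 0 := by rw [D.sx, lie_zero]
      rw [leibniz_lie, D.vx 0 (-1) rfl, D.vx 1 0 rfl, smul_lie, lie_smul, lie_self, smul_zero,
        add_zero] at h
      exact (smul_eq_zero.1 h).resolve_left two_ne_zero
    have hs : ⁅x (-2), x (-1)⁆ = 0 := by rw [← lie_skew, D.sx', neg_zero]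
    refine D.xx_succ_of_lie (m := -2) hs (D.lie_h2_x hs) ?_
    change ⁅⁅x 1, y 1⁆, x (-1)⁆ = (2 : ℝ) • x 1
    rw [lie_lie, ← lie_skew (x 1) (x (-1)), h0, neg_zero, lie_zero, sub_zero, ← lie_skew (y 1),
      D.r0 (-1) 1 rfl, lie_neg, lie_skew, add_lie, D.hx, smul_lie, D.cx, smul_zero, add_zero]
  · obtain ⟨n, rfl⟩ : ∃ n : ℕ, m = n := ⟨m.toNat, by omega⟩
    exact D.xx_succ_nat n

/-- Induction on the distance of the modes by ad u. Two consecutive distances are carried along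
because ad u raises either mode. -/
theorem xx (D : LoopData x y u v h c) (m n : ℤ) : ⁅x m, x n⁆ = 0 := by
  have key : ∀ d : ℕ, ∀ m : ℤ, ⁅x m, x (m + d)⁆ = 0 ∧ ⁅x m, x (m + d + 1)⁆ = 0 := by
    intro d
    induction d with
    | zero => exact fun m => by simpa using D.xx_succ m
    | succ d ih =>
      intro m
      push_cast
      rw [← add_assoc]
      refine ⟨(ih m).2, ?_⟩
      have h := D.lie_u_xx m (m + d + 1)
      rw [(ih m).2, lie_zero] at h
      have h2 := (smul_eq_zero.1 h.symm).resolve_left two_ne_zero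
      have h3 := (ih (m + 1)).1
      rw [add_right_comm] at h3
      rwa [h3, zero_add] at h2
  rcases le_total m n with hmn | hmn
  · obtain ⟨d, rfl⟩ := Int.le.dest hmn
    exact (key d m).1
  · obtain ⟨d, rfl⟩ := Int.le.dest hmn
    rw [← lie_skew, (key d n).1, neg_zero]

theorem yy (D : LoopData x y u v h c) (m n : ℤ) : ⁅y m, y n⁆ = 0 := by
  simpa using D.swap.xx (m - 1) (n - 1)

/-- The elements `[x m, y n]` depend on `m + n > 0` only and act by translations. -/
theorem pos (D : LoopData x y u v h c) (N : ℕ) :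
    (∀ m n, m + n = (N + 1 : ℤ) → ⁅x m, y n⁆ = ⁅x 0, y (N + 1)⁆) ∧
    (∀ m, ⁅⁅x 0, y (N + 1)⁆, x m⁆ = (2 : ℝ) • x (m + (N + 1))) ∧
    (∀ m, ⁅⁅x 0, y (N + 1)⁆, y m⁆ = (-2 : ℝ) • y (m + (N + 1))) := by
  induction N with
  | zero =>
    have h0 : ⁅x 0, y ((0 : ℕ) + 1)⁆ = u := D.r1 _ _ rfl
    rw [h0]
    exact ⟨fun m n hmn => D.r1 m n (by simpa using hmn), fun m => D.ux _ _ (by simp),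
      fun m => D.uy _ _ (by simp)⟩
  | succ N ih =>
    obtain ⟨ih1, ih2, ih3⟩ := ih
    set H := ⁅x 0, y (N + 1)⁆ with hH
    have hstep : ∀ m n, m + n = (N + 1 : ℤ) →
        ⁅u, H⁆ = (2 : ℝ) • (⁅x (m + 1), y n⁆ - ⁅x m, y (n + 1)⁆) := fun m n hmn => by
      rw [← ih1 m n hmn, D.lie_u_xy]
    -- With the total mode fixed, the products form an arithmetic progression with common difference
    -- half of [u,H].
    have hlin : ∀ m : ℕ, (2 : ℝ) • ⁅x m, y (N + 2 - m)⁆ =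
        (2 : ℝ) • ⁅x 0, y (N + 2)⁆ + (m : ℝ) • ⁅u, H⁆ := by
      intro m
      induction m with
      | zero => simp
      | succ m ihm =>
        have h := hstep m (N + 1 - m) (by ring)
        have e : (N + 1 - m + 1 : ℤ) = N + 2 - m := by ring
        rw [e] at h
        have e2 : (N + 2 - ((m + 1 : ℕ) : ℤ)) = N + 1 - m := by push_cast; ring
        rw [e2]
        push_cast
        rw [add_smul, ← add_assoc, ← ihm, one_smul, h]
        module
    -- Letting H act on u = [x_0,y_1] gives the difference of two members of the progression, namely
    -- (N+1)[u,H]. It also equals -[u,H].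
    have hQ : ⁅u, H⁆ = 0 := by
      have h1 : ⁅H, u⁆ = (2 : ℝ) • ⁅x (N + 1), y 1⁆ - (2 : ℝ) • ⁅x 0, y (N + 2)⁆ := by
        rw [← D.r1 0 1 rfl, leibniz_lie, ih2, ih3, smul_lie, lie_smul]
        rw [zero_add, show (1 + (N + 1) : ℤ) = N + 2 by ring]
        module
      have h2 := hlin (N + 1)
      rw [show (N + 2 - ((N + 1 : ℕ) : ℤ)) = 1 by push_cast; ring] at h2
      push_cast at h2
      rw [h2, ← lie_skew] at h1
      have h3 : ((N : ℝ) + 2) • ⁅u, H⁆ = 0 := by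
        linear_combination (norm := module) -h1
      exact (smul_eq_zero.1 h3).resolve_left (by positivity)
    have hconst : ∀ m n, m + n = (N + 1 + 1 : ℤ) → ⁅x m, y n⁆ = ⁅x 0, y (N + 1 + 1)⁆ := by
      have hs : ∀ m, ⁅x (m + 1), y (N + 1 - m)⁆ = ⁅x m, y (N + 2 - m)⁆ := by
        intro m
        have h := hstep m (N + 1 - m) (by ring)
        rw [hQ] at h
        have h2 := (smul_eq_zero.1 h.symm).resolve_left two_ne_zero
        rw [sub_eq_zero] at h2
        rw [h2]
        congr 2
        ring
      intro m n hmn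
      obtain rfl : n = N + 2 - m := by omega
      clear hmn
      induction m using Int.induction_on with
      | zero => congr 2
      | succ i ih =>
        rw [show (N + 2 - (i + 1) : ℤ) = N + 1 - i by ring, hs, ih]
      | pred i ih =>
        rw [← ih, ← hs, sub_add_cancel, show (N + 1 - (-i - 1) : ℤ) = N + 2 - -i by ring]
    push_cast
    refine ⟨hconst, fun m => ?_, fun m => ?_⟩
    · rw [← hconst (m + 1) (N + 1 - m) (by ring), lie_lie, D.xx, lie_zero, sub_zero,
        ← lie_skew (y _), ih1 m _ (by ring), lie_neg, lie_skew, ih2]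
      congr 2
      ring
    · rw [← hconst (N + 1 - m) (m + 1) (by ring), lie_lie, D.yy, lie_zero, zero_sub,
        ih1 _ m (by ring), lie_skew, ih3]
      congr 2
      ring

theorem xy_const (D : LoopData x y u v h c) (m n : ℤ) (hmn : m + n ≠ 0) :
    ⁅x m, y n⁆ = ⁅x (m + n), y 0⁆ := by
  rcases lt_or_gt_of_ne hmn with hlt | hgt
  · obtain ⟨N, hN⟩ : ∃ N : ℕ, m + n = -(N + 1) := ⟨(-(m + n) - 1).toNat, by omega⟩
    have key := (D.reflect.pos N).1
    have h1 := key (-1 - m) (1 - n) (by omega)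
    have h2 := key (-1 - (m + n)) 1 (by omega)
    rw [← h2] at h1
    simpa using h1
  · obtain ⟨N, hN⟩ : ∃ N : ℕ, m + n = N + 1 := ⟨(m + n - 1).toNat, by omega⟩
    rw [(D.pos N).1 m n hN, (D.pos N).1 (m + n) 0 (by omega)]

theorem hx_all (D : LoopData x y u v h c) (m n : ℤ) :
    ⁅⁅x m, y 0⁆, x n⁆ = (2 : ℝ) • x (m + n) := by
  rcases lt_trichotomy m 0 with hlt | rfl | hgt
  · obtain ⟨N, rfl⟩ : ∃ N : ℕ, m = -(N + 1) := ⟨(-m - 1).toNat, by omega⟩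
    have h1 := (D.reflect.pos N).2.1 (-1 - n)
    rw [← (D.reflect.pos N).1 N 1 rfl] at h1
    simp only [sub_sub_cancel, sub_self] at h1
    rw [show (-(N + 1) : ℤ) = -1 - N by ring, h1]
    congr 2
    ring
  · rw [D.r0 0 0 rfl, Int.cast_zero, zero_smul, add_zero, D.hx, zero_add]
  · obtain ⟨N, rfl⟩ : ∃ N : ℕ, m = N + 1 := ⟨(m - 1).toNat, by omega⟩
    rw [(D.pos N).1 _ _ (add_zero _), (D.pos N).2.1, add_comm n]

theorem hy_all (D : LoopData x y u v h c) (m n : ℤ) :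
    ⁅⁅x m, y 0⁆, y n⁆ = (-2 : ℝ) • y (m + n) := by
  rcases lt_trichotomy m 0 with hlt | rfl | hgt
  · obtain ⟨N, rfl⟩ : ∃ N : ℕ, m = -(N + 1) := ⟨(-m - 1).toNat, by omega⟩
    have h1 := (D.reflect.pos N).2.2 (1 - n)
    rw [← (D.reflect.pos N).1 N 1 rfl] at h1
    simp only [sub_sub_cancel, sub_self] at h1
    rw [show (-(N + 1) : ℤ) = -1 - N by ring, h1]
    congr 2
    ring
  · rw [D.r0 0 0 rfl, Int.cast_zero, zero_smul, add_zero, D.hy, zero_add]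
  · obtain ⟨N, rfl⟩ : ∃ N : ℕ, m = N + 1 := ⟨(m - 1).toNat, by omega⟩
    rw [(D.pos N).1 _ _ (add_zero _), (D.pos N).2.2, add_comm n]

theorem loopRelations (D : LoopData x y u v h c) :
    LoopRelations x y (fun m => ⁅x m, y 0⁆) c := by
  have hxy : ∀ m n, ⁅x m, y n⁆ = ⁅x (m + n), y 0⁆ + if m + n = 0 then (m : ℝ) • c else 0 := by
    intro m n
    split_ifs with hmn
    · rw [D.r0 m n hmn, hmn, D.r0 0 0 rfl, Int.cast_zero, zero_smul, add_zero]
    · rw [add_zero, D.xy_const m n hmn]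
  refine ⟨D.xx, D.yy, hxy, D.hx_all, D.hy_all, fun m n => ?_, D.cx, D.cy, fun m => ?_⟩
  -- The terms without center cancel; the central term survives only because [x_n, y_m] carries the
  -- mode of x.
  · rw [leibniz_lie ⁅x m, y 0⁆, D.hx_all, D.hy_all, smul_lie, lie_smul, add_zero, hxy n m,
      add_comm n m]
    split_ifs with hmn
    · obtain rfl : n = -m := by omega
      push_cast
      module
    · module
  · rw [leibniz_lie, D.cx, D.cy, zero_lie, lie_zero, add_zero]

end LoopData

end Loop

end AE3

namespace AE3

/-! ### The transposition as an anti-automorphism of order two. -/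

section Transpose

theorem transpose_add (x y : Alg) : transpose (x + y) = transpose x + transpose y := by
  simp only [transpose, map_add, neg_add]

theorem transpose_smul (r : ℝ) (x : Alg) : transpose (r • x) = r • transpose x := by
  simp only [transpose, map_smul, smul_neg]

theorem transpose_zero : transpose 0 = 0 := by simp [transpose]

theorem transpose_neg (x : Alg) : transpose (-x) = -transpose x := by simp [transpose]

theorem transpose_lie (x y : Alg) : transpose ⁅x, y⁆ = ⁅transpose y, transpose x⁆ := by
  simp only [transpose, LieHom.map_lie, lie_neg, neg_lie, lie_skew]

theorem transpose_genE (i : Fin 3) : transpose (genE i) = genF i := by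
  rw [transpose, omega_genE, neg_neg]

theorem transpose_genF (i : Fin 3) : transpose (genF i) = genE i := by
  rw [transpose, omega_genF, neg_neg]

theorem transpose_genH (i : Fin 3) : transpose (genH i) = genH i := by
  rw [transpose, omega_genH, neg_neg]

theorem transpose_transpose (x : Alg) : transpose (transpose x) = x := by
  let K : LieSubalgebra ℝ Alg :=
    { carrier := {x | transpose (transpose x) = x}
      add_mem' := fun {a b} ha hb => by
        rw [Set.mem_ofPred_eq, transpose_add, transpose_add, ha, hb]
      zero_mem' := by rw [Set.mem_ofPred_eq, transpose_zero, transpose_zero]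
      smul_mem' := fun r a ha => by rw [Set.mem_ofPred_eq, transpose_smul, transpose_smul, ha]
      lie_mem' := fun {a b} ha hb => by
        rw [Set.mem_ofPred_eq] at ha hb
        change transpose (transpose ⁅a, b⁆) = ⁅a, b⁆
        rw [transpose_lie, transpose_lie, ha, hb] }
  refine mem_of_genE_genF_mem K (fun i => ?_) (fun i => ?_) x
  · change transpose (transpose (genE i)) = genE i
    rw [transpose_genE, transpose_genF]
  · change transpose (transpose (genF i)) = genF i
    rw [transpose_genF, transpose_genE]

/-- Transposition as a linear equivalence. -/
noncomputable def transposeEquiv : Alg ≃ₗ[ℝ] Alg where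
  toFun := transpose
  invFun := transpose
  map_add' := transpose_add
  map_smul' := transpose_smul
  left_inv := transpose_transpose
  right_inv := transpose_transpose

theorem transpose_sub (x y : Alg) : transpose (x - y) = transpose x - transpose y :=
  map_sub transposeEquiv x y

theorem transpose_sum {ι : Type*} (s : Finset ι) (f : ι → Alg) :
    transpose (∑ i ∈ s, f i) = ∑ i ∈ s, transpose (f i) :=
  map_sum transposeEquiv f s

end Transpose

/-! ### Ladders under two elements whose commutator is central on them. -/

section Ladder

variable {L : Type*} [LieRing L] [LieAlgebra ℝ L]

/-- The sequence of vectors obtained from `e` by iterating `t⁻¹ ad u` upwards and `t⁻¹ ad v`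
downwards. -/
noncomputable def ladder (u v e : L) (t : ℝ) : ℤ → L
  | Int.ofNat n => ((t⁻¹ • LieAlgebra.ad ℝ L u : Module.End ℝ L) ^ n) e
  | Int.negSucc n => ((t⁻¹ • LieAlgebra.ad ℝ L v : Module.End ℝ L) ^ (n + 1)) e

theorem lie_pow_of_commute {z u e : L} {a t : ℝ} (hu : ⁅z, u⁆ = 0) (he : ⁅z, e⁆ = a • e) (n : ℕ) :
    ⁅z, ((t • LieAlgebra.ad ℝ L u : Module.End ℝ L) ^ n) e⁆ =
      a • ((t • LieAlgebra.ad ℝ L u : Module.End ℝ L) ^ n) e := by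
  induction n with
  | zero => simpa
  | succ n ih =>
    rw [pow_succ', Module.End.mul_apply, LinearMap.smul_apply, LieAlgebra.ad_apply, lie_smul,
      leibniz_lie, hu, zero_lie, zero_add, ih, lie_smul, smul_comm]

theorem lie_ladder_of_commute {z u v e : L} {a t : ℝ} (hu : ⁅z, u⁆ = 0) (hv : ⁅z, v⁆ = 0)
    (he : ⁅z, e⁆ = a • e) (m : ℤ) : ⁅z, ladder u v e t m⁆ = a • ladder u v e t m := by
  cases m with
  | ofNat n => exact lie_pow_of_commute hu he n
  | negSucc n => exact lie_pow_of_commute hv he (n + 1)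

/-- The commutator of v and u annihilates the whole ladder, so v moves inward freely until it meets
the last u, where the hypothesis on [v,[u,e]] applies. -/
theorem lie_pow_ladder {u v e : L} {t : ℝ} (ht : t ≠ 0) (hz : ⁅⁅v, u⁆, u⁆ = 0)
    (he : ⁅⁅v, u⁆, e⁆ = 0) (hvu : ⁅v, ⁅u, e⁆⁆ = (t * t) • e) (n : ℕ) :
    ⁅v, ((t⁻¹ • LieAlgebra.ad ℝ L u : Module.End ℝ L) ^ (n + 1)) e⁆ =
      t • ((t⁻¹ • LieAlgebra.ad ℝ L u : Module.End ℝ L) ^ n) e := by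
  induction n with
  | zero =>
    simp only [zero_add, pow_one, LinearMap.smul_apply, LieAlgebra.ad_apply, lie_smul, hvu,
      pow_zero, Module.End.one_apply, smul_smul]
    congr 1
    field_simp
  | succ n ih =>
    have hc := lie_pow_of_commute (t := t⁻¹) (a := 0) hz (by rw [he, zero_smul]) (n + 1)
    rw [zero_smul] at hc
    rw [pow_succ', Module.End.mul_apply, LinearMap.smul_apply, LieAlgebra.ad_apply, lie_smul,
      leibniz_lie, hc, zero_add, ih, lie_smul, smul_comm]
    rw [pow_succ' _ n, Module.End.mul_apply, LinearMap.smul_apply, LieAlgebra.ad_apply]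

theorem lie_pow_succ {u e : L} {t : ℝ} (ht : t ≠ 0) (n : ℕ) :
    ⁅u, ((t⁻¹ • LieAlgebra.ad ℝ L u : Module.End ℝ L) ^ n) e⁆ =
      t • ((t⁻¹ • LieAlgebra.ad ℝ L u : Module.End ℝ L) ^ (n + 1)) e := by
  rw [pow_succ', Module.End.mul_apply, LinearMap.smul_apply, LieAlgebra.ad_apply,
    smul_inv_smul₀ ht]

/-- The upward and downward halves fit together at mode zero: since [u,v] kills e, the double
brackets [u,[v,e]] and [v,[u,e]] agree, and t^2 is the right normalization on both sides. -/
theorem lie_ladder {u v e : L} {t : ℝ} (ht : t ≠ 0) (hu : ⁅⁅u, v⁆, u⁆ = 0) (hv : ⁅⁅u, v⁆, v⁆ = 0)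
    (he : ⁅⁅u, v⁆, e⁆ = 0) (huv : ⁅u, ⁅v, e⁆⁆ = (t * t) • e) (m n : ℤ) :
    (n = m + 1 → ⁅u, ladder u v e t m⁆ = t • ladder u v e t n) ∧
    (n = m - 1 → ⁅v, ladder u v e t m⁆ = t • ladder u v e t n) := by
  have hvu : ⁅v, ⁅u, e⁆⁆ = (t * t) • e := by
    rw [leibniz_lie, huv, ← lie_skew v u, neg_lie, he, neg_zero, zero_add]
  have hs : ∀ w : L, ⁅⁅u, v⁆, w⁆ = 0 → ⁅⁅v, u⁆, w⁆ = 0 := fun w h => by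
    rw [← lie_skew v u, neg_lie, h, neg_zero]
  constructor
  · rintro rfl
    match m with
    | Int.ofNat n => exact lie_pow_succ ht n
    | Int.negSucc 0 => exact lie_pow_ladder ht hv he huv 0
    | Int.negSucc (n + 1) => exact lie_pow_ladder ht hv he huv (n + 1)
  · rintro rfl
    match m with
    | Int.ofNat 0 => exact lie_pow_succ ht 0
    | Int.ofNat (n + 1) =>
      have e : (Int.ofNat (n + 1) - 1 : ℤ) = Int.ofNat n := by
        simp
      rw [e]
      exact lie_pow_ladder ht (hs _ hu) (hs _ he) hvu n
    | Int.negSucc n => exact lie_pow_succ ht (n + 1)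

end Ladder

/-! ### The loop generators inside AE_3. -/

section AffineElements

/-- `[K̄_0, K̄_1]`-component along the Cartan element. -/
noncomputable def loopU : Alg := ⁅genE 1, genE 2⁆

/-- The transpose of `loopU`. -/
noncomputable def loopV : Alg := ⁅genF 2, genF 1⁆

/-- The elements `K̄_m^2_3`. -/
noncomputable def loopX : ℤ → Alg := ladder loopU loopV (genE 1) 2

/-- The elements `K̄_m^3_2`. -/
noncomputable def loopY : ℤ → Alg := ladder loopU loopV (genF 1) (-2)

/-- The elements `K̄_m^2_2 - K̄_m^3_3`. -/
noncomputable def loopH (m : ℤ) : Alg := ⁅loopX m, loopY 0⁆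

theorem affC_eq : affC = genH 1 + genH 2 := by
  simp [affC, glK]
  abel

theorem rel_HE' (i j : Fin 3) : ⁅genH i, genE j⁆ = (cartan i j : ℝ) • genE j := by
  rw [rel_HE]; module

theorem rel_HF' (i j : Fin 3) : ⁅genH i, genF j⁆ = (-cartan i j : ℝ) • genF j := by
  rw [rel_HF]; module

theorem rel_FE (i j : Fin 3) : ⁅genF i, genE j⁆ = if i = j then -genH i else 0 := by
  rw [← lie_skew, rel_EF]
  rcases eq_or_ne i j with h | h
  · simp [h]
  · simp [h, h.symm]

theorem rel_EH (i j : Fin 3) : ⁅genE i, genH j⁆ = (-cartan j i : ℝ) • genE i := by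
  rw [← lie_skew, rel_HE']; module

theorem rel_FH (i j : Fin 3) : ⁅genF i, genH j⁆ = (cartan j i : ℝ) • genF i := by
  rw [← lie_skew, rel_HF']; module

theorem loopU_F1 : ⁅loopU, genF 1⁆ = (-2 : ℝ) • genE 2 := by
  rw [loopU, lie_lie, rel_EF, rel_EF]
  simp [rel_EH, cartan]

theorem loopU_F2 : ⁅loopU, genF 2⁆ = (2 : ℝ) • genE 1 := by
  rw [loopU, lie_lie, rel_EF, rel_EF]
  simp [rel_EH, cartan]

theorem loopV_E1 : ⁅loopV, genE 1⁆ = (2 : ℝ) • genF 2 := by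
  rw [loopV, lie_lie, rel_FE, rel_FE]
  simp [rel_FH, cartan]

theorem loopV_E2 : ⁅loopV, genE 2⁆ = (-2 : ℝ) • genF 1 := by
  rw [loopV, lie_lie, rel_FE, rel_FE]
  simp [rel_FH, cartan]

theorem loopU_loopV : ⁅loopU, loopV⁆ = (2 : ℝ) • affC := by
  rw [loopV, leibniz_lie, loopU_F1, loopU_F2, smul_lie, lie_smul, rel_EF, ← lie_skew, rel_EF,
    affC_eq]
  simp

theorem affC_lie_genE (i : Fin 3) (hi : i ≠ 0) : ⁅affC, genE i⁆ = 0 := by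
  rw [affC_eq, add_lie, rel_HE', rel_HE', ← add_smul]
  fin_cases i <;> simp [cartan] at hi ⊢

theorem affC_lie_genF (i : Fin 3) (hi : i ≠ 0) : ⁅affC, genF i⁆ = 0 := by
  rw [affC_eq, add_lie, rel_HF', rel_HF', ← add_smul]
  fin_cases i <;> simp [cartan] at hi ⊢

theorem affC_lie_loopU : ⁅affC, loopU⁆ = 0 := by
  rw [loopU, leibniz_lie, affC_lie_genE 1 (by decide), affC_lie_genE 2 (by decide)]
  simp

theorem affC_lie_loopV : ⁅affC, loopV⁆ = 0 := by
  rw [loopV, leibniz_lie, affC_lie_genF 1 (by decide), affC_lie_genF 2 (by decide)]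
  simp

theorem genH_lie_loopU : ⁅genH 1, loopU⁆ = 0 := by
  rw [loopU, lie_lie_weight (rel_HE' 1 1) (rel_HE' 1 2)]
  simp [cartan]

theorem genH_lie_loopV : ⁅genH 1, loopV⁆ = 0 := by
  rw [loopV, lie_lie_weight (rel_HF' 1 2) (rel_HF' 1 1)]
  simp [cartan]

theorem loopUV_lie_eq_zero {w : Alg} (hw : ⁅affC, w⁆ = 0) : ⁅⁅loopU, loopV⁆, w⁆ = 0 := by
  rw [loopU_loopV, smul_lie, hw, smul_zero]

theorem lie_loopX (m n : ℤ) :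
    (n = m + 1 → ⁅loopU, loopX m⁆ = (2 : ℝ) • loopX n) ∧
    (n = m - 1 → ⁅loopV, loopX m⁆ = (2 : ℝ) • loopX n) :=
  lie_ladder two_ne_zero (loopUV_lie_eq_zero affC_lie_loopU) (loopUV_lie_eq_zero affC_lie_loopV)
    (loopUV_lie_eq_zero (affC_lie_genE 1 (by decide)))
    (by rw [loopV_E1, lie_smul, loopU_F2, smul_smul]) m n

/-- The same ladder as for `loopX`, with factor -2, because y has opposite weight under the Cartan
direction of u and v. With this sign the first step up from f_2 is exactly e_3. -/
theorem lie_loopY (m n : ℤ) :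
    (n = m + 1 → ⁅loopU, loopY m⁆ = (-2 : ℝ) • loopY n) ∧
    (n = m - 1 → ⁅loopV, loopY m⁆ = (-2 : ℝ) • loopY n) := by
  have hF : ⁅loopV, ⁅loopU, genF 1⁆⁆ = (-2 * -2 : ℝ) • genF 1 := by
    rw [loopU_F1, lie_smul, loopV_E2, smul_smul]
  refine lie_ladder (neg_ne_zero.2 two_ne_zero) (loopUV_lie_eq_zero affC_lie_loopU)
    (loopUV_lie_eq_zero affC_lie_loopV) (loopUV_lie_eq_zero (affC_lie_genF 1 (by decide))) ?_ m n
  rw [leibniz_lie, hF, loopUV_lie_eq_zero (affC_lie_genF 1 (by decide)), zero_add]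

theorem loopX_zero : loopX 0 = genE 1 := rfl

theorem loopY_zero : loopY 0 = genF 1 := rfl

theorem loopY_one : loopY 1 = genE 2 := by
  have h := (lie_loopY 0 1).1 rfl
  rw [loopY_zero, loopU_F1] at h
  exact (smul_right_injective Alg (neg_ne_zero.2 (two_ne_zero (α := ℝ))) h).symm

theorem loopX_neg_one : loopX (-1) = genF 2 := by
  have h := (lie_loopX 0 (-1)).2 rfl
  rw [loopX_zero, loopV_E1] at h
  exact (smul_right_injective Alg (two_ne_zero (α := ℝ)) h).symm

theorem genH_lie_loopX (m : ℤ) : ⁅genH 1, loopX m⁆ = (2 : ℝ) • loopX m :=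
  lie_ladder_of_commute genH_lie_loopU genH_lie_loopV (by rw [rel_HE']; simp [cartan]) m

theorem genH_lie_loopY (m : ℤ) : ⁅genH 1, loopY m⁆ = (-2 : ℝ) • loopY m :=
  lie_ladder_of_commute genH_lie_loopU genH_lie_loopV (by rw [rel_HF']; simp [cartan]) m

theorem affC_lie_loopX (m : ℤ) : ⁅affC, loopX m⁆ = 0 := by
  simpa [loopX] using lie_ladder_of_commute (a := 0) (t := 2) affC_lie_loopU affC_lie_loopV
    (by rw [affC_lie_genE 1 (by decide), zero_smul]) m

theorem affC_lie_loopY (m : ℤ) : ⁅affC, loopY m⁆ = 0 := by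
  simpa [loopY] using lie_ladder_of_commute (a := 0) (t := -2) affC_lie_loopU affC_lie_loopV
    (by rw [affC_lie_genF 1 (by decide), zero_smul]) m

/-- Both formulas are proved together. Applying ad u to total mode zero gives zero and shifts the
product of mode one; applying ad v to mode one gives a multiple of the center and accounts for the
growth of the central term. -/
theorem loop_r (m : ℤ) : ⁅loopX m, loopY (-m)⁆ = genH 1 + (m : ℝ) • affC ∧
    ⁅loopX m, loopY (1 - m)⁆ = loopU := by
  have hU : ∀ m n, ⁅loopU, ⁅loopX m, loopY n⁆⁆ =
      (2 : ℝ) • (⁅loopX (m + 1), loopY n⁆ - ⁅loopX m, loopY (n + 1)⁆) := fun m n => by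
    rw [leibniz_lie, (lie_loopX m _).1 rfl, (lie_loopY n _).1 rfl, smul_lie, lie_smul]
    module
  have hV : ∀ m n, ⁅loopV, ⁅loopX m, loopY n⁆⁆ =
      (2 : ℝ) • (⁅loopX (m - 1), loopY n⁆ - ⁅loopX m, loopY (n - 1)⁆) := fun m n => by
    rw [leibniz_lie, (lie_loopX m _).2 rfl, (lie_loopY n _).2 rfl, smul_lie, lie_smul]
    module
  have hc : ∀ r : ℝ, ⁅loopU, genH 1 + r • affC⁆ = 0 := fun r => by
    rw [lie_add, lie_smul, ← lie_skew, genH_lie_loopU, ← lie_skew loopU affC, affC_lie_loopU]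
    simp
  have hVU : ⁅loopV, loopU⁆ = (-2 : ℝ) • affC := by
    rw [← lie_skew, loopU_loopV]; module
  induction m using Int.induction_on with
  | zero =>
    constructor
    · rw [neg_zero, loopX_zero, loopY_zero, rel_EF]; simp
    · rw [sub_zero, loopX_zero, loopY_one]; rfl
  | succ m ih =>
    have h1 : ⁅loopX (m + 1), loopY (1 - (m + 1))⁆ = loopU := by
      have h := hU m (-m)
      rw [ih.1, hc] at h
      have h2 := sub_eq_zero.1 ((smul_eq_zero.1 h.symm).resolve_left two_ne_zero)
      rw [show (1 - (m + 1) : ℤ) = -m by ring, h2, ← ih.2]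
      congr 2
      ring
    refine ⟨?_, h1⟩
    have h := hV (m + 1) (1 - (m + 1))
    rw [h1, hVU, show (1 - (m + 1) : ℤ) = -m by ring, add_sub_cancel_right, ih.1] at h
    have h2 : (2 : ℝ) • ⁅loopX (m + 1), loopY (-m - 1)⁆ =
        (2 : ℝ) • (genH 1 + ((m : ℝ) + 1) • affC) := by
      push_cast at h
      linear_combination (norm := module) h
    have h3 := smul_right_injective Alg (two_ne_zero (α := ℝ)) h2
    rw [show (-(m + 1) : ℤ) = -m - 1 by ring]
    push_cast
    exact h3
  | pred m ih =>
    have h0 : ⁅loopX (-m - 1), loopY (-(-m - 1))⁆ = genH 1 + ((-m - 1 : ℤ) : ℝ) • affC := by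
      have h := hV (-m) (1 - -m)
      rw [ih.2, hVU, show (1 - -m - 1 : ℤ) = - -m by ring, ih.1] at h
      have h2 : (2 : ℝ) • ⁅loopX (-m - 1), loopY (1 - -m)⁆ =
          (2 : ℝ) • (genH 1 + ((-m - 1 : ℤ) : ℝ) • affC) := by
        push_cast at h ⊢
        linear_combination (norm := module) -h
      rw [show (-(-m - 1) : ℤ) = 1 - -m by ring]
      exact smul_right_injective Alg (two_ne_zero (α := ℝ)) h2
    refine ⟨h0, ?_⟩
    have h := hU (-m - 1) (-(-m - 1))
    rw [h0, hc] at h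
    have h2 := sub_eq_zero.1 ((smul_eq_zero.1 h.symm).resolve_left two_ne_zero)
    rw [show (1 - (-m - 1) : ℤ) = -(-m - 1) + 1 by ring, ← h2, ← ih.2]
    congr 2
    · ring
    · ring

theorem loopData : LoopData loopX loopY loopU loopV (genH 1) affC where
  ux m n := (lie_loopX m n).1
  uy m n := (lie_loopY m n).1
  vx m n := (lie_loopX m n).2
  vy m n := (lie_loopY m n).2
  r0 m n h := by
    obtain rfl : n = -m := by omega
    exact (loop_r m).1
  r1 m n h := by
    obtain rfl : n = 1 - m := by omega
    exact (loop_r m).2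
  r1' m n h := by
    have hc : ⁅loopV, ⁅loopX (m + 1), loopY n⁆⁆ = 0 := by
      obtain rfl : n = -(m + 1) := by omega
      rw [(loop_r (m + 1)).1, lie_add, lie_smul, ← lie_skew, genH_lie_loopV, ← lie_skew loopV affC,
        affC_lie_loopV]
      simp
    have hstep : ∀ m, ⁅loopX (m - 1), loopY (-m)⁆ = ⁅loopX m, loopY (-m - 1)⁆ := by
      intro m
      have hc : ⁅loopV, ⁅loopX m, loopY (-m)⁆⁆ = 0 := by
        rw [(loop_r m).1, lie_add, lie_smul, ← lie_skew, genH_lie_loopV, ← lie_skew loopV affC,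
          affC_lie_loopV]
        simp
      rw [leibniz_lie, (lie_loopX m _).2 rfl, (lie_loopY _ _).2 rfl, smul_lie, lie_smul] at hc
      have h2 : (2 : ℝ) • (⁅loopX (m - 1), loopY (-m)⁆ - ⁅loopX m, loopY (-m - 1)⁆) = 0 := by
        linear_combination (norm := module) hc
      exact sub_eq_zero.1 ((smul_eq_zero.1 h2).resolve_left two_ne_zero)
    obtain rfl : n = -m - 1 := by omega
    clear h hc
    have h0 : ⁅loopX 0, loopY (-0 - 1)⁆ = loopV := by
      rw [← hstep]
      change ⁅loopX (-1), loopY 0⁆ = _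
      rw [loopX_neg_one, loopY_zero, loopV]
    induction m using Int.induction_on with
    | zero => exact h0
    | succ m ih =>
      rw [← hstep, add_sub_cancel_right, show (-(m + 1) : ℤ) = -m - 1 by ring, ih]
    | pred m ih =>
      rw [← ih, ← hstep (-m)]
      congr 2
      ring
  hx := genH_lie_loopX
  hy := genH_lie_loopY
  cx := affC_lie_loopX
  cy := affC_lie_loopY
  sx := by
    -- The inner commutator is u and [u,x_0] = 2 x_1, so the Serre relation says that x_0 and x_1
    -- commute. The other three are read in the same way.
    have h : ⁅genE 1, ⁅genE 1, ⁅genE 1, genE 2⁆⁆⁆ = 0 := rel_adE 1 2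
    change ⁅genE 1, ⁅genE 1, loopU⁆⁆ = 0 at h
    rw [← lie_skew _ loopU, ← loopX_zero, (lie_loopX 0 1).1 rfl, lie_neg, lie_smul] at h
    exact (smul_eq_zero.1 (neg_eq_zero.1 h)).resolve_left two_ne_zero
  sx' := by
    have h : ⁅genF 2, ⁅genF 2, ⁅genF 2, genF 1⁆⁆⁆ = 0 := rel_adF 2 1
    change ⁅genF 2, ⁅genF 2, loopV⁆⁆ = 0 at h
    rw [← lie_skew _ loopV, ← loopX_neg_one, (lie_loopX (-1) (-2)).2 rfl, lie_neg, lie_smul] at h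
    exact (smul_eq_zero.1 (neg_eq_zero.1 h)).resolve_left two_ne_zero
  sy := by
    have h : ⁅genE 2, ⁅genE 2, ⁅genE 2, genE 1⁆⁆⁆ = 0 := rel_adE 2 1
    rw [← lie_skew _ (genE 1)] at h
    change ⁅genE 2, ⁅genE 2, -loopU⁆⁆ = 0 at h
    rw [lie_neg, lie_skew, ← loopY_one, (lie_loopY 1 2).1 rfl, lie_smul] at h
    exact (smul_eq_zero.1 h).resolve_left (neg_ne_zero.2 two_ne_zero)
  sy' := by
    have h : ⁅genF 1, ⁅genF 1, ⁅genF 1, genF 2⁆⁆⁆ = 0 := rel_adF 1 2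
    rw [← lie_skew _ (genF 2)] at h
    change ⁅genF 1, ⁅genF 1, -loopV⁆⁆ = 0 at h
    rw [lie_neg, lie_skew, ← loopY_zero, (lie_loopY 0 (-1)).2 rfl, lie_smul] at h
    exact (smul_eq_zero.1 h).resolve_left (neg_ne_zero.2 two_ne_zero)

theorem loopRelations : LoopRelations loopX loopY loopH affC := loopData.loopRelations

theorem transpose_loopU : transpose loopU = loopV := by
  rw [loopU, transpose_lie, transpose_genE, transpose_genE, loopV]

/-- Transposition exchanges u and v and reverses brackets, so it carries the ladder over f_2 to the
ladder over e_2 with modes negated. -/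
theorem transpose_loopY (m : ℤ) : transpose (loopY m) = loopX (-m) := by
  induction m using Int.induction_on with
  | zero => rw [neg_zero, loopX_zero, loopY_zero, transpose_genF]
  | succ m ih =>
    have h := congrArg transpose ((lie_loopY m (m + 1)).1 rfl)
    rw [transpose_lie, ih, transpose_loopU, transpose_smul, ← lie_skew,
      (lie_loopX (-m) (-(m + 1))).2 (by ring)] at h
    have h2 : (2 : ℝ) • transpose (loopY (m + 1)) = (2 : ℝ) • loopX (-(m + 1)) := by
      linear_combination (norm := module) h
    exact smul_right_injective Alg (two_ne_zero (α := ℝ)) h2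
  | pred m ih =>
    have h := congrArg transpose ((lie_loopY (-m) (-m - 1)).2 rfl)
    rw [transpose_lie, ih, ← transpose_loopU, transpose_transpose, transpose_smul, ← lie_skew,
      (lie_loopX (- -m) (-(-m - 1))).1 (by ring)] at h
    have h2 : (2 : ℝ) • transpose (loopY (-m - 1)) = (2 : ℝ) • loopX (-(-m - 1)) := by
      linear_combination (norm := module) h
    exact smul_right_injective Alg (two_ne_zero (α := ℝ)) h2

theorem transpose_loopX (m : ℤ) : transpose (loopX m) = loopY (-m) := by
  rw [← transpose_transpose (loopY (-m)), transpose_loopY, neg_neg]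

theorem transpose_loopH (m : ℤ) : transpose (loopH m) = loopH (-m) := by
  rw [loopH, transpose_lie, transpose_loopX, transpose_loopY, neg_zero, loopRelations.xy]
  simp

theorem loopH_zero : loopH 0 = genH 1 := by
  rw [loopH, loopX_zero, loopY_zero, rel_EF, if_pos rfl]

end AffineElements

end AE3

namespace AE3

/-! ### The commutation relations of gl_3. -/

section GeneralLinear

theorem E0_K13 : ⁅genE 0, ⁅genE 0, genE 1⁆⁆ = 0 := rel_adE 0 1

theorem F0_K31 : ⁅genF 0, ⁅genF 1, genF 0⁆⁆ = 0 := by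
  have h : ⁅genF 0, ⁅genF 0, genF 1⁆⁆ = 0 := rel_adF 0 1
  rwa [← lie_skew (genF 0) (genF 1), lie_neg, neg_eq_zero] at h

theorem E1_K13 : ⁅genE 1, ⁅genE 0, genE 1⁆⁆ = 0 := by
  have h : ⁅genE 1, ⁅genE 1, genE 0⁆⁆ = 0 := rel_adE 1 0
  rwa [← lie_skew (genE 1) (genE 0), lie_neg, neg_eq_zero] at h

theorem F1_K31 : ⁅genF 1, ⁅genF 1, genF 0⁆⁆ = 0 := rel_adF 1 0

theorem E0_K31 : ⁅genE 0, ⁅genF 1, genF 0⁆⁆ = -genF 1 := by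
  rw [leibniz_lie, rel_EF, rel_EF]
  simp [rel_FH, cartan]

theorem E1_K31 : ⁅genE 1, ⁅genF 1, genF 0⁆⁆ = genF 0 := by
  rw [leibniz_lie, rel_EF, rel_EF]
  simp [rel_HF', cartan]

theorem K13_F0 : ⁅⁅genE 0, genE 1⁆, genF 0⁆ = -genE 1 := by
  rw [lie_lie, rel_EF, rel_EF]
  simp [rel_EH, cartan]

theorem K13_F1 : ⁅⁅genE 0, genE 1⁆, genF 1⁆ = genE 0 := by
  rw [lie_lie, rel_EF, rel_EF]
  simp [rel_EH, cartan]

theorem K13_K31 : ⁅⁅genE 0, genE 1⁆, ⁅genF 1, genF 0⁆⁆ = genH 0 + genH 1 := by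
  rw [leibniz_lie, K13_F1, K13_F0, lie_neg, rel_EF, if_pos rfl, ← lie_skew (genF 1), rel_EF,
    if_pos rfl, neg_neg]

theorem glK_00 : glK 0 0 = -genH 1 - genH 2 := rfl
theorem glK_01 : glK 0 1 = genE 0 := rfl
theorem glK_02 : glK 0 2 = ⁅genE 0, genE 1⁆ := rfl
theorem glK_10 : glK 1 0 = genF 0 := rfl
theorem glK_11 : glK 1 1 = -genH 0 - genH 1 - genH 2 := rfl
theorem glK_12 : glK 1 2 = genE 1 := rfl
theorem glK_20 : glK 2 0 = ⁅genF 1, genF 0⁆ := rfl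
theorem glK_21 : glK 2 1 = genF 1 := rfl
theorem glK_22 : glK 2 2 = -genH 0 - (2 : ℝ) • genH 1 - genH 2 := rfl

/-- The coordinates of `K^a_a` in the basis of the `h_i`. -/
noncomputable def glDiagCoord (a : Fin 3) : Fin 3 → ℝ :=
  ![![0, -1, -1], ![-1, -1, -1], ![-1, -2, -1]] a

theorem glK_diag (a : Fin 3) : glK a a = cartanElem (glDiagCoord a) := by
  fin_cases a <;> simp [glK, cartanElem, glDiagCoord, Fin.sum_univ_three] <;> module

theorem simpleRoot_glDiagCoord (a i : Fin 3) : simpleRoot (glDiagCoord a) i =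
    ![kron a 0 - kron a 1, kron a 1 - kron a 2, 2 * kron a 2] i := by
  fin_cases a <;> fin_cases i <;>
    simp [simpleRoot, glDiagCoord, cartan, Fin.sum_univ_three, kron] <;> norm_num

theorem glK_diag_lie_chev (a : Fin 3) (s : Bool) (i : Fin 3) :
    ⁅glK a a, chev s i⁆ = (chevSign s * simpleRoot (glDiagCoord a) i) • chev s i := by
  rw [glK_diag]
  simpa [word] using lie_cartanElem_word (glDiagCoord a) s i []

theorem glK_diag_lie_genE (a i : Fin 3) :
    ⁅glK a a, genE i⁆ = simpleRoot (glDiagCoord a) i • genE i := by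
  simpa [chevSign, chev] using glK_diag_lie_chev a true i

theorem glK_diag_lie_genF (a i : Fin 3) :
    ⁅glK a a, genF i⁆ = (-simpleRoot (glDiagCoord a) i) • genF i := by
  simpa [chevSign, chev] using glK_diag_lie_chev a false i

theorem glK_diag_lie_glK_diag (a b : Fin 3) : ⁅glK a a, glK b b⁆ = 0 := by
  rw [glK_diag b, cartanElem, glK_diag a]
  simp [lie_sum, lie_cartanElem_genH]

theorem glK_diag_lie (a c d : Fin 3) :
    ⁅glK a a, glK c d⁆ = (kron c a - kron a d) • glK c d := by
  have hE := glK_diag_lie_genE a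
  have hF := glK_diag_lie_genF a
  have hEE := lie_lie_weight (hE 0) (hE 1)
  have hFF := lie_lie_weight (hF 1) (hF 0)
  have hdd := glK_diag_lie_glK_diag a
  simp only [simpleRoot_glDiagCoord] at hE hF hEE hFF
  by_cases hcd : c = d
  · subst hcd
    rw [hdd]
    fin_cases a <;> fin_cases c <;> simp [kron]
  · fin_cases c <;> fin_cases d <;> simp at hcd <;>
      simp only [glK_01, glK_02, glK_10, glK_12, glK_20, glK_21, Fin.mk_one, Fin.zero_eta,
        Fin.reduceFinMk, hE, hF, hEE, hFF] <;> congr 1 <;> fin_cases a <;> simp [kron]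

/-- A finite table of products of root vectors of sl_3. The skew forms of the known brackets are
supplied so that each entry can be rewritten in either order. -/
theorem glK_offdiag_lie (a b c d : Fin 3) (hab : a ≠ b) (hcd : c ≠ d) :
    ⁅glK a b, glK c d⁆ = kron c b • glK a d - kron a d • glK c b := by
  have e1 := lie_skew ⁅genE 0, genE 1⁆ (genE 0)
  have e2 := lie_skew ⁅genE 0, genE 1⁆ (genE 1)
  have e3 := lie_skew ⁅genF 1, genF 0⁆ (genF 0)
  have e4 := lie_skew ⁅genF 1, genF 0⁆ (genF 1)
  have e5 := lie_skew ⁅genF 1, genF 0⁆ (genE 0)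
  have e6 := lie_skew ⁅genF 1, genF 0⁆ (genE 1)
  have e7 := lie_skew (genF 0) ⁅genE 0, genE 1⁆
  have e8 := lie_skew (genF 1) ⁅genE 0, genE 1⁆
  have e9 := lie_skew ⁅genF 1, genF 0⁆ ⁅genE 0, genE 1⁆
  have e10 := lie_skew (genE 1) (genE 0)
  have e11 := lie_skew (genF 0) (genF 1)
  rw [E0_K13] at e1
  rw [E1_K13] at e2
  rw [F0_K31] at e3
  rw [F1_K31] at e4
  rw [E0_K31] at e5
  rw [E1_K31] at e6
  rw [K13_F0] at e7
  rw [K13_F1] at e8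
  rw [K13_K31] at e9
  have e12 : ⁅genE 0, genF 0⁆ = genH 0 := by rw [rel_EF, if_pos rfl]
  have e13 : ⁅genE 1, genF 1⁆ = genH 1 := by rw [rel_EF, if_pos rfl]
  have e14 : ⁅genF 0, genE 0⁆ = -genH 0 := by rw [rel_FE, if_pos rfl]
  have e15 : ⁅genF 1, genE 1⁆ = -genH 1 := by rw [rel_FE, if_pos rfl]
  have e16 : ⁅genE 0, genF 1⁆ = 0 := by rw [rel_EF, if_neg (by decide)]
  have e17 : ⁅genE 1, genF 0⁆ = 0 := by rw [rel_EF, if_neg (by decide)]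
  have e18 : ⁅genF 0, genE 1⁆ = 0 := by rw [rel_FE, if_neg (by decide)]
  have e19 : ⁅genF 1, genE 0⁆ = 0 := by rw [rel_FE, if_neg (by decide)]
  fin_cases a <;> fin_cases b <;> simp at hab <;> fin_cases c <;> fin_cases d <;> simp at hcd <;>
    simp only [glK_00, glK_01, glK_02, glK_10, glK_11, glK_12, glK_20, glK_21, glK_22, Fin.mk_one,
      Fin.zero_eta, Fin.reduceFinMk, kron, if_true, lie_self, E0_K13, E1_K13, F0_K31, F1_K31,
      E0_K31, E1_K31, K13_F0, K13_F1, K13_K31, ← e1, ← e2, ← e3, ← e4, ← e5, ← e6, ← e7, ← e8, ← e9,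
      e12, e13, e14, e15, e16, e17, e18, e19, ← e10, ← e11, Fin.reduceEq, if_false] <;> module

theorem glK_lie_glK (a b c d : Fin 3) :
    ⁅glK a b, glK c d⁆ = kron c b • glK a d - kron a d • glK c b := by
  by_cases hab : a = b
  · subst hab
    rw [glK_diag_lie, sub_smul]
    congr 1
    · by_cases h : c = a
      · rw [h]
      · simp [kron, h]
    · by_cases h : a = d
      · rw [h]
      · simp [kron, h]
  by_cases hcd : c = d
  · subst hcd
    rw [← lie_skew, glK_diag_lie, sub_smul, neg_sub]
    congr 1
    · by_cases h : c = b
      · rw [h]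
      · simp [kron, h]
    · by_cases h : a = c
      · rw [h]
      · simp [kron, h]
  exact glK_offdiag_lie a b c d hab hcd

theorem glTr_lie_glK (a b : Fin 3) : ⁅glTr, glK a b⁆ = 0 := by
  simp only [glTr, sum_lie, glK_diag_lie, ← Finset.sum_smul]
  rw [show ∑ i, (kron a i - kron i b) = 0 from ?_, zero_smul]
  simp [kron, Finset.sum_sub_distrib]

end GeneralLinear

/-! ### Level zero and the affine subalgebra as centralizers. -/

section Level

theorem mem_level {n : ℤ} {x : Alg} : x ∈ level n ↔ ⁅glTr, x⁆ = (2 * n : ℝ) • x := by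
  rw [level, LinearMap.mem_ker, LinearMap.sub_apply, sub_eq_zero]
  rfl

/-- The coordinates of `K` in the basis of the `h_i`. -/
noncomputable def glTrCoord : Fin 3 → ℝ := ![-2, -4, -3]

theorem glTr_eq : glTr = cartanElem glTrCoord := by
  simp [glTr, glK, cartanElem, glTrCoord, Fin.sum_univ_three]
  module

theorem simpleRoot_glTrCoord : simpleRoot glTrCoord = ![0, 0, 2] := by
  funext j
  fin_cases j <;> simp [simpleRoot, glTrCoord, cartan, Fin.sum_univ_three] <;> norm_num

/-- The subspace `gl₃`. -/
noncomputable def glSpan : Submodule ℝ Alg := Submodule.span ℝ {x | ∃ a b, glK a b = x}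

theorem glK_mem_glSpan (a b : Fin 3) : glK a b ∈ glSpan := Submodule.subset_span ⟨a, b, rfl⟩

theorem glK_lie_mem_glSpan (a b : Fin 3) : ∀ x ∈ glSpan, ⁅glK a b, x⁆ ∈ glSpan := by
  intro x hx
  refine Submodule.span_induction (p := fun x _ => ⁅glK a b, x⁆ ∈ glSpan) ?_ ?_ ?_ ?_ hx
  · rintro x ⟨c, d, rfl⟩
    rw [glK_lie_glK]
    exact Submodule.sub_mem _ (Submodule.smul_mem _ _ (glK_mem_glSpan _ _))
      (Submodule.smul_mem _ _ (glK_mem_glSpan _ _))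
  · rw [lie_zero]; exact Submodule.zero_mem _
  · intro x y _ _ hx hy; rw [lie_add]; exact Submodule.add_mem _ hx hy
  · intro r x _ hx; rw [lie_smul]; exact Submodule.smul_mem _ _ hx

theorem chev_eq_glK (s : Bool) (i : Fin 3) (hi : i ≠ 2) : ∃ a b, chev s i = glK a b := by
  fin_cases i
  · cases s
    exacts [⟨1, 0, rfl⟩, ⟨0, 1, rfl⟩]
  · cases s
    exacts [⟨2, 1, rfl⟩, ⟨1, 2, rfl⟩]
  · exact absurd rfl hi

theorem genH_mem_glSpan (i : Fin 3) : genH i ∈ glSpan := by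
  fin_cases i
  · have h : genH 0 = glK 0 0 - glK 1 1 := by rw [glK_00, glK_11]; abel
    exact h ▸ Submodule.sub_mem _ (glK_mem_glSpan 0 0) (glK_mem_glSpan 1 1)
  · have h : genH 1 = glK 1 1 - glK 2 2 := by rw [glK_22, glK_11]; module
    exact h ▸ Submodule.sub_mem _ (glK_mem_glSpan 1 1) (glK_mem_glSpan 2 2)
  · have h : genH 2 = glK 2 2 - glK 0 0 - glK 1 1 := by rw [glK_00, glK_22, glK_11]; module
    exact h ▸ Submodule.sub_mem _ (Submodule.sub_mem _ (glK_mem_glSpan 2 2) (glK_mem_glSpan 0 0))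
      (glK_mem_glSpan 1 1)

/-- Among the simple roots, K is nonzero only on α_3, where it takes the value 2. Its centralizer is
therefore generated by the Cartan subalgebra and the other two nodes. -/
theorem level_zero : level 0 = glSpan := by
  refine le_antisymm (fun x hx => ?_) (Submodule.span_le.2 ?_)
  · rw [mem_level, glTr_eq, Int.cast_zero, mul_zero, zero_smul] at hx
    refine centralizer_le (k := 2) (by simp [simpleRoot_glTrCoord]) (fun j hj => ?_)
      genH_mem_glSpan (fun s i hi => ?_) (fun s i hi x hx => ?_) hx
    · rw [simpleRoot_glTrCoord]
      fin_cases j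
      exacts [rfl, rfl, absurd rfl hj]
    · obtain ⟨a, b, h⟩ := chev_eq_glK s i hi
      exact h ▸ glK_mem_glSpan a b
    · obtain ⟨a, b, h⟩ := chev_eq_glK s i hi
      exact h ▸ glK_lie_mem_glSpan a b x hx
  · rintro _ ⟨a, b, rfl⟩
    rw [SetLike.mem_coe, mem_level, glTr_lie_glK]
    simp

theorem lie_mem_level {m n p : ℤ} (hp : p = m + n) {x y : Alg} (hx : x ∈ level m)
    (hy : y ∈ level n) : ⁅x, y⁆ ∈ level p := by
  rw [mem_level] at *
  rw [lie_lie_weight hx hy, hp]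
  push_cast
  ring_nf

theorem genE_mem_affine {i : Fin 3} (hi : i ≠ 0) : genE i ∈ affineSubalgebra := by
  refine LieSubalgebra.subset_lieSpan (Or.inl ?_)
  fin_cases i
  exacts [absurd rfl hi, Or.inl rfl, Or.inr (Or.inl rfl)]

theorem genF_mem_affine {i : Fin 3} (hi : i ≠ 0) : genF i ∈ affineSubalgebra := by
  refine LieSubalgebra.subset_lieSpan (Or.inl ?_)
  fin_cases i
  exacts [absurd rfl hi, Or.inr (Or.inr (Or.inl rfl)), Or.inr (Or.inr (Or.inr rfl))]

theorem genH_mem_affine (i : Fin 3) : genH i ∈ affineSubalgebra :=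
  LieSubalgebra.subset_lieSpan (Or.inr ⟨i, rfl⟩)

/-- The centralizer of `ĉ` is the affine subalgebra. -/
theorem mem_affine_of_lie {x : Alg} (hx : ⁅glK 0 0, x⁆ = 0) : x ∈ affineSubalgebra := by
  rw [glK_diag] at hx
  have hc : ∀ s, ∀ i : Fin 3, i ≠ 0 → chev s i ∈ affineSubalgebra := fun s i hi => by
    cases s
    exacts [genF_mem_affine hi, genE_mem_affine hi]
  refine centralizer_le (k := 0) (S := affineSubalgebra.toSubmodule) ?_ (fun j hj => ?_)
    genH_mem_affine hc (fun s i hi x hx => affineSubalgebra.lie_mem (hc s i hi) hx) hx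
  · simp [simpleRoot_glDiagCoord, kron]
  · rw [simpleRoot_glDiagCoord]
    fin_cases j
    · exact absurd rfl hj
    · simp [kron]
    · simp [kron]

end Level

end AE3

namespace AE3

/-! ### Irreducible tensors are generated by their lowest weight component. -/

section Tensors

variable {M : Type*} [AddCommGroup M] [Module ℝ M] {k : ℕ}

/-- Families `T_{a_1…a_k}^{b_1 b_2}` with values in `M`. -/
abbrev GTens (k : ℕ) (M : Type*) : Type _ := (Fin k → Fin 3) → Fin 3 → Fin 3 → M

/-- Symmetry in the `a`'s, symmetry in the `b`'s, and vanishing of any contraction. -/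
structure IsIrr (T : GTens k M) : Prop where
  symm_left : ∀ (σ : Equiv.Perm (Fin k)) a b₁ b₂, T (a ∘ σ) b₁ b₂ = T a b₁ b₂
  symm_right : ∀ a b₁ b₂, T a b₁ b₂ = T a b₂ b₁
  traceless : ∀ (i : Fin k) a b, ∑ s, T (Function.update a i s) s b = 0

theorem isIrreducibleTensor_iff {T : Tens k} : IsIrreducibleTensor T ↔ IsIrr T :=
  ⟨fun h => ⟨h.1, h.2, h.3⟩, fun h => ⟨h.1, h.2, h.3⟩⟩

/-- The action of `K^c_d` on tensors. -/
noncomputable def gAct (c d : Fin 3) : GTens k M →ₗ[ℝ] GTens k M where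
  toFun T := fun a b₁ b₂ =>
    -(∑ i, kron c (a i) • T (Function.update a i d) b₁ b₂)
      + kron b₁ d • T a c b₂ + kron b₂ d • T a b₁ c + (k * kron c d) • T a b₁ b₂
  map_add' S T := by
    funext a b₁ b₂
    simp only [Pi.add_apply, smul_add, Finset.sum_add_distrib]
    abel
  map_smul' r T := by
    funext a b₁ b₂
    simp only [Pi.smul_apply, RingHom.id_apply, smul_add, smul_neg, Finset.smul_sum, smul_comm r]

theorem gAct_apply (c d : Fin 3) (T : GTens k M) (a : Fin k → Fin 3) (b₁ b₂ : Fin 3) :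
    gAct c d T a b₁ b₂ = -(∑ i, kron c (a i) • T (Function.update a i d) b₁ b₂)
      + kron b₁ d • T a c b₂ + kron b₂ d • T a b₁ c + (k * kron c d) • T a b₁ b₂ := rfl

theorem gAct_map {N : Type*} [AddCommGroup N] [Module ℝ N] (φ : M →ₗ[ℝ] N) (c d : Fin 3)
    (T : GTens k M) (a : Fin k → Fin 3) (b₁ b₂ : Fin 3) :
    gAct c d (fun a b₁ b₂ => φ (T a b₁ b₂)) a b₁ b₂ = φ (gAct c d T a b₁ b₂) := by
  simp only [gAct_apply, map_add, map_neg, map_sum, map_smul]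

theorem IsIrr.map {N : Type*} [AddCommGroup N] [Module ℝ N] {T : GTens k M} (hT : IsIrr T)
    (φ : M →ₗ[ℝ] N) : IsIrr fun a b₁ b₂ => φ (T a b₁ b₂) where
  symm_left σ a b₁ b₂ := congrArg φ (hT.symm_left σ a b₁ b₂)
  symm_right a b₁ b₂ := congrArg φ (hT.symm_right a b₁ b₂)
  traceless i a b := by rw [← map_sum, hT.traceless, map_zero]

theorem IsIrr.sub {S T : GTens k M} (hS : IsIrr S) (hT : IsIrr T) : IsIrr (S - T) where
  symm_left σ a b₁ b₂ := congrArg₂ (· - ·) (hS.symm_left σ a b₁ b₂) (hT.symm_left σ a b₁ b₂)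
  symm_right a b₁ b₂ := congrArg₂ (· - ·) (hS.symm_right a b₁ b₂) (hT.symm_right a b₁ b₂)
  traceless i a b := by
    simp only [Pi.sub_apply, Finset.sum_sub_distrib, hS.traceless, hT.traceless, sub_self]

theorem IsIrr.smul {T : GTens k M} (hT : IsIrr T) (r : ℝ) : IsIrr (r • T) :=
  hT.map (r • LinearMap.id)

theorem IsIrr.traceless' {T : GTens k M} (hT : IsIrr T) (i : Fin k) (a : Fin k → Fin 3)
    (b : Fin 3) : ∑ s, T (Function.update a i s) b s = 0 := by
  rw [← hT.traceless i a b]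
  exact Finset.sum_congr rfl fun s _ => hT.symm_right _ _ _

theorem kron_nonneg (a b : Fin 3) : 0 ≤ kron a b := by unfold kron; split_ifs <;> norm_num

theorem kron_self (a : Fin 3) : kron a a = 1 := if_pos rfl

theorem kron_of_ne {a b : Fin 3} (h : a ≠ b) : kron a b = 0 := if_neg h

theorem kron_comm (a b : Fin 3) : kron a b = kron b a := by simp [kron, eq_comm]

theorem update_comp_swap (a : Fin k → Fin 3) {i j : Fin k} (h : a i = a j) (t : Fin 3) :
    Function.update a i t ∘ Equiv.swap i j = Function.update a j t := by
  funext m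
  simp only [Function.comp_apply]
  by_cases hj : m = j
  · subst hj; simp
  by_cases hi : m = i
  · subst hi
    rw [Equiv.swap_apply_left, Function.update_of_ne hj]
    by_cases hij : j = m
    · exact absurd hij.symm hj
    · rw [Function.update_of_ne hij, h]
  · rw [Equiv.swap_apply_of_ne_of_ne hi hj, Function.update_of_ne hi, Function.update_of_ne hj]

/-- Components that agree up to exchanging two lower indices. -/
theorem symm_update {T : GTens k M}
    (hT : ∀ (σ : Equiv.Perm (Fin k)) a b₁ b₂, T (a ∘ σ) b₁ b₂ = T a b₁ b₂) {a : Fin k → Fin 3}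
    {i j : Fin k} (h : a i = a j) (t b₁ b₂ : Fin 3) :
    T (Function.update a j t) b₁ b₂ = T (Function.update a i t) b₁ b₂ := by
  rw [← update_comp_swap a h t, hT]

/-- The number of lower indices equal to `s`. -/
def countIdx (s : Fin 3) (a : Fin k → Fin 3) : ℕ := ∑ i, if a i = s then 1 else 0

theorem countIdx_update (s : Fin 3) (a : Fin k → Fin 3) (i : Fin k) (t : Fin 3) :
    countIdx s (Function.update a i t) + (if a i = s then 1 else 0) =
      countIdx s a + if t = s then 1 else 0 := by
  unfold countIdx
  rw [← Finset.add_sum_erase _ _ (Finset.mem_univ i), ← Finset.add_sum_erase (a := i) _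
    (fun i => if a i = s then 1 else 0) (Finset.mem_univ i), Function.update_self]
  have : ∑ x ∈ Finset.univ.erase i, (if Function.update a i t x = s then 1 else 0) =
      ∑ x ∈ Finset.univ.erase i, if a x = s then 1 else 0 :=
    Finset.sum_congr rfl fun x hx => by
      rw [Function.update_of_ne (Finset.ne_of_mem_erase hx)]
  rw [this]
  omega

theorem exists_of_countIdx_pos {s : Fin 3} {a : Fin k → Fin 3} (h : 0 < countIdx s a) :
    ∃ i, a i = s := by
  by_contra hne
  simp only [not_exists] at hne
  simp [countIdx, hne] at h

/-- Lower indices with equal value can be exchanged, so all nonzero terms agree and only their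
number matters. -/
theorem sum_kron_smul_update {T : GTens k M} (hT : IsIrr T) {a : Fin k → Fin 3} {i : Fin k}
    {c : Fin 3} (hi : a i = c) (t b₁ b₂ : Fin 3) :
    ∑ j, kron c (a j) • T (Function.update a j t) b₁ b₂ =
      (∑ j, kron c (a j)) • T (Function.update a i t) b₁ b₂ := by
  rw [Finset.sum_smul]
  refine Finset.sum_congr rfl fun j _ => ?_
  by_cases h : c = a j
  · rw [symm_update hT.symm_left (hi.trans h)]
  · rw [kron_of_ne h, zero_smul, zero_smul]

theorem sum_kron_nonneg (c : Fin 3) (a : Fin k → Fin 3) : 0 ≤ ∑ j, kron c (a j) :=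
  Finset.sum_nonneg fun _ _ => kron_nonneg _ _

/-- The raising operator from the second to the first basis direction converts a lower index 0 into
1 with a positive multiplicity. Thus components with many indices 1 are reached from those with
fewer. -/
theorem lowest_step {T : GTens k M} (hT : IsIrr T)
    (hact : ∀ c d, c < d → ∀ a b₁ b₂, T a b₁ b₂ = 0 → gAct c d T a b₁ b₂ = 0)
    (h0 : T (fun _ => 0) 2 2 = 0) (n : ℕ) :
    ∀ a : Fin k → Fin 3, countIdx 2 a = 0 → countIdx 1 a = n → T a 2 2 = 0 := by
  induction n with
  | zero =>
    intro a h2 h1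
    have : a = fun _ => 0 := by
      funext i
      have e2 : a i ≠ 2 := fun h => by
        have := (Finset.sum_eq_zero_iff.1 h2) i (Finset.mem_univ i)
        simp [h] at this
      have e1 : a i ≠ 1 := fun h => by
        have := (Finset.sum_eq_zero_iff.1 h1) i (Finset.mem_univ i)
        simp [h] at this
      revert e1 e2
      generalize a i = s
      fin_cases s <;> simp
    rw [this, h0]
  | succ n ih =>
    intro a h2 h1
    obtain ⟨i, hi⟩ := exists_of_countIdx_pos (s := 1) (a := a) (by omega)
    have c1 := countIdx_update 1 a i 0
    have c2 := countIdx_update 2 a i 0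
    simp [hi] at c1 c2
    have h := hact 0 1 (by decide) _ 2 2 (ih (Function.update a i 0) (by omega) (by omega))
    rw [gAct_apply, sum_kron_smul_update hT (i := i) (Function.update_self _ _ _),
      Function.update_idem, ← hi, Function.update_eq_self, hi] at h
    simp only [kron_of_ne (show (2 : Fin 3) ≠ 1 by decide),
      kron_of_ne (show (0 : Fin 3) ≠ 1 by decide), zero_smul, mul_zero, add_zero, neg_eq_zero] at h
    refine (smul_eq_zero.1 h).resolve_left (ne_of_gt ?_)
    refine Finset.sum_pos' (fun _ _ => kron_nonneg _ _) ⟨i, Finset.mem_univ i, ?_⟩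
    rw [Function.update_self, kron_self]
    exact one_pos

/-- An irreducible tensor whose vanishing components are preserved by the raising operators
vanishes if its lowest weight component does. -/
theorem IsIrr.eq_zero {T : GTens k M} (hT : IsIrr T)
    (hact : ∀ c d, c < d → ∀ a b₁ b₂, T a b₁ b₂ = 0 → gAct c d T a b₁ b₂ = 0)
    (h0 : T (fun _ => 0) 2 2 = 0) (a : Fin k → Fin 3) (b₁ b₂ : Fin 3) : T a b₁ b₂ = 0 := by
  -- The induction parameter counts the lower indices 2 and the upper indices different from 2. It
  -- is zero exactly on the components of `lowest_step`.
  have key : ∀ n : ℕ, ∀ (a : Fin k → Fin 3) (b₁ b₂ : Fin 3), countIdx 2 a +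
      ((if b₁ = 2 then 0 else 1) + if b₂ = 2 then 0 else 1) = n → T a b₁ b₂ = 0 := by
    intro n
    induction n with
    | zero =>
      intro a b₁ b₂ h
      have hb₁ : b₁ = 2 := by
        by_contra hb; simp [hb] at h
      have hb₂ : b₂ = 2 := by
        by_contra hb; simp [hb] at h
      subst hb₁ hb₂
      exact lowest_step hT hact h0 _ a (by omega) rfl
    | succ n ih =>
      -- Raising with α < 2 relates the component with the lower and an upper index set to α to a
      -- nonnegative multiple of the wanted one. Inserting this into the trace condition leaves the
      -- wanted component times a coefficient at least 2.
      have s1 : ∀ a : Fin k → Fin 3, countIdx 2 a = n + 1 → T a 2 2 = 0 := by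
        intro a ha
        obtain ⟨i, hi⟩ := exists_of_countIdx_pos (s := 2) (a := a) (by omega)
        have hα : ∀ α : Fin 3, α < 2 → (2 : ℝ) • T (Function.update a i α) α 2 =
            (∑ j, kron α (Function.update a i α j)) • T a 2 2 := by
          intro α hα2
          have c2 := countIdx_update 2 a i α
          simp [hi, hα2.ne] at c2
          have h := hact α 2 hα2 _ 2 2 (ih (Function.update a i α) 2 2 (by simp; omega))
          rw [gAct_apply, sum_kron_smul_update hT (i := i) (Function.update_self _ _ _),
            Function.update_idem, ← hi, Function.update_eq_self, hi, kron_self,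
            kron_of_ne hα2.ne, hT.symm_right _ 2 α] at h
          linear_combination (norm := module) h
        have htr := hT.traceless i a 2
        rw [Fin.sum_univ_three] at htr
        have e : Function.update a i 2 = a := by rw [← hi, Function.update_eq_self]
        rw [e] at htr
        have hsum : ((∑ j, kron 0 (Function.update a i 0 j)) +
            (∑ j, kron 1 (Function.update a i 1 j)) + 2) • T a 2 2 = 0 := by
          rw [add_smul, add_smul, ← hα 0 (by decide), ← hα 1 (by decide), ← smul_add, ← smul_add,
            htr, smul_zero]
        refine (smul_eq_zero.1 hsum).resolve_left (ne_of_gt ?_)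
        have p0 := sum_kron_nonneg 0 (Function.update a i 0)
        have p1 := sum_kron_nonneg 1 (Function.update a i 1)
        linarith
      have hsum0 : ∀ (a : Fin k → Fin 3) (α β : Fin 3), α < 2 →
          (∀ i, a i = α → T (Function.update a i 2) β 2 = 0) →
          ∑ j, kron α (a j) • T (Function.update a j 2) β 2 = 0 := by
        intro a α β hα h
        refine Finset.sum_eq_zero fun j _ => ?_
        by_cases hj : a j = α
        · rw [h j hj, smul_zero]
        · rw [kron_of_ne (Ne.symm hj), zero_smul]
      -- Once all components with upper indices 22 at this stage are known to vanish, a raising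
      -- operator reaches one upper index α, and then the other in `s3`, without needing the trace
      -- condition again.
      have s2 : ∀ (a : Fin k → Fin 3) (α : Fin 3), α < 2 → countIdx 2 a = n → T a α 2 = 0 := by
        intro a α hα ha
        have h := hact α 2 hα _ 2 2 (ih a 2 2 (by simpa using ha))
        rw [gAct_apply, hsum0 a α 2 hα (fun i hi => s1 _ (by
          have c2 := countIdx_update 2 a i 2
          simp [hi, hα.ne] at c2
          omega)), kron_self, kron_of_ne hα.ne, hT.symm_right _ 2 α] at h
        have h2 : (2 : ℝ) • T a α 2 = 0 := by
          linear_combination (norm := module) h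
        exact (smul_eq_zero.1 h2).resolve_left two_ne_zero
      have s3 : ∀ (a : Fin k → Fin 3) (α β : Fin 3), α < 2 → β < 2 → countIdx 2 a + 1 = n →
          T a β α = 0 := by
        intro a α β hα hβ ha
        have h := hact α 2 hα _ β 2 (ih a β 2 (by simpa [hβ.ne] using ha))
        rw [gAct_apply, hsum0 a α β hα (fun i hi => s2 _ β hβ (by
          have c2 := countIdx_update 2 a i 2
          simp [hi, hα.ne] at c2
          omega)), kron_self, kron_of_ne hα.ne, kron_of_ne hβ.ne] at h
        linear_combination (norm := module) h
      have hlt : ∀ b : Fin 3, b ≠ 2 → b < 2 := by decide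
      intro a b₁ b₂ h
      by_cases hb₁ : b₁ = 2 <;> by_cases hb₂ : b₂ = 2
      · subst hb₁ hb₂
        exact s1 a (by simpa using h)
      · subst hb₁
        rw [hT.symm_right]
        exact s2 a b₂ (hlt _ hb₂) (by simpa [hb₂] using h)
      · subst hb₂
        exact s2 a b₁ (hlt _ hb₁) (by simpa [hb₁] using h)
      · exact s3 a b₂ b₁ (hlt _ hb₂) (hlt _ hb₁) (by simp [hb₁, hb₂] at h; omega)
  exact key _ a b₁ b₂ rfl

/-- An irreducible tensor is generated by its lowest weight component under raising operators. -/
theorem IsIrr.mem {T : GTens k M} (hT : IsIrr T) (S : Submodule ℝ M)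
    (hact : ∀ c d, c < d → ∀ a b₁ b₂, T a b₁ b₂ ∈ S → gAct c d T a b₁ b₂ ∈ S)
    (h0 : T (fun _ => 0) 2 2 ∈ S) (a : Fin k → Fin 3) (b₁ b₂ : Fin 3) : T a b₁ b₂ ∈ S := by
  -- Membership in S is vanishing in the quotient by S.
  have h := (hT.map S.mkQ).eq_zero (fun c d hcd a b₁ b₂ h => by
    rw [gAct_map]
    exact (Submodule.Quotient.mk_eq_zero S).2
      (hact c d hcd a b₁ b₂ ((Submodule.Quotient.mk_eq_zero S).1 h)))
    ((Submodule.Quotient.mk_eq_zero S).2 h0) a b₁ b₂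
  exact (Submodule.Quotient.mk_eq_zero S).1 h

end Tensors

end AE3

namespace AE3

/-! ### The traceless projection and its covariance. -/

noncomputable section Projection

variable {M : Type*} [AddCommGroup M] [Module ℝ M] {k : ℕ}

set_option linter.unusedSectionVars false

/-- Exchange of the two upper indices. -/
def swapUpper : GTens k M →ₗ[ℝ] GTens k M where
  toFun T := fun a b₁ b₂ => T a b₂ b₁
  map_add' _ _ := rfl
  map_smul' _ _ := rfl

/-- Contraction of the second upper index with the `i`-th lower one, followed by multiplication
with the Kronecker symbol of these two indices. -/
def traceOp (i : Fin k) : GTens k M →ₗ[ℝ] GTens k M where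
  toFun T := fun a b₁ b₂ => kron b₂ (a i) • ∑ s, T (Function.update a i s) b₁ s
  map_add' S T := by
    funext a b₁ b₂
    simp only [Pi.add_apply, Finset.sum_add_distrib, smul_add]
  map_smul' r T := by
    funext a b₁ b₂
    simp only [Pi.smul_apply, RingHom.id_apply, ← Finset.smul_sum, smul_comm r]

theorem swapUpper_apply (T : GTens k M) (a b₁ b₂) : swapUpper T a b₁ b₂ = T a b₂ b₁ := rfl

theorem traceOp_apply (i : Fin k) (T : GTens k M) (a b₁ b₂) :
    traceOp i T a b₁ b₂ = kron b₂ (a i) • ∑ s, T (Function.update a i s) b₁ s := rfl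

/-- The projection of symmetric tensors onto irreducible ones. -/
def projOp : GTens k M →ₗ[ℝ] GTens k M :=
  LinearMap.id - (1 / (3 + k) : ℝ) • ∑ i, (swapUpper ∘ₗ traceOp i + traceOp i)
    + (1 / ((3 + k) * (2 + k)) : ℝ) • ∑ i : Fin k, ∑ j ∈ Finset.univ.erase i,
        swapUpper ∘ₗ traceOp i ∘ₗ swapUpper ∘ₗ traceOp j

/-- The double contraction over two lower indices. -/
def doubleTrace (T : GTens k M) (i j : Fin k) (a : Fin k → Fin 3) : M :=
  ∑ s, ∑ t, T (Function.update (Function.update a i s) j t) s t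

theorem traceOp_traceOp {i j : Fin k} (hij : j ≠ i) (T : GTens k M) (a b₁ b₂) :
    swapUpper (traceOp i (swapUpper (traceOp j T))) a b₁ b₂ =
      (kron b₁ (a i) * kron b₂ (a j)) • doubleTrace T i j a := by
  simp only [swapUpper_apply, traceOp_apply, Function.update_of_ne hij, ← Finset.smul_sum,
    smul_smul, doubleTrace]

theorem projOp_apply (T : GTens k M) (a b₁ b₂) :
    projOp T a b₁ b₂ = T a b₁ b₂
      - (1 / (3 + k) : ℝ) • ∑ i, (kron b₁ (a i) • ∑ s, T (Function.update a i s) b₂ s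
          + kron b₂ (a i) • ∑ s, T (Function.update a i s) b₁ s)
      + (1 / ((3 + k) * (2 + k)) : ℝ) • ∑ i, ∑ j ∈ Finset.univ.erase i,
          (kron b₁ (a i) * kron b₂ (a j)) • doubleTrace T i j a := by
  have h : ∀ i : Fin k, ∀ j ∈ Finset.univ.erase i,
      (swapUpper ∘ₗ traceOp i ∘ₗ swapUpper ∘ₗ traceOp j) T a b₁ b₂ =
        (kron b₁ (a i) * kron b₂ (a j)) • doubleTrace T i j a := fun i j hj =>
    traceOp_traceOp (Finset.ne_of_mem_erase hj) T a b₁ b₂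
  simp only [← fun i => Finset.sum_congr rfl (h i)]
  simp only [projOp, LinearMap.add_apply, LinearMap.sub_apply, LinearMap.smul_apply,
    LinearMap.sum_apply, Pi.add_apply, Pi.sub_apply, Pi.smul_apply, Finset.sum_apply]
  rfl

theorem projOp_map {N : Type*} [AddCommGroup N] [Module ℝ N] (φ : M →ₗ[ℝ] N) (T : GTens k M)
    (a b₁ b₂) : projOp (fun a b₁ b₂ => φ (T a b₁ b₂)) a b₁ b₂ = φ (projOp T a b₁ b₂) := by
  simp only [projOp_apply, doubleTrace, map_add, map_sub, map_smul, map_sum]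

theorem IsIrr.projOp_eq {T : GTens k M} (hT : IsIrr T) : projOp T = T := by
  funext a b₁ b₂
  have h : ∀ i j, doubleTrace T i j a = 0 := fun i j => by
    unfold doubleTrace
    exact Finset.sum_eq_zero fun s _ => hT.traceless' j _ _
  simp only [projOp_apply, h, hT.traceless', smul_zero, add_zero, Finset.sum_const_zero, sub_zero]

/-- Symmetry in the lower and in the upper indices. -/
structure IsSymm (T : GTens k M) : Prop where
  symm_left : ∀ (σ : Equiv.Perm (Fin k)) a b₁ b₂, T (a ∘ σ) b₁ b₂ = T a b₁ b₂
  symm_right : ∀ a b₁ b₂, T a b₁ b₂ = T a b₂ b₁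

theorem update_comp_perm (a : Fin k → Fin 3) (σ : Equiv.Perm (Fin k)) (i : Fin k) (s : Fin 3) :
    Function.update (a ∘ σ) i s = Function.update a (σ i) s ∘ σ := by
  funext m
  by_cases h : m = i
  · subst h; simp
  · simp [Function.update_of_ne h, Function.update_of_ne (σ.injective.ne h)]

theorem IsSymm.doubleTrace_perm {T : GTens k M} (hT : IsSymm T) (σ : Equiv.Perm (Fin k))
    (i j : Fin k) (a : Fin k → Fin 3) :
    doubleTrace T i j (a ∘ σ) = doubleTrace T (σ i) (σ j) a := by
  simp only [doubleTrace, update_comp_perm, hT.symm_left]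

theorem IsSymm.doubleTrace_comm {T : GTens k M} (hT : IsSymm T) {i j : Fin k} (hij : i ≠ j)
    (a : Fin k → Fin 3) : doubleTrace T i j a = doubleTrace T j i a := by
  unfold doubleTrace
  rw [Finset.sum_comm]
  simp only [Function.update_comm hij]
  exact Finset.sum_congr rfl fun s _ => Finset.sum_congr rfl fun t _ => hT.symm_right _ _ _

theorem IsSymm.projOp_symm_left {T : GTens k M} (hT : IsSymm T) (σ : Equiv.Perm (Fin k))
    (a b₁ b₂) : projOp T (a ∘ σ) b₁ b₂ = projOp T a b₁ b₂ := by
  simp only [projOp_apply, hT.doubleTrace_perm, update_comp_perm, hT.symm_left,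
    Function.comp_apply]
  congr 2
  · rw [Equiv.sum_comp σ (fun i => kron b₁ (a i) • ∑ s, T (Function.update a i s) b₂ s
          + kron b₂ (a i) • ∑ s, T (Function.update a i s) b₁ s)]
  · conv_rhs => rw [← Equiv.sum_comp σ]
    refine congrArg _ (funext fun i => ?_)
    refine Finset.sum_bij (fun j _ => σ j) (fun j hj => ?_) (fun j _ j' _ h => σ.injective h)
      (fun j hj => ⟨σ.symm j, ?_, by simp⟩) (fun j _ => rfl)
    · simpa using hj
    · simp only [Finset.mem_erase, Finset.mem_univ, and_true, ne_eq] at hj ⊢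
      rwa [Equiv.symm_apply_eq]

theorem IsSymm.projOp_symm_right {T : GTens k M} (hT : IsSymm T) (a b₁ b₂) :
    projOp T a b₁ b₂ = projOp T a b₂ b₁ := by
  simp only [projOp_apply]
  congr 1
  · rw [hT.symm_right]
    simp only [add_comm]
  · congr 1
    simp only [← Finset.filter_ne, Finset.sum_filter]
    rw [Finset.sum_comm]
    refine Finset.sum_congr rfl fun i _ => Finset.sum_congr rfl fun j _ => ?_
    by_cases h : i = j
    · simp [h]
    · rw [if_pos h, if_pos (Ne.symm h), hT.doubleTrace_comm h, mul_comm]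

/-- Contraction with a Kronecker symbol, the basic move of all index manipulations below. -/
theorem sum_kron_smul (f : Fin 3 → M) (a : Fin 3) : ∑ s, kron s a • f s = f a := by
  simp [kron, ite_smul]

theorem sum_kron_smul' (f : Fin 3 → M) (a : Fin 3) : ∑ s, kron a s • f s = f a := by
  simp [kron, ite_smul]

theorem IsSymm.update_eq {T : GTens k M} (hT : IsSymm T) {i l : Fin k} (h : i ≠ l)
    (a : Fin k → Fin 3) (s b₁ b₂ : Fin 3) :
    T (Function.update (Function.update a l (a i)) i s) b₁ b₂ = T (Function.update a l s) b₁ b₂ := by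
  rw [symm_update hT.symm_left (i := l) (j := i), Function.update_idem]
  rw [Function.update_self, Function.update_of_ne h]

theorem update_self_comp_swap (a : Fin k → Fin 3) {i l : Fin k} (h : a i = a l) :
    a ∘ Equiv.swap i l = a := by
  have := update_comp_swap a h (a i)
  rwa [Function.update_eq_self, h, Function.update_eq_self] at this

/-- Let t be the trace of T and G the sum of the double trace terms g. The trace of the single trace
correction is (3+k)t + G, that of the double trace correction is (2+k)G. The two coefficients of
`projOp` are exactly those for which everything cancels. -/
theorem IsSymm.projOp_traceless {T : GTens k M} (hT : IsSymm T) (l : Fin k) (a b) :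
    ∑ s, projOp T (Function.update a l s) s b = 0 := by
  set t : M := ∑ s, T (Function.update a l s) b s with ht
  set g : Fin k → M := fun i => if i = l then 0 else kron b (a i) • doubleTrace T l i a with hg
  have h0 : ∑ r, T (Function.update a l r) r b = t :=
    Finset.sum_congr rfl fun r _ => hT.symm_right _ _ _
  have h1 : ∀ i, ∑ r, (kron r (Function.update a l r i) •
        ∑ s, T (Function.update (Function.update a l r) i s) b s
      + kron b (Function.update a l r i) •
        ∑ s, T (Function.update (Function.update a l r) i s) r s) =
      t + (if i = l then (3 : ℝ) • t else 0) + g i := by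
    intro i
    rw [Finset.sum_add_distrib]
    by_cases hi : i = l
    · subst hi
      simp only [Function.update_self, Function.update_idem, kron_self, one_smul,
        sum_kron_smul', hg, if_pos, ← ht]
      simp
      module
    · simp only [Function.update_of_ne hi, sum_kron_smul (fun r =>
        ∑ s, T (Function.update (Function.update a l r) i s) b s), hT.update_eq hi, hg, if_neg hi,
        ← Finset.smul_sum, ← ht, add_zero]
      rfl
  have hD : ∀ i j r, doubleTrace T i j (Function.update a i r) = doubleTrace T i j a := by
    intro i j r
    simp only [doubleTrace, Function.update_idem]
  have h2 : ∀ i j : Fin k, ∑ r, (if j ≠ i then (kron r (Function.update a l r i) *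
      kron b (Function.update a l r j)) • doubleTrace T i j (Function.update a l r) else 0) =
      g j + (if i = l then (2 : ℝ) • g j else 0) + (if j = l then g i else 0)
        - (if i = j then g j else 0) := by
    intro i j
    by_cases hij : j = i
    · subst hij
      by_cases hl : j = l <;> simp [hg, hl]
    simp only [if_pos hij, if_neg (Ne.symm hij), sub_zero]
    by_cases hi : i = l
    · subst hi
      simp only [Function.update_self, Function.update_of_ne hij, kron_self, one_mul, hD, hg,
        if_pos, if_neg hij]
      simp
      module
    by_cases hj : j = l
    · subst hj
      simp only [Function.update_self, Function.update_of_ne hi, mul_smul, sum_kron_smul (fun r =>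
        kron b r • doubleTrace T i j (Function.update a j r)), hg, if_neg hi, if_pos]
      rw [hT.doubleTrace_comm (Ne.symm hij), hD]
      simp
    · simp only [Function.update_of_ne hi, Function.update_of_ne hj, mul_smul, sum_kron_smul
        (fun r => kron b (a j) • doubleTrace T i j (Function.update a l r)), hg, if_neg hi,
        if_neg hj, add_zero]
      -- After the contraction the positions i and l carry the same index, so exchanging them moves
      -- the double trace from i to l.
      have hp : Function.update a l (a i) ∘ Equiv.swap i l = Function.update a l (a i) := by
        rw [update_self_comp_swap _ (by rw [Function.update_self, Function.update_of_ne hi])]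
      have h := hT.doubleTrace_perm (Equiv.swap i l) i j (Function.update a l (a i))
      rw [hp, Equiv.swap_apply_left, Equiv.swap_apply_of_ne_of_ne hij hj, hD] at h
      rw [h]
  have e1 : ∑ i, (t + (if i = l then (3 : ℝ) • t else 0) + g i) = (3 + k : ℝ) • t + ∑ i, g i := by
    simp only [Finset.sum_add_distrib, Finset.sum_ite_eq', Finset.mem_univ, if_true,
      Finset.sum_const, Finset.card_univ, Fintype.card_fin]
    module
  have e2 : ∑ i, ∑ j, (g j + (if i = l then (2 : ℝ) • g j else 0) + (if j = l then g i else 0)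
      - (if i = j then g j else 0)) = (2 + k : ℝ) • ∑ i, g i := by
    simp only [Finset.sum_add_distrib, Finset.sum_sub_distrib, Finset.sum_ite_eq',
      Finset.sum_ite_eq, Finset.mem_univ, if_true, Finset.sum_const, Finset.card_univ,
      Fintype.card_fin]
    rw [Finset.sum_comm]
    simp only [Finset.sum_ite_eq', Finset.mem_univ, if_true, ← Finset.smul_sum]
    module
  simp only [projOp_apply, Finset.sum_add_distrib, Finset.sum_sub_distrib, ← Finset.smul_sum, h0]
  simp only [← Finset.sum_add_distrib]
  rw [Finset.sum_comm, Finset.sum_congr rfl fun i _ => h1 i, e1, Finset.sum_comm]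
  simp only [← Finset.filter_ne', Finset.sum_filter]
  rw [Finset.sum_congr rfl fun i _ => Finset.sum_comm, Finset.sum_congr rfl fun i _ =>
    Finset.sum_congr rfl fun j _ => h2 i j, e2, smul_add, smul_smul, smul_smul]
  have k3 : (3 + k : ℝ) ≠ 0 := by positivity
  have k2 : (2 + k : ℝ) ≠ 0 := by positivity
  rw [show 1 / (3 + k : ℝ) * (3 + k) = 1 by field_simp,
    show 1 / ((3 + k) * (2 + k) : ℝ) * (2 + k) = 1 / (3 + k) by field_simp]
  module

theorem IsSymm.isIrr_projOp {T : GTens k M} (hT : IsSymm T) : IsIrr (projOp T) :=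
  ⟨hT.projOp_symm_left, hT.projOp_symm_right, hT.projOp_traceless⟩

/-! ### Covariance -/

theorem gAct_swapUpper (c d : Fin 3) (T : GTens k M) :
    gAct c d (swapUpper T) = swapUpper (gAct c d T) := by
  funext a b₁ b₂
  simp only [gAct_apply, swapUpper_apply]
  abel

/-- Contracting an upper with a lower index is invariant: the contribution of the contracted lower
index cancels that of the contracted upper one. The same holds for the two indices on the Kronecker
symbol that is multiplied back. -/
theorem gAct_traceOp (c d : Fin 3) (i : Fin k) (T : GTens k M) :
    gAct c d (traceOp i T) = traceOp i (gAct c d T) := by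
  funext a b₁ b₂
  have h1 : ∑ j, kron c (a j) • traceOp i T (Function.update a j d) b₁ b₂ =
      (kron c (a i) * kron b₂ d) • ∑ s, T (Function.update a i s) b₁ s +
      kron b₂ (a i) • ∑ j ∈ Finset.univ.erase i, kron c (a j) •
        ∑ s, T (Function.update (Function.update a i s) j d) b₁ s := by
    rw [← Finset.add_sum_erase _ _ (Finset.mem_univ i),
      Finset.smul_sum (s := Finset.univ.erase i)]
    congr 1
    · simp only [traceOp_apply, Function.update_self, Function.update_idem, smul_smul]
    · refine Finset.sum_congr rfl fun j hj => ?_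
      have hj := Finset.ne_of_mem_erase hj
      simp only [traceOp_apply, Function.update_of_ne hj.symm, Function.update_comm hj]
      rw [smul_comm]
  have h2 : ∑ s, ∑ j, kron c (Function.update a i s j) •
      T (Function.update (Function.update a i s) j d) b₁ s =
      T (Function.update a i d) b₁ c + ∑ j ∈ Finset.univ.erase i, kron c (a j) •
        ∑ s, T (Function.update (Function.update a i s) j d) b₁ s := by
    rw [Finset.sum_comm, ← Finset.add_sum_erase _ _ (Finset.mem_univ i)]
    congr 1
    · simp only [Function.update_self, Function.update_idem]
      exact sum_kron_smul' (fun s => T (Function.update a i d) b₁ s) c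
    · refine Finset.sum_congr rfl fun j hj => ?_
      have hj := Finset.ne_of_mem_erase hj
      simp only [Function.update_of_ne hj, Finset.smul_sum]
  rw [gAct_apply, h1]
  simp only [traceOp_apply, gAct_apply, Finset.sum_add_distrib, Finset.sum_neg_distrib, h2,
    ← Finset.smul_sum]
  rw [sum_kron_smul (fun s => T (Function.update a i s) b₁ c), kron_comm c (a i)]
  module

theorem gAct_projOp (c d : Fin 3) (T : GTens k M) :
    gAct c d (projOp T) = projOp (gAct c d T) := by
  simp only [projOp, LinearMap.add_apply, LinearMap.sub_apply, LinearMap.smul_apply,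
    LinearMap.sum_apply, LinearMap.comp_apply, LinearMap.id_apply, map_add, map_sub, map_smul,
    map_sum, gAct_swapUpper, gAct_traceOp]

end Projection

end AE3

namespace AE3

/-! ### The explicit projector as the kernel of the projection. -/

noncomputable section ProjectorKernel

variable {M : Type*} [AddCommGroup M] [Module ℝ M] {k : ℕ}

/-- The tensor `δ_{a_1}^{c_{σ 1}} ⋯ δ_{a_k}^{c_{σ k}} δ̄^{b₁b₂}_{d₁d₂}`. -/
def permKron (σ : Equiv.Perm (Fin k)) (c : Fin k → Fin 3) (d₁ d₂ : Fin 3) : GTens k ℝ :=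
  fun a b₁ b₂ => (∏ i, kron (a i) (c (σ i))) * symPair b₁ b₂ d₁ d₂

/-- The identity on symmetric tensors. -/
def symKernel (c : Fin k → Fin 3) (d₁ d₂ : Fin 3) : GTens k ℝ :=
  (1 / k.factorial : ℝ) • ∑ σ, permKron σ c d₁ d₂

theorem symPair_swap_left (b₁ b₂ d₁ d₂ : Fin 3) : symPair b₂ b₁ d₁ d₂ = symPair b₁ b₂ d₁ d₂ := by
  unfold symPair; ring

theorem symPair_comm (b₁ b₂ d₁ d₂ : Fin 3) : symPair d₁ d₂ b₁ b₂ = symPair b₁ b₂ d₁ d₂ := by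
  unfold symPair; simp only [kron_comm d₁, kron_comm d₂]; ring

theorem prod_kron_update (a b : Fin k → Fin 3) (i : Fin k) (s : Fin 3) :
    ∏ j, kron (Function.update a i s j) (b j) =
      kron s (b i) * ∏ j ∈ Finset.univ.erase i, kron (a j) (b j) := by
  rw [← Finset.mul_prod_erase _ _ (Finset.mem_univ i), Function.update_self]
  congr 1
  exact Finset.prod_congr rfl fun j hj => by rw [Function.update_of_ne (Finset.ne_of_mem_erase hj)]

theorem prod_kron_update_update (a b : Fin k → Fin 3) {i j : Fin k} (hij : j ≠ i) (s t : Fin 3) :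
    ∏ m, kron (Function.update (Function.update a i s) j t m) (b m) =
      kron s (b i) * kron t (b j) *
        ∏ m ∈ (Finset.univ.erase i).erase j, kron (a m) (b m) := by
  rw [prod_kron_update, ← Finset.mul_prod_erase _ _ (Finset.mem_erase.2
    ⟨hij.symm, Finset.mem_univ i⟩), Function.update_self, Finset.erase_right_comm]
  rw [← mul_assoc, mul_comm (kron t _)]
  congr 1
  refine Finset.prod_congr rfl fun m hm => ?_
  rw [Function.update_of_ne (Finset.ne_of_mem_erase (Finset.mem_of_mem_erase hm))]

theorem sum_kron_mul (f : Fin 3 → ℝ) (a : Fin 3) : ∑ s, kron s a * f s = f a :=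
  sum_kron_smul f a

theorem projOp_permKron (σ : Equiv.Perm (Fin k)) (c : Fin k → Fin 3) (d₁ d₂ : Fin 3)
    (a : Fin k → Fin 3) (b₁ b₂ : Fin 3) :
    projOp (permKron σ c d₁ d₂) a b₁ b₂ =
      ((∏ i, kron (a i) (c (σ i))) * symPair b₁ b₂ d₁ d₂
      - 2 / (3 + k) * ∑ i, (∏ j ∈ Finset.univ.erase i, kron (a j) (c (σ j)))
          * symMix b₁ b₂ (a i) (c (σ i)) d₁ d₂
      + 1 / ((3 + k) * (2 + k)) * ∑ i, ∑ j ∈ Finset.univ.erase i,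
          (∏ m ∈ (Finset.univ.erase i).erase j, kron (a m) (c (σ m)))
            * symPair b₁ b₂ (a i) (a j) * symPair (c (σ i)) (c (σ j)) d₁ d₂) := by
  have h1 : ∀ (i : Fin k) (b : Fin 3), ∑ s, permKron σ c d₁ d₂ (Function.update a i s) b s =
      (∏ j ∈ Finset.univ.erase i, kron (a j) (c (σ j))) * symPair b (c (σ i)) d₁ d₂ := by
    intro i b
    simp only [permKron, prod_kron_update a (fun j => c (σ j)), mul_assoc]
    rw [sum_kron_mul fun s => _ * symPair b s d₁ d₂]
  have h2 : ∀ (i j : Fin k), j ≠ i → doubleTrace (permKron σ c d₁ d₂) i j a =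
      (∏ m ∈ (Finset.univ.erase i).erase j, kron (a m) (c (σ m))) *
        symPair (c (σ i)) (c (σ j)) d₁ d₂ := by
    intro i j hij
    simp only [doubleTrace, permKron, prod_kron_update_update a (fun j => c (σ j)) hij, mul_assoc]
    simp only [← Finset.mul_sum]
    rw [sum_kron_mul fun s => ∑ t, kron t _ * (_ * symPair s t d₁ d₂), sum_kron_mul fun t =>
      _ * symPair _ t d₁ d₂]
  rw [projOp_apply]
  have h3 : ∑ i, ∑ j ∈ Finset.univ.erase i,
      (kron b₁ (a i) * kron b₂ (a j)) • doubleTrace (permKron σ c d₁ d₂) i j a =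
      ∑ i, ∑ j ∈ Finset.univ.erase i,
          (∏ m ∈ (Finset.univ.erase i).erase j, kron (a m) (c (σ m)))
            * symPair b₁ b₂ (a i) (a j) * symPair (c (σ i)) (c (σ j)) d₁ d₂ := by
    -- The operator carries an unsymmetrized product of Kronecker symbols in the double trace term.
    -- Averaging over the exchange of i and j produces the symmetrized pair.
    have e : ∀ f : Fin k → Fin k → ℝ, ∑ i, ∑ j ∈ Finset.univ.erase i, f i j =
        ∑ i, ∑ j ∈ Finset.univ.erase i, (f i j + f j i) / 2 := by
      intro f
      have : ∑ i, ∑ j ∈ Finset.univ.erase i, f i j = ∑ i, ∑ j ∈ Finset.univ.erase i, f j i := by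
        simp only [← Finset.filter_ne, Finset.sum_filter]
        rw [Finset.sum_comm]
        simp only [ne_comm]
      simp only [← Finset.sum_div, Finset.sum_add_distrib, ← this]
      ring
    rw [e]
    refine Finset.sum_congr rfl fun i _ => Finset.sum_congr rfl fun j hj => ?_
    have hij := Finset.ne_of_mem_erase hj
    rw [h2 i j hij, h2 j i hij.symm, symPair_swap_left (c (σ i)), Finset.erase_right_comm]
    unfold symPair
    simp only [smul_eq_mul]
    ring
  rw [h3]
  simp only [h1, smul_eq_mul]
  rw [show (2 / (3 + k) : ℝ) = 1 / (3 + k) * 2 by ring, mul_assoc (1 / (3 + k) : ℝ),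
    Finset.mul_sum _ _ (2 : ℝ)]
  congr 3
  refine Finset.sum_congr rfl fun i _ => ?_
  unfold symPair symMix
  ring

/-- This transfers to the explicit formula for P everything known about the operator: symmetry,
tracelessness, idempotence on irreducible tensors and invariance. -/
theorem proj_eq (a : Fin k → Fin 3) (b₁ b₂ : Fin 3) (c : Fin k → Fin 3) (d₁ d₂ : Fin 3) :
    proj a b₁ b₂ c d₁ d₂ = projOp (symKernel c d₁ d₂) a b₁ b₂ := by
  simp only [symKernel, map_smul, map_sum, Pi.smul_apply, Finset.sum_apply, projOp_permKron, proj,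
    smul_eq_mul]
  ring

theorem symKernel_apply (a : Fin k → Fin 3) (b₁ b₂ : Fin 3) (c : Fin k → Fin 3) (d₁ d₂ : Fin 3) :
    symKernel c d₁ d₂ a b₁ b₂ = symDelta a c * symPair b₁ b₂ d₁ d₂ := by
  simp only [symKernel, Pi.smul_apply, Finset.sum_apply, permKron, smul_eq_mul, ← Finset.sum_mul,
    symDelta]
  ring

theorem symDelta_perm_left (σ : Equiv.Perm (Fin k)) (a c : Fin k → Fin 3) :
    symDelta (a ∘ σ) c = symDelta a c := by
  unfold symDelta
  congr 1
  rw [← Equiv.sum_comp (Equiv.mulRight σ)]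
  refine Finset.sum_congr rfl fun τ _ => ?_
  exact Equiv.prod_comp σ fun i => kron (a i) (c (τ i))

theorem symKernel_isSymm (c : Fin k → Fin 3) (d₁ d₂ : Fin 3) : IsSymm (symKernel c d₁ d₂) where
  symm_left σ a b₁ b₂ := by simp only [symKernel_apply, symDelta_perm_left]
  symm_right a b₁ b₂ := by simp only [symKernel_apply, symPair_swap_left]

theorem isIrr_proj_left (c : Fin k → Fin 3) (d₁ d₂ : Fin 3) :
    IsIrr (fun a b₁ b₂ => proj a b₁ b₂ c d₁ d₂) := by
  have h := (symKernel_isSymm c d₁ d₂).isIrr_projOp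
  simp only [proj_eq]
  exact h

theorem symMix_comm (b₁ b₂ a c d₁ d₂ : Fin 3) : symMix d₁ d₂ c a b₁ b₂ = symMix b₁ b₂ a c d₁ d₂ := by
  unfold symMix
  simp only [kron_comm d₁, kron_comm d₂, kron_comm a]
  ring

theorem erase_eq_map (τ : Equiv.Perm (Fin k)) (s : Finset (Fin k)) (i : Fin k) :
    (s.map τ.toEmbedding).erase (τ i) = (s.erase i).map τ.toEmbedding := by
  rw [Finset.map_erase]; rfl

/-- Replacing each permutation by its inverse exchanges the roles of the a's and the c's, and the
building blocks are symmetric. -/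
theorem proj_comm (a : Fin k → Fin 3) (b₁ b₂ : Fin 3) (c : Fin k → Fin 3) (d₁ d₂ : Fin 3) :
    proj a b₁ b₂ c d₁ d₂ = proj c d₁ d₂ a b₁ b₂ := by
  unfold proj
  congr 1
  rw [← Equiv.sum_comp (Equiv.inv (Equiv.Perm (Fin k)))]
  refine Finset.sum_congr rfl fun τ _ => ?_
  have hu : (Finset.univ : Finset (Fin k)) = Finset.univ.map τ.toEmbedding := by simp
  have hτ : ∀ i, (Equiv.inv (Equiv.Perm (Fin k)) τ) (τ i) = i := fun i => by simp
  have hE : ∀ i, Finset.univ.erase (τ i) = (Finset.univ.erase i).map τ.toEmbedding := by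
    intro i; rw [← erase_eq_map, ← hu]
  have e1 : ∏ i, kron (a i) (c ((Equiv.inv (Equiv.Perm (Fin k)) τ) i)) =
      ∏ i, kron (c i) (a (τ i)) := by
    rw [← Equiv.prod_comp τ]
    exact Finset.prod_congr rfl fun i _ => by rw [hτ, kron_comm]
  have e2 : ∀ i, ∏ j ∈ Finset.univ.erase (τ i),
      kron (a j) (c ((Equiv.inv (Equiv.Perm (Fin k)) τ) j)) =
      ∏ j ∈ Finset.univ.erase i, kron (c j) (a (τ j)) := by
    intro i
    rw [hE, Finset.prod_map]
    exact Finset.prod_congr rfl fun i _ => by rw [Equiv.coe_toEmbedding, hτ, kron_comm]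
  have e3 : ∀ i j, ∏ m ∈ (Finset.univ.erase (τ i)).erase (τ j),
      kron (a m) (c ((Equiv.inv (Equiv.Perm (Fin k)) τ) m)) =
      ∏ m ∈ (Finset.univ.erase i).erase j, kron (c m) (a (τ m)) := by
    intro i j
    rw [hE, erase_eq_map, Finset.prod_map]
    exact Finset.prod_congr rfl fun i _ => by rw [Equiv.coe_toEmbedding, hτ, kron_comm]
  refine congrArg₂ _ (congrArg₂ _ ?_ (congrArg₂ _ rfl ?_)) (congrArg₂ _ rfl ?_)
  · rw [e1, symPair_comm]
  · rw [← Equiv.sum_comp τ]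
    exact Finset.sum_congr rfl fun i _ => by rw [e2, hτ, symMix_comm]
  · rw [← Equiv.sum_comp τ]
    refine Finset.sum_congr rfl fun i _ => ?_
    rw [hE, Finset.sum_map]
    refine Finset.sum_congr rfl fun j _ => ?_
    rw [Equiv.coe_toEmbedding, ← hE, e3, hτ, hτ, symPair_comm d₁, symPair_comm b₁]
    ring

theorem isIrr_proj_right (a : Fin k → Fin 3) (b₁ b₂ : Fin 3) : IsIrr (proj a b₁ b₂) := by
  have h := isIrr_proj_left a b₁ b₂
  simp only [← proj_comm a b₁ b₂] at h
  exact h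

/-! ### Contraction with the projector -/

theorem prod_kron (a c : Fin k → Fin 3) : ∏ i, kron (a i) (c i) = if a = c then 1 else 0 := by
  split_ifs with h
  · simp [h, kron_self]
  · obtain ⟨i, hi⟩ := Function.ne_iff.1 h
    exact Finset.prod_eq_zero (Finset.mem_univ i) (kron_of_ne hi)

theorem sum_prod_kron_smul (σ : Equiv.Perm (Fin k)) (a : Fin k → Fin 3)
    (f : (Fin k → Fin 3) → M) : ∑ c : Fin k → Fin 3, (∏ i, kron (a i) (c (σ i))) • f c =
      f (a ∘ σ.symm) := by
  have h : ∀ c : Fin k → Fin 3, (a = fun i => c (σ i)) ↔ c = a ∘ σ.symm := by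
    intro c
    constructor
    · rintro rfl; funext i; simp
    · rintro rfl; funext i; simp
  simp only [fun c : Fin k → Fin 3 => prod_kron a fun i => c (σ i), h, ite_smul, one_smul,
    zero_smul, Finset.sum_ite_eq', Finset.mem_univ, if_true]

theorem sum_symDelta_smul (a : Fin k → Fin 3) (f : (Fin k → Fin 3) → M)
    (hf : ∀ σ : Equiv.Perm (Fin k), f (a ∘ σ) = f a) :
    ∑ c, symDelta a c • f c = f a := by
  simp only [symDelta, div_eq_inv_mul, mul_smul, Finset.sum_smul, ← Finset.smul_sum]
  rw [Finset.sum_comm]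
  simp only [sum_prod_kron_smul, hf, Finset.sum_const, Finset.card_univ, Fintype.card_perm,
    Fintype.card_fin]
  rw [← Nat.cast_smul_eq_nsmul ℝ, smul_smul, inv_mul_cancel₀ (by positivity), one_smul]

theorem sum_symPair_smul (b₁ b₂ : Fin 3) (f : Fin 3 → Fin 3 → M) :
    ∑ d₁, ∑ d₂, symPair b₁ b₂ d₁ d₂ • f d₁ d₂ = (1 / 2 : ℝ) • (f b₁ b₂ + f b₂ b₁) := by
  have h : ∀ d₁ d₂, symPair b₁ b₂ d₁ d₂ • f d₁ d₂ = kron b₁ d₁ • kron b₂ d₂ •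
      (1 / 2 : ℝ) • f d₁ d₂ + kron b₂ d₁ • kron b₁ d₂ • (1 / 2 : ℝ) • f d₁ d₂ := fun d₁ d₂ => by
    unfold symPair; module
  simp only [h, Finset.sum_add_distrib, ← Finset.smul_sum, sum_kron_smul']
  rw [smul_add]

/-- Contraction with the projector. -/
def projSmul (T : GTens k M) : GTens k M := fun a b₁ b₂ =>
  ∑ c, ∑ d₁, ∑ d₂, proj a b₁ b₂ c d₁ d₂ • T c d₁ d₂

theorem isIrr_projSmul (T : GTens k M) : IsIrr (projSmul T) where
  symm_left σ a b₁ b₂ := by simp only [projSmul, (isIrr_proj_left _ _ _).symm_left]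
  symm_right a b₁ b₂ := by
    simp only [projSmul, (isIrr_proj_left _ _ _).symm_right a b₁ b₂]
  traceless i a b := by
    simp only [projSmul]
    rw [Finset.sum_comm]
    refine Finset.sum_eq_zero fun c _ => ?_
    rw [Finset.sum_comm]
    refine Finset.sum_eq_zero fun d₁ _ => ?_
    rw [Finset.sum_comm]
    refine Finset.sum_eq_zero fun d₂ _ => ?_
    rw [← Finset.sum_smul, (isIrr_proj_left c d₁ d₂).traceless, zero_smul]

theorem projSmul_eq_projOp (T : GTens k M) : projSmul T =
    projOp (fun a b₁ b₂ => ∑ c, ∑ d₁, ∑ d₂, symKernel c d₁ d₂ a b₁ b₂ • T c d₁ d₂) := by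
  have h : (fun a b₁ b₂ => ∑ c, ∑ d₁, ∑ d₂, symKernel c d₁ d₂ a b₁ b₂ • T c d₁ d₂) =
      ∑ c, ∑ d₁, ∑ d₂, fun a b₁ b₂ =>
        LinearMap.toSpanSingleton ℝ M (T c d₁ d₂) (symKernel c d₁ d₂ a b₁ b₂) := by
    funext a b₁ b₂
    simp only [Finset.sum_apply, LinearMap.toSpanSingleton_apply]
  rw [h]
  funext a b₁ b₂
  simp only [map_sum, Finset.sum_apply, projOp_map]
  simp only [LinearMap.toSpanSingleton_apply, projSmul, proj_eq]

/-- The symmetrized identity reproduces a symmetric tensor, and the trace corrections vanish on a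
traceless one. Contraction with P is thus idempotent, which makes P a reproducing kernel. -/
theorem IsIrr.projSmul_eq {T : GTens k M} (hT : IsIrr T) : projSmul T = T := by
  rw [projSmul_eq_projOp]
  have h : (fun a b₁ b₂ => ∑ c, ∑ d₁, ∑ d₂, symKernel c d₁ d₂ a b₁ b₂ • T c d₁ d₂) = T := by
    funext a b₁ b₂
    simp only [symKernel_apply, mul_smul, ← Finset.smul_sum, sum_symPair_smul,
      ← hT.symm_right _ b₁ b₂]
    rw [sum_symDelta_smul a (fun c => (1 / 2 : ℝ) • (T c b₁ b₂ + T c b₁ b₂))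
      fun σ => by rw [hT.symm_left]]
    module
  rw [h, hT.projOp_eq]

/-- A product of Kronecker symbols is an invariant pairing, so acting on one index set equals acting
with the transposed matrix on the other. The density weight is the same on both sides. -/
theorem gAct_permKron (p q : Fin 3) (σ : Equiv.Perm (Fin k)) (a : Fin k → Fin 3) (b₁ b₂ : Fin 3)
    (c : Fin k → Fin 3) (d₁ d₂ : Fin 3) : gAct p q (permKron σ c d₁ d₂) a b₁ b₂ =
      gAct q p (fun c d₁ d₂ => permKron σ c d₁ d₂ a b₁ b₂) c d₁ d₂ := by
  have h1 : ∀ i, ∏ j, kron (a j) (Function.update c (σ i) p (σ j)) =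
      kron (a i) p * ∏ j ∈ Finset.univ.erase i, kron (a j) (c (σ j)) := by
    intro i
    rw [← Finset.mul_prod_erase _ _ (Finset.mem_univ i), Function.update_self]
    congr 1
    exact Finset.prod_congr rfl fun j hj => by
      rw [Function.update_of_ne (σ.injective.ne (Finset.ne_of_mem_erase hj))]
  have h2 : ∑ i, kron p (a i) • permKron σ c d₁ d₂ (Function.update a i q) b₁ b₂ =
      ∑ i, kron q (c i) • permKron σ (Function.update c i p) d₁ d₂ a b₁ b₂ := by
    rw [← Equiv.sum_comp σ fun i => kron q (c i) • permKron σ (Function.update c i p) d₁ d₂ a b₁ b₂]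
    refine Finset.sum_congr rfl fun i _ => ?_
    simp only [permKron, smul_eq_mul, h1, prod_kron_update a fun j => c (σ j), kron_comm p]
    ring
  simp only [gAct_apply, h2, kron_comm q p]
  simp only [permKron, symPair, smul_eq_mul, kron_comm d₁, kron_comm d₂]
  ring

theorem gAct_symKernel (p q : Fin 3) (c : Fin k → Fin 3) (d₁ d₂ : Fin 3) :
    gAct p q (symKernel c d₁ d₂) = gAct q p symKernel c d₁ d₂ := by
  funext a b₁ b₂
  have h : (fun c d₁ d₂ => symKernel c d₁ d₂ a b₁ b₂ : GTens k ℝ) =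
      (1 / k.factorial : ℝ) • ∑ σ, fun c d₁ d₂ => permKron σ c d₁ d₂ a b₁ b₂ := by
    funext c d₁ d₂
    simp only [symKernel, Pi.smul_apply, Finset.sum_apply]
  have h2 := gAct_map (LinearMap.proj b₂ ∘ₗ LinearMap.proj b₁ ∘ₗ LinearMap.proj a) q p
    (symKernel : GTens k (GTens k ℝ)) c d₁ d₂
  simp only [LinearMap.comp_apply, LinearMap.proj_apply] at h2
  rw [← h2, h, symKernel, map_smul, map_smul, map_sum, map_sum]
  simp only [Pi.smul_apply, Finset.sum_apply, gAct_permKron]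

/-- The projector is an invariant tensor. -/
theorem gAct_proj (p q : Fin 3) (a : Fin k → Fin 3) (b₁ b₂ : Fin 3) (c : Fin k → Fin 3)
    (d₁ d₂ : Fin 3) : gAct p q (fun a b₁ b₂ => proj a b₁ b₂ c d₁ d₂) a b₁ b₂ =
      gAct q p (proj a b₁ b₂) c d₁ d₂ := by
  have h : (fun a b₁ b₂ => proj a b₁ b₂ c d₁ d₂) = projOp (symKernel c d₁ d₂) := by
    funext a b₁ b₂; rw [proj_eq]
  rw [h, gAct_projOp, gAct_symKernel]
  have h2 := gAct_map ((LinearMap.proj b₂ ∘ₗ LinearMap.proj b₁ ∘ₗ LinearMap.proj a) ∘ₗ projOp) q p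
    (symKernel : GTens k (GTens k ℝ)) c d₁ d₂
  simp only [LinearMap.comp_apply, LinearMap.proj_apply, ← proj_eq] at h2
  exact h2.symm

end ProjectorKernel

end AE3

namespace AE3

/-! ### The level one representation. -/

noncomputable section LevelOne

/-- The elements `E^{b₁b₂}` of level 1. -/
def levelOne : Fin 3 → Fin 3 → Alg :=
  let m12 := (1 / 2 : ℝ) • ⁅genE 1, genE 2⁆
  let m11 := ⁅genE 1, m12⁆
  let m02 := ⁅genE 0, m12⁆
  let m01 := (1 / 2 : ℝ) • ⁅genE 0, m11⁆
  let m00 := ⁅genE 0, m01⁆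
  ![![m00, m01, m02], ![m01, m11, m12], ![m02, m12, genE 2]]

theorem levelOne_22 : levelOne 2 2 = genE 2 := rfl
theorem levelOne_12 : levelOne 1 2 = (1 / 2 : ℝ) • ⁅genE 1, genE 2⁆ := rfl
theorem levelOne_11 : levelOne 1 1 = ⁅genE 1, levelOne 1 2⁆ := rfl
theorem levelOne_02 : levelOne 0 2 = ⁅genE 0, levelOne 1 2⁆ := rfl
theorem levelOne_01 : levelOne 0 1 = (1 / 2 : ℝ) • ⁅genE 0, levelOne 1 1⁆ := rfl
theorem levelOne_00 : levelOne 0 0 = ⁅genE 0, levelOne 0 1⁆ := rfl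

theorem levelOne_comm (b₁ b₂ : Fin 3) : levelOne b₁ b₂ = levelOne b₂ b₁ := by
  fin_cases b₁ <;> fin_cases b₂ <;> rfl

theorem E1_levelOne_22 : ⁅genE 1, levelOne 2 2⁆ = (2 : ℝ) • levelOne 1 2 := by
  rw [levelOne_22, levelOne_12]; module

theorem E0_levelOne_22 : ⁅genE 0, levelOne 2 2⁆ = 0 := rel_adE 0 2

theorem E0_levelOne_11 : ⁅genE 0, levelOne 1 1⁆ = (2 : ℝ) • levelOne 0 1 := by
  rw [levelOne_01]; module

theorem E1_levelOne_11 : ⁅genE 1, levelOne 1 1⁆ = 0 := by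
  have h : ⁅genE 1, ⁅genE 1, ⁅genE 1, genE 2⁆⁆⁆ = 0 := rel_adE 1 2
  rw [levelOne_11, levelOne_12, lie_smul, lie_smul, h, smul_zero]

theorem K13_E1 : ⁅⁅genE 0, genE 1⁆, genE 1⁆ = 0 := by
  rw [← lie_skew, E1_K13, neg_zero]

theorem K13_levelOne_22 : ⁅⁅genE 0, genE 1⁆, levelOne 2 2⁆ = (2 : ℝ) • levelOne 0 2 := by
  rw [lie_lie, E0_levelOne_22, E1_levelOne_22, lie_smul, levelOne_02, lie_zero, sub_zero]

/-- Obtained by expanding the vanishing of [[K^1_3, e_2], e_3], which avoids any further Serre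
relation. -/
theorem K13_levelOne_12 : ⁅⁅genE 0, genE 1⁆, levelOne 1 2⁆ = ⁅genE 1, levelOne 0 2⁆ := by
  have h := lie_lie ⁅genE 0, genE 1⁆ (genE 1) (levelOne 2 2)
  rw [K13_E1, zero_lie, E1_levelOne_22, K13_levelOne_22, lie_smul,
    lie_smul] at h
  linear_combination (norm := module) (-1 / 2 : ℝ) • h

theorem E1_levelOne_02 : ⁅genE 1, levelOne 0 2⁆ = levelOne 0 1 := by
  have h := lie_lie (genE 0) (genE 1) (levelOne 1 2)
  rw [K13_levelOne_12, ← levelOne_02, ← levelOne_11, E0_levelOne_11] at h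
  linear_combination (norm := module) (1 / 2 : ℝ) • h

/-- Expanding the action of K^1_3 on E^{22} in two ways gives -2 and +1 times the same vector, which
is therefore zero. -/
theorem E1_levelOne_01 : ⁅genE 1, levelOne 0 1⁆ = 0 := by
  have h := lie_lie (genE 0) (genE 1) (levelOne 1 1)
  rw [E1_levelOne_11, lie_zero, E0_levelOne_11, lie_smul] at h
  have h2 := lie_lie ⁅genE 0, genE 1⁆ (genE 1) (levelOne 1 2)
  rw [K13_E1, zero_lie, ← levelOne_11, K13_levelOne_12, E1_levelOne_02] at h2
  rw [h] at h2
  linear_combination (norm := module) (1 / 3 : ℝ) • h2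

theorem E0_levelOne_02 : ⁅genE 0, levelOne 0 2⁆ = 0 := by
  have h := lie_lie (genE 0) ⁅genE 0, genE 1⁆ (levelOne 2 2)
  rw [E0_K13, zero_lie, K13_levelOne_22, E0_levelOne_22, lie_zero, lie_smul] at h
  linear_combination (norm := module) (-1 / 2 : ℝ) • h

theorem K13_levelOne_11 : ⁅⁅genE 0, genE 1⁆, levelOne 1 1⁆ = 0 := by
  rw [lie_lie, E1_levelOne_11, E0_levelOne_11, lie_smul, E1_levelOne_01]
  simp

theorem E1_levelOne_00 : ⁅genE 1, levelOne 0 0⁆ = 0 := by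
  have h := lie_lie (genE 0) ⁅genE 0, genE 1⁆ (levelOne 1 1)
  rw [E0_K13, zero_lie, K13_levelOne_11, E0_levelOne_11, lie_zero, lie_smul] at h
  have h2 := lie_lie (genE 0) (genE 1) (levelOne 0 1)
  rw [E1_levelOne_01, lie_zero, ← levelOne_00] at h2
  linear_combination (norm := module) h2 - (1 / 2 : ℝ) • h

theorem E0_levelOne_00 : ⁅genE 0, levelOne 0 0⁆ = 0 := by
  have h := lie_lie (genE 0) ⁅genE 0, genE 1⁆ (levelOne 0 2)
  have h2 := lie_lie (genE 0) (genE 1) (levelOne 0 2)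
  rw [E0_K13, zero_lie, E0_levelOne_02, lie_zero] at h
  rw [E0_levelOne_02, lie_zero, E1_levelOne_02, ← levelOne_00] at h2
  rw [h2, sub_zero, sub_zero] at h
  linear_combination (norm := module) -h

theorem genH_lie_levelOne (i b₁ b₂ : Fin 3) : ⁅genH i, levelOne b₁ b₂⁆ =
    ((cartan i 2 : ℝ) + (if b₁ = 2 then 0 else (cartan i 1 : ℝ)) + (if b₁ = 0 then (cartan i 0 : ℝ) else 0)
      + (if b₂ = 2 then 0 else (cartan i 1 : ℝ)) + (if b₂ = 0 then (cartan i 0 : ℝ) else 0)) •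
      levelOne b₁ b₂ := by
  have h22 : ⁅genH i, levelOne 2 2⁆ = (cartan i 2 : ℝ) • levelOne 2 2 := rel_HE' i 2
  have h12 : ⁅genH i, levelOne 1 2⁆ = (cartan i 1 + cartan i 2 : ℝ) • levelOne 1 2 := by
    rw [levelOne_12, lie_smul, lie_lie_weight (rel_HE' i 1) (rel_HE' i 2), smul_comm]
  have h11 := lie_lie_weight (rel_HE' i 1) h12
  have h02 := lie_lie_weight (rel_HE' i 0) h12
  rw [← levelOne_11] at h11
  rw [← levelOne_02] at h02
  have h01 : ⁅genH i, levelOne 0 1⁆ =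
      (cartan i 0 + (cartan i 1 + (cartan i 1 + cartan i 2)) : ℝ) • levelOne 0 1 := by
    rw [levelOne_01, lie_smul, lie_lie_weight (rel_HE' i 0) h11, smul_comm]
  have h00 := lie_lie_weight (rel_HE' i 0) h01
  rw [← levelOne_00] at h00
  fin_cases b₁ <;> fin_cases b₂ <;> simp
  · rw [h00]; module
  · rw [h01]; module
  · rw [h02]; module
  · rw [levelOne_comm 1 0, h01]; module
  · rw [h11]; module
  · rw [h12]; module
  · rw [levelOne_comm 2 0, h02]; module
  · rw [levelOne_comm 2 1, h12]; module
  · rw [h22]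

theorem genF_lie_levelOne_step {i : Fin 3} {x : Alg} {w : ℝ} (hw : ⁅genH i, x⁆ = w • x) :
    ⁅genF i, ⁅genE i, x⁆⁆ = -(w • x) + ⁅genE i, ⁅genF i, x⁆⁆ := by
  rw [leibniz_lie, rel_FE, if_pos rfl, neg_lie, hw]

theorem genF_lie_levelOne_comm {i j : Fin 3} (hij : i ≠ j) (x : Alg) :
    ⁅genF i, ⁅genE j, x⁆⁆ = ⁅genE j, ⁅genF i, x⁆⁆ := by
  rw [leibniz_lie, rel_FE, if_neg hij, zero_lie, zero_add]

theorem F1_levelOne_22 : ⁅genF 1, levelOne 2 2⁆ = 0 := by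
  rw [levelOne_22, rel_FE]; simp

theorem F0_levelOne_22 : ⁅genF 0, levelOne 2 2⁆ = 0 := by
  rw [levelOne_22, rel_FE]; simp

theorem F1_levelOne_12 : ⁅genF 1, levelOne 1 2⁆ = levelOne 2 2 := by
  rw [levelOne_12, lie_smul, ← levelOne_22, genF_lie_levelOne_step (genH_lie_levelOne 1 2 2),
    F1_levelOne_22]
  simp [cartan]

theorem F0_levelOne_12 : ⁅genF 0, levelOne 1 2⁆ = 0 := by
  rw [levelOne_12, lie_smul, ← levelOne_22, genF_lie_levelOne_comm (by decide), F0_levelOne_22]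
  simp

theorem F1_levelOne_11 : ⁅genF 1, levelOne 1 1⁆ = (2 : ℝ) • levelOne 1 2 := by
  rw [levelOne_11, genF_lie_levelOne_step (genH_lie_levelOne 1 1 2),
    F1_levelOne_12, E1_levelOne_22]
  simp [cartan]

theorem F0_levelOne_11 : ⁅genF 0, levelOne 1 1⁆ = 0 := by
  rw [levelOne_11, genF_lie_levelOne_comm (by decide), F0_levelOne_12, lie_zero]

theorem F1_levelOne_02 : ⁅genF 1, levelOne 0 2⁆ = 0 := by
  rw [levelOne_02, genF_lie_levelOne_comm (by decide), F1_levelOne_12, E0_levelOne_22]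

theorem F0_levelOne_02 : ⁅genF 0, levelOne 0 2⁆ = levelOne 1 2 := by
  rw [levelOne_02, genF_lie_levelOne_step (genH_lie_levelOne 0 1 2), F0_levelOne_12]
  simp [cartan]

theorem F1_levelOne_01 : ⁅genF 1, levelOne 0 1⁆ = levelOne 0 2 := by
  rw [levelOne_01, lie_smul, genF_lie_levelOne_comm (by decide), F1_levelOne_11, lie_smul,
    levelOne_02]
  module

theorem F0_levelOne_01 : ⁅genF 0, levelOne 0 1⁆ = levelOne 1 1 := by
  rw [levelOne_01, lie_smul, genF_lie_levelOne_step (genH_lie_levelOne 0 1 1), F0_levelOne_11]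
  simp [cartan]
  module

theorem F1_levelOne_00 : ⁅genF 1, levelOne 0 0⁆ = 0 := by
  rw [levelOne_00, genF_lie_levelOne_comm (by decide), F1_levelOne_01, E0_levelOne_02]

theorem F0_levelOne_00 : ⁅genF 0, levelOne 0 0⁆ = (2 : ℝ) • levelOne 0 1 := by
  rw [levelOne_00, genF_lie_levelOne_step (genH_lie_levelOne 0 0 1), F0_levelOne_01,
    E0_levelOne_11]
  simp [cartan]
  norm_num

/-- The simple root vectors and the diagonal are checked on components; the remaining two generators
are commutators of these, and both sides are representations. -/
theorem glK_lie_levelOne (c d b₁ b₂ : Fin 3) : ⁅glK c d, levelOne b₁ b₂⁆ =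
    kron b₁ d • levelOne c b₂ + kron b₂ d • levelOne b₁ c := by
  have e0 : ∀ b₁ b₂, ⁅glK 0 1, levelOne b₁ b₂⁆ =
      kron b₁ 1 • levelOne 0 b₂ + kron b₂ 1 • levelOne b₁ 0 := by
    intro b₁ b₂
    rw [glK_01]
    fin_cases b₁ <;> fin_cases b₂ <;> simp [kron, levelOne_comm 1 0, levelOne_comm 2 0,
      levelOne_comm 2 1, E0_levelOne_00, E0_levelOne_02, E0_levelOne_22, E0_levelOne_11,
      ← levelOne_00, ← levelOne_02]
    module
  have e1 : ∀ b₁ b₂, ⁅glK 1 2, levelOne b₁ b₂⁆ =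
      kron b₁ 2 • levelOne 1 b₂ + kron b₂ 2 • levelOne b₁ 1 := by
    intro b₁ b₂
    rw [glK_12]
    fin_cases b₁ <;> fin_cases b₂ <;> simp [kron, levelOne_comm 1 0, levelOne_comm 2 0,
      levelOne_comm 2 1, E1_levelOne_00, E1_levelOne_02, E1_levelOne_22, E1_levelOne_11,
      E1_levelOne_01, ← levelOne_11]
    module
  have f0 : ∀ b₁ b₂, ⁅glK 1 0, levelOne b₁ b₂⁆ =
      kron b₁ 0 • levelOne 1 b₂ + kron b₂ 0 • levelOne b₁ 1 := by
    intro b₁ b₂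
    rw [glK_10]
    fin_cases b₁ <;> fin_cases b₂ <;> simp [kron, levelOne_comm 1 0, levelOne_comm 2 0,
      levelOne_comm 2 1, F0_levelOne_00, F0_levelOne_02, F0_levelOne_22, F0_levelOne_11,
      F0_levelOne_01, F0_levelOne_12]
    module
  have f1 : ∀ b₁ b₂, ⁅glK 2 1, levelOne b₁ b₂⁆ =
      kron b₁ 1 • levelOne 2 b₂ + kron b₂ 1 • levelOne b₁ 2 := by
    intro b₁ b₂
    rw [glK_21]
    fin_cases b₁ <;> fin_cases b₂ <;> simp [kron, levelOne_comm 1 0, levelOne_comm 2 0,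
      levelOne_comm 2 1, F1_levelOne_00, F1_levelOne_02, F1_levelOne_22, F1_levelOne_11,
      F1_levelOne_01, F1_levelOne_12]
    module
  have hd : ∀ c b₁ b₂, ⁅glK c c, levelOne b₁ b₂⁆ =
      kron b₁ c • levelOne c b₂ + kron b₂ c • levelOne b₁ c := by
    intro c b₁ b₂
    have h : ⁅glK c c, levelOne b₁ b₂⁆ = (kron b₁ c + kron b₂ c) • levelOne b₁ b₂ := by
      rw [glK_diag, cartanElem, sum_lie]
      simp only [smul_lie, genH_lie_levelOne, smul_smul, ← Finset.sum_smul]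
      congr 1
      rw [Fin.sum_univ_three]
      fin_cases c <;> fin_cases b₁ <;> fin_cases b₂ <;>
        simp [kron, glDiagCoord, cartan] <;> norm_num
    rw [h, add_smul]
    congr 1
    · by_cases hb : b₁ = c
      · rw [hb]
      · rw [kron_of_ne hb, zero_smul, zero_smul]
    · by_cases hb : b₂ = c
      · rw [hb]
      · rw [kron_of_ne hb, zero_smul, zero_smul]
  have e2 : ∀ b₁ b₂, ⁅glK 0 2, levelOne b₁ b₂⁆ =
      kron b₁ 2 • levelOne 0 b₂ + kron b₂ 2 • levelOne b₁ 0 := by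
    intro b₁ b₂
    rw [glK_02, lie_lie, ← glK_01, ← glK_12]
    simp only [e0, e1, lie_add, lie_smul]
    rw [kron_self, kron_of_ne (show (0 : Fin 3) ≠ 2 by decide)]
    module
  have f2 : ∀ b₁ b₂, ⁅glK 2 0, levelOne b₁ b₂⁆ =
      kron b₁ 0 • levelOne 2 b₂ + kron b₂ 0 • levelOne b₁ 2 := by
    intro b₁ b₂
    rw [glK_20, lie_lie, ← glK_10, ← glK_21]
    simp only [f0, f1, lie_add, lie_smul]
    rw [kron_self, kron_of_ne (show (2 : Fin 3) ≠ 0 by decide)]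
    module
  fin_cases c <;> fin_cases d
  exacts [hd 0 b₁ b₂, e0 b₁ b₂, e2 b₁ b₂, f0 b₁ b₂, hd 1 b₁ b₂, e1 b₁ b₂, f2 b₁ b₂, f1 b₁ b₂,
    hd 2 b₁ b₂]

end LevelOne

end AE3

namespace AE3

/-! ### Construction of the gradient generators. -/

noncomputable section Family

/-- Covariance of a tensor under `gl₃`. -/
def IsCovariant {k : ℕ} (T : Tens k) : Prop :=
  ∀ c d a b₁ b₂, ⁅glK c d, T a b₁ b₂⁆ = gAct c d T a b₁ b₂

/-- The totally antisymmetric symbol as an integer. -/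
def epsInt (a b c : Fin 3) : ℤ :=
  ((b : ℤ) - (a : ℤ)) * ((c : ℤ) - (a : ℤ)) * ((c : ℤ) - (b : ℤ)) / 2

theorem eps_eq_cast (a b c : Fin 3) : eps a b c = epsInt a b c := by
  have h : (2 : ℤ) * epsInt a b c = ((b : ℤ) - (a : ℤ)) * ((c : ℤ) - (a : ℤ)) * ((c : ℤ) - (b : ℤ)) := by
    revert a b c; decide
  have h2 : (2 : ℝ) * epsInt a b c =
      ((b : ℝ) - (a : ℝ)) * ((c : ℝ) - (a : ℝ)) * ((c : ℝ) - (b : ℝ)) := by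
    exact_mod_cast congrArg (Int.cast : ℤ → ℝ) h
  rw [eps, ← h2]
  ring

/-- The Kronecker symbol as an integer. -/
def kronInt (a b : Fin 3) : ℤ := if a = b then 1 else 0

theorem kron_eq_cast (a b : Fin 3) : kron a b = kronInt a b := by
  unfold kron kronInt; split_ifs <;> simp

/-- Antisymmetrization over four indices vanishes in three dimensions. Passing to integer values
makes it a finite check. -/
theorem eps_kron (a d c p q : Fin 3) : eps a d q * kron p c + eps a p d * kron q c =
    kron c d * eps a p q - kron c a * eps d p q := by
  have h : epsInt a d q * kronInt p c + epsInt a p d * kronInt q c =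
    kronInt c d * epsInt a p q - kronInt c a * epsInt d p q := by
    revert a d c p q; decide
  simp only [eps_eq_cast, kron_eq_cast]
  exact_mod_cast h

theorem eps_cycle (a b c : Fin 3) : eps b c a = eps a b c := by
  unfold eps; ring

/-- The product `ε_{a_{k+1} p q} [S_{a_1…a_k}^{p b₁}, T^{q b₂}]`. -/
def epsProduct {k : ℕ} (S : Tens k) (T : Fin 3 → Fin 3 → Alg) : Tens (k + 1) := fun a b₁ b₂ =>
  ∑ p, ∑ q, eps (a (Fin.last k)) p q • ⁅S (Fin.init a) p b₁, T q b₂⁆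

/-- The symbol ε with lower indices transforms with an extra trace term by `eps_kron`. This raises
the density weight from k to k + 1, as the additional lower index requires. -/
theorem isCovariant_epsProduct {k : ℕ} {S : Tens k} (hS : IsCovariant S)
    {T : Fin 3 → Fin 3 → Alg} (hT : ∀ c d b₁ b₂, ⁅glK c d, T b₁ b₂⁆ =
      kron b₁ d • T c b₂ + kron b₂ d • T b₁ c) : IsCovariant (epsProduct S T) := by
  intro c d a b₁ b₂
  have h1 : ∑ i, kron c (a i) • epsProduct S T (Function.update a i d) b₁ b₂ =
      ∑ p, ∑ q, (eps (a (Fin.last k)) p q • ∑ i : Fin k, kron c (Fin.init a i) •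
        ⁅S (Function.update (Fin.init a) i d) p b₁, T q b₂⁆ +
        (kron c (a (Fin.last k)) * eps d p q) • ⁅S (Fin.init a) p b₁, T q b₂⁆) := by
    rw [Fin.sum_univ_castSucc]
    simp only [epsProduct, Fin.init_update_castSucc, Fin.init_update_last, Function.update_self,
      Function.update_of_ne (Fin.castSucc_lt_last _).ne', Finset.sum_add_distrib, Finset.smul_sum,
      smul_smul]
    congr 1
    rw [Finset.sum_comm]
    refine Finset.sum_congr rfl fun p _ => ?_
    rw [Finset.sum_comm]
    refine Finset.sum_congr rfl fun q _ => Finset.sum_congr rfl fun i _ => ?_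
    rw [mul_comm]; rfl
  have h2 : ∀ Z : Fin 3 → Fin 3 → Alg, ∑ p, ∑ q, eps (a (Fin.last k)) p q •
      (kron p d • Z c q + kron q d • Z p c) = ∑ p, ∑ q, (kron c d * eps (a (Fin.last k)) p q -
        kron c (a (Fin.last k)) * eps d p q) • Z p q := by
    intro Z
    simp only [← eps_kron, add_smul, smul_add, Finset.sum_add_distrib]
    congr 1
    · rw [Finset.sum_comm, Finset.sum_comm (f := fun p q => (_ : ℝ) • Z p q)]
      refine Finset.sum_congr rfl fun q _ => ?_
      simp only [mul_comm (eps _ _ _), mul_smul, smul_comm (eps _ _ _)]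
      rw [sum_kron_smul fun p => eps (a (Fin.last k)) p q • Z c q, sum_kron_smul fun p =>
        eps (a (Fin.last k)) d q • Z p q]
    · refine Finset.sum_congr rfl fun q _ => ?_
      simp only [mul_comm (eps _ _ _), mul_smul, smul_comm (eps _ _ _)]
      rw [sum_kron_smul fun p => eps (a (Fin.last k)) q p • Z q c, sum_kron_smul fun p =>
        eps (a (Fin.last k)) q d • Z q p]
  have h3 : ∀ p q, ⁅glK c d, ⁅S (Fin.init a) p b₁, T q b₂⁆⁆ =
      (-(∑ i : Fin k, kron c (Fin.init a i) •
        ⁅S (Function.update (Fin.init a) i d) p b₁, T q b₂⁆) +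
      kron b₁ d • ⁅S (Fin.init a) p c, T q b₂⁆ + kron b₂ d • ⁅S (Fin.init a) p b₁, T q c⁆ +
      (k * kron c d) • ⁅S (Fin.init a) p b₁, T q b₂⁆) +
      (kron p d • ⁅S (Fin.init a) c b₁, T q b₂⁆ + kron q d • ⁅S (Fin.init a) p b₁, T c b₂⁆) := by
    intro p q
    simp only [leibniz_lie (glK c d), hS c d, hT c d, gAct_apply, add_lie, neg_lie, sum_lie,
      smul_lie, lie_add, lie_smul]
    abel
  simp only [epsProduct, lie_sum, lie_smul, h3, smul_add (eps _ _ _) (_ + _ + _ + _),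
    Finset.sum_add_distrib]
  rw [h2 fun p q => ⁅S (Fin.init a) p b₁, T q b₂⁆, gAct_apply, h1]
  simp only [epsProduct, Finset.smul_sum (s := (Finset.univ : Finset (Fin 3))),
    ← Finset.sum_neg_distrib, ← Finset.sum_add_distrib]
  refine Finset.sum_congr rfl fun p _ => Finset.sum_congr rfl fun q _ => ?_
  push_cast
  simp only [Finset.sum_neg_distrib]
  module

/-! ### Contraction with the projector is covariant -/

/-- Exchanging the values p and q in position i permutes the index tuples, and h does not depend on
this position. -/
theorem sum_kron_swap {k : ℕ} (i : Fin k) (p q : Fin 3) (h : (Fin k → Fin 3) → Alg)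
    (hh : ∀ c s, h (Function.update c i s) = h c) :
    ∑ c, kron q (c i) • h c = ∑ c, kron p (c i) • h c := by
  let e : (Fin k → Fin 3) ≃ (Fin k → Fin 3) :=
    Equiv.piCongrRight fun j => if j = i then Equiv.swap p q else Equiv.refl _
  rw [← Equiv.sum_comp e]
  refine Finset.sum_congr rfl fun c _ => ?_
  have e1 : e c = Function.update c i (Equiv.swap p q (c i)) := by
    funext j
    by_cases hj : j = i
    · subst hj; simp [e]
    · simp [e, hj]
  rw [e1, hh, Function.update_self]
  congr 1
  unfold kron
  have h2 := (Equiv.swap p q).injective.eq_iff (a := p) (b := c i)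
  rw [Equiv.swap_apply_left] at h2
  simp only [h2]

/-- Summation by parts: under the full contraction the operator with indices q, p is the transpose
of the one with indices p, q. With invariance of P it follows that contraction with P preserves
covariance. -/
theorem sum_gAct_smul {k : ℕ} (p q : Fin 3) (r : GTens k ℝ) (T : Tens k) :
    ∑ c, ∑ d₁, ∑ d₂, gAct q p r c d₁ d₂ • T c d₁ d₂ =
      ∑ c, ∑ d₁, ∑ d₂, r c d₁ d₂ • gAct p q T c d₁ d₂ := by
  have h1 : ∀ d₁ d₂, ∑ c, (∑ i, kron q (c i) • r (Function.update c i p) d₁ d₂) • T c d₁ d₂ =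
      ∑ c, r c d₁ d₂ • ∑ i, kron p (c i) • T (Function.update c i q) d₁ d₂ := by
    intro d₁ d₂
    simp only [Finset.sum_smul, Finset.smul_sum]
    rw [Finset.sum_comm, Finset.sum_comm (s := Finset.univ (α := Fin k → Fin 3))]
    refine Finset.sum_congr rfl fun i _ => ?_
    have h := sum_kron_swap i p q (fun c => r (Function.update c i p) d₁ d₂ •
      T (Function.update c i q) d₁ d₂) fun c s => by simp only [Function.update_idem]
    refine Eq.trans (Finset.sum_congr rfl fun c _ => ?_)
      (h.trans (Finset.sum_congr rfl fun c _ => ?_))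
    · by_cases hc : q = c i
      · rw [hc, Function.update_eq_self, smul_assoc]
      · rw [kron_of_ne hc, zero_smul, zero_smul, zero_smul]
    · by_cases hc : p = c i
      · rw [hc, Function.update_eq_self, smul_comm]
      · rw [kron_of_ne hc, zero_smul, zero_smul, smul_zero]
  have h2 : ∀ c, ∑ d₁, ∑ d₂, (kron d₁ p * r c q d₂) • T c d₁ d₂ =
      ∑ d₁, ∑ d₂, (r c d₁ d₂ * kron d₁ q) • T c p d₂ := by
    intro c
    rw [Finset.sum_comm, Finset.sum_comm (f := fun d₁ d₂ => (r c d₁ d₂ * kron d₁ q) • T c p d₂)]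
    refine Finset.sum_congr rfl fun d₂ _ => ?_
    simp only [mul_comm (r _ _ _), mul_smul]
    rw [sum_kron_smul fun d₁ => r c q d₂ • T c d₁ d₂, sum_kron_smul fun d₁ =>
      r c d₁ d₂ • T c p d₂]
  have h3 : ∀ c, ∑ d₁, ∑ d₂, (kron d₂ p * r c d₁ q) • T c d₁ d₂ =
      ∑ d₁, ∑ d₂, (r c d₁ d₂ * kron d₂ q) • T c d₁ p := by
    intro c
    refine Finset.sum_congr rfl fun d₁ _ => ?_
    simp only [mul_comm (r _ _ _), mul_smul]
    rw [sum_kron_smul fun d₂ => r c d₁ q • T c d₁ d₂, sum_kron_smul fun d₂ =>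
      r c d₁ d₂ • T c d₁ p]
  have h4 : ∑ c, ∑ d₁, ∑ d₂, (∑ i, kron q (c i) • r (Function.update c i p) d₁ d₂) • T c d₁ d₂ =
      ∑ c, ∑ d₁, ∑ d₂, r c d₁ d₂ • ∑ i, kron p (c i) • T (Function.update c i q) d₁ d₂ := by
    rw [Finset.sum_comm, Finset.sum_comm (s := Finset.univ (α := Fin k → Fin 3))]
    refine Finset.sum_congr rfl fun d₁ _ => ?_
    rw [Finset.sum_comm, Finset.sum_comm (s := Finset.univ (α := Fin k → Fin 3))]
    exact Finset.sum_congr rfl fun d₂ _ => h1 d₁ d₂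
  simp only [gAct_apply, add_smul, neg_smul, smul_add, smul_neg, Finset.sum_add_distrib,
    Finset.sum_neg_distrib, h4]
  simp only [smul_smul, smul_eq_mul, h2, h3, kron_comm q p, mul_comm (r _ _ _) (_ * _)]

theorem IsCovariant.projSmul {k : ℕ} {T : Tens k} (hT : IsCovariant T) :
    IsCovariant (projSmul T) := by
  intro p q a b₁ b₂
  have h1 : gAct p q (AE3.projSmul T) a b₁ b₂ =
      ∑ c, ∑ d₁, ∑ d₂, gAct p q (fun a b₁ b₂ => proj a b₁ b₂ c d₁ d₂) a b₁ b₂ • T c d₁ d₂ := by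
    have h : AE3.projSmul T = ∑ c, ∑ d₁, ∑ d₂, fun a b₁ b₂ =>
        LinearMap.toSpanSingleton ℝ Alg (T c d₁ d₂) (proj a b₁ b₂ c d₁ d₂) := by
      funext a b₁ b₂
      simp only [Finset.sum_apply, LinearMap.toSpanSingleton_apply, AE3.projSmul]
    rw [h]
    simp only [map_sum, Finset.sum_apply, gAct_map]
    simp only [LinearMap.toSpanSingleton_apply]
  rw [h1]
  simp only [gAct_proj]
  rw [sum_gAct_smul]
  simp only [AE3.projSmul, lie_sum, lie_smul, hT p q]

/-- The projector acts trivially on the components with affine indices. -/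
theorem projSmul_affine {k : ℕ} (T : Tens k) {b₁ b₂ : Fin 3} (h₁ : b₁ ≠ 0) (h₂ : b₂ ≠ 0) :
    projSmul T (fun _ => 0) b₁ b₂ =
      (1 / 2 : ℝ) • (T (fun _ => 0) b₁ b₂ + T (fun _ => 0) b₂ b₁) := by
  have h : ∀ c d₁ d₂, proj (fun _ => 0) b₁ b₂ c d₁ d₂ =
      symKernel c d₁ d₂ (fun _ : Fin k => 0) b₁ b₂ := by
    intro c d₁ d₂
    simp only [proj_eq, projOp_apply, kron_of_ne h₁, kron_of_ne h₂, zero_mul, zero_smul, add_zero,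
      Finset.sum_const_zero, smul_zero, sub_zero]
  simp only [AE3.projSmul, h, symKernel_apply, mul_smul, ← Finset.smul_sum, sum_symPair_smul]
  rw [sum_symDelta_smul (fun _ : Fin k => (0 : Fin 3))
    (fun c => (1 / 2 : ℝ) • (T c b₁ b₂ + T c b₂ b₁)) fun _ => rfl]

/-! ### The gradient generators -/

/-- The gradient generators `E_{a_1…a_k}^{b₁b₂}`. -/
def gradient : (k : ℕ) → Tens k
  | 0 => fun _ b₁ b₂ => levelOne b₁ b₂
  | k + 1 => (-1 / 2 : ℝ) • projSmul (epsProduct (gradient k) levelOne)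

theorem gradient_irr (k : ℕ) : IsIrr (gradient k) := by
  cases k with
  | zero => exact ⟨fun _ _ _ _ => rfl, fun _ => levelOne_comm, fun i => i.elim0⟩
  | succ k => exact (isIrr_projSmul _).smul _

theorem IsCovariant.smul {k : ℕ} {T : Tens k} (hT : IsCovariant T) (r : ℝ) :
    IsCovariant (r • T) := by
  intro c d a b₁ b₂
  rw [map_smul, Pi.smul_apply, Pi.smul_apply, Pi.smul_apply, lie_smul, hT]
  rfl

theorem gradient_covariant (k : ℕ) : IsCovariant (gradient k) := by
  induction k with
  | zero =>
    intro c d a b₁ b₂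
    rw [gAct_apply]
    simp [gradient, glK_lie_levelOne]
  | succ k ih => exact (isCovariant_epsProduct ih glK_lie_levelOne).projSmul.smul _

/-- The components with affine indices. -/
structure IsLoopValued (E : (k : ℕ) → Tens k) : Prop where
  yy : ∀ k, E k (fun _ => 0) 2 2 = loopY (k + 1)
  hh : ∀ k, E k (fun _ => 0) 1 2 = (1 / 2 : ℝ) • loopH (k + 1)
  hh' : ∀ k, E k (fun _ => 0) 2 1 = (1 / 2 : ℝ) • loopH (k + 1)
  xx : ∀ k, E k (fun _ => 0) 1 1 = -loopX (k + 1)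

theorem IsCovariant.component_hh {k : ℕ} {T : Tens k} (h : IsCovariant T) (hT : IsIrr T)
    (hy : T (fun _ => 0) 2 2 = loopY (k + 1)) :
    T (fun _ => 0) 1 2 = (1 / 2 : ℝ) • loopH (k + 1) := by
  have h1 := h 1 2 (fun _ => 0) 2 2
  rw [gAct_apply, hy, glK_12, ← loopX_zero, loopRelations.xy] at h1
  have h0 : ¬((0 : ℤ) + (k + 1) = 0) := by omega
  rw [if_neg h0] at h1
  simp [kron, hT.symm_right _ 2 1] at h1
  rw [h1]
  module

/-- The affine components form an orbit of the lowest one under e_2 = x_0, so covariance fixes them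
from the component 33 alone. -/
theorem IsCovariant.loopValued {E : (k : ℕ) → Tens k} (h : ∀ k, IsCovariant (E k))
    (hE : ∀ k, IsIrr (E k)) (hy : ∀ k, E k (fun _ => 0) 2 2 = loopY (k + 1)) :
    IsLoopValued E := by
  have h12 : ∀ k, E k (fun _ => 0) 1 2 = (1 / 2 : ℝ) • loopH (k + 1) := fun k =>
    (h k).component_hh (hE k) (hy k)
  refine ⟨hy, h12, fun k => by rw [(hE k).symm_right, h12], fun k => ?_⟩
  have h1 := h k 1 2 (fun _ => 0) 1 2
  rw [gAct_apply, h12, lie_smul, glK_12, ← loopX_zero, ← lie_skew, loopRelations.hx] at h1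
  simp [kron] at h1
  rw [← h1]

theorem levelOne_loop : levelOne 2 2 = loopY 1 ∧ levelOne 1 2 = (1 / 2 : ℝ) • loopH 1 ∧
    levelOne 2 1 = (1 / 2 : ℝ) • loopH 1 ∧ levelOne 1 1 = -loopX 1 := by
  have h := loopRelations.xy 0 1
  simp at h
  have h12 : levelOne 1 2 = (1 / 2 : ℝ) • loopH 1 := by
    rw [levelOne_12, ← h, loopX_zero, loopY_one]
  refine ⟨loopY_one.symm, h12, h12, ?_⟩
  rw [levelOne_11, h12, lie_smul, ← loopX_zero, ← lie_skew, loopRelations.hx]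
  simp

theorem gradient_loopValued : IsLoopValued gradient := by
  refine IsCovariant.loopValued gradient_covariant gradient_irr fun k => ?_
  induction k with
  | zero => exact levelOne_loop.1
  | succ k ih =>
    have h12 := (gradient_covariant k).component_hh (gradient_irr k) ih
    have hinit : Fin.init (fun _ : Fin (k + 1) => (0 : Fin 3)) = fun _ => 0 := rfl
    -- Two terms of the ε contraction survive, each a commutator of half a Cartan loop generator
    -- with y, and they add up to -2 times the next y. This is the origin of the factor -1/2 in
    -- `gradient`.
    have hY : epsProduct (gradient k) levelOne (fun _ => 0) 2 2 = (-2 : ℝ) • loopY (k + 1 + 1) := by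
      simp only [epsProduct, hinit]
      simp only [Fin.sum_univ_three, ih, h12, levelOne_loop.1,
        levelOne_loop.2.1]
      simp [eps, loopRelations.hy]
      rw [← lie_skew, loopRelations.hy, add_comm (1 : ℤ)]
      module
    simp only [gradient, Pi.smul_apply]
    rw [projSmul_affine _ (by decide) (by decide), hY]
    push_cast
    module

end Family

end AE3

namespace AE3

/-! ### Uniqueness of the gradient family, and the span of the affine generators. -/

noncomputable section Affine

/-- The elements `K̄_m^α_β` in terms of the loop generators. -/
def affVal (m : ℤ) : Fin 2 → Fin 2 → Alg :=
  ![![(1 / 2 : ℝ) • loopH m, loopX m], ![loopY m, -(1 / 2 : ℝ) • loopH m]]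

theorem affK_eq_affVal {E : (k : ℕ) → Tens k} (hE : IsLoopValued E) (m : ℤ) (α β : Fin 2) :
    affK E m α β = affVal m α β := by
  match m with
  | Int.ofNat 0 =>
    have h : (Int.ofNat 0 : ℤ) = 0 := rfl
    simp only [affK, affVal, h, loopH_zero, loopX_zero, loopY_zero]
    fin_cases α <;> fin_cases β <;> simp [kronG, glK] <;> module
  | Int.ofNat (k + 1) =>
    have h : (Int.ofNat (k + 1) : ℤ) = k + 1 := rfl
    simp only [affK, affVal, h]
    fin_cases α <;> fin_cases β <;>
      simp [epsG, eps, Fin.sum_univ_two, hE.yy, hE.hh, hE.hh', hE.xx] <;> module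
  | Int.negSucc k =>
    have h : (Int.negSucc k : ℤ) = -(k + 1) := by omega
    simp only [affK, affVal, h, transposeFamily]
    fin_cases α <;> fin_cases β <;>
      simp [epsG, eps, Fin.sum_univ_two, hE.yy, hE.hh, hE.hh', hE.xx, transpose_smul,
        transpose_neg, transpose_loopX, transpose_loopY, transpose_loopH] <;> module

theorem affVal_relations (m n : ℤ) (α β γ δ : Fin 2) : ⁅affVal m α β, affVal n γ δ⁆ =
    kronG γ β • affVal (m + n) α δ - kronG α δ • affVal (m + n) γ β
      + (if m = -n then (m : ℝ) * (kronG α δ * kronG γ β - kronG α β * kronG γ δ / 2) else 0) •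
        affC := by
  have hL := loopRelations
  have hyx : ∀ m n, ⁅loopY m, loopX n⁆ = -(loopH (m + n) + if m + n = 0 then (n : ℝ) • affC else 0) :=
    fun m n => by rw [← lie_skew, hL.xy, add_comm n m]
  have hxh : ∀ m n, ⁅loopX m, loopH n⁆ = (-2 : ℝ) • loopX (m + n) := fun m n => by
    rw [← lie_skew, hL.hx, add_comm n m, neg_smul]
  have hyh : ∀ m n, ⁅loopY m, loopH n⁆ = (2 : ℝ) • loopY (m + n) := fun m n => by
    rw [← lie_skew, hL.hy, add_comm n m]; module
  have hmn : m = -n ↔ m + n = 0 := by omega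
  simp only [hmn]
  have hn : m + n = 0 → (n : ℝ) = -m := fun h => by
    have : n = -m := by omega
    rw [this]; push_cast; ring
  by_cases h0 : m + n = 0
  · fin_cases α <;> fin_cases β <;> fin_cases γ <;> fin_cases δ <;>
      simp [affVal, kronG, h0, hL.xx, hL.yy, hL.xy, hL.hx, hL.hy, hL.hh, hyx, hxh, hyh, hn h0] <;>
      module
  · fin_cases α <;> fin_cases β <;> fin_cases γ <;> fin_cases δ <;>
      simp [affVal, kronG, h0, hL.xx, hL.yy, hL.xy, hL.hx, hL.hy, hL.hh, hyx, hxh, hyh] <;>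
      module

theorem gradient_isGradientFamily : IsGradientFamily gradient where
  irreducible k := isIrreducibleTensor_iff.2 (gradient_irr k)
  covariant := gradient_covariant
  chevalley := rfl
  affine m n α β γ δ := by
    simp only [affK_eq_affVal gradient_loopValued, affVal_relations]

namespace IsGradientFamily

variable {E : (k : ℕ) → Tens k}

theorem irr (hE : IsGradientFamily E) (k : ℕ) : IsIrr (E k) :=
  isIrreducibleTensor_iff.1 (hE.irreducible k)

theorem isCovariant (hE : IsGradientFamily E) (k : ℕ) : IsCovariant (E k) := hE.covariant k

/-- The affine relation between K̄_{k+1}^3_2 and K̄_1^2_2 expresses the lowest component at the next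
level through the preceding one. No choice remains after E^{33} = e_3. -/
theorem lowest (hE : IsGradientFamily E) (k : ℕ) : E k (fun _ => 0) 2 2 = loopY (k + 1) := by
  have h0 : E 0 (fun _ => 0) 2 2 = loopY ((0 : ℕ) + 1) := by
    have : (fun _ : Fin 0 => (0 : Fin 3)) = ![] := Subsingleton.elim _ _
    rw [this, hE.chevalley]
    simp [loopY_one]
  induction k with
  | zero => exact h0
  | succ k ih =>
    have h := hE.affine (k + 1) 1 1 0 0 0
    have e1 : ∀ k : ℕ, affK E (k + 1) 1 0 = E k (fun _ => 0) 2 2 := fun k => by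
      have : ((k : ℤ) + 1) = Int.ofNat (k + 1) := rfl
      rw [this]
      simp [affK, Fin.sum_univ_two, epsG, eps]
    have e2 : affK E 1 0 0 = E 0 (fun _ => 0) 1 2 := by
      have : (1 : ℤ) = Int.ofNat (0 + 1) := rfl
      rw [this]
      simp [affK, Fin.sum_univ_two, epsG, eps, (hE.irr 0).symm_right _ 2 1]
    have h12 := (hE.isCovariant 0).component_hh (hE.irr 0) h0
    have hk : ¬((k : ℤ) + 1 = -1) := by omega
    have e3 := e1 (k + 1)
    push_cast at e3
    rw [e1, e2, ih, h12, e3, if_neg hk, lie_smul, ← lie_skew, loopRelations.hy] at h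
    simp [kronG] at h
    rw [← h]
    push_cast
    rw [add_comm (1 : ℤ)]

theorem loopValued (hE : IsGradientFamily E) : IsLoopValued E :=
  IsCovariant.loopValued hE.isCovariant hE.irr hE.lowest

/-- The difference of two families at a given level is irreducible and covariant and vanishes on its
lowest component. -/
theorem unique {E' : (k : ℕ) → Tens k} (hE : IsGradientFamily E) (hE' : IsGradientFamily E') :
    E = E' := by
  funext k a b₁ b₂
  have h := ((hE.irr k).sub (hE'.irr k)).eq_zero (fun c d _ a b₁ b₂ h => by
    rw [map_sub, Pi.sub_apply, Pi.sub_apply, Pi.sub_apply, ← hE.isCovariant, ← hE'.isCovariant,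
      ← lie_sub]
    simp only [Pi.sub_apply] at h
    rw [h, lie_zero]) (by
    simp only [Pi.sub_apply, hE.lowest, hE'.lowest, sub_self]) a b₁ b₂
  exact sub_eq_zero.1 h

end IsGradientFamily

theorem existsUnique_isGradientFamily : ∃! E : (k : ℕ) → Tens k, IsGradientFamily E :=
  ⟨gradient, gradient_isGradientFamily, fun _ h => h.unique gradient_isGradientFamily⟩

/-! ### The span of the affine generators -/

theorem affC_lie_affVal (m : ℤ) (α β : Fin 2) : ⁅affC, affVal m α β⁆ = 0 := by
  fin_cases α <;> fin_cases β <;>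
    simp [affVal, loopRelations.cx, loopRelations.cy, loopRelations.ch]

theorem affD_eq : affD = genH 0 + (5 / 4 : ℝ) • genH 1 + (3 / 4 : ℝ) • genH 2 := by
  simp only [affD, glK_00, glK_11, glK_22]
  module

theorem affD_lie_genE (i : Fin 3) : ⁅affD, genE i⁆ =
    (cartan 0 i + (5 / 4) * cartan 1 i + (3 / 4) * cartan 2 i : ℝ) • genE i := by
  rw [affD_eq, add_lie, add_lie, smul_lie, smul_lie, rel_HE', rel_HE', rel_HE']
  module

theorem affD_lie_genF (i : Fin 3) : ⁅affD, genF i⁆ =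
    -(cartan 0 i + (5 / 4) * cartan 1 i + (3 / 4) * cartan 2 i : ℝ) • genF i := by
  rw [affD_eq, add_lie, add_lie, smul_lie, smul_lie, rel_HF', rel_HF', rel_HF']
  module

theorem affD_lie_loopX (m : ℤ) : ⁅affD, loopX m⁆ = (-m : ℝ) • loopX m := by
  have hU : ⁅affD, loopU⁆ = (-1 : ℝ) • loopU := by
    rw [loopU, lie_lie_weight (affD_lie_genE 1) (affD_lie_genE 2)]
    simp [cartan]
    norm_num
  have hV : ⁅affD, loopV⁆ = (1 : ℝ) • loopV := by
    rw [loopV, lie_lie_weight (affD_lie_genF 2) (affD_lie_genF 1)]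
    simp [cartan]
    norm_num
  induction m using Int.induction_on with
  | zero =>
    rw [loopX_zero, affD_lie_genE]
    simp [cartan]
    norm_num
  | succ m ih =>
    have h := lie_lie_weight hU ih
    rw [(lie_loopX m (m + 1)).1 rfl, lie_smul, smul_comm] at h
    have h2 := smul_right_injective Alg (two_ne_zero (α := ℝ)) h
    rw [h2]
    push_cast
    module
  | pred m ih =>
    have h := lie_lie_weight hV ih
    rw [(lie_loopX (-m) (-m - 1)).2 rfl, lie_smul, smul_comm] at h
    have h2 := smul_right_injective Alg (two_ne_zero (α := ℝ)) h
    rw [h2]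
    push_cast
    module

theorem transpose_affD : transpose affD = affD := by
  simp only [affD_eq, transpose_add, transpose_smul, transpose_genH]

theorem affD_lie_loopY (m : ℤ) : ⁅affD, loopY m⁆ = (-m : ℝ) • loopY m := by
  have h := congrArg transpose (affD_lie_loopX (-m))
  rw [transpose_lie, transpose_loopX, transpose_affD, transpose_smul, transpose_loopX,
    ← lie_skew, neg_neg] at h
  push_cast at h
  linear_combination (norm := module) -h

theorem affD_lie_loopH (m : ℤ) : ⁅affD, loopH m⁆ = (-m : ℝ) • loopH m := by
  rw [loopH, lie_lie_weight (affD_lie_loopX m) (affD_lie_loopY 0)]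
  simp

theorem affD_lie_affVal (m : ℤ) (α β : Fin 2) :
    ⁅affD, affVal m α β⁆ = (-m : ℝ) • affVal m α β := by
  fin_cases α <;> fin_cases β <;>
    simp only [affVal, Fin.mk_one, Fin.zero_eta, Matrix.cons_val_zero, Matrix.cons_val_one,
      lie_smul, affD_lie_loopX, affD_lie_loopY, affD_lie_loopH] <;> module

theorem affC_lie_affD : ⁅affC, affD⁆ = 0 := by
  rw [affC_eq, affD_eq]
  simp [rel_HH]

/-- The span of the elements `K̄_m^α_β`, `ĉ` and `d̂`. -/
def affSpan : Submodule ℝ Alg :=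
  Submodule.span ℝ ({x | ∃ m α β, affVal m α β = x} ∪ {affC, affD})

theorem affVal_mem_affSpan (m : ℤ) (α β : Fin 2) : affVal m α β ∈ affSpan :=
  Submodule.subset_span (Or.inl ⟨m, α, β, rfl⟩)

theorem affC_mem_affSpan : affC ∈ affSpan := Submodule.subset_span (Or.inr (Or.inl rfl))

theorem affD_mem_affSpan : affD ∈ affSpan := Submodule.subset_span (Or.inr (Or.inr rfl))

theorem lie_mem_affSpan {x y : Alg} (hx : x ∈ affSpan) (hy : y ∈ affSpan) : ⁅x, y⁆ ∈ affSpan := by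
  have hD : ∀ m α β, ⁅affVal m α β, affD⁆ ∈ affSpan := fun m α β => by
    rw [← lie_skew, affD_lie_affVal]
    exact neg_mem (Submodule.smul_mem _ _ (affVal_mem_affSpan m α β))
  have hC : ∀ m α β, ⁅affVal m α β, affC⁆ ∈ affSpan := fun m α β => by
    rw [← lie_skew, affC_lie_affVal, neg_zero]
    exact zero_mem _
  unfold affSpan at hx hy
  induction hx, hy using Submodule.span_induction₂ with
  | mem_mem x y hx hy =>
    rcases hx with ⟨m, α, β, rfl⟩ | rfl | rfl <;> rcases hy with ⟨n, γ, δ, rfl⟩ | rfl | rfl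
    · rw [affVal_relations]
      exact add_mem (sub_mem (Submodule.smul_mem _ _ (affVal_mem_affSpan _ _ _))
        (Submodule.smul_mem _ _ (affVal_mem_affSpan _ _ _)))
        (Submodule.smul_mem _ _ affC_mem_affSpan)
    · exact hC m α β
    · exact hD m α β
    · rw [affC_lie_affVal]
      exact zero_mem _
    · rw [lie_self]
      exact zero_mem _
    · rw [affC_lie_affD]
      exact zero_mem _
    · rw [affD_lie_affVal]
      exact Submodule.smul_mem _ _ (affVal_mem_affSpan _ _ _)
    · rw [← lie_skew, affC_lie_affD, neg_zero]
      exact zero_mem _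
    · rw [lie_self]
      exact zero_mem _
  | zero_left y hy => rw [zero_lie]; exact zero_mem _
  | zero_right x hx => rw [lie_zero]; exact zero_mem _
  | add_left x y z _ _ _ h₁ h₂ => rw [add_lie]; exact add_mem h₁ h₂
  | add_right x y z _ _ _ h₁ h₂ => rw [lie_add]; exact add_mem h₁ h₂
  | smul_left r x y _ _ h => rw [smul_lie]; exact Submodule.smul_mem _ _ h
  | smul_right r x y _ _ h => rw [lie_smul]; exact Submodule.smul_mem _ _ h

/-- One inclusion holds because the span is closed under brackets and contains the generators, h_1
being recovered from d̂. The other holds because everything in the span commutes with K^1_1. -/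
theorem affineSubalgebra_eq_affSpan : affineSubalgebra.toSubmodule = affSpan := by
  apply le_antisymm
  · have h : affineSubalgebra ≤ { affSpan with lie_mem' := lie_mem_affSpan } := by
      refine LieSubalgebra.lieSpan_le.2 ?_
      have hX := fun m => affVal_mem_affSpan m 0 1
      have hY := fun m => affVal_mem_affSpan m 1 0
      have h1 : genH 1 ∈ affSpan := by
        rw [← loopH_zero, show loopH 0 = (2 : ℝ) • affVal 0 0 0 by simp [affVal]]
        exact Submodule.smul_mem _ _ (affVal_mem_affSpan 0 0 0)
      have h2 : genH 2 ∈ affSpan := by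
        rw [show genH 2 = affC - genH 1 by rw [affC_eq]; abel]
        exact sub_mem affC_mem_affSpan h1
      have h0 : genH 0 ∈ affSpan := by
        rw [show genH 0 = affD - (5 / 4 : ℝ) • genH 1 - (3 / 4 : ℝ) • genH 2 by
          rw [affD_eq]; abel]
        exact sub_mem (sub_mem affD_mem_affSpan (Submodule.smul_mem _ _ h1))
          (Submodule.smul_mem _ _ h2)
      rintro x ((rfl | rfl | rfl | rfl) | ⟨i, rfl⟩)
      · exact loopX_zero ▸ hX 0
      · exact loopY_one ▸ hY 1
      · exact loopY_zero ▸ hY 0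
      · have h := hX (-1)
        rw [show affVal (-1) 0 1 = loopX (-1) from rfl, loopX_neg_one] at h
        exact h
      · fin_cases i
        exacts [h0, h1, h2]
    exact h
  · refine Submodule.span_le.2 ?_
    rintro x (⟨m, α, β, rfl⟩ | rfl | rfl)
    · refine mem_affine_of_lie ?_
      have h := affC_lie_affVal m α β
      rwa [affC, neg_lie, neg_eq_zero] at h
    · rw [affC_eq]
      exact add_mem (genH_mem_affine 1) (genH_mem_affine 2)
    · rw [affD_eq]
      exact add_mem (add_mem (genH_mem_affine 0) (Submodule.smul_mem _ _ (genH_mem_affine 1)))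
        (Submodule.smul_mem _ _ (genH_mem_affine 2))

end Affine

end AE3

namespace AE3

/-! ### Pairing of the gradient generators with their transposes. -/

noncomputable section Form

theorem transpose_glK (a b : Fin 3) : transpose (glK a b) = glK b a := by
  fin_cases a <;> fin_cases b <;>
    simp [glK, transpose_lie, transpose_sub, transpose_neg, transpose_smul, transpose_genE,
      transpose_genF, transpose_genH]

theorem lie_transpose (x y : Alg) : ⁅transpose x, transpose y⁆ = -transpose ⁅x, y⁆ := by
  rw [transpose_lie, lie_skew]

/-- The lower indices contribute -k, the upper ones 2 and the density weight 3k. -/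
theorem sum_gAct_diag {k : ℕ} {M : Type*} [AddCommGroup M] [Module ℝ M] (T : GTens k M)
    (a : Fin k → Fin 3) (b₁ b₂ : Fin 3) :
    ∑ c, gAct c c T a b₁ b₂ = (2 * (k + 1) : ℝ) • T a b₁ b₂ := by
  have h1 : ∑ c, ∑ i, kron c (a i) • T (Function.update a i c) b₁ b₂ = (k : ℝ) • T a b₁ b₂ := by
    rw [Finset.sum_comm]
    simp only [sum_kron_smul (fun c => T (Function.update a _ c) b₁ b₂), Function.update_eq_self,
      Finset.sum_const, Finset.card_univ, Fintype.card_fin, Nat.cast_smul_eq_nsmul]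
  simp only [gAct_apply, Finset.sum_add_distrib, Finset.sum_neg_distrib, h1, sum_kron_smul',
    ← Finset.sum_smul, ← Finset.mul_sum]
  have h2 : ∑ c : Fin 3, kron c c = 3 := by simp [kron_self]
  rw [h2]
  module

/-- A lowering operator would need a lower index different from the first value, or an upper index
below the last; the lowest component has neither. -/
theorem gAct_lowest_eq_zero {k : ℕ} {M : Type*} [AddCommGroup M] [Module ℝ M] (T : GTens k M)
    {p q : Fin 3} (hpq : q < p) : gAct p q T (fun _ => 0) 2 2 = 0 := by
  have h0 : p ≠ 0 := fun h => by subst h; exact absurd hpq (Fin.not_lt_zero q)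
  have h2 : q ≠ 2 := fun h => by
    subst h
    revert hpq h0
    fin_cases p <;> decide
  rw [gAct_apply]
  simp [kron_of_ne h0, kron_of_ne h2.symm, kron_of_ne hpq.ne']

theorem gAct_map₂ {k l : ℕ} {N : Type*} [AddCommGroup N] [Module ℝ N] (p q : Fin 3)
    (R : GTens k (GTens l N)) (a b₁ b₂ c d₁ d₂) : gAct p q R a b₁ b₂ c d₁ d₂ =
      gAct p q (fun a b₁ b₂ => R a b₁ b₂ c d₁ d₂) a b₁ b₂ :=
  (gAct_map (LinearMap.proj (R := ℝ) d₂ ∘ₗ LinearMap.proj d₁ ∘ₗ LinearMap.proj c) p q R a b₁ b₂).symm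

/-- An invariant pairing of two irreducible tensors vanishes if it does on the lowest weights. -/
theorem eq_zero_of_invariant {k l : ℕ} {N : Type*} [AddCommGroup N] [Module ℝ N]
    {R : GTens k (GTens l N)} (h₁ : ∀ c d₁ d₂, IsIrr fun a b₁ b₂ => R a b₁ b₂ c d₁ d₂)
    (h₂ : ∀ a b₁ b₂, IsIrr (R a b₁ b₂))
    (hinv : ∀ p q a b₁ b₂ c d₁ d₂, gAct p q (fun a b₁ b₂ => R a b₁ b₂ c d₁ d₂) a b₁ b₂ =
      gAct q p (R a b₁ b₂) c d₁ d₂)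
    (h0 : R (fun _ => 0) 2 2 (fun _ => 0) 2 2 = 0) (a b₁ b₂ c d₁ d₂) :
    R a b₁ b₂ c d₁ d₂ = 0 := by
  have hR : IsIrr R :=
    ⟨fun σ a b₁ b₂ => funext fun c => funext fun d₁ => funext fun d₂ =>
      (h₁ c d₁ d₂).symm_left σ a b₁ b₂,
    fun a b₁ b₂ => funext fun c => funext fun d₁ => funext fun d₂ =>
      (h₁ c d₁ d₂).symm_right a b₁ b₂,
    fun i a b => funext fun c => funext fun d₁ => funext fun d₂ => by
      simp only [Finset.sum_apply]
      exact (h₁ c d₁ d₂).traceless i a b⟩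
  -- Lowering operators kill the lowest component of the first index set. By invariance this means
  -- that raising operators kill the components in the second set, so that `IsIrr.eq_zero` applies
  -- there first.
  have hlow : R (fun _ => 0) 2 2 = 0 := by
    funext c d₁ d₂
    refine (h₂ _ _ _).eq_zero (fun p q hpq c d₁ d₂ _ => ?_) h0 c d₁ d₂
    rw [← hinv, gAct_lowest_eq_zero _ hpq]
  have h := hR.eq_zero (fun p q _ a b₁ b₂ h => by
    funext c d₁ d₂
    rw [gAct_map₂, hinv, h, map_zero]) hlow a b₁ b₂
  rw [h]
  rfl

theorem IsIrr.transpose {k : ℕ} {T : Tens k} (hT : IsIrr T) :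
    IsIrr fun a b₁ b₂ => transpose (T a b₁ b₂) :=
  hT.map transposeEquiv.toLinearMap

theorem glK_lie_transpose {k : ℕ} {T : Tens k} (hT : IsCovariant T) (p q : Fin 3) (a b₁ b₂) :
    ⁅glK p q, transpose (T a b₁ b₂)⁆ =
      -gAct q p (fun a b₁ b₂ => transpose (T a b₁ b₂)) a b₁ b₂ := by
  have h := gAct_map transposeEquiv.toLinearMap q p T a b₁ b₂
  rw [← transpose_glK q p, lie_transpose, hT]
  exact (congrArg Neg.neg h).symm

namespace IsStandardForm

variable {B : LinearMap.BilinForm ℝ Alg}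

theorem lie_left (hB : IsStandardForm B) (x y z : Alg) : B ⁅x, y⁆ z = -B y ⁅x, z⁆ := by
  rw [← lie_skew, map_neg, LinearMap.neg_apply, hB.invariant]

theorem unique (hB : IsStandardForm B) {B' : LinearMap.BilinForm ℝ Alg} (hB' : IsStandardForm B') :
    B = B' :=
  existsUnique_isStandardForm.unique hB hB'

/-- The form pulled back by transposition is again standard, so uniqueness applies. -/
theorem transpose (hB : IsStandardForm B) (x y : Alg) :
    B (transpose x) (AE3.transpose y) = B x y := by
  let B' : LinearMap.BilinForm ℝ Alg := B.compl₁₂ transposeEquiv.toLinearMap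
    transposeEquiv.toLinearMap
  have h' : ∀ x y, B' x y = B (AE3.transpose x) (AE3.transpose y) := fun _ _ => rfl
  have hB' : IsStandardForm B' := by
    refine ⟨fun x y => ?_, fun x y z => ?_, fun i j => ?_, fun i j => ?_⟩
    · rw [h', h', hB.symm]
    · rw [h', h', transpose_lie, transpose_lie, hB.lie_left, ← lie_skew (AE3.transpose z),
        map_neg]
    · rw [h', transpose_genE, transpose_genF, hB.symm, hB.ef]
      simp only [eq_comm]
    · rw [h', transpose_genH, transpose_genH, hB.hh]
  rw [← h', hB'.unique hB]

theorem eq_zero_of_eigen (hB : IsStandardForm B) {z x y : Alg} {r s : ℝ} (hx : ⁅z, x⁆ = r • x)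
    (hy : ⁅z, y⁆ = s • y) (hrs : r + s ≠ 0) : B x y = 0 := by
  have h := hB.lie_left z x y
  rw [hx, hy, map_smul, map_smul, LinearMap.smul_apply] at h
  have h2 : (r + s) * B x y = 0 := by
    simp only [smul_eq_mul] at h
    linear_combination h
  exact (mul_eq_zero.1 h2).resolve_left hrs

/-- Moving the Cartan loop generator of mode one across the form shifts a unit of mode from one
factor to the other without changing the value. The start is ⟨f_2|e_2⟩ = 1. -/
theorem loopY_loopX (hB : IsStandardForm B) (k : ℕ) : B (loopY k) (loopX (-k)) = 1 := by
  induction k with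
  | zero =>
    simp only [Nat.cast_zero, neg_zero]
    rw [loopY_zero, loopX_zero, hB.symm, hB.ef, if_pos rfl]
  | succ k ih =>
    have h := hB.lie_left (loopH 1) (loopY k) (loopX (-(k + 1)))
    rw [loopRelations.hy, loopRelations.hx, add_comm (1 : ℤ) k,
      show (1 : ℤ) + -(k + 1) = -k by ring, map_smul, map_smul, ih] at h
    push_cast
    rw [LinearMap.smul_apply] at h
    simp only [smul_eq_mul] at h
    linarith

end IsStandardForm

theorem proj_lowest (k : ℕ) : proj (fun _ : Fin k => 0) 2 2 (fun _ => 0) 2 2 = 1 := by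
  have h2 : (2 : Fin 3) ≠ 0 := by decide
  simp only [proj_eq, projOp_apply, kron_of_ne h2, zero_mul, zero_smul, add_zero,
    Finset.sum_const_zero, smul_zero, sub_zero, symKernel_apply, symPair, symDelta, kron_self,
    Finset.prod_const_one, Finset.sum_const, Finset.card_univ, Fintype.card_perm,
    Fintype.card_fin, nsmul_eq_mul]
  have : (k.factorial : ℝ) ≠ 0 := by positivity
  field_simp
  norm_num

namespace IsGradientFamily

variable {E : (k : ℕ) → Tens k}

theorem mem_level (hE : IsGradientFamily E) (k : ℕ) (a b₁ b₂) : E k a b₁ b₂ ∈ level (k + 1) := by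
  rw [AE3.mem_level, glTr, sum_lie]
  simp only [hE.isCovariant k _ _, sum_gAct_diag]
  push_cast
  ring_nf

end IsGradientFamily

theorem transpose_mem_level {n : ℤ} {x : Alg} (hx : x ∈ level n) : transpose x ∈ level (-n) := by
  rw [mem_level] at *
  have h : transpose glTr = glTr := by
    simp only [glTr, transpose_sum, transpose_glK]
  rw [← h, lie_transpose, hx, transpose_smul]
  push_cast
  module

variable {E : (k : ℕ) → Tens k} {B : LinearMap.BilinForm ℝ Alg}

theorem form_of_level (hB : IsStandardForm B) {m n : ℤ} (hmn : m + n ≠ 0) {x y : Alg}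
    (hx : x ∈ level m) (hy : y ∈ level n) : B x y = 0 := by
  refine hB.eq_zero_of_eigen (mem_level.1 hx) (mem_level.1 hy) ?_
  have : (m : ℝ) + n ≠ 0 := by exact_mod_cast hmn
  intro h
  exact this (by linarith)

/-- The pairing and P are both invariant and irreducible in each index set, so it suffices to
compare them on the lowest components, where both are 1. -/
theorem form_gradient (hE : IsGradientFamily E) (hB : IsStandardForm B) (k : ℕ) (a b₁ b₂ c d₁ d₂) :
    B (E k a b₁ b₂) (transposeFamily E k c d₁ d₂) = proj a b₁ b₂ c d₁ d₂ := by
  have hF := (hE.irr k).transpose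
  refine sub_eq_zero.1 (eq_zero_of_invariant (R := fun a b₁ b₂ c d₁ d₂ =>
    B (E k a b₁ b₂) (transposeFamily E k c d₁ d₂) - proj a b₁ b₂ c d₁ d₂)
    (fun c d₁ d₂ => ((hE.irr k).map (B.flip (transposeFamily E k c d₁ d₂))).sub
      (isIrr_proj_left c d₁ d₂))
    (fun a b₁ b₂ => (hF.map (B (E k a b₁ b₂))).sub (isIrr_proj_right a b₁ b₂))
    (fun p q a b₁ b₂ c d₁ d₂ => ?_) ?_ a b₁ b₂ c d₁ d₂)
  · have h1 := map_sub (gAct p q) (fun a b₁ b₂ => B.flip (transposeFamily E k c d₁ d₂) (E k a b₁ b₂))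
      (fun a b₁ b₂ => proj a b₁ b₂ c d₁ d₂)
    have h2 := map_sub (gAct q p) (fun c d₁ d₂ => B (E k a b₁ b₂) (transposeFamily E k c d₁ d₂))
      (proj a b₁ b₂)
    have h3 := gAct_map (B.flip (transposeFamily E k c d₁ d₂)) p q (E k) a b₁ b₂
    have h4 := gAct_map (B (E k a b₁ b₂)) q p (transposeFamily E k) c d₁ d₂
    have h5 := glK_lie_transpose (hE.isCovariant k) p q c d₁ d₂
    have h6 := hB.lie_left (glK p q) (E k a b₁ b₂) (transposeFamily E k c d₁ d₂)
    have h7 : ⁅glK p q, transposeFamily E k c d₁ d₂⁆ = -gAct q p (transposeFamily E k) c d₁ d₂ := h5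
    rw [hE.isCovariant k, h7, map_neg, neg_neg] at h6
    refine (congrFun (congrFun (congrFun h1 a) b₁) b₂).trans
      (Eq.trans ?_ (congrFun (congrFun (congrFun h2 c) d₁) d₂).symm)
    rw [Pi.sub_apply, Pi.sub_apply, Pi.sub_apply, Pi.sub_apply, Pi.sub_apply, Pi.sub_apply, h3, h4,
      gAct_proj]
    exact congrArg₂ _ h6 rfl
  · have h := hB.loopY_loopX (k + 1)
    push_cast at h
    rw [transposeFamily, hE.lowest, transpose_loopY, h, proj_lowest, sub_self]

end Form

end AE3

namespace AE3

/-! ### The non-gradient part as an orthogonal complement; irreducibility. -/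

noncomputable section NonGradient

variable {E : (k : ℕ) → Tens k} {B : LinearMap.BilinForm ℝ Alg}

theorem mem_tensorSpan {k : ℕ} (T : Tens k) (a b₁ b₂) : T a b₁ b₂ ∈ tensorSpan T :=
  Submodule.subset_span ⟨a, b₁, b₂, rfl⟩

/-- The component along the gradient representation. -/
def gradientPart (E : (k : ℕ) → Tens k) (B : LinearMap.BilinForm ℝ Alg) (k : ℕ) :
    Alg →ₗ[ℝ] Alg :=
  ∑ c, ∑ d₁, ∑ d₂, (B.flip (transposeFamily E k c d₁ d₂)).smulRight (E k c d₁ d₂)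

theorem gradientPart_apply (k : ℕ) (x : Alg) : gradientPart E B k x =
    ∑ c, ∑ d₁, ∑ d₂, B x (transposeFamily E k c d₁ d₂) • E k c d₁ d₂ := by
  simp only [gradientPart, LinearMap.sum_apply, LinearMap.smulRight_apply]
  rfl

theorem gradientPart_mem (k : ℕ) (x : Alg) : gradientPart E B k x ∈ tensorSpan (E k) := by
  rw [gradientPart_apply]
  exact sum_mem fun c _ => sum_mem fun d₁ _ => sum_mem fun d₂ _ =>
    Submodule.smul_mem _ _ (mem_tensorSpan _ _ _ _)

theorem gradientPart_eq (hE : IsGradientFamily E) (hB : IsStandardForm B) {k : ℕ} {x : Alg}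
    (hx : x ∈ tensorSpan (E k)) : gradientPart E B k x = x := by
  have h : Set.EqOn (gradientPart E B k) (LinearMap.id : Alg →ₗ[ℝ] Alg) {x | ∃ a b₁ b₂, E k a b₁ b₂ = x} := by
    rintro x ⟨a, b₁, b₂, rfl⟩
    simp only [gradientPart_apply, form_gradient hE hB]
    exact congrFun (congrFun (congrFun (hE.irr k).projSmul_eq a) b₁) b₂
  exact LinearMap.eqOn_span h hx

/-- The matrix of the pairing is the symmetric kernel P, which acts as the identity on the F's.
Hence `gradientPart` is a projection, and its kernel is seen by the pairings alone. -/
theorem form_gradientPart (hE : IsGradientFamily E) (hB : IsStandardForm B) (k : ℕ) (x : Alg)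
    (a b₁ b₂) : B (gradientPart E B k x) (transposeFamily E k a b₁ b₂) =
      B x (transposeFamily E k a b₁ b₂) := by
  have hF : IsIrr (transposeFamily E k) := (hE.irr k).transpose
  conv_rhs => rw [← hF.projSmul_eq]
  simp only [gradientPart_apply, map_sum, LinearMap.sum_apply, map_smul, LinearMap.smul_apply,
    form_gradient hE hB, projSmul, smul_eq_mul]
  refine Finset.sum_congr rfl fun c _ => Finset.sum_congr rfl fun d₁ _ =>
    Finset.sum_congr rfl fun d₂ _ => ?_
  rw [proj_comm, mul_comm]

/-- The elements of level `k + 1` orthogonal to the transposed gradient generators. -/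
def gradientPerp (E : (k : ℕ) → Tens k) (B : LinearMap.BilinForm ℝ Alg) (k : ℕ) :
    Submodule ℝ Alg :=
  level (k + 1) ⊓ LinearMap.ker (gradientPart E B k)

theorem mem_gradientPerp (hE : IsGradientFamily E) (hB : IsStandardForm B) {k : ℕ} {x : Alg} :
    x ∈ gradientPerp E B k ↔
      x ∈ level (k + 1) ∧ ∀ c d₁ d₂, B x (transposeFamily E k c d₁ d₂) = 0 := by
  refine and_congr Iff.rfl ⟨fun h c d₁ d₂ => ?_, fun h => ?_⟩
  · rw [← form_gradientPart hE hB, LinearMap.mem_ker.1 h, map_zero, LinearMap.zero_apply]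
  · rw [SetLike.mem_coe, LinearMap.mem_ker, gradientPart_apply]
    simp only [h, zero_smul, Finset.sum_const_zero]

theorem lie_glK_mem_level {n : ℤ} {x : Alg} (hx : x ∈ level n) (p q : Fin 3) :
    ⁅glK p q, x⁆ ∈ level n := by
  refine lie_mem_level (m := 0) (zero_add n).symm ?_ hx
  rw [level_zero]
  exact glK_mem_glSpan p q

theorem form_glK_lie (hE : IsGradientFamily E) (hB : IsStandardForm B) (k : ℕ) (p q : Fin 3)
    (x : Alg) (c d₁ d₂) : B ⁅glK p q, x⁆ (transposeFamily E k c d₁ d₂) =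
      gAct q p (fun c d₁ d₂ => B x (transposeFamily E k c d₁ d₂)) c d₁ d₂ := by
  have h : ⁅glK p q, transposeFamily E k c d₁ d₂⁆ = -gAct q p (transposeFamily E k) c d₁ d₂ :=
    glK_lie_transpose (hE.isCovariant k) p q c d₁ d₂
  rw [hB.lie_left, h, map_neg, neg_neg]
  exact (gAct_map (B x) q p (transposeFamily E k) c d₁ d₂).symm

theorem isGlStable_gradientPerp (hE : IsGradientFamily E) (hB : IsStandardForm B) (k : ℕ) :
    IsGlStable (gradientPerp E B k) := by
  intro p q x hx
  rw [mem_gradientPerp hE hB] at hx ⊢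
  refine ⟨lie_glK_mem_level hx.1 p q, fun c d₁ d₂ => ?_⟩
  have h0 : (fun c d₁ d₂ => B x (transposeFamily E k c d₁ d₂)) = 0 := by
    funext c d₁ d₂
    exact hx.2 c d₁ d₂
  rw [form_glK_lie hE hB, h0, map_zero]
  rfl

theorem disjoint_gradientPerp (hE : IsGradientFamily E) (hB : IsStandardForm B) (k : ℕ) :
    Disjoint (tensorSpan (E k)) (gradientPerp E B k) :=
  Submodule.disjoint_def.2 fun x hx hx' => by
    rw [← gradientPart_eq hE hB hx, LinearMap.mem_ker.1 hx'.2]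

theorem tensorSpan_le_level (hE : IsGradientFamily E) (k : ℕ) :
    tensorSpan (E k) ≤ level (k + 1) := by
  refine Submodule.span_le.2 ?_
  rintro x ⟨a, b₁, b₂, rfl⟩
  exact hE.mem_level k a b₁ b₂

theorem tensorSpan_sup_gradientPerp (hE : IsGradientFamily E) (hB : IsStandardForm B) (k : ℕ) :
    tensorSpan (E k) ⊔ gradientPerp E B k = level (k + 1) := by
  refine le_antisymm (sup_le (tensorSpan_le_level hE k) inf_le_left) fun x hx => ?_
  have h := gradientPart_mem (E := E) (B := B) k x
  rw [← add_sub_cancel (gradientPart E B k x) x]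
  refine Submodule.add_mem_sup h ⟨sub_mem hx (tensorSpan_le_level hE k h), ?_⟩
  rw [SetLike.mem_coe, LinearMap.mem_ker, map_sub, gradientPart_eq hE hB h, sub_self]

/-- K is a combination of the center and the derivation, which is why the level of an affine element
is its mode number. -/
theorem glTr_eq_affC_affD : glTr = (-3 / 2 : ℝ) • affC - (2 : ℝ) • affD := by
  rw [glTr, Fin.sum_univ_three, affC, affD]
  module

theorem glTr_lie_affVal (m : ℤ) (α β : Fin 2) :
    ⁅glTr, affVal m α β⁆ = (2 * m : ℝ) • affVal m α β := by
  rw [glTr_eq_affC_affD, sub_lie, smul_lie, smul_lie, affC_lie_affVal, affD_lie_affVal]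
  module

/-- Affine elements of positive level are spanned by the elements `K̄_m^α_β` of this level. -/
theorem affine_inf_level {n : ℤ} (hn : n ≠ 0) :
    affineSubalgebra.toSubmodule ⊓ level n ≤
      Submodule.span ℝ {x | ∃ α β, affVal n α β = x} := by
  rintro x ⟨hx, hxn⟩
  have h0 : ∀ y ∈ ({affC, affD} : Set Alg), ⁅glTr, y⁆ = (0 : ℝ) • y := by
    rw [glTr_eq_affC_affD]
    rintro y (rfl | rfl)
    · rw [sub_lie, smul_lie, smul_lie, lie_self, ← lie_skew, affC_lie_affD]
      simp
    · rw [sub_lie, smul_lie, smul_lie, lie_self, affC_lie_affD]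
      simp
  rw [affineSubalgebra_eq_affSpan, affSpan] at hx
  have h := mem_span_eigen (LieAlgebra.ad ℝ Alg glTr) (μ := 2 * n) (fun y hy => by
    rcases hy with ⟨m, α, β, rfl⟩ | hy
    · exact ⟨_, glTr_lie_affVal m α β⟩
    · exact ⟨0, h0 y hy⟩) hx (mem_level.1 hxn)
  refine Submodule.span_le.2 ?_ h
  rintro y ⟨hy, hy2⟩
  have hn' : (2 * n : ℝ) ≠ 0 := mul_ne_zero two_ne_zero (Int.cast_ne_zero.2 hn)
  change ⁅glTr, y⁆ = _ at hy2
  rcases hy with ⟨m, α, β, rfl⟩ | hy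
  · rw [glTr_lie_affVal, ← sub_eq_zero, ← sub_smul] at hy2
    rcases smul_eq_zero.1 hy2 with h | h
    · have : m = n := by
        have : (m : ℝ) = n := by linarith
        exact_mod_cast this
      subst this
      exact Submodule.subset_span ⟨α, β, rfl⟩
    · rw [h]; exact zero_mem _
  · rw [h0 y hy, ← sub_eq_zero, ← sub_smul] at hy2
    rcases smul_eq_zero.1 hy2 with h | h
    · exact absurd (by linarith) hn'
    · rw [h]; exact zero_mem _

theorem affVal_mem_tensorSpan (hE : IsGradientFamily E) (k : ℕ) (α β : Fin 2) :
    affVal (k + 1) α β ∈ tensorSpan (E k) := by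
  have h := affK_eq_affVal hE.loopValued (Int.ofNat (k + 1)) α β
  change _ = affVal (k + 1) α β at h
  rw [← h, affK]
  exact sum_mem fun γ _ => Submodule.smul_mem _ _ (mem_tensorSpan _ _ _ _)

theorem affine_inf_level_le (hE : IsGradientFamily E) (k : ℕ) :
    affineSubalgebra.toSubmodule ⊓ level (k + 1) ≤ tensorSpan (E k) := by
  refine (affine_inf_level (by omega)).trans (Submodule.span_le.2 ?_)
  rintro x ⟨α, β, rfl⟩
  exact affVal_mem_tensorSpan hE k α β

theorem disjoint_affine_gradientPerp (hE : IsGradientFamily E) (hB : IsStandardForm B) (k : ℕ) :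
    Disjoint affineSubalgebra.toSubmodule (gradientPerp E B k) :=
  Submodule.disjoint_def.2 fun _ hx hx' =>
    Submodule.disjoint_def.1 (disjoint_gradientPerp hE hB k) _
      (affine_inf_level_le hE k ⟨hx, hx'.1⟩) hx'

theorem lie_genH_mem {S : Submodule ℝ Alg} (hS : IsGlStable S) (i : Fin 3) {x : Alg} (hx : x ∈ S) :
    ⁅genH i, x⁆ ∈ S := by
  refine Submodule.span_induction (p := fun y _ => ⁅y, x⁆ ∈ S) ?_ ?_ ?_ ?_ (genH_mem_glSpan i)
  · rintro y ⟨a, b, rfl⟩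
    exact hS a b x hx
  · rw [zero_lie]; exact zero_mem _
  · intro y z _ _ hy hz
    rw [add_lie]; exact add_mem hy hz
  · intro r y _ hy
    rw [smul_lie]; exact Submodule.smul_mem _ _ hy

/-- Orthogonality to the transposed gradient generators for subspaces stable under the lowering
operators. -/
theorem form_eq_zero_of_lowest (hE : IsGradientFamily E) (hB : IsStandardForm B) {k : ℕ}
    {S : Submodule ℝ Alg} (hS : ∀ p q, p < q → ∀ x ∈ S, ⁅glK q p, x⁆ ∈ S)
    (h : ∀ x ∈ S, B x (transposeFamily E k (fun _ => 0) 2 2) = 0) {x : Alg} (hx : x ∈ S)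
    (c d₁ d₂) : B x (transposeFamily E k c d₁ d₂) = 0 := by
  have hF : IsIrr (transposeFamily E k) := (hE.irr k).transpose
  refine hF.mem (B.orthogonal S) (fun p q hpq c d₁ d₂ h0 => ?_) h c d₁ d₂ x hx
  intro s hs
  have h2 : B ⁅glK q p, s⁆ (transposeFamily E k c d₁ d₂) = 0 := h0 _ (hS p q hpq s hs)
  rw [form_glK_lie hE hB] at h2
  exact (gAct_map (B s) p q (transposeFamily E k) c d₁ d₂).symm.trans h2

/-- A subrepresentation that is not orthogonal to the transposed gradient generators contains an
affine element that is not orthogonal to `F^{1…1}_{33}`. -/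
theorem exists_affine_mem (hE : IsGradientFamily E) (hB : IsStandardForm B) {k : ℕ}
    {S : Submodule ℝ Alg} (hSl : S ≤ level (k + 1)) (hS : IsGlStable S)
    (hne : ¬S ≤ gradientPerp E B k) :
    ∃ x ∈ S, x ∈ affineSubalgebra ∧ B x (transposeFamily E k (fun _ => 0) 2 2) ≠ 0 := by
  have h1 : ∃ s ∈ S, B s (transposeFamily E k (fun _ => 0) 2 2) ≠ 0 := by
    by_contra! h
    refine hne fun s hs => (mem_gradientPerp hE hB).2 ⟨hSl hs, fun c d₁ d₂ => ?_⟩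
    exact form_eq_zero_of_lowest hE hB (fun p q _ => hS q p) h hs c d₁ d₂
  obtain ⟨s, hs, hne⟩ := h1
  -- The part of s of weight zero under K^1_1 stays in the subrepresentation, is affine because it
  -- centralizes K^1_1, and carries the whole pairing, since F^{1…1}_{33} itself has weight zero.
  obtain ⟨a, ha, b, hb, rfl⟩ := exists_eigen_decomposition
    (LieAlgebra.ad ℝ Alg (glK 0 0)) (X := wordSet) (by rw [glK_diag]; exact wordSet_eigen _) 0
    (y := s) (by rw [span_wordSet]; trivial)
  have ha' := Module.End.mem_eigenspace_iff.1 (span_le_eigenspace _ _ _ ha)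
  have haS := eigencomponent_mem _ S (fun x hx => hS 0 0 x hx) ha' hb hs
  refine ⟨a, haS, mem_affine_of_lie (ha'.trans (zero_smul _ _)), ?_⟩
  have hFw : ⁅glK 0 0, transposeFamily E k (fun _ => 0) 2 2⁆ =
      (0 : ℝ) • transposeFamily E k (fun _ => 0) 2 2 := by
    have h : ⁅glK 0 0, transposeFamily E k (fun _ => 0) 2 2⁆ =
      -gAct 0 0 (transposeFamily E k) (fun _ => 0) 2 2 :=
      glK_lie_transpose (hE.isCovariant k) 0 0 _ 2 2
    rw [h, gAct_apply]
    simp [kron]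
    module
  have hb0 : B b (transposeFamily E k (fun _ => 0) 2 2) = 0 := by
    have : (⨆ ν ≠ (0 : ℝ), Module.End.eigenspace (LieAlgebra.ad ℝ Alg (glK 0 0) :
        Module.End ℝ Alg) ν) ≤
        LinearMap.ker (B.flip (transposeFamily E k (fun _ => 0) 2 2)) := by
      refine iSup₂_le fun ν hν y hy => ?_
      exact hB.eq_zero_of_eigen (Module.End.mem_eigenspace_iff.1 hy) hFw (by rwa [add_zero])
    exact this hb
  rwa [map_add, LinearMap.add_apply, hb0, add_zero] at hne

/-- The complement is one of the subrepresentations in the supremum. Conversely, one not contained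
in it has an affine vector with nonzero pairing, and this vector lies in G, contradicting
disjointness. The supremum can thus be tested by pairings. -/
theorem nonGradient_eq (hE : IsGradientFamily E) (hB : IsStandardForm B) (k : ℕ) :
    nonGradient (k + 1) (tensorSpan (E k)) = gradientPerp E B k := by
  refine le_antisymm (sSup_le ?_) (le_sSup ⟨inf_le_left, isGlStable_gradientPerp hE hB k,
    (disjoint_gradientPerp hE hB k).symm⟩)
  rintro S ⟨hSl, hS, hd⟩
  by_contra hne
  obtain ⟨x, hx, hxa, hx0⟩ := exists_affine_mem hE hB hSl hS hne
  have := Submodule.disjoint_def.1 hd x hx (affine_inf_level_le hE k ⟨hxa, hSl hx⟩)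
  rw [this, map_zero, LinearMap.zero_apply] at hx0
  exact hx0 rfl

/-- A subrepresentation of G that is orthogonal to the F's is zero. Otherwise it contains an affine
vector with a nonzero y component; projecting onto that weight yields the lowest component, which
generates G. -/
theorem eq_bot_or_eq_tensorSpan (hE : IsGradientFamily E) (hB : IsStandardForm B) (k : ℕ)
    {S : Submodule ℝ Alg} (hSG : S ≤ tensorSpan (E k)) (hS : IsGlStable S) :
    S = ⊥ ∨ S = tensorSpan (E k) := by
  by_cases hne : S ≤ gradientPerp E B k
  · left
    exact eq_bot_iff.2 (disjoint_gradientPerp hE hB k hSG hne)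
  right
  refine le_antisymm hSG ?_
  obtain ⟨x, hx, hxa, hx0⟩ := exists_affine_mem hE hB
    (hSG.trans (tensorSpan_le_level hE k)) hS hne
  have hspan := affine_inf_level (n := k + 1) (by omega)
    ⟨hxa, tensorSpan_le_level hE k (hSG hx)⟩
  set F := transposeFamily E k (fun _ => 0) 2 2 with hF
  have hFx : F = loopX (-(k + 1)) := by rw [hF, transposeFamily, hE.lowest, transpose_loopY]
  have hw := loopRelations.hx 0 (-(k + 1))
  rw [loopH_zero, zero_add] at hw
  have hBX : B (loopX (k + 1)) F = 0 := by
    have h := loopRelations.hx 0 (k + 1)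
    rw [loopH_zero, zero_add] at h
    exact hB.eq_zero_of_eigen h (hFx ▸ hw) (by norm_num)
  have hBH : B (loopH (k + 1)) F = 0 := by
    refine hB.eq_zero_of_eigen (z := genH 1) (r := 0) ?_ (hFx ▸ hw) (by norm_num)
    have hk : ¬((0 : ℤ) + (k + 1) = 0) := by omega
    rw [← loopH_zero, loopRelations.hh, if_neg hk, zero_smul]
  have hBY : B (loopY (k + 1)) F = 1 := by
    have h := hB.loopY_loopX (k + 1)
    push_cast at h
    rw [hFx, h]
  -- The polynomial t(t-2) in ad h_2 kills the weights 0 and 2 of the Cartan and x directions and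
  -- takes the value 8 at the weight -2 of y; the pairing with F reads off the y coefficient.
  have key : ⁅genH 1, ⁅genH 1, x⁆⁆ - (2 : ℝ) • ⁅genH 1, x⁆ = (8 * B x F) • loopY (k + 1) := by
    have hk : ¬((0 : ℤ) + (k + 1) = 0) := by omega
    have hX := loopRelations.hx 0 (k + 1)
    have hY := loopRelations.hy 0 (k + 1)
    have hH := loopRelations.hh 0 (k + 1)
    rw [if_neg hk] at hH
    rw [loopH_zero, zero_add] at hX hY
    rw [loopH_zero] at hH
    refine Submodule.span_induction (p := fun x _ => ⁅genH 1, ⁅genH 1, x⁆⁆ -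
      (2 : ℝ) • ⁅genH 1, x⁆ = (8 * B x F) • loopY (k + 1)) ?_ ?_ ?_ ?_ hspan
    · rintro x ⟨α, β, rfl⟩
      fin_cases α <;> fin_cases β <;> simp [affVal, hX, hY, hH, hBX, hBY, hBH]
      module
    · simp
    · intro y z _ _ hy hz
      simp only [lie_add, map_add, LinearMap.add_apply]
      linear_combination (norm := module) hy + hz
    · intro r y _ hy
      simp only [lie_smul, map_smul, LinearMap.smul_apply, smul_eq_mul]
      linear_combination (norm := module) r • hy
  have hlow : E k (fun _ => 0) 2 2 ∈ S := by
    have hmem := sub_mem (lie_genH_mem hS 1 (lie_genH_mem hS 1 hx))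
      (Submodule.smul_mem S (2 : ℝ) (lie_genH_mem hS 1 hx))
    rw [key] at hmem
    rw [hE.lowest]
    exact (Submodule.smul_mem_iff S (mul_ne_zero (by norm_num) hx0)).1 hmem
  refine Submodule.span_le.2 ?_
  rintro y ⟨a, b₁, b₂, rfl⟩
  refine (hE.irr k).mem S (fun p q _ a b₁ b₂ h => ?_) hlow a b₁ b₂
  rw [← hE.isCovariant]
  exact hS p q _ h

end NonGradient

end AE3

namespace AE3

/-! ### Transport to negative levels by transposition. -/

noncomputable section Transposed

theorem map_map_transposeEquiv (S : Submodule ℝ Alg) :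
    (S.map transposeEquiv.toLinearMap).map transposeEquiv.toLinearMap = S := by
  ext x
  constructor
  · rintro ⟨_, ⟨y, hy, rfl⟩, rfl⟩
    have : transposeEquiv.toLinearMap (transposeEquiv.toLinearMap y) = y := transpose_transpose y
    rwa [this]
  · intro hx
    exact ⟨transpose x, ⟨x, hx, rfl⟩, transpose_transpose x⟩

theorem mem_map_transposeEquiv {S : Submodule ℝ Alg} {x : Alg} :
    x ∈ S.map transposeEquiv.toLinearMap ↔ transpose x ∈ S := by
  constructor
  · rintro ⟨y, hy, rfl⟩
    have : transpose (transposeEquiv.toLinearMap y) = y := transpose_transpose y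
    rwa [this]
  · intro h
    exact ⟨transpose x, h, transpose_transpose x⟩

theorem disjoint_map_transposeEquiv {S T : Submodule ℝ Alg} (h : Disjoint S T) :
    Disjoint (S.map transposeEquiv.toLinearMap) (T.map transposeEquiv.toLinearMap) :=
  Submodule.disjoint_def.2 fun x hx hx' => by
    have := Submodule.disjoint_def.1 h _ (mem_map_transposeEquiv.1 hx) (mem_map_transposeEquiv.1 hx')
    rw [← transpose_transpose x, this, transpose_zero]

theorem map_level (n : ℤ) : (level n).map transposeEquiv.toLinearMap = level (-n) := by
  ext x
  rw [mem_map_transposeEquiv]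
  refine ⟨fun h => ?_, fun h => ?_⟩
  · have := transpose_mem_level h
    rwa [transpose_transpose] at this
  · have := transpose_mem_level h
    rwa [neg_neg] at this

theorem IsGlStable.map_transpose {S : Submodule ℝ Alg} (hS : IsGlStable S) :
    IsGlStable (S.map transposeEquiv.toLinearMap) := by
  intro p q x hx
  rw [mem_map_transposeEquiv] at *
  rw [transpose_lie, transpose_glK, ← lie_skew]
  exact neg_mem (hS q p _ hx)

/-- Transposition preserves gl_3 up to sign in the action, reverses the level and preserves
disjointness, so it maps the admissible subrepresentations to admissible ones. -/
theorem map_nonGradient_le (n : ℤ) (G : Submodule ℝ Alg) :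
    (nonGradient n G).map transposeEquiv.toLinearMap ≤
      nonGradient (-n) (G.map transposeEquiv.toLinearMap) := by
  rw [Submodule.map_le_iff_le_comap]
  refine sSup_le ?_
  rintro S ⟨hSl, hS, hd⟩
  rw [← Submodule.map_le_iff_le_comap]
  exact le_sSup ⟨map_level n ▸ Submodule.map_mono hSl, hS.map_transpose,
    disjoint_map_transposeEquiv hd⟩

theorem map_nonGradient (n : ℤ) (G : Submodule ℝ Alg) :
    (nonGradient n G).map transposeEquiv.toLinearMap =
      nonGradient (-n) (G.map transposeEquiv.toLinearMap) := by
  refine le_antisymm (map_nonGradient_le n G) ?_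
  have h := map_nonGradient_le (-n) (G.map transposeEquiv.toLinearMap)
  rw [neg_neg, map_map_transposeEquiv] at h
  have h2 := Submodule.map_mono (f := transposeEquiv.toLinearMap) h
  rwa [map_map_transposeEquiv] at h2

theorem tensorSpan_transpose {k : ℕ} (T : Tens k) :
    tensorSpan (fun a b₁ b₂ => transpose (T a b₁ b₂)) =
      (tensorSpan T).map transposeEquiv.toLinearMap := by
  rw [tensorSpan, tensorSpan, Submodule.map_span]
  congr 1
  ext x
  constructor
  · rintro ⟨a, b₁, b₂, rfl⟩
    exact ⟨_, ⟨a, b₁, b₂, rfl⟩, rfl⟩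
  · rintro ⟨_, ⟨a, b₁, b₂, rfl⟩, rfl⟩
    exact ⟨a, b₁, b₂, rfl⟩

theorem map_affineSubalgebra : affineSubalgebra.toSubmodule.map transposeEquiv.toLinearMap =
    affineSubalgebra.toSubmodule := by
  have h : affineSubalgebra.toSubmodule.map transposeEquiv.toLinearMap ≤
      affineSubalgebra.toSubmodule := by
    intro x hx
    rw [mem_map_transposeEquiv] at hx
    rw [affineSubalgebra_eq_affSpan] at *
    have h : ∀ y ∈ affSpan, transpose y ∈ affSpan := by
      intro y hy
      refine Submodule.span_induction (p := fun y _ => transpose y ∈ affSpan) ?_ ?_ ?_ ?_ hy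
      · rintro y (⟨m, α, β, rfl⟩ | rfl | rfl)
        · have e : transpose (affVal m α β) = affVal (-m) β α := by
            fin_cases α <;> fin_cases β <;>
              simp [affVal, transpose_smul, transpose_neg, transpose_loopH, transpose_loopX,
                transpose_loopY]
          rw [e]
          exact affVal_mem_affSpan _ _ _
        · rw [affC, transpose_neg, transpose_glK]
          exact affC_mem_affSpan
        · rw [transpose_affD]
          exact affD_mem_affSpan
      · rw [transpose_zero]; exact zero_mem _
      · intro x y _ _ hx hy
        rw [transpose_add]; exact add_mem hx hy
      · intro r x _ hx
        rw [transpose_smul]; exact Submodule.smul_mem _ _ hx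
    have := h _ hx
    rwa [transpose_transpose] at this
  refine le_antisymm h ?_
  have h2 := Submodule.map_mono (f := transposeEquiv.toLinearMap) h
  rwa [map_map_transposeEquiv] at h2

theorem transpose_mem_nonGradient {E : (k : ℕ) → Tens k} {k : ℕ} {n : ℤ} {x : Alg}
    (hx : x ∈ nonGradient n (tensorSpan (E k))) :
    transpose x ∈ nonGradient (-n) (tensorSpan (transposeFamily E k)) := by
  have h : tensorSpan (transposeFamily E k) = _ := tensorSpan_transpose (E k)
  rw [h, ← map_nonGradient]
  exact ⟨x, hx, rfl⟩

end Transposed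

end AE3

namespace AE3

/-! ### Symmetries and covariance of the right hand side of [E,E]. -/

noncomputable section EpsSum

variable {k l : ℕ}

theorem append_update_left (a : Fin k → Fin 3) (c : Fin l → Fin 3) (i : Fin k) (s : Fin 3) :
    Fin.append (Function.update a i s) c = Function.update (Fin.append a c) (Fin.castAdd l i) s := by
  funext j
  refine Fin.addCases (fun j => ?_) (fun j => ?_) j
  · by_cases h : j = i
    · subst h; simp
    · have : Fin.castAdd l j ≠ Fin.castAdd l i := fun e => h (Fin.castAdd_injective k l e)
      simp [Function.update_of_ne h, Function.update_of_ne this]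
  · have : Fin.natAdd k j ≠ Fin.castAdd l i := by
      intro e; have := congrArg Fin.val e; simp at this; omega
    simp [Function.update_of_ne this]

theorem append_update_right (a : Fin k → Fin 3) (c : Fin l → Fin 3) (i : Fin l) (s : Fin 3) :
    Fin.append a (Function.update c i s) = Function.update (Fin.append a c) (Fin.natAdd k i) s := by
  funext j
  refine Fin.addCases (fun j => ?_) (fun j => ?_) j
  · have : Fin.castAdd l j ≠ Fin.natAdd k i := by
      intro e; have := congrArg Fin.val e; simp at this; omega
    simp [Function.update_of_ne this]
  · by_cases h : j = i
    · subst h; simp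
    · have : Fin.natAdd k j ≠ Fin.natAdd k i := fun e => h (Fin.natAdd_injective l k e)
      simp [Function.update_of_ne h, Function.update_of_ne this]

theorem append_comp_perm (a : Fin k → Fin 3) (c : Fin l → Fin 3) (σ : Equiv.Perm (Fin k))
    (τ : Equiv.Perm (Fin l)) : ∃ ρ : Equiv.Perm (Fin (k + l)),
      Fin.append (a ∘ σ) (c ∘ τ) = Fin.append a c ∘ ρ := by
  refine ⟨(finSumFinEquiv.symm.trans (Equiv.sumCongr σ τ)).trans finSumFinEquiv, ?_⟩
  funext j
  refine Fin.addCases (fun j => ?_) (fun j => ?_) j <;> simp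

/-- The lower indices `a_1 … a_k c_1 … c_l e`. -/
def joint (a : Fin k → Fin 3) (c : Fin l → Fin 3) (e : Fin 3) : Fin (k + l + 1) → Fin 3 :=
  Fin.snoc (Fin.append a c) e

theorem joint_comp_perm (a : Fin k → Fin 3) (c : Fin l → Fin 3) (e : Fin 3)
    (σ : Equiv.Perm (Fin k)) (τ : Equiv.Perm (Fin l)) : ∃ ρ : Equiv.Perm (Fin (k + l + 1)),
      joint (a ∘ σ) (c ∘ τ) e = joint a c e ∘ ρ := by
  obtain ⟨ρ, hρ⟩ := append_comp_perm a c σ τ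
  obtain ⟨ρ', hρ'⟩ := append_comp_perm (Fin.append a c) (fun _ : Fin 1 => e) ρ 1
  refine ⟨ρ', ?_⟩
  rw [joint, joint, hρ]
  have h := Fin.append_right_eq_snoc (Fin.append a c) (fun _ : Fin 1 => e)
  have h2 := Fin.append_right_eq_snoc (Fin.append a c ∘ ρ) (fun _ : Fin 1 => e)
  rw [← h, ← h2]
  exact hρ'

theorem joint_update_left (a : Fin k → Fin 3) (c : Fin l → Fin 3) (e : Fin 3) (i : Fin k)
    (s : Fin 3) : joint (Function.update a i s) c e =
      Function.update (joint a c e) (Fin.castAdd l i).castSucc s := by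
  rw [joint, append_update_left, Fin.snoc_update]; rfl

theorem joint_update_right (a : Fin k → Fin 3) (c : Fin l → Fin 3) (e : Fin 3) (i : Fin l)
    (s : Fin 3) : joint a (Function.update c i s) e =
      Function.update (joint a c e) (Fin.natAdd k i).castSucc s := by
  rw [joint, append_update_right, Fin.snoc_update]; rfl

theorem joint_castAdd (a : Fin k → Fin 3) (c : Fin l → Fin 3) (e : Fin 3) (i : Fin k) :
    joint a c e (Fin.castAdd l i).castSucc = a i := by
  rw [joint, Fin.snoc_castSucc, Fin.append_left]

theorem joint_natAdd (a : Fin k → Fin 3) (c : Fin l → Fin 3) (e : Fin 3) (i : Fin l) :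
    joint a c e (Fin.natAdd k i).castSucc = c i := by
  rw [joint, Fin.snoc_castSucc, Fin.append_right]

theorem joint_last (a : Fin k → Fin 3) (c : Fin l → Fin 3) (e : Fin 3) :
    joint a c e (Fin.last (k + l)) = e := by
  rw [joint, Fin.snoc_last]

theorem joint_update_last (a : Fin k → Fin 3) (c : Fin l → Fin 3) (e s : Fin 3) :
    Function.update (joint a c e) (Fin.last (k + l)) s = joint a c s := Fin.update_snoc_last ..

theorem update_update_swap {n : ℕ} {T : Tens n} (hT : IsIrr T) (f : Fin n → Fin 3) {i j : Fin n}
    (hij : i ≠ j) (s t b₁ b₂ : Fin 3) :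
    T (Function.update (Function.update f i s) j t) b₁ b₂ =
      T (Function.update (Function.update f i t) j s) b₁ b₂ := by
  rw [← hT.symm_left (Equiv.swap i j)]
  congr 1
  funext m
  simp only [Function.comp_apply]
  by_cases hj : m = j
  · subst hj
    rw [Equiv.swap_apply_right, Function.update_of_ne hij, Function.update_self,
      Function.update_self]
  by_cases hi : m = i
  · subst hi
    rw [Equiv.swap_apply_left, Function.update_self, Function.update_of_ne hij,
      Function.update_self]
  · rw [Equiv.swap_apply_of_ne_of_ne hi hj, Function.update_of_ne hj, Function.update_of_ne hi,
      Function.update_of_ne hj, Function.update_of_ne hi]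

/-- `T_{a c e}^{d₁ b₁} ε^{b₂ d₂ e}`. -/
def epsTerm (T : Tens (k + l + 1)) : GTens k (GTens l Alg) := fun a b₁ b₂ c d₁ d₂ =>
  ∑ e, eps b₂ d₂ e • T (joint a c e) d₁ b₁

variable {T : Tens (k + l + 1)}

theorem epsSum_eq (T : Tens (k + l + 1)) (a b₁ b₂ c d₁ d₂) : epsSum T a b₁ b₂ c d₁ d₂ =
    (1 / 2 : ℝ) • (epsTerm T a b₁ b₂ c d₁ d₂ + epsTerm T a b₂ b₁ c d₁ d₂
      + epsTerm T a b₁ b₂ c d₂ d₁ + epsTerm T a b₂ b₁ c d₂ d₁) := by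
  simp only [epsSum, epsTerm, ← Finset.sum_add_distrib, Finset.smul_sum]
  refine Finset.sum_congr rfl fun e _ => ?_
  simp only [joint]
  module

theorem epsTerm_comp_perm (hT : IsIrr T) (σ : Equiv.Perm (Fin k)) (τ : Equiv.Perm (Fin l))
    (a b₁ b₂ c d₁ d₂) : epsTerm T (a ∘ σ) b₁ b₂ (c ∘ τ) d₁ d₂ = epsTerm T a b₁ b₂ c d₁ d₂ := by
  refine Finset.sum_congr rfl fun e _ => ?_
  obtain ⟨ρ, hρ⟩ := joint_comp_perm a c e σ τ
  rw [hρ, hT.symm_left]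

/-- A symmetric pair is contracted with an antisymmetric one. -/
theorem sum_eps_antisymm {f : Fin 3 → Fin 3 → Alg} (hf : ∀ s e, f s e = f e s) (d : Fin 3) :
    ∑ s, ∑ e, eps s d e • f s e = 0 := by
  have h : ∑ s, ∑ e, eps s d e • f s e = -∑ s, ∑ e, eps s d e • f s e := by
    conv_lhs => rw [Finset.sum_comm]
    rw [← Finset.sum_neg_distrib]
    refine Finset.sum_congr rfl fun s _ => ?_
    rw [← Finset.sum_neg_distrib]
    refine Finset.sum_congr rfl fun e _ => ?_
    rw [hf s e, ← neg_smul]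
    congr 1
    unfold eps; ring
  have h2 : (2 : ℝ) • ∑ s, ∑ e, eps s d e • f s e = 0 := by
    rw [two_smul]
    nth_rewrite 1 [h]
    exact neg_add_cancel _
  exact (smul_eq_zero.1 h2).resolve_left two_ne_zero

theorem joint_update_left_comm (hT : IsIrr T) (a : Fin k → Fin 3) (c : Fin l → Fin 3) (i : Fin k)
    (s e b₁ b₂ : Fin 3) : T (joint (Function.update a i s) c e) b₁ b₂ =
      T (joint (Function.update a i e) c s) b₁ b₂ := by
  rw [joint_update_left, joint_update_left, ← joint_update_last a c 0, ← joint_update_last a c 0 s,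
    Function.update_comm (Fin.castSucc_lt_last _).ne', Function.update_comm
      (Fin.castSucc_lt_last _).ne', update_update_swap hT _ (Fin.castSucc_lt_last _).ne]

theorem joint_update_right_comm (hT : IsIrr T) (a : Fin k → Fin 3) (c : Fin l → Fin 3) (i : Fin l)
    (s e b₁ b₂ : Fin 3) : T (joint a (Function.update c i s) e) b₁ b₂ =
      T (joint a (Function.update c i e) s) b₁ b₂ := by
  rw [joint_update_right, joint_update_right, ← joint_update_last a c 0,
    ← joint_update_last a c 0 s,
    Function.update_comm (Fin.castSucc_lt_last _).ne', Function.update_comm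
      (Fin.castSucc_lt_last _).ne', update_update_swap hT _ (Fin.castSucc_lt_last _).ne]

/-- In a contraction of an a with a b, either the b sits on T, giving a trace of T, or it sits on ε,
and then ε meets two lower indices in which T is symmetric. -/
theorem isIrr_epsSum_left (hT : IsIrr T) (c : Fin l → Fin 3) (d₁ d₂ : Fin 3) :
    IsIrr fun a b₁ b₂ => epsSum T a b₁ b₂ c d₁ d₂ where
  symm_left σ a b₁ b₂ := by
    have h := fun b₁ b₂ d₁ d₂ => epsTerm_comp_perm hT σ 1 a b₁ b₂ c d₁ d₂
    simp only [epsSum_eq]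
    exact congrArg _ (congrArg₂ _ (congrArg₂ _ (congrArg₂ _ (h _ _ _ _) (h _ _ _ _))
      (h _ _ _ _)) (h _ _ _ _))
  symm_right a b₁ b₂ := by
    simp only [epsSum_eq]
    module
  traceless i a b := by
    have h1 : ∀ d₁ d₂, ∑ s, epsTerm T (Function.update a i s) s b c d₁ d₂ = 0 := by
      intro d₁ d₂
      simp only [epsTerm]
      rw [Finset.sum_comm]
      simp only [joint_update_left, ← Finset.smul_sum, hT.traceless', smul_zero,
        Finset.sum_const_zero]
    have h2 : ∀ d₁ d₂, ∑ s, epsTerm T (Function.update a i s) b s c d₁ d₂ = 0 := fun d₁ d₂ =>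
      sum_eps_antisymm (fun s e => joint_update_left_comm hT a c i s e _ _) _
    simp only [epsSum_eq, ← Finset.smul_sum, Finset.sum_add_distrib, h1, h2, add_zero, smul_zero]

theorem isIrr_epsSum_right (hT : IsIrr T) (a : Fin k → Fin 3) (b₁ b₂ : Fin 3) :
    IsIrr (epsSum T a b₁ b₂) where
  symm_left σ c d₁ d₂ := by
    have h := fun b₁ b₂ d₁ d₂ => epsTerm_comp_perm hT 1 σ a b₁ b₂ c d₁ d₂
    simp only [epsSum_eq]
    exact congrArg _ (congrArg₂ _ (congrArg₂ _ (congrArg₂ _ (h _ _ _ _) (h _ _ _ _))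
      (h _ _ _ _)) (h _ _ _ _))
  symm_right c d₁ d₂ := by
    simp only [epsSum_eq]
    module
  traceless i c d := by
    have h1 : ∀ b₁ b₂, ∑ s, epsTerm T a b₁ b₂ (Function.update c i s) s d = 0 := by
      intro b₁ b₂
      simp only [epsTerm]
      rw [Finset.sum_comm]
      simp only [joint_update_right, ← Finset.smul_sum, hT.traceless, smul_zero,
        Finset.sum_const_zero]
    have h2 : ∀ b₁ b₂, ∑ s, epsTerm T a b₁ b₂ (Function.update c i s) d s = 0 := by
      intro b₁ b₂
      rw [← neg_eq_zero, ← Finset.sum_neg_distrib,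
        ← sum_eps_antisymm (f := fun s e => T (joint a (Function.update c i s) e) d b₁)
        (fun s e => joint_update_right_comm hT a c i s e _ _) b₂]
      refine Finset.sum_congr rfl fun s _ => ?_
      simp only [epsTerm]
      rw [← Finset.sum_neg_distrib]
      refine Finset.sum_congr rfl fun e _ => ?_
      rw [← neg_smul]
      congr 1
      unfold eps; ring
    simp only [epsSum_eq, ← Finset.smul_sum, Finset.sum_add_distrib, h1, h2, add_zero, smul_zero]

theorem sum_joint (p q : Fin 3) (a : Fin k → Fin 3) (c : Fin l → Fin 3) (e b₁ b₂ : Fin 3) :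
    ∑ i, kron p (joint a c e i) • T (Function.update (joint a c e) i q) b₁ b₂ =
      ∑ i, kron p (a i) • T (joint (Function.update a i q) c e) b₁ b₂ +
      ∑ i, kron p (c i) • T (joint a (Function.update c i q) e) b₁ b₂ +
      kron p e • T (joint a c q) b₁ b₂ := by
  rw [Fin.sum_univ_castSucc, Fin.sum_univ_add, joint_update_last]
  simp only [joint_update_left, joint_update_right]
  congr 1
  · congr 1 <;> refine Finset.sum_congr rfl fun i _ => ?_
    · rw [joint_castAdd]
    · rw [joint_natAdd]
  · rw [joint_last]

theorem eps_kron' (b d e p q : Fin 3) : kron b q * eps p d e + kron d q * eps b p e =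
    kron p q * eps b d e - kron q e * eps b d p := by
  have h : kronInt b q * epsInt p d e + kronInt d q * epsInt b p e =
    kronInt p q * epsInt b d e - kronInt q e * epsInt b d p := by
    revert b d e p q; decide
  simp only [eps_eq_cast, kron_eq_cast]
  exact_mod_cast h

/-- T has density weight k + l + 1 while the two index sets together have k + l. The surplus is
absorbed by ε with upper indices, whose trace term is supplied by `eps_kron'`. -/
theorem glK_lie_epsTerm (hT : IsCovariant T) (p q : Fin 3) (a b₁ b₂ c d₁ d₂) :
    ⁅glK p q, epsTerm T a b₁ b₂ c d₁ d₂⁆ =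
      gAct p q (fun a b₁ b₂ => epsTerm T a b₁ b₂ c d₁ d₂) a b₁ b₂ +
      gAct p q (epsTerm T a b₁ b₂) c d₁ d₂ := by
  have h1 : ∑ e, eps b₂ d₂ e • kron p e • T (joint a c q) d₁ b₁ =
      ∑ e, (kron q e * eps b₂ d₂ p) • T (joint a c e) d₁ b₁ := by
    simp only [smul_comm (eps _ _ _), mul_smul]
    rw [sum_kron_smul' (fun e => eps b₂ d₂ e • T (joint a c q) d₁ b₁),
      sum_kron_smul' (fun e => eps b₂ d₂ p • T (joint a c e) d₁ b₁)]
  have h2 : ∑ e, eps b₂ d₂ e • kron p e • T (joint a c q) d₁ b₁ =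
      ∑ e, (kron p q * eps b₂ d₂ e - kron b₂ q * eps p d₂ e - kron d₂ q * eps b₂ p e) •
        T (joint a c e) d₁ b₁ := by
    rw [h1]
    refine Finset.sum_congr rfl fun e _ => ?_
    congr 1
    linear_combination eps_kron' b₂ d₂ e p q
  simp only [gAct_apply, epsTerm, lie_sum, lie_smul, hT p q, sum_joint]
  have h3 : ∀ e, eps b₂ d₂ e • (-(∑ i, kron p (a i) • T (joint (Function.update a i q) c e) d₁ b₁ +
      ∑ i, kron p (c i) • T (joint a (Function.update c i q) e) d₁ b₁ +
      kron p e • T (joint a c q) d₁ b₁) + kron d₁ q • T (joint a c e) p b₁ +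
      kron b₁ q • T (joint a c e) d₁ p +
      ((k + l + 1 : ℕ) * kron p q) • T (joint a c e) d₁ b₁) =
      (-(eps b₂ d₂ e • ∑ i, kron p (a i) • T (joint (Function.update a i q) c e) d₁ b₁)
      - (eps b₂ d₂ e • ∑ i, kron p (c i) • T (joint a (Function.update c i q) e) d₁ b₁)
      + eps b₂ d₂ e • kron d₁ q • T (joint a c e) p b₁ + eps b₂ d₂ e • kron b₁ q •
        T (joint a c e) d₁ p + (eps b₂ d₂ e * ((k + l + 1 : ℕ) * kron p q)) • T (joint a c e) d₁ b₁)
      - eps b₂ d₂ e • kron p e • T (joint a c q) d₁ b₁ := by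
    intro e
    module
  simp only [h3]
  rw [Finset.sum_sub_distrib, h2, ← Finset.sum_sub_distrib]
  have h4 : ∀ {n : ℕ} (f : Fin n → Fin 3 → Alg) (r : Fin n → ℝ),
      ∑ i, r i • ∑ e, eps b₂ d₂ e • f i e = ∑ e, eps b₂ d₂ e • ∑ i, r i • f i e := by
    intro n f r
    simp only [Finset.smul_sum]
    rw [Finset.sum_comm]
    exact Finset.sum_congr rfl fun e _ => Finset.sum_congr rfl fun i _ => smul_comm _ _ _
  rw [h4 (fun i e => T (joint (Function.update a i q) c e) d₁ b₁),
    h4 (fun i e => T (joint a (Function.update c i q) e) d₁ b₁)]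
  simp only [← Finset.sum_neg_distrib (s := (Finset.univ : Finset (Fin 3))),
    Finset.smul_sum (s := (Finset.univ : Finset (Fin 3))), ← Finset.sum_add_distrib]
  refine Finset.sum_congr rfl fun e _ => ?_
  push_cast
  module

theorem glK_lie_epsSum (hT : IsCovariant T) (p q : Fin 3) (a b₁ b₂ c d₁ d₂) :
    ⁅glK p q, epsSum T a b₁ b₂ c d₁ d₂⁆ =
      gAct p q (fun a b₁ b₂ => epsSum T a b₁ b₂ c d₁ d₂) a b₁ b₂ +
      gAct p q (epsSum T a b₁ b₂) c d₁ d₂ := by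
  have h1 : (fun a b₁ b₂ => epsSum T a b₁ b₂ c d₁ d₂) =
      (1 / 2 : ℝ) • ((fun a b₁ b₂ => epsTerm T a b₁ b₂ c d₁ d₂)
        + swapUpper (fun a b₁ b₂ => epsTerm T a b₁ b₂ c d₁ d₂)
        + (fun a b₁ b₂ => epsTerm T a b₁ b₂ c d₂ d₁)
        + swapUpper (fun a b₁ b₂ => epsTerm T a b₁ b₂ c d₂ d₁)) := by
    funext a b₁ b₂
    rw [epsSum_eq]; rfl
  have h2 : epsSum T a b₁ b₂ =
      (1 / 2 : ℝ) • (epsTerm T a b₁ b₂ + epsTerm T a b₂ b₁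
        + swapUpper (epsTerm T a b₁ b₂) + swapUpper (epsTerm T a b₂ b₁)) := by
    funext c d₁ d₂
    rw [epsSum_eq]; rfl
  rw [epsSum_eq, h1, h2]
  simp only [map_smul, map_add, gAct_swapUpper, lie_smul, lie_add, glK_lie_epsTerm hT,
    Pi.smul_apply, Pi.add_apply, swapUpper_apply]
  module

end EpsSum

end AE3

namespace AE3

/-! ### Covariant families with two index sets are determined by one component. -/

noncomputable section Trilinear

/-- A covariant family that is irreducible in two sets of indices. -/
structure IsBiTensor {k l : ℕ} (Y : GTens k (GTens l Alg)) : Prop where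
  left : ∀ c d₁ d₂, IsIrr fun a b₁ b₂ => Y a b₁ b₂ c d₁ d₂
  right : ∀ a b₁ b₂, IsIrr (Y a b₁ b₂)
  covariant : ∀ p q a b₁ b₂ c d₁ d₂, ⁅glK p q, Y a b₁ b₂ c d₁ d₂⁆ =
    gAct p q (fun a b₁ b₂ => Y a b₁ b₂ c d₁ d₂) a b₁ b₂ + gAct p q (Y a b₁ b₂) c d₁ d₂

variable {k l : ℕ} {E : (k : ℕ) → Tens k} {B : LinearMap.BilinForm ℝ Alg}

theorem IsBiTensor.sub_smul {Y Z : GTens k (GTens l Alg)} (hY : IsBiTensor Y) (hZ : IsBiTensor Z)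
    (r : ℝ) : IsBiTensor (Y - r • Z) where
  left c d₁ d₂ := (hY.left c d₁ d₂).sub ((hZ.left c d₁ d₂).smul r)
  right a b₁ b₂ := (hY.right a b₁ b₂).sub ((hZ.right a b₁ b₂).smul r)
  covariant p q a b₁ b₂ c d₁ d₂ := by
    have h1 : (fun a b₁ b₂ => (Y - r • Z) a b₁ b₂ c d₁ d₂) =
      (fun a b₁ b₂ => Y a b₁ b₂ c d₁ d₂) - r • fun a b₁ b₂ => Z a b₁ b₂ c d₁ d₂ := rfl
    have h2 : (Y - r • Z) a b₁ b₂ = Y a b₁ b₂ - r • Z a b₁ b₂ := rfl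
    rw [h1, h2, map_sub, map_sub, map_smul, map_smul]
    simp only [Pi.sub_apply, Pi.smul_apply, lie_sub, lie_smul, hY.covariant, hZ.covariant]
    module

theorem isBiTensor_epsSum {T : Tens (k + l + 1)} (hT : IsIrr T) (hc : IsCovariant T) :
    IsBiTensor (epsSum T : GTens k (GTens l Alg)) :=
  ⟨isIrr_epsSum_left hT, isIrr_epsSum_right hT, glK_lie_epsSum hc⟩

theorem isBiTensor_lie {S : Tens k} {T : Tens l} (hS : IsIrr S) (hT : IsIrr T)
    (hSc : IsCovariant S) (hTc : IsCovariant T) :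
    IsBiTensor fun a b₁ b₂ c d₁ d₂ => ⁅S a b₁ b₂, T c d₁ d₂⁆ where
  left c d₁ d₂ := by
    have h := hS.map (-(LieAlgebra.ad ℝ Alg (T c d₁ d₂) : Alg →ₗ[ℝ] Alg))
    simpa using h
  right a b₁ b₂ := hT.map (LieAlgebra.ad ℝ Alg (S a b₁ b₂) : Alg →ₗ[ℝ] Alg)
  covariant p q a b₁ b₂ c d₁ d₂ := by
    have h1 := gAct_map (-(LieAlgebra.ad ℝ Alg (T c d₁ d₂) : Alg →ₗ[ℝ] Alg)) p q S a b₁ b₂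
    have h2 := gAct_map (LieAlgebra.ad ℝ Alg (S a b₁ b₂) : Alg →ₗ[ℝ] Alg) p q T c d₁ d₂
    simp only [LinearMap.neg_apply, LieAlgebra.ad_apply, lie_skew] at h1 h2
    rw [h1, h2, leibniz_lie, hSc, hTc]

theorem gAct_diag {M : Type*} [AddCommGroup M] [Module ℝ M] (p : Fin 3) (T : GTens k M)
    (a : Fin k → Fin 3) (b₁ b₂ : Fin 3) : gAct p p T a b₁ b₂ =
      (∑ i, (1 - kron p (a i)) + kron b₁ p + kron b₂ p) • T a b₁ b₂ := by
  have h1 : ∑ i, kron p (a i) • T (Function.update a i p) b₁ b₂ =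
      (∑ i, kron p (a i)) • T a b₁ b₂ := by
    rw [Finset.sum_smul]
    refine Finset.sum_congr rfl fun i _ => ?_
    by_cases h : p = a i
    · rw [h, Function.update_eq_self]
    · rw [kron_of_ne h, zero_smul, zero_smul]
  have h2 : kron b₁ p • T a p b₂ = kron b₁ p • T a b₁ b₂ := by
    by_cases h : b₁ = p
    · rw [h]
    · rw [kron_of_ne h, zero_smul, zero_smul]
  have h3 : kron b₂ p • T a b₁ p = kron b₂ p • T a b₁ b₂ := by
    by_cases h : b₂ = p
    · rw [h]
    · rw [kron_of_ne h, zero_smul, zero_smul]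
  rw [gAct_apply, h1, h2, h3, kron_self]
  simp only [Finset.sum_sub_distrib, Finset.sum_const, Finset.card_univ, Fintype.card_fin,
    nsmul_eq_mul, mul_one]
  module

theorem kron_le_one (a b : Fin 3) : kron a b ≤ 1 := by unfold kron; split_ifs <;> norm_num

namespace IsBiTensor

variable {Y : GTens k (GTens l Alg)}

/-- A nonzero pairing requires equal weights under the diagonal K's. The weight of K^1_1 forces
every c to be the first index and excludes it from the d's; that of K^2_2 leaves one d equal to each
of the other two values. -/
theorem form_lowest_eq_zero (hY : IsBiTensor Y) (hE : IsGradientFamily E) (hB : IsStandardForm B)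
    (h0 : B (Y (fun _ => 0) 2 2 (fun _ => 0) 1 2) (transposeFamily E (k + l + 1) (fun _ => 0) 2 2) = 0)
    (c : Fin l → Fin 3) (d₁ d₂ : Fin 3) :
    B (Y (fun _ => 0) 2 2 c d₁ d₂) (transposeFamily E (k + l + 1) (fun _ => 0) 2 2) = 0 := by
  by_contra hne
  have hw : ∀ p, (∑ i : Fin k, (1 - kron p 0) + kron 2 p + kron 2 p) +
      (∑ i, (1 - kron p (c i)) + kron d₁ p + kron d₂ p) =
      ∑ i : Fin (k + l + 1), (1 - kron p 0) + kron 2 p + kron 2 p := by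
    intro p
    have h := form_glK_lie hE hB (k + l + 1) p p (Y (fun _ => 0) 2 2 c d₁ d₂) (fun _ => 0) 2 2
    rw [hY.covariant, gAct_diag, gAct_diag, gAct_diag, ← add_smul, map_smul,
      LinearMap.smul_apply, smul_eq_mul, smul_eq_mul] at h
    exact mul_right_cancel₀ hne h
  have hw0 := hw 0
  have hw1 := hw 1
  simp only [kron_self, kron_of_ne (show (2 : Fin 3) ≠ 0 by decide),
    kron_of_ne (show (1 : Fin 3) ≠ 0 by decide), kron_of_ne (show (2 : Fin 3) ≠ 1 by decide),
    sub_self, Finset.sum_const_zero, sub_zero, Finset.sum_const, Finset.card_univ,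
    Fintype.card_fin, nsmul_eq_mul, mul_one, add_zero, zero_add] at hw0 hw1
  have hnn : ∀ i, 0 ≤ 1 - kron 0 (c i) := fun i => sub_nonneg.2 (kron_le_one _ _)
  have hs := Finset.sum_nonneg fun i (_ : i ∈ Finset.univ) => hnn i
  have hk1 := kron_nonneg d₁ 0
  have hk2 := kron_nonneg d₂ 0
  have hd₁ : d₁ ≠ 0 := by
    rintro rfl
    rw [kron_self] at hw0
    linarith
  have hd₂ : d₂ ≠ 0 := by
    rintro rfl
    rw [kron_self] at hw0
    linarith
  have hc : c = fun _ => 0 := by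
    funext i
    have hi := (Finset.sum_eq_zero_iff_of_nonneg fun i _ => hnn i).1
      (by linarith : ∑ i, (1 - kron 0 (c i)) = 0) i (Finset.mem_univ i)
    by_contra hi0
    rw [kron_of_ne (Ne.symm hi0)] at hi
    norm_num at hi
  subst hc
  simp only [kron_of_ne (show (1 : Fin 3) ≠ 0 by decide), sub_zero, Finset.sum_const,
    Finset.card_univ, Fintype.card_fin, nsmul_eq_mul, mul_one] at hw1
  push_cast at hw1
  have h3 : ∀ d : Fin 3, d ≠ 0 → d = 1 ∨ d = 2 := by decide
  rcases h3 d₁ hd₁ with rfl | rfl <;> rcases h3 d₂ hd₂ with rfl | rfl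
  · rw [kron_self] at hw1
    linarith
  · exact hne h0
  · rw [(hY.right _ _ _).symm_right] at hne
    exact hne h0
  · rw [kron_of_ne (by decide)] at hw1
    linarith

/-- A covariant family with two sets of irreducible indices is orthogonal to the transposed
gradient generators if one of its components is. -/
theorem gradientPart_eq_zero (hY : IsBiTensor Y) (hE : IsGradientFamily E) (hB : IsStandardForm B)
    (h0 : B (Y (fun _ => 0) 2 2 (fun _ => 0) 1 2) (transposeFamily E (k + l + 1) (fun _ => 0) 2 2) = 0)
    (a b₁ b₂ c d₁ d₂) : gradientPart E B (k + l + 1) (Y a b₁ b₂ c d₁ d₂) = 0 := by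
  -- Lowering operators act on these components only through the second index set, because the first
  -- one is at its lowest. The span is therefore stable under lowering, and orthogonality to the
  -- lowest F suffices.
  have hlow : ∀ c d₁ d₂, gradientPart E B (k + l + 1) (Y (fun _ => 0) 2 2 c d₁ d₂) = 0 := by
    intro c d₁ d₂
    have hmem := mem_tensorSpan (Y (fun _ => 0) 2 2)
    have h := fun c' d₁' d₂' => form_eq_zero_of_lowest hE hB (k := k + l + 1)
      (S := tensorSpan (Y (fun _ => 0) 2 2)) (fun p q hpq x hx => ?_) (fun x hx => ?_)
      (hmem c d₁ d₂) c' d₁' d₂'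
    · rw [gradientPart_apply]
      simp only [h, zero_smul, Finset.sum_const_zero]
    · refine Submodule.span_induction (p := fun x _ => ⁅glK q p, x⁆ ∈ _) ?_ ?_ ?_ ?_ hx
      · rintro x ⟨c, d₁, d₂, rfl⟩
        rw [hY.covariant, gAct_lowest_eq_zero _ hpq, zero_add, gAct_apply]
        exact add_mem (add_mem (add_mem (neg_mem (sum_mem fun i _ =>
          Submodule.smul_mem _ _ (hmem _ _ _))) (Submodule.smul_mem _ _ (hmem _ _ _)))
          (Submodule.smul_mem _ _ (hmem _ _ _))) (Submodule.smul_mem _ _ (hmem _ _ _))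
      · rw [lie_zero]; exact zero_mem _
      · intro x y _ _ hx hy
        rw [lie_add]; exact add_mem hx hy
      · intro r x _ hx
        rw [lie_smul]; exact Submodule.smul_mem _ _ hx
    · refine Submodule.span_induction (p := fun x _ => B x _ = 0) ?_ ?_ ?_ ?_ hx
      · rintro x ⟨c, d₁, d₂, rfl⟩
        exact hY.form_lowest_eq_zero hE hB h0 c d₁ d₂
      · rw [map_zero, LinearMap.zero_apply]
      · intro x y _ _ hx hy
        rw [map_add, LinearMap.add_apply, hx, hy, add_zero]
      · intro r x _ hx
        rw [map_smul, LinearMap.smul_apply, hx, smul_zero]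
  have hstab : ∀ p q x, gradientPart E B (k + l + 1) x = 0 →
      gradientPart E B (k + l + 1) ⁅glK p q, x⁆ = 0 := by
    intro p q x hx
    have h1 : (fun c d₁ d₂ => B x (transposeFamily E (k + l + 1) c d₁ d₂)) = 0 := by
      funext c d₁ d₂
      rw [← form_gradientPart hE hB, hx, map_zero, LinearMap.zero_apply]; rfl
    rw [gradientPart_apply]
    simp only [form_glK_lie hE hB, h1, map_zero, Pi.zero_apply, zero_smul, Finset.sum_const_zero]
  let R : GTens k (GTens l Alg) := fun a b₁ b₂ c d₁ d₂ =>
    gradientPart E B (k + l + 1) (Y a b₁ b₂ c d₁ d₂)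
  have hR : IsIrr R :=
    ⟨fun σ a b₁ b₂ => funext fun c => funext fun d₁ => funext fun d₂ =>
      congrArg _ ((hY.left c d₁ d₂).symm_left σ a b₁ b₂),
    fun a b₁ b₂ => funext fun c => funext fun d₁ => funext fun d₂ =>
      congrArg _ ((hY.left c d₁ d₂).symm_right a b₁ b₂),
    fun i a b => funext fun c => funext fun d₁ => funext fun d₂ => by
      simp only [Finset.sum_apply, R, ← map_sum]
      rw [(hY.left c d₁ d₂).traceless i a b, map_zero]; rfl⟩
  -- The first index set is now raised. Covariance expresses the action on it through the bracket,
  -- under which the kernel of the projection is stable, and through the action on the second set,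
  -- where everything already vanishes.
  have h := hR.eq_zero (fun p q _ a b₁ b₂ h => by
    funext c d₁ d₂
    rw [gAct_map₂]
    have h1 := gAct_map (gradientPart E B (k + l + 1)) p q (fun a b₁ b₂ => Y a b₁ b₂ c d₁ d₂) a b₁ b₂
    have h2 := gAct_map (gradientPart E B (k + l + 1)) p q (Y a b₁ b₂) c d₁ d₂
    refine h1.trans ?_
    rw [← sub_eq_of_eq_add (hY.covariant p q a b₁ b₂ c d₁ d₂), map_sub, ← h2,
      hstab p q _ (congrFun (congrFun (congrFun h c) d₁) d₂), zero_sub]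
    have h3 : (fun c d₁ d₂ => gradientPart E B (k + l + 1) (Y a b₁ b₂ c d₁ d₂)) = 0 := h
    rw [h3, map_zero]
    exact neg_zero)
    (funext fun c => funext fun d₁ => funext fun d₂ => hlow c d₁ d₂) a b₁ b₂
  exact congrFun (congrFun (congrFun h c) d₁) d₂

end IsBiTensor

theorem epsSum_lowest (T : Tens (k + l + 1)) :
    epsSum T (fun _ : Fin k => 0) 2 2 (fun _ : Fin l => 0) 1 2 = -T (fun _ => 0) 2 2 := by
  have h : joint (fun _ : Fin k => (0 : Fin 3)) (fun _ : Fin l => 0) 0 = fun _ => 0 := by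
    funext i
    refine Fin.lastCases ?_ (fun i => ?_) i
    · rw [joint_last]
    · refine Fin.addCases (fun i => ?_) (fun i => ?_) i
      · rw [joint_castAdd]
      · rw [joint_natAdd]
  rw [epsSum_eq]
  simp only [epsTerm, Fin.sum_univ_three, h]
  simp [eps]
  module

theorem form_lowest (hE : IsGradientFamily E) (hB : IsStandardForm B) (k : ℕ) :
    B (E k (fun _ => 0) 2 2) (transposeFamily E k (fun _ => 0) 2 2) = 1 := by
  rw [form_gradient hE hB, proj_lowest]

theorem epsSum_mem (T : Tens (k + l + 1)) (a : Fin k → Fin 3) (b₁ b₂) (c : Fin l → Fin 3) (d₁ d₂) :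
    epsSum T a b₁ b₂ c d₁ d₂ ∈ tensorSpan T := by
  refine sum_mem fun e _ => ?_
  exact add_mem (add_mem (add_mem (Submodule.smul_mem _ _ (mem_tensorSpan _ _ _ _))
    (Submodule.smul_mem _ _ (mem_tensorSpan _ _ _ _)))
    (Submodule.smul_mem _ _ (mem_tensorSpan _ _ _ _)))
    (Submodule.smul_mem _ _ (mem_tensorSpan _ _ _ _))

/-- By the preceding reduction one loop commutator decides: y_{k+1} with half of the Cartan
generator of mode l+1 gives y_{k+l+2}, while `epsSum` takes the opposite value there by
`epsSum_lowest`. -/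
theorem lie_add_epsSum_mem (hE : IsGradientFamily E) (hB : IsStandardForm B)
    (a : Fin k → Fin 3) (b₁ b₂) (c : Fin l → Fin 3) (d₁ d₂) :
    ⁅E k a b₁ b₂, E l c d₁ d₂⁆ + epsSum (E (k + l + 1)) a b₁ b₂ c d₁ d₂ ∈
      gradientPerp E B (k + l + 1) := by
  have hY := (isBiTensor_lie (hE.irr k) (hE.irr l) (hE.isCovariant k)
    (hE.isCovariant l)).sub_smul (isBiTensor_epsSum (hE.irr (k + l + 1))
    (hE.isCovariant (k + l + 1))) (-1)
  have hadd : ∀ a b₁ b₂ c d₁ d₂, ((fun a b₁ b₂ c d₁ d₂ => ⁅E k a b₁ b₂, E l c d₁ d₂⁆ :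
      GTens k (GTens l Alg)) - (-1 : ℝ) • (epsSum (E (k + l + 1)) : GTens k (GTens l Alg)))
      a b₁ b₂ c d₁ d₂ = ⁅E k a b₁ b₂, E l c d₁ d₂⁆ + epsSum (E (k + l + 1)) a b₁ b₂ c d₁ d₂ := by
    intro a b₁ b₂ c d₁ d₂
    simp only [Pi.sub_apply, Pi.smul_apply]
    module
  refine ⟨add_mem (lie_mem_level ?_ (hE.mem_level k a b₁ b₂) (hE.mem_level l c d₁ d₂))
    (tensorSpan_le_level hE _ (epsSum_mem _ _ _ _ _ _ _)), ?_⟩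
  · push_cast; ring
  · have h := hY.gradientPart_eq_zero hE hB ?_ a b₁ b₂ c d₁ d₂
    · rw [hadd] at h
      exact h
    · rw [hadd, epsSum_lowest, hE.lowest, hE.loopValued.hh, lie_smul, ← lie_skew,
        loopRelations.hy, hE.lowest]
      push_cast
      rw [show ((l : ℤ) + 1 + (k + 1)) = k + l + 1 + 1 by ring]
      have : (1 / 2 : ℝ) • -((-2 : ℝ) • loopY ((k : ℤ) + l + 1 + 1)) +
        -loopY ((k : ℤ) + l + 1 + 1) = 0 := by module
      rw [this, map_zero, LinearMap.zero_apply]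

/-- The scalar is read off from the single decisive component, on which `epsSum` is minus the lowest
vector of norm one; this explains the sign. -/
theorem eq_smul_epsSum (hE : IsGradientFamily E) (hB : IsStandardForm B)
    {X : GTens k (GTens l Alg)} (hX : IsBiTensor X)
    (hG : ∀ a b₁ b₂ c d₁ d₂, X a b₁ b₂ c d₁ d₂ ∈ tensorSpan (E (k + l + 1))) :
    ∃ r : ℝ, ∀ a b₁ b₂ c d₁ d₂, X a b₁ b₂ c d₁ d₂ =
      r • epsSum (E (k + l + 1)) a b₁ b₂ c d₁ d₂ := by
  refine ⟨-B (X (fun _ => 0) 2 2 (fun _ => 0) 1 2)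
    (transposeFamily E (k + l + 1) (fun _ => 0) 2 2), fun a b₁ b₂ c d₁ d₂ => ?_⟩
  have h := (hX.sub_smul (isBiTensor_epsSum (hE.irr (k + l + 1)) (hE.isCovariant (k + l + 1)))
    (-B (X (fun _ => 0) 2 2 (fun _ => 0) 1 2)
      (transposeFamily E (k + l + 1) (fun _ => 0) 2 2))).gradientPart_eq_zero hE hB ?_
    a b₁ b₂ c d₁ d₂
  · simp only [Pi.sub_apply, Pi.smul_apply] at h
    rw [gradientPart_eq hE hB (sub_mem (hG _ _ _ _ _ _)
      (Submodule.smul_mem _ _ (epsSum_mem _ _ _ _ _ _ _)))] at h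
    exact sub_eq_zero.1 h
  · simp only [Pi.sub_apply, Pi.smul_apply]
    rw [epsSum_lowest, map_sub, LinearMap.sub_apply, map_smul, LinearMap.smul_apply, map_neg,
      LinearMap.neg_apply, form_lowest hE hB, smul_eq_mul]
    ring

end Trilinear

end AE3

namespace AE3

/-! ### The commutator at opposite levels, in gl_3. -/

noncomputable section OppositeLevels

variable {k l m : ℕ} {E : (k : ℕ) → Tens k} {B : LinearMap.BilinForm ℝ Alg}
  {M : Type*} [AddCommGroup M] [Module ℝ M]

/-- Invariance under the diagonal K's leaves only pairs of opposite weight. These are fixed by the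
Chevalley normalization and by the Cartan matrix; the trace term comes from the Cartan block. -/
theorem form_glK_glK (hB : IsStandardForm B) (a b c d : Fin 3) :
    B (glK a b) (glK c d) = kron c b * kron a d - kron a b * kron c d := by
  have hw : ∀ p, (kron p a - kron p b + kron p c - kron p d) * B (glK a b) (glK c d) = 0 := by
    intro p
    have h := hB.lie_left (glK p p) (glK a b) (glK c d)
    simp only [glK_lie_glK] at h
    have h1 : ∀ u v, kron u p • glK p v - kron p v • glK u p = (kron p u - kron p v) • glK u v := by
      intro u v
      rw [sub_smul]
      by_cases h2 : p = u <;> by_cases h3 : p = v <;> simp [kron, h2, h3, Ne.symm]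
      all_goals try simp_all
      all_goals tauto
    rw [h1, h1, map_smul, map_smul, LinearMap.smul_apply, smul_eq_mul, smul_eq_mul] at h
    linear_combination h
  have e01 : B (glK 0 1) (glK 1 0) = 1 := (hB.ef 0 0).trans (if_pos rfl)
  have e12 : B (glK 1 2) (glK 2 1) = 1 := (hB.ef 1 1).trans (if_pos rfl)
  have e02 : B (glK 0 2) (glK 2 0) = 1 := by
    have h := hB.invariant (glK 0 1) (glK 1 2) (glK 2 0)
    rw [glK_lie_glK, glK_lie_glK] at h
    simpa [kron, e01] using h
  have hh : ∀ p q, B (glK p p) (glK q q) = kron p q - 1 := by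
    intro p q
    fin_cases p <;> fin_cases q <;>
      simp [glK, kron, hB.hh, cartan] <;> norm_num
  by_cases hab : a = b
  · subst hab
    by_cases hcd : c = d
    · subst hcd
      rw [hh, kron_self, kron_self, one_mul]
      by_cases hac : c = a
      · subst hac
        simp only [kron_self, mul_one]
      · rw [kron_of_ne hac, kron_of_ne (Ne.symm hac)]
        ring
    · have h := hw c
      rw [sub_self, zero_add, kron_self, kron_of_ne hcd, sub_zero, one_mul] at h
      rw [h, kron_of_ne hcd]
      by_cases hca : c = a
      · subst hca
        rw [kron_of_ne hcd, mul_zero, sub_zero]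
      · rw [kron_of_ne hca, zero_mul, mul_zero, sub_zero]
  · rw [kron_of_ne hab, zero_mul, sub_zero]
    by_cases hda : a = d
    · subst hda
      by_cases hcb : c = b
      · subst hcb
        rw [kron_self, kron_self, mul_one]
        fin_cases a <;> fin_cases c <;> first | exact absurd rfl hab | assumption |
          exact (hB.symm _ _).trans (by assumption)
      · have h := hw b
        rw [kron_of_ne (Ne.symm hab), kron_self, kron_of_ne (Ne.symm hcb)] at h
        rw [kron_of_ne hcb]
        linarith
    · have h := hw a
      rw [kron_self, kron_of_ne hab, kron_of_ne hda] at h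
      have h1 : (1 : ℝ) - 0 + kron a c - 0 ≠ 0 := by
        have := kron_nonneg a c
        linarith
      rw [(mul_eq_zero.1 h).resolve_left h1, kron_of_ne hda, mul_zero]

theorem sum_prod_kron (e : Fin k → Fin 3) (f : (Fin k → Fin 3) → M) :
    ∑ g : Fin k → Fin 3, (∏ i, kron (g i) (e i)) • f g = f e := by
  simp only [prod_kron, ite_smul, one_smul, zero_smul, Finset.sum_ite_eq', Finset.mem_univ, if_true]

theorem sum_prod_erase_kron (e : Fin k → Fin 3) (i : Fin k) (f : (Fin k → Fin 3) → M) :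
    ∑ g : Fin k → Fin 3, (∏ j ∈ Finset.univ.erase i, kron (g j) (e j)) • f g =
      ∑ s, f (Function.update e i s) := by
  have h : ∀ g : Fin k → Fin 3, ∏ j ∈ Finset.univ.erase i, kron (g j) (e j) =
      ∑ s, ∏ j, kron (g j) (Function.update e i s j) := by
    intro g
    have h1 : ∀ s, ∏ j, kron (g j) (Function.update e i s j) =
        kron s (g i) * ∏ j ∈ Finset.univ.erase i, kron (g j) (e j) := by
      intro s
      simp only [kron_comm (g _)]
      exact prod_kron_update e g i s
    simp only [h1]
    exact (sum_kron_mul (fun _ => _) _).symm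
  simp only [h, Finset.sum_smul]
  rw [Finset.sum_comm]
  simp only [sum_prod_kron]

theorem eq_zero_of_form_glK (hB : IsStandardForm B) {x : Alg} (hx : x ∈ level 0)
    (h : ∀ p q, B x (glK p q) = 0) : x = 0 := by
  rw [level_zero] at hx
  have h1 : ∃ r : Fin 3 → Fin 3 → ℝ, x = ∑ a, ∑ b, r a b • glK a b := by
    refine Submodule.span_induction (p := fun x _ => ∃ r : Fin 3 → Fin 3 → ℝ,
      x = ∑ a, ∑ b, r a b • glK a b) ?_ ?_ ?_ ?_ hx
    · rintro x ⟨a, b, rfl⟩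
      refine ⟨fun c d => kron a c * kron b d, ?_⟩
      simp only [mul_smul, ← Finset.smul_sum, sum_kron_smul']
    · exact ⟨0, by simp⟩
    · rintro x y _ _ ⟨r, rfl⟩ ⟨s, rfl⟩
      refine ⟨r + s, ?_⟩
      simp only [Pi.add_apply, add_smul, Finset.sum_add_distrib]
    · rintro t x _ ⟨r, rfl⟩
      refine ⟨t • r, ?_⟩
      simp only [Pi.smul_apply, smul_eq_mul, mul_smul, Finset.smul_sum]
  obtain ⟨r, rfl⟩ := h1
  have h2 : ∀ p q, r q p = (∑ a, r a a) * kron p q := by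
    intro p q
    have h3 := h p q
    simp only [map_sum, LinearMap.sum_apply, map_smul, LinearMap.smul_apply, smul_eq_mul] at h3
    simp only [form_glK_glK hB, Fin.sum_univ_three] at h3
    rw [Fin.sum_univ_three]
    fin_cases p <;> fin_cases q <;> simp [kron] at h3 ⊢ <;> linarith
  -- Orthogonality makes the coefficient matrix its trace times the identity. In dimension three the
  -- trace is then three times itself, hence zero.
  have h4 : ∑ a, r a a = 0 := by
    have h5 : ∑ a, r a a = ∑ p : Fin 3, (∑ a, r a a) * kron p p :=
      Finset.sum_congr rfl fun p _ => h2 p p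
    simp only [kron_self, mul_one, Finset.sum_const, Finset.card_univ, Fintype.card_fin] at h5
    rw [nsmul_eq_mul] at h5
    push_cast at h5
    linarith
  refine Finset.sum_eq_zero fun a _ => Finset.sum_eq_zero fun b _ => ?_
  rw [h2 b a, h4, zero_mul, zero_smul]

theorem form_glTr_glK (hB : IsStandardForm B) (p q : Fin 3) :
    B glTr (glK p q) = -2 * kron p q := by
  simp only [glTr, map_sum, LinearMap.sum_apply, form_glK_glK hB, kron_self]
  fin_cases p <;> fin_cases q <;> simp [kron] <;> norm_num

/-- Pairing the gl_3 element with K^p_q reproduces the action of K^p_q on P term by term: the term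
with K cancels the trace part of the second term, and the trace parts of the last one give the
density weight. -/
theorem form_glSum (hB : IsStandardForm B) (a : Fin k → Fin 3) (b₁ b₂) (c : Fin k → Fin 3)
    (d₁ d₂) (p q : Fin 3) : B (glSum a b₁ b₂ c d₁ d₂) (glK p q) =
      -∑ e, ∑ f₁, ∑ f₂, proj a b₁ b₂ e f₁ f₂ •
        gAct p q (fun g h₁ h₂ => proj g h₁ h₂ c d₁ d₂) e f₁ f₂ := by
  have hsplit : ∀ (e : Fin k → Fin 3) (f₁ f₂ : Fin 3), ∑ g : Fin k → Fin 3, ∑ h₁, ∑ h₂,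
      (proj a b₁ b₂ e f₁ f₂ * proj g h₁ h₂ c d₁ d₂) *
        (((∏ i, kron (g i) (e i)) * kron f₁ h₁ * kron f₂ h₂) * (-2 * kron p q)
        - (2 * (∏ i, kron (g i) (e i)) * kron f₁ h₁) *
          (kron p h₂ * kron f₂ q - kron f₂ h₂ * kron p q)
        + (kron f₁ h₁ * kron f₂ h₂) *
            ∑ i, (∏ j ∈ Finset.univ.erase i, kron (g j) (e j)) *
              (kron p (e i) * kron (g i) q - kron (g i) (e i) * kron p q)) =
      proj a b₁ b₂ e f₁ f₂ * (-2 * kron p q * proj e f₁ f₂ c d₁ d₂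
        - 2 * (kron f₂ q * proj e f₁ p c d₁ d₂ - kron p q * proj e f₁ f₂ c d₁ d₂)
        + ∑ i, (kron p (e i) * proj (Function.update e i q) f₁ f₂ c d₁ d₂
          - kron p q * proj e f₁ f₂ c d₁ d₂)) := by
    intro e f₁ f₂
    have e1 : ∑ g : Fin k → Fin 3, ∑ h₁, ∑ h₂, (∏ i, kron (g i) (e i)) • kron f₁ h₁ • kron f₂ h₂ •
        proj g h₁ h₂ c d₁ d₂ = proj e f₁ f₂ c d₁ d₂ := by
      simp only [← Finset.smul_sum, sum_kron_smul', sum_prod_kron]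
    have e2 : ∑ g : Fin k → Fin 3, ∑ h₁, ∑ h₂, (∏ i, kron (g i) (e i)) • kron f₁ h₁ • kron p h₂ •
        proj g h₁ h₂ c d₁ d₂ = proj e f₁ p c d₁ d₂ := by
      simp only [← Finset.smul_sum, sum_kron_smul', sum_prod_kron]
    have e3 : ∀ i, ∑ g : Fin k → Fin 3, ∑ h₁, ∑ h₂, (∏ j ∈ Finset.univ.erase i, kron (g j) (e j)) •
        kron f₁ h₁ • kron f₂ h₂ • kron (g i) q • proj g h₁ h₂ c d₁ d₂ = proj (Function.update e i q) f₁ f₂ c d₁ d₂ := by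
      intro i
      simp only [← Finset.smul_sum, sum_kron_smul', sum_prod_erase_kron, Function.update_self]
      exact sum_kron_smul (fun s => proj (Function.update e i s) f₁ f₂ c d₁ d₂) q
    have e4 : ∀ i, ∑ g : Fin k → Fin 3, ∑ h₁, ∑ h₂, (∏ j ∈ Finset.univ.erase i, kron (g j) (e j)) •
        kron f₁ h₁ • kron f₂ h₂ • kron (g i) (e i) • proj g h₁ h₂ c d₁ d₂ = proj e f₁ f₂ c d₁ d₂ := by
      intro i
      simp only [← Finset.smul_sum, sum_kron_smul', sum_prod_erase_kron, Function.update_self]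
      exact (sum_kron_smul (fun s => proj (Function.update e i s) f₁ f₂ c d₁ d₂) (e i)).trans (by
        rw [Function.update_eq_self])
    have e5 : ∑ i, (kron p (e i) * proj (Function.update e i q) f₁ f₂ c d₁ d₂ - kron p q * proj e f₁ f₂ c d₁ d₂) =
        ∑ g : Fin k → Fin 3, ∑ h₁, ∑ h₂, ∑ i, (kron p (e i) *
          ((∏ j ∈ Finset.univ.erase i, kron (g j) (e j)) •
            kron f₁ h₁ • kron f₂ h₂ • kron (g i) q • proj g h₁ h₂ c d₁ d₂) - kron p q *
          ((∏ j ∈ Finset.univ.erase i, kron (g j) (e j)) •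
            kron f₁ h₁ • kron f₂ h₂ • kron (g i) (e i) • proj g h₁ h₂ c d₁ d₂)) := by
      have hc : ∀ F : (Fin k → Fin 3) → Fin 3 → Fin 3 → Fin k → ℝ, ∑ g, ∑ h₁, ∑ h₂, ∑ i, F g h₁ h₂ i
          = ∑ i, ∑ g, ∑ h₁, ∑ h₂, F g h₁ h₂ i := by
        intro F
        simp only [Finset.sum_comm (s := (Finset.univ : Finset (Fin 3)))
          (t := (Finset.univ : Finset (Fin k)))]
        rw [Finset.sum_comm]
      rw [hc]
      refine Finset.sum_congr rfl fun i _ => ?_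
      simp only [Finset.sum_sub_distrib, ← Finset.mul_sum, e3, e4]
    rw [e5, ← e1, ← e2]
    simp only [Finset.mul_sum, ← Finset.sum_sub_distrib, ← Finset.sum_add_distrib]
    refine Finset.sum_congr rfl fun g _ => Finset.sum_congr rfl fun h₁ _ =>
      Finset.sum_congr rfl fun h₂ _ => ?_
    simp only [smul_eq_mul, mul_add, Finset.mul_sum]
    congr 1
    · ring
    · exact Finset.sum_congr rfl fun i _ => by ring
  simp only [glSum, map_sum, LinearMap.sum_apply, map_smul, LinearMap.smul_apply, map_add, map_sub,
    LinearMap.add_apply, LinearMap.sub_apply, form_glK_glK hB, form_glTr_glK hB, smul_eq_mul]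
  refine (Finset.sum_congr rfl fun e _ => Finset.sum_congr rfl fun f₁ _ =>
    Finset.sum_congr rfl fun f₂ _ => hsplit e f₁ f₂).trans ?_
  rw [← Finset.sum_neg_distrib]
  refine Finset.sum_congr rfl fun e _ => ?_
  -- The action treats both upper indices, the formula only one with a factor 2; symmetry of the
  -- projectors identifies the two contributions.
  have hsym : ∑ f₁, ∑ f₂, proj a b₁ b₂ e f₁ f₂ * (kron f₁ q * proj e p f₂ c d₁ d₂) =
      ∑ f₁, ∑ f₂, proj a b₁ b₂ e f₁ f₂ * (kron f₂ q * proj e f₁ p c d₁ d₂) := by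
    rw [Finset.sum_comm]
    refine Finset.sum_congr rfl fun f₁ _ => Finset.sum_congr rfl fun f₂ _ => ?_
    rw [(isIrr_proj_right a b₁ b₂).symm_right, (isIrr_proj_left c d₁ d₂).symm_right e p]
  have hR : ∀ f₁ f₂, proj a b₁ b₂ e f₁ f₂ • gAct p q (fun g h₁ h₂ => proj g h₁ h₂ c d₁ d₂) e f₁ f₂ =
      proj a b₁ b₂ e f₁ f₂ * (kron f₁ q * proj e p f₂ c d₁ d₂) +
      proj a b₁ b₂ e f₁ f₂ * (-(∑ i, kron p (e i) * proj (Function.update e i q) f₁ f₂ c d₁ d₂)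
        + kron f₂ q * proj e f₁ p c d₁ d₂ + k * kron p q * proj e f₁ f₂ c d₁ d₂) := by
    intro f₁ f₂
    rw [gAct_apply]
    simp only [smul_eq_mul]
    ring
  have hR' : ∑ f₁, ∑ f₂, proj a b₁ b₂ e f₁ f₂ •
      gAct p q (fun g h₁ h₂ => proj g h₁ h₂ c d₁ d₂) e f₁ f₂ =
      ∑ f₁, ∑ f₂, (proj a b₁ b₂ e f₁ f₂ * (kron f₂ q * proj e f₁ p c d₁ d₂) +
      proj a b₁ b₂ e f₁ f₂ * (-(∑ i, kron p (e i) * proj (Function.update e i q) f₁ f₂ c d₁ d₂)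
        + kron f₂ q * proj e f₁ p c d₁ d₂ + k * kron p q * proj e f₁ f₂ c d₁ d₂)) := by
    simp only [hR, Finset.sum_add_distrib, hsym]
  refine Eq.trans ?_ (congrArg Neg.neg hR').symm
  simp only [← Finset.sum_neg_distrib]
  refine Finset.sum_congr rfl fun f₁ _ => Finset.sum_congr rfl fun f₂ _ => ?_
  simp only [Finset.sum_sub_distrib, Finset.sum_neg_distrib, Finset.sum_const, Finset.card_univ,
    Fintype.card_fin, nsmul_eq_mul]
  ring

/-- Both sides have level zero, where the form is nondegenerate on gl_3. By invariance ⟨[E,F]|K⟩ is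
⟨[K,E]|F⟩, the action of K on the pairing P; contraction with the left projector changes nothing
because E is irreducible. -/
theorem lie_transpose_eq_glSum (hE : IsGradientFamily E) (hB : IsStandardForm B)
    (a : Fin k → Fin 3) (b₁ b₂) (c : Fin k → Fin 3) (d₁ d₂) :
    ⁅E k a b₁ b₂, transposeFamily E k c d₁ d₂⁆ = -glSum a b₁ b₂ c d₁ d₂ := by
  rw [← sub_eq_zero, sub_neg_eq_add]
  refine eq_zero_of_form_glK hB (add_mem ?_ ?_) fun p q => ?_
  · exact lie_mem_level (by ring) (hE.mem_level k a b₁ b₂)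
      (transpose_mem_level (hE.mem_level k c d₁ d₂))
  · rw [level_zero]
    refine sum_mem fun e _ => sum_mem fun f₁ _ => sum_mem fun f₂ _ => sum_mem fun g _ =>
      sum_mem fun h₁ _ => sum_mem fun h₂ _ => Submodule.smul_mem _ _ (add_mem (sub_mem
      (Submodule.smul_mem _ _ ?_) (Submodule.smul_mem _ _ (glK_mem_glSpan _ _)))
      (Submodule.smul_mem _ _ (sum_mem fun i _ => Submodule.smul_mem _ _ (glK_mem_glSpan _ _))))
    exact sum_mem fun i _ => glK_mem_glSpan i i
  · rw [map_add, LinearMap.add_apply, form_glSum hB, hB.symm, ← hB.invariant]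
    have hT : IsIrr fun a b₁ b₂ => B ⁅glK p q, E k a b₁ b₂⁆ (transposeFamily E k c d₁ d₂) :=
      (hE.irr k).map ((B.flip (transposeFamily E k c d₁ d₂)) ∘ₗ
        (LieAlgebra.ad ℝ Alg (glK p q) : Alg →ₗ[ℝ] Alg))
    have h1 : ∀ a b₁ b₂, B ⁅glK p q, E k a b₁ b₂⁆ (transposeFamily E k c d₁ d₂) =
        gAct p q (fun g h₁ h₂ => proj g h₁ h₂ c d₁ d₂) a b₁ b₂ := by
      intro a b₁ b₂
      have h2 := gAct_map (B.flip (transposeFamily E k c d₁ d₂)) p q (E k) a b₁ b₂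
      rw [hE.isCovariant]
      refine h2.symm.trans ?_
      exact congrArg (fun T => gAct p q T a b₁ b₂) (funext fun a => funext fun b₁ =>
        funext fun b₂ => form_gradient hE hB k a b₁ b₂ c d₁ d₂)
    have h3 := congrFun (congrFun (congrFun hT.projSmul_eq a) b₁) b₂
    rw [← h3]
    simp only [projSmul, h1]
    exact add_neg_cancel _

end OppositeLevels

end AE3

namespace AE3

/-! ### Commutators of E and F at different levels. -/

noncomputable section MixedLevels

variable {k l m : ℕ} {E : (k : ℕ) → Tens k} {B : LinearMap.BilinForm ℝ Alg}
  {M : Type*} [AddCommMonoid M]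

theorem sum_eq_sum_joint (f : (Fin (k + l + 1) → Fin 3) → M) :
    ∑ e, f e = ∑ g : Fin k → Fin 3, ∑ n : Fin l → Fin 3, ∑ s, f (joint g n s) := by
  rw [← (Fin.snocEquiv fun _ : Fin (k + l + 1) => Fin 3).sum_comp, Fintype.sum_prod_type,
    Finset.sum_comm, ← (Fin.appendEquiv k l).sum_comp, Fintype.sum_prod_type]
  rfl

theorem sum_reorder {α β γ δ ε ζ : Type*} [Fintype α] [Fintype β] [Fintype γ] [Fintype δ]
    [Fintype ε] [Fintype ζ] (f : α → β → γ → δ → ε → ζ → M) :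
    ∑ h₁, ∑ h₂, ∑ n, ∑ q₁, ∑ q₂, ∑ s, f h₁ h₂ n q₁ q₂ s =
      ∑ n, ∑ s, ∑ h₁, ∑ q₁, ∑ h₂, ∑ q₂, f h₁ h₂ n q₁ q₂ s := by
  simp only [← Fintype.sum_prod_type']
  exact Fintype.sum_equiv ⟨fun x => (x.2.2.1, x.2.2.2.2.2, x.1, x.2.2.2.1, x.2.1, x.2.2.2.2.1),
    fun x => (x.2.2.1, x.2.2.2.2.1, x.1, x.2.2.2.1, x.2.2.2.2.2, x.2.1), fun _ => rfl,
    fun _ => rfl⟩ _ _ fun _ => rfl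

theorem transpose_epsSum (T : Tens (k + l + 1)) (a : Fin k → Fin 3) (b₁ b₂) (c : Fin l → Fin 3)
    (d₁ d₂) : transpose (epsSum T a b₁ b₂ c d₁ d₂) =
      epsSum (fun a b₁ b₂ => transpose (T a b₁ b₂)) a b₁ b₂ c d₁ d₂ := by
  simp only [epsSum, transpose_sum, transpose_add, transpose_smul]

theorem transpose_projSum (T : Tens m) (a : Fin (k + m + 1) → Fin 3) (b₁ b₂) (c : Fin k → Fin 3)
    (d₁ d₂) : transpose (projSum T a b₁ b₂ c d₁ d₂) =
      projSum (fun a b₁ b₂ => transpose (T a b₁ b₂)) a b₁ b₂ c d₁ d₂ := by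
  simp only [projSum, transpose_sum, transpose_smul]

/-- The symmetrized delta is absorbed by the second projector, which is symmetric in the g's, and
the remaining Kronecker symbol identifies h_2 with f_1. -/
theorem form_projSum (hE : IsGradientFamily E) (hB : IsStandardForm B)
    (a : Fin (k + m + 1) → Fin 3) (b₁ b₂) (c : Fin k → Fin 3) (d₁ d₂) (x : Fin m → Fin 3) (y₁ y₂) :
    B (projSum (E m) a b₁ b₂ c d₁ d₂) (transposeFamily E m x y₁ y₂) =
      ∑ g, ∑ n, ∑ s, ∑ f₁, ∑ f₂, ∑ h, ∑ i, proj a b₁ b₂ (joint g n s) f₁ f₂ *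
        (proj g h f₁ c d₁ d₂ * (eps s h i * proj n f₂ i x y₁ y₂)) := by
  simp only [projSum, map_sum, LinearMap.sum_apply, map_smul, LinearMap.smul_apply, smul_eq_mul,
    form_gradient hE hB]
  rw [sum_eq_sum_joint]
  refine Finset.sum_congr rfl fun g _ => Finset.sum_congr rfl fun n _ =>
    Finset.sum_congr rfl fun s _ => Finset.sum_congr rfl fun f₁ _ => Finset.sum_congr rfl fun f₂ _ => ?_
  simp only [joint_castAdd, joint_natAdd, joint_last]
  have h1 : ∀ g', ∑ h₁, ∑ h₂, ∑ i, proj a b₁ b₂ (joint g n s) f₁ f₂ * proj g' h₁ h₂ c d₁ d₂ *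
      eps s h₁ i * kron h₂ f₁ * symDelta g g' * proj n f₂ i x y₁ y₂ =
      symDelta g g' • ∑ h₁, ∑ i, proj a b₁ b₂ (joint g n s) f₁ f₂ *
        (proj g' h₁ f₁ c d₁ d₂ * (eps s h₁ i * proj n f₂ i x y₁ y₂)) := by
    intro g'
    rw [Finset.smul_sum]
    refine Finset.sum_congr rfl fun h₁ _ => ?_
    rw [← sum_kron_smul (fun h₂ => ∑ i, proj a b₁ b₂ (joint g n s) f₁ f₂ *
        (proj g' h₁ h₂ c d₁ d₂ * (eps s h₁ i * proj n f₂ i x y₁ y₂))) f₁, Finset.smul_sum]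
    refine Finset.sum_congr rfl fun h₂ _ => ?_
    simp only [smul_eq_mul, Finset.mul_sum]
    exact Finset.sum_congr rfl fun i _ => by ring
  refine (Finset.sum_congr rfl fun g' _ => h1 g').trans ?_
  refine sum_symDelta_smul g (fun g' => ∑ h₁, ∑ i, proj a b₁ b₂ (joint g n s) f₁ f₂ *
    (proj g' h₁ f₁ c d₁ d₂ * (eps s h₁ i * proj n f₂ i x y₁ y₂))) fun σ => ?_
  refine Finset.sum_congr rfl fun h₁ _ => Finset.sum_congr rfl fun i _ => ?_
  rw [(isIrr_proj_left c d₁ d₂).symm_left]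

theorem form_epsSum (hE : IsGradientFamily E) (hB : IsStandardForm B)
    (a : Fin (k + m + 1) → Fin 3) (b₁ b₂) (c : Fin k → Fin 3) (d₁ d₂) (x : Fin m → Fin 3) (y₁ y₂) :
    B (E (k + m + 1) a b₁ b₂) (epsSum (transposeFamily E (k + m + 1)) c d₁ d₂ x y₁ y₂) =
      2 * B (projSum (E m) a b₁ b₂ c d₁ d₂) (transposeFamily E m x y₁ y₂) := by
  have hF : IsIrr (transposeFamily E (k + m + 1)) := (hE.irr (k + m + 1)).transpose
  set φ := B (E (k + m + 1) a b₁ b₂) with hφ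
  set T := transposeFamily E (k + m + 1) with hT
  have e1 := fun x y₁ y₂ => congrFun (congrFun (congrFun ((isIrr_epsSum_left (k := k) (l := m) hF x
    y₁ y₂).map φ).projSmul_eq c) d₁) d₂
  have e2 := fun g h₁ h₂ => congrFun (congrFun (congrFun ((isIrr_epsSum_right (k := k) (l := m) hF g
    h₁ h₂).map φ).projSmul_eq x) y₁) y₂
  simp only [projSmul, smul_eq_mul] at e1 e2
  rw [← e1]
  simp only [← e2]
  simp only [epsSum_eq, map_smul, map_add, smul_eq_mul]
  let t := fun (g : Fin k → Fin 3) h₁ h₂ (n : Fin m → Fin 3) q₁ q₂ => φ (epsTerm T g h₁ h₂ n q₁ q₂)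
  -- Contracted with projectors, the four terms of the symmetrization coincide. Four times one half
  -- is the factor 2 in front of `projSum`.
  have hsum : ∑ g, ∑ h₁, ∑ h₂, proj c d₁ d₂ g h₁ h₂ * ∑ n, ∑ q₁, ∑ q₂, proj x y₁ y₂ n q₁ q₂ *
      (1 / 2 * (t g h₁ h₂ n q₁ q₂ + t g h₂ h₁ n q₁ q₂ + t g h₁ h₂ n q₂ q₁ + t g h₂ h₁ n q₂ q₁)) =
      2 * ∑ g, ∑ h₁, ∑ h₂, proj c d₁ d₂ g h₁ h₂ * ∑ n, ∑ q₁, ∑ q₂, proj x y₁ y₂ n q₁ q₂ *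
        t g h₁ h₂ n q₁ q₂ := by
    have s1 : ∀ g h₁ h₂ n, ∑ q₁, ∑ q₂, proj x y₁ y₂ n q₁ q₂ * t g h₁ h₂ n q₂ q₁ =
        ∑ q₁, ∑ q₂, proj x y₁ y₂ n q₁ q₂ * t g h₁ h₂ n q₁ q₂ := by
      intro g h₁ h₂ n
      rw [Finset.sum_comm]
      refine Finset.sum_congr rfl fun q₁ _ => Finset.sum_congr rfl fun q₂ _ => ?_
      rw [(isIrr_proj_right x y₁ y₂).symm_right]
    have s2 : ∀ g, ∀ u : Fin 3 → Fin 3 → ℝ, ∑ h₁, ∑ h₂, proj c d₁ d₂ g h₁ h₂ * u h₂ h₁ =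
        ∑ h₁, ∑ h₂, proj c d₁ d₂ g h₁ h₂ * u h₁ h₂ := by
      intro g u
      rw [Finset.sum_comm]
      refine Finset.sum_congr rfl fun q₁ _ => Finset.sum_congr rfl fun q₂ _ => ?_
      rw [(isIrr_proj_right c d₁ d₂).symm_right]
    have s3 : ∀ g h₁ h₂, ∑ n, ∑ q₁, ∑ q₂, proj x y₁ y₂ n q₁ q₂ *
        (1 / 2 * (t g h₁ h₂ n q₁ q₂ + t g h₂ h₁ n q₁ q₂ + t g h₁ h₂ n q₂ q₁ + t g h₂ h₁ n q₂ q₁)) =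
        (∑ n, ∑ q₁, ∑ q₂, proj x y₁ y₂ n q₁ q₂ * t g h₁ h₂ n q₁ q₂) +
        ∑ n, ∑ q₁, ∑ q₂, proj x y₁ y₂ n q₁ q₂ * t g h₂ h₁ n q₁ q₂ := by
      intro g h₁ h₂
      rw [← Finset.sum_add_distrib]
      refine Finset.sum_congr rfl fun n _ => ?_
      have := s1 g h₁ h₂ n
      have := s1 g h₂ h₁ n
      simp only [mul_add, mul_left_comm _ (1 / 2 : ℝ), Finset.sum_add_distrib, ← Finset.mul_sum] at *
      linarith
    rw [Finset.mul_sum]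
    refine Finset.sum_congr rfl fun g _ => ?_
    simp only [s3]
    simp only [mul_add, Finset.sum_add_distrib]
    rw [two_mul]
    exact congrArg (_ + ·)
      (s2 g fun h₁ h₂ => ∑ n, ∑ q₁, ∑ q₂, proj x y₁ y₂ n q₁ q₂ * t g h₁ h₂ n q₁ q₂)
  refine hsum.trans (congrArg (2 * ·) ?_)
  rw [form_projSum hE hB]
  refine Finset.sum_congr rfl fun g _ => ?_
  have ht : ∀ h₁ h₂ n q₁ q₂, t g h₁ h₂ n q₁ q₂ =
      ∑ s, eps h₂ q₂ s * proj a b₁ b₂ (joint g n s) q₁ h₁ := by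
    intro h₁ h₂ n q₁ q₂
    simp only [t, epsTerm, map_sum, map_smul, smul_eq_mul, hφ, hT, form_gradient hE hB]
  simp only [ht, Finset.mul_sum]
  rw [sum_reorder]
  refine Finset.sum_congr rfl fun n _ => Finset.sum_congr rfl fun s _ =>
    Finset.sum_congr rfl fun f₁ _ => Finset.sum_congr rfl fun f₂ _ =>
    Finset.sum_congr rfl fun h _ => Finset.sum_congr rfl fun i _ => ?_
  rw [(isIrr_proj_right a b₁ b₂).symm_right, eps_cycle, proj_comm x, proj_comm c,
    (isIrr_proj_left c d₁ d₂).symm_right g h f₁]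
  ring

/-- Membership is tested by pairing with a third generator F', and ⟨[E,F]|F'⟩ = ⟨E|[F,F']⟩ reduces
it to the bracket of two F's, known up to the non-gradient part. -/
theorem lie_transpose_sub_projSum_mem (hE : IsGradientFamily E) (hB : IsStandardForm B)
    (a : Fin (k + m + 1) → Fin 3) (b₁ b₂) (c : Fin k → Fin 3) (d₁ d₂) :
    ⁅E (k + m + 1) a b₁ b₂, transposeFamily E k c d₁ d₂⁆ -
      (2 : ℝ) • projSum (E m) a b₁ b₂ c d₁ d₂ ∈ gradientPerp E B m := by
  refine (mem_gradientPerp hE hB).2 ⟨sub_mem ?_ (Submodule.smul_mem _ _ ?_), fun x y₁ y₂ => ?_⟩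
  · exact lie_mem_level (by push_cast; ring) (hE.mem_level _ a b₁ b₂)
      (transpose_mem_level (hE.mem_level k c d₁ d₂))
  · exact sum_mem fun e _ => sum_mem fun f₁ _ => sum_mem fun f₂ _ => sum_mem fun g _ =>
      sum_mem fun h₁ _ => sum_mem fun h₂ _ => sum_mem fun i _ =>
      Submodule.smul_mem _ _ (hE.mem_level m _ _ _)
  -- The non-gradient remainder of [F,F'] is the transpose of an element orthogonal to all F's of
  -- that level. Since the form is invariant under transposition, it does not contribute to the
  -- pairing with E.
  · have hn := lie_add_epsSum_mem hE hB c d₁ d₂ x y₁ y₂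
    have h1 := ((mem_gradientPerp hE hB).1 hn).2 a b₁ b₂
    have h2 : ⁅transposeFamily E k c d₁ d₂, transposeFamily E m x y₁ y₂⁆ =
        epsSum (transposeFamily E (k + m + 1)) c d₁ d₂ x y₁ y₂ -
        transpose (⁅E k c d₁ d₂, E m x y₁ y₂⁆ + epsSum (E (k + m + 1)) c d₁ d₂ x y₁ y₂) := by
      rw [transposeFamily, transposeFamily, lie_transpose, transpose_add, transpose_epsSum]
      change _ = epsSum (transposeFamily E (k + m + 1)) c d₁ d₂ x y₁ y₂ -
        (_ + epsSum (transposeFamily E (k + m + 1)) c d₁ d₂ x y₁ y₂)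
      abel
    rw [map_sub, LinearMap.sub_apply, hB.invariant, h2, map_sub, form_epsSum hE hB, map_smul,
      LinearMap.smul_apply, smul_eq_mul, sub_sub_cancel_left, hB.symm, ← hB.transpose, transpose_transpose]
    exact neg_eq_zero.2 h1

end MixedLevels

end AE3

namespace AE3

/-! ### The statements in final form. -/

noncomputable section Assembly

variable {k l m : ℕ} {E : (k : ℕ) → Tens k} {B : LinearMap.BilinForm ℝ Alg}

theorem affineSubalgebra_eq_span (hE : IsGradientFamily E) : affineSubalgebra.toSubmodule =
    Submodule.span ℝ ({x | ∃ m α β, affK E m α β = x} ∪ {affC, affD}) := by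
  rw [affineSubalgebra_eq_affSpan, affSpan]
  simp only [affK_eq_affVal hE.loopValued]

theorem lowest_ne_zero (hE : IsGradientFamily E) (hB : IsStandardForm B) (k : ℕ) :
    E k (fun _ => 0) 2 2 ≠ 0 := by
  intro h
  have h1 := form_lowest hE hB k
  rw [h, map_zero, LinearMap.zero_apply] at h1
  exact zero_ne_one h1

theorem genF_zero_lie_lowest (hE : IsGradientFamily E) (k : ℕ) :
    ⁅genF 0, E k (fun _ => 0) 2 2⁆ = 0 :=
  (hE.isCovariant k 1 0 _ _ _).trans (gAct_lowest_eq_zero (E k) (by decide))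

theorem genF_one_lie_lowest (hE : IsGradientFamily E) (k : ℕ) :
    ⁅genF 1, E k (fun _ => 0) 2 2⁆ = 0 :=
  (hE.isCovariant k 2 1 _ _ _).trans (gAct_lowest_eq_zero (E k) (by decide))

theorem glK_diag_lie_lowest (hE : IsGradientFamily E) (k : ℕ) (p : Fin 3) :
    ⁅glK p p, E k (fun _ => 0) 2 2⁆ =
      (k * (1 - kron p 0) + 2 * kron 2 p) • E k (fun _ => 0) 2 2 := by
  rw [hE.isCovariant, gAct_diag, Finset.sum_const, Finset.card_univ, Fintype.card_fin,
    nsmul_eq_mul, add_assoc, ← two_mul]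

theorem genH_zero_lie_lowest (hE : IsGradientFamily E) (k : ℕ) :
    ⁅genH 0, E k (fun _ => 0) 2 2⁆ = -(k : ℝ) • E k (fun _ => 0) 2 2 := by
  have h : genH 0 = glK 0 0 - glK 1 1 := by
    simp only [glK_00, glK_11]
    module
  rw [h, sub_lie, glK_diag_lie_lowest hE, glK_diag_lie_lowest hE, ← sub_smul]
  simp [kron]

theorem genH_one_lie_lowest (hE : IsGradientFamily E) (k : ℕ) :
    ⁅genH 1, E k (fun _ => 0) 2 2⁆ = -(2 : ℝ) • E k (fun _ => 0) 2 2 := by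
  have h : genH 1 = glK 1 1 - glK 2 2 := by
    simp only [glK_11, glK_22]
    module
  rw [h, sub_lie, glK_diag_lie_lowest hE, glK_diag_lie_lowest hE, ← sub_smul]
  simp [kron]

theorem form_gradient_of_ne (hE : IsGradientFamily E) (hB : IsStandardForm B) (hkl : k ≠ l)
    (a : Fin k → Fin 3) (b₁ b₂) (c : Fin l → Fin 3) (d₁ d₂) :
    B (E k a b₁ b₂) (transposeFamily E l c d₁ d₂) = 0 :=
  form_of_level hB (by omega) (hE.mem_level k a b₁ b₂) (transpose_mem_level (hE.mem_level l c d₁ d₂))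

theorem gradient_complement (hE : IsGradientFamily E) (k : ℕ) :
    Disjoint (tensorSpan (E k)) (nonGradient (k + 1) (tensorSpan (E k))) ∧
      tensorSpan (E k) ⊔ nonGradient (k + 1) (tensorSpan (E k)) = level (k + 1) ∧
      Disjoint affineSubalgebra.toSubmodule (nonGradient (k + 1) (tensorSpan (E k))) := by
  have hB := invForm_isStandardForm
  rw [nonGradient_eq hE hB]
  exact ⟨disjoint_gradientPerp hE hB k, tensorSpan_sup_gradientPerp hE hB k,
    disjoint_affine_gradientPerp hE hB k⟩

/-- Transposition maps level, gradient span, non-gradient part and affine subalgebra to their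
counterparts at the opposite level. -/
theorem transpose_gradient_complement (hE : IsGradientFamily E) (k : ℕ) :
    Disjoint (tensorSpan (transposeFamily E k))
        (nonGradient (-(k + 1)) (tensorSpan (transposeFamily E k))) ∧
      tensorSpan (transposeFamily E k) ⊔
        nonGradient (-(k + 1)) (tensorSpan (transposeFamily E k)) = level (-(k + 1)) ∧
      Disjoint affineSubalgebra.toSubmodule
        (nonGradient (-(k + 1)) (tensorSpan (transposeFamily E k))) := by
  obtain ⟨h1, h2, h3⟩ := gradient_complement hE k
  have h : tensorSpan (transposeFamily E k) = _ := tensorSpan_transpose (E k)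
  rw [h, ← map_nonGradient, ← map_level, ← h2, Submodule.map_sup]
  refine ⟨disjoint_map_transposeEquiv h1, rfl, ?_⟩
  have h4 := disjoint_map_transposeEquiv h3
  rwa [map_affineSubalgebra] at h4

theorem lie_gradient_mem (hE : IsGradientFamily E) (a : Fin k → Fin 3) (b₁ b₂) (c : Fin l → Fin 3)
    (d₁ d₂) : ⁅E k a b₁ b₂, E l c d₁ d₂⁆ - -epsSum (E (k + l + 1)) a b₁ b₂ c d₁ d₂ ∈
      nonGradient (k + l + 1 + 1) (tensorSpan (E (k + l + 1))) := by
  have h := lie_add_epsSum_mem hE invForm_isStandardForm a b₁ b₂ c d₁ d₂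
  rw [← nonGradient_eq hE invForm_isStandardForm] at h
  rw [sub_neg_eq_add]
  push_cast at h
  exact h

theorem lie_transpose_gradient_mem (hE : IsGradientFamily E) (a : Fin k → Fin 3) (b₁ b₂)
    (c : Fin l → Fin 3) (d₁ d₂) :
    ⁅transposeFamily E k a b₁ b₂, transposeFamily E l c d₁ d₂⁆ -
      epsSum (transposeFamily E (k + l + 1)) a b₁ b₂ c d₁ d₂ ∈
      nonGradient (-(k + l + 1 + 1)) (tensorSpan (transposeFamily E (k + l + 1))) := by
  have h := neg_mem (transpose_mem_nonGradient (lie_gradient_mem hE a b₁ b₂ c d₁ d₂))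
  rw [transpose_sub, transpose_neg, transpose_epsSum, sub_neg_eq_add, neg_add (transpose _),
    ← lie_transpose, ← sub_eq_add_neg] at h
  exact h

theorem lie_transpose_mem (hE : IsGradientFamily E) (a : Fin (k + m + 1) → Fin 3) (b₁ b₂)
    (c : Fin k → Fin 3) (d₁ d₂) :
    ⁅E (k + m + 1) a b₁ b₂, transposeFamily E k c d₁ d₂⁆ -
      (2 : ℝ) • projSum (E m) a b₁ b₂ c d₁ d₂ ∈ nonGradient (m + 1) (tensorSpan (E m)) := by
  rw [nonGradient_eq hE invForm_isStandardForm]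
  exact lie_transpose_sub_projSum_mem hE invForm_isStandardForm a b₁ b₂ c d₁ d₂

/-- The transpose of the preceding case; reversing the bracket brings the factors into the required
order without a sign. -/
theorem lie_transpose_mem' (hE : IsGradientFamily E) (a : Fin k → Fin 3) (b₁ b₂)
    (c : Fin (k + m + 1) → Fin 3) (d₁ d₂) :
    ⁅E k a b₁ b₂, transposeFamily E (k + m + 1) c d₁ d₂⁆ -
      (2 : ℝ) • projSum (transposeFamily E m) c d₁ d₂ a b₁ b₂ ∈
      nonGradient (-(m + 1)) (tensorSpan (transposeFamily E m)) := by
  have h := transpose_mem_nonGradient (lie_transpose_mem hE c d₁ d₂ a b₁ b₂)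
  rw [transpose_sub, transpose_smul, transpose_projSum, transpose_lie, transposeFamily,
    transpose_transpose] at h
  exact h

end Assembly

end AE3

theorem mainTheorem2 :
    -- the invariant form, and the subalgebra gl₃ of all elements of level 0
    (∃! B : LinearMap.BilinForm ℝ AE3.Alg, AE3.IsStandardForm B) ∧
    (∀ a b c d : Fin 3, ⁅AE3.glK a b, AE3.glK c d⁆ =
      AE3.kron c b • AE3.glK a d - AE3.kron a d • AE3.glK c b) ∧
    AE3.level 0 = Submodule.span ℝ {x | ∃ a b, AE3.glK a b = x} ∧
    -- the gradient generators exist and are unique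
    (∃! E : (k : ℕ) → AE3.Tens k, AE3.IsGradientFamily E) ∧
    ∀ E : (k : ℕ) → AE3.Tens k, AE3.IsGradientFamily E →
      -- the affine subalgebra
      (AE3.affineSubalgebra.toSubmodule = Submodule.span ℝ
        ({x | ∃ m α β, AE3.affK E m α β = x} ∪ {AE3.affC, AE3.affD})) ∧
      (∀ (m : ℤ) (α β : Fin 2), ⁅AE3.affC, AE3.affK E m α β⁆ = 0 ∧
        ⁅AE3.affD, AE3.affK E m α β⁆ = -(m : ℝ) • AE3.affK E m α β) ∧
      -- irreducible representations with lowest weight vector E_{1…1}^{33}, Dynkin labels [k,2]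
      (∀ k : ℕ, AE3.tensorSpan (E k) ≤ AE3.level (k + 1) ∧
        (∀ S ≤ AE3.tensorSpan (E k), AE3.IsGlStable S → S = ⊥ ∨ S = AE3.tensorSpan (E k)) ∧
        E k (fun _ => 0) 2 2 ≠ 0 ∧
        ⁅AE3.genF 0, E k (fun _ => 0) 2 2⁆ = 0 ∧ ⁅AE3.genF 1, E k (fun _ => 0) 2 2⁆ = 0 ∧
        ⁅AE3.genH 0, E k (fun _ => 0) 2 2⁆ = -(k : ℝ) • E k (fun _ => 0) 2 2 ∧
        ⁅AE3.genH 1, E k (fun _ => 0) 2 2⁆ = -(2 : ℝ) • E k (fun _ => 0) 2 2) ∧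
      -- normalization in the invariant form
      (∀ B : LinearMap.BilinForm ℝ AE3.Alg, AE3.IsStandardForm B →
        (∀ (k : ℕ) (a : Fin k → Fin 3) (b₁ b₂ : Fin 3) (c : Fin k → Fin 3) (d₁ d₂ : Fin 3),
          B (E k a b₁ b₂) (AE3.transposeFamily E k c d₁ d₂) = AE3.proj a b₁ b₂ c d₁ d₂) ∧
        (∀ (k l : ℕ), k ≠ l →
          ∀ (a : Fin k → Fin 3) (b₁ b₂ : Fin 3) (c : Fin l → Fin 3) (d₁ d₂ : Fin 3),
            B (E k a b₁ b₂) (AE3.transposeFamily E l c d₁ d₂) = 0)) ∧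
      -- the gradient and the non-gradient representations are complementary in each level, and
      -- the latter vanish upon restriction to the affine subalgebra
      (∀ k : ℕ,
        (Disjoint (AE3.tensorSpan (E k)) (AE3.nonGradient (k + 1) (AE3.tensorSpan (E k))) ∧
          AE3.tensorSpan (E k) ⊔ AE3.nonGradient (k + 1) (AE3.tensorSpan (E k)) =
            AE3.level (k + 1) ∧
          Disjoint AE3.affineSubalgebra.toSubmodule
            (AE3.nonGradient (k + 1) (AE3.tensorSpan (E k)))) ∧
        (Disjoint (AE3.tensorSpan (AE3.transposeFamily E k))
            (AE3.nonGradient (-(k + 1)) (AE3.tensorSpan (AE3.transposeFamily E k))) ∧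
          AE3.tensorSpan (AE3.transposeFamily E k) ⊔
              AE3.nonGradient (-(k + 1)) (AE3.tensorSpan (AE3.transposeFamily E k)) =
            AE3.level (-(k + 1)) ∧
          Disjoint AE3.affineSubalgebra.toSubmodule
            (AE3.nonGradient (-(k + 1)) (AE3.tensorSpan (AE3.transposeFamily E k))))) ∧
      -- [E, E] modulo non-gradient representations
      (∀ (k l : ℕ) (a : Fin k → Fin 3) (b₁ b₂ : Fin 3) (c : Fin l → Fin 3) (d₁ d₂ : Fin 3),
        ⁅E k a b₁ b₂, E l c d₁ d₂⁆ - -AE3.epsSum (E (k + l + 1)) a b₁ b₂ c d₁ d₂ ∈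
          AE3.nonGradient (k + l + 1 + 1) (AE3.tensorSpan (E (k + l + 1)))) ∧
      -- its gradient part is fixed up to normalization by the tensor symmetries
      (∀ (k l : ℕ) (X : (Fin k → Fin 3) → Fin 3 → Fin 3 → AE3.Tens l),
        (∀ a b₁ b₂ c d₁ d₂, X a b₁ b₂ c d₁ d₂ ∈ AE3.tensorSpan (E (k + l + 1))) →
        (∀ a b₁ b₂, AE3.IsIrreducibleTensor (X a b₁ b₂)) →
        (∀ c d₁ d₂, AE3.IsIrreducibleTensor (fun a b₁ b₂ => X a b₁ b₂ c d₁ d₂)) →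
        (∀ p q a b₁ b₂ c d₁ d₂, ⁅AE3.glK p q, X a b₁ b₂ c d₁ d₂⁆ =
          AE3.glAct p q (fun a' b₁' b₂' => X a' b₁' b₂' c d₁ d₂) a b₁ b₂
            + AE3.glAct p q (X a b₁ b₂) c d₁ d₂) →
        ∃ r : ℝ, ∀ a b₁ b₂ c d₁ d₂,
          X a b₁ b₂ c d₁ d₂ = r • AE3.epsSum (E (k + l + 1)) a b₁ b₂ c d₁ d₂) ∧
      -- [F, F] modulo non-gradient representations
      (∀ (k l : ℕ) (a : Fin k → Fin 3) (b₁ b₂ : Fin 3) (c : Fin l → Fin 3) (d₁ d₂ : Fin 3),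
        ⁅AE3.transposeFamily E k a b₁ b₂, AE3.transposeFamily E l c d₁ d₂⁆
            - AE3.epsSum (AE3.transposeFamily E (k + l + 1)) a b₁ b₂ c d₁ d₂ ∈
          AE3.nonGradient (-(k + l + 1 + 1))
            (AE3.tensorSpan (AE3.transposeFamily E (k + l + 1)))) ∧
      -- [E, F] modulo non-gradient representations, with more indices a than indices c
      (∀ (k m : ℕ) (a : Fin (k + m + 1) → Fin 3) (b₁ b₂ : Fin 3)
          (c : Fin k → Fin 3) (d₁ d₂ : Fin 3),
        ⁅E (k + m + 1) a b₁ b₂, AE3.transposeFamily E k c d₁ d₂⁆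
            - (2 : ℝ) • AE3.projSum (E m) a b₁ b₂ c d₁ d₂ ∈
          AE3.nonGradient (m + 1) (AE3.tensorSpan (E m))) ∧
      -- [E, F] modulo non-gradient representations, with fewer indices a than indices c
      (∀ (k m : ℕ) (a : Fin k → Fin 3) (b₁ b₂ : Fin 3)
          (c : Fin (k + m + 1) → Fin 3) (d₁ d₂ : Fin 3),
        ⁅E k a b₁ b₂, AE3.transposeFamily E (k + m + 1) c d₁ d₂⁆
            - (2 : ℝ) • AE3.projSum (AE3.transposeFamily E m) c d₁ d₂ a b₁ b₂ ∈
          AE3.nonGradient (-(m + 1)) (AE3.tensorSpan (AE3.transposeFamily E m))) ∧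
      -- [E, F] at opposite levels, exactly
      (∀ (k : ℕ) (a : Fin k → Fin 3) (b₁ b₂ : Fin 3) (c : Fin k → Fin 3) (d₁ d₂ : Fin 3),
        ⁅E k a b₁ b₂, AE3.transposeFamily E k c d₁ d₂⁆ = -AE3.glSum a b₁ b₂ c d₁ d₂) := by
  refine ⟨AE3.existsUnique_isStandardForm, AE3.glK_lie_glK, AE3.level_zero,
    AE3.existsUnique_isGradientFamily, fun E hE => ?_⟩
  have hB := AE3.invForm_isStandardForm
  refine ⟨AE3.affineSubalgebra_eq_span hE, fun m α β => ?_, fun k => ?_,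
    fun B hB => ⟨AE3.form_gradient hE hB, fun k l hkl => AE3.form_gradient_of_ne hE hB hkl⟩,
    fun k => ⟨AE3.gradient_complement hE k, AE3.transpose_gradient_complement hE k⟩,
    fun k l => AE3.lie_gradient_mem hE, fun k l X hG hr hl hc => ?_,
    fun k l => AE3.lie_transpose_gradient_mem hE, fun k m => AE3.lie_transpose_mem hE,
    fun k m => AE3.lie_transpose_mem' hE, fun k => AE3.lie_transpose_eq_glSum hE hB⟩
  · rw [AE3.affK_eq_affVal hE.loopValued]
    exact ⟨AE3.affC_lie_affVal m α β, AE3.affD_lie_affVal m α β⟩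
  · exact ⟨AE3.tensorSpan_le_level hE k, fun S => AE3.eq_bot_or_eq_tensorSpan hE hB k,
      AE3.lowest_ne_zero hE hB k, AE3.genF_zero_lie_lowest hE k, AE3.genF_one_lie_lowest hE k,
      AE3.genH_zero_lie_lowest hE k, AE3.genH_one_lie_lowest hE k⟩
  · exact AE3.eq_smul_epsSum hE hB ⟨fun c d₁ d₂ => AE3.isIrreducibleTensor_iff.1 (hl c d₁ d₂),
      fun a b₁ b₂ => AE3.isIrreducibleTensor_iff.1 (hr a b₁ b₂), hc⟩ hG
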